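/- Let $(N^n,g_N)$ be a closed Riemannian spin manifold (possibly zero-dimensional) and let $c\ge 0$, $k\ge 0$. Let $\mathbb H_c^{k+1}$ be $\mathbb R^{k+1}$ with the metric $dr^2+\sinh_c(r)^2\sigma^k$, where $\sigma^k$ is the round metric of $S^k$, $\sinh_c(r)=\frac1c\sinh(cr)$ for $c\ne0$ and $\sinh_0(r)=r$; put $\coth_c(r)=\sinh_c'(r)/\sinh_c(r)$, let $p_0$ be the origin, so that $r=d(\cdot,p_0)$, and let $B_s(p_0)$ be the open ball of radius $s$. Let $M=\mathbb H_c^{k+1}\times N$ with the product metric and product spin structure, spinor bundle $\Sigma_M$ and Dirac operator $D$. Let $\lambda_0\ge 0$ be such that $\lambda_0^2$ is the smallest eigenvalue of the square of the Dirac operator of $N$, and let $\mu\in(\mathbb C\setminus\mathbb R)\cup(-\lambda_0,\lambda_0)$. On $\{r>0\}\subset M$ let $\partial_r\cdot$ be Clifford multiplication by the radial unit field, $D^N=\sum_b e_b\cdot\nabla_{e_b}$ the partial Dirac operator along $N$ ($(e_b)$ an orthonormal frame of $TN$), and $D^{S^k}=\sinh_c(r)\bigl(\sum_i \epsilon_i\cdot\nabla_{\epsilon_i}-\tfrac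 k2\coth_c(r)\,\partial_r\cdot\bigr)$ the rescaled intrinsic Dirac operator of the spheres $\{r\}\times S^k\times\{y\}$ ($(\epsilon_i)$ an orthonormal frame of the sphere). Let $\rho\in\frac k2+\mathbb N_0$ and $\lambda\in\mathbb R$. A spinor $\phi$ on $\{r>r_0\}$ is said to be of mode $(\rho,\lambda)$ if there are functions $\phi_1,\dots,\phi_4:(r_0,\infty)\to\mathbb C$ and a smooth spinor $\psi\not\equiv0$ on $\{r>0\}$, parallel in the direction of $\partial_r$, with $D^N\psi=\lambda\psi$ and $(D^{S^k})^2\psi=\rho^2\psi$, such that $$\phi=\phi_1(r)\,\psi+\phi_2(r)\,\partial_r\cdot\psi+\phi_3(r)\,P\psi+\phi_4(r)\,\partial_r\cdot P\psi,\qquad P=D^{S^k}/\rho$$ (with $P=0$ if $\rho=0$, which occurs only for $k=0$, where $D^{S^k}=0$). Let $r_0>0$ and let $\phi$ be a differentiable solution of $D\phi=\mu\phi$ on $\{r>r_0\}$, of mode $(\rho,\lambda)$ and with finite $L^2$-norm $\|\phi\|$ over $\{r>r_0\}$. 1. If $\kappa\in\mathbb C$ satisfies $\kappa^2=\lambda^2-\mu^2$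 and $\operatorname{Re}\kappa\ge0$, then $\operatorname{Re}\kappa>0$. 2. Let $\kappa_{\lambda_0}^2=\lambda_0^2-\mu^2$ with $\operatorname{Re}\kappa_{\lambda_0}>0$. Then there are $r_1>r_0$ and $C>0$ such that, if $c>0$, $$|\phi(x)|\le C\,\|\phi\|\,e^{(-ck/2-\operatorname{Re}\kappa_{\lambda_0})\,d(x_1,p_0)}\qquad\text{for all }x=(x_1,x_2)\in(\mathbb H_c^{k+1}\setminus B_{r_1}(p_0))\times N,$$ and, if $c=0$, the same holds with $d(x_1,p_0)^{-k/2}\,e^{-\operatorname{Re}\kappa_{\lambda_0}d(x_1,p_0)}$ in place of the exponential factor. Here $r_1$ does not depend on $\lambda$ or $\phi$, and, for the fixed manifold $N$, $C$ depends only on $c,k,r_1,\lambda_0,\mu$ and $\rho$, but not on $\lambda$ or $\phi$. -/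

import Mathlib

open scoped Manifold ContDiff ENNReal

noncomputable section

/-! ### Clifford modules -/

/-- The negative definite form `v ↦ -∑ vᵢ²`, so that `v · v = -|v|²` in the Clifford algebra. -/
abbrev cliffordForm (κ : Type*) [Fintype κ] : QuadraticForm ℝ (κ → ℝ) :=
  QuadraticMap.weightedSumSquares ℝ (fun _ : κ => (-1 : ℝ))

/-- The real Clifford algebra `Cl_m`, `m = card κ`, of Euclidean space with orthonormal basis
indexed by `κ`. -/
abbrev Cl (κ : Type*) [Fintype κ] : Type _ := CliffordAlgebra (cliffordForm κ)

/-- The generator of `Cl κ` belonging to the basis vector with index `a`. -/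
def cliffordGen {κ : Type*} [Fintype κ] [DecidableEq κ] (a : κ) : Cl κ :=
  CliffordAlgebra.ι (cliffordForm κ) (Pi.single a 1)

/-- The isometric inclusion of the second summand of an orthogonal direct sum. -/
def inclRight (κ₁ κ₂ : Type*) [Fintype κ₁] [Fintype κ₂] :
    cliffordForm κ₂ →qᵢ cliffordForm (κ₁ ⊕ κ₂) where
  toFun v := Sum.elim 0 v
  map_add' v w := by ext (a | b) <;> simp
  map_smul' t v := by ext (a | b) <;> simp
  map_app' v := by simp [QuadraticMap.weightedSumSquares_apply, Fintype.sum_sum_type]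

/-- The algebra map `Cl κ₂ → Cl (κ₁ ⊕ κ₂)` induced by the inclusion of the second summand.
Restricted to the spin group of `κ₂` it is the lift of `SO(κ₂) → SO(κ₁ ⊕ κ₂)`, `R ↦ id ⊕ R`. -/
def cliffordInclRight (κ₁ κ₂ : Type*) [Fintype κ₁] [Fintype κ₂] :
    Cl κ₂ →ₐ[ℝ] Cl (κ₁ ⊕ κ₂) :=
  CliffordAlgebra.map (inclRight κ₁ κ₂)

/-- The structure of an irreducible complex representation of `Cl κ` on the finite-dimensional
Hermitian vector space `S`, with vectors acting by skew-adjoint maps. -/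
structure SpinorModule (κ : Type*) [Fintype κ] (S : Type*) [NormedAddCommGroup S]
    [InnerProductSpace ℂ S] [FiniteDimensional ℂ S] where
  /-- the action of the Clifford algebra -/
  act : Cl κ →ₐ[ℝ] Module.End ℂ S
  skew : ∀ (v : κ → ℝ) (s t : S),
    inner ℂ (act (CliffordAlgebra.ι _ v) s) t = -inner ℂ s (act (CliffordAlgebra.ι _ v) t)
  nontrivial : Nontrivial S
  irreducible : ∀ W : Submodule ℂ S, (∀ a : Cl κ, ∀ s ∈ W, act a s ∈ W) → W = ⊥ ∨ W = ⊤

/-- Clifford multiplication by the basis vector with index `a`. -/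
def SpinorModule.gen {κ : Type*} [Fintype κ] [DecidableEq κ] {S : Type*} [NormedAddCommGroup S]
    [InnerProductSpace ℂ S] [FiniteDimensional ℂ S] (ρ : SpinorModule κ S) (a : κ) :
    Module.End ℂ S :=
  ρ.act (cliffordGen a)

/-! ### Spin connection in an orthonormal frame -/

section Local

variable {E : Type*} [NormedAddCommGroup E] [NormedSpace ℝ E]
  {H : Type*} [TopologicalSpace H] (I : ModelWithCorners ℝ E H)
  {M : Type*} [TopologicalSpace M] [ChartedSpace H M]
  {κ : Type*} [Fintype κ] [DecidableEq κ]
  {S : Type*} [NormedAddCommGroup S] [InnerProductSpace ℂ S] [FiniteDimensional ℂ S]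

/-- The Levi-Civita connection coefficient `g(∇_{e_a} e_b, e_c)` of an orthonormal frame `e`,
given by the Koszul formula. -/
def connCoeff (g : ∀ x : M, TangentSpace I x → TangentSpace I x → ℝ)
    (e : κ → ∀ x : M, TangentSpace I x) (a b c : κ) (x : M) : ℝ :=
  (1 / 2) * (g x (VectorField.mlieBracket I (e a) (e b) x) (e c x)
    - g x (VectorField.mlieBracket I (e b) (e c) x) (e a x)
    + g x (VectorField.mlieBracket I (e c) (e a) x) (e b x))

/-- The spinorial Levi-Civita derivative `∇_{e_a} σ` of a spinor that is given, in the spin frame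
lifting the orthonormal frame `e`, by the function `σ`:
`∂_{e_a} σ + ¼ ∑_{b,c} g(∇_{e_a} e_b, e_c) e_b · e_c · σ`. -/
def frameSpinDeriv (g : ∀ x : M, TangentSpace I x → TangentSpace I x → ℝ)
    (e : κ → ∀ x : M, TangentSpace I x) (ρ : SpinorModule κ S) (σ : M → S) (a : κ) (x : M) : S :=
  (show S from mfderiv I 𝓘(ℝ, S) σ x (e a x)) +
    (1 / 4 : ℝ) • ∑ b, ∑ c, connCoeff I g e a b c x • ρ.gen b (ρ.gen c (σ x))

end Local

/-! ### Riemannian volume -/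

section Volume

variable {d : ℕ} {M : Type*} [TopologicalSpace M]
  [ChartedSpace (EuclideanSpace ℝ (Fin d)) M] [MeasurableSpace M]

/-- The Gram matrix `g(∂_a, ∂_b)` of the coordinate fields of the chart at `x₀`, at the point with
coordinates `u`. -/
def chartGram (g : ∀ x : M, TangentSpace (𝓡 d) x → TangentSpace (𝓡 d) x → ℝ) (x₀ : M)
    (u : EuclideanSpace ℝ (Fin d)) : Matrix (Fin d) (Fin d) ℝ :=
  Matrix.of fun a b => g ((extChartAt (𝓡 d) x₀).symm u)
    (mfderiv 𝓘(ℝ, EuclideanSpace ℝ (Fin d)) (𝓡 d) (extChartAt (𝓡 d) x₀).symm u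
      (EuclideanSpace.single a (1 : ℝ)))
    (mfderiv 𝓘(ℝ, EuclideanSpace ℝ (Fin d)) (𝓡 d) (extChartAt (𝓡 d) x₀).symm u
      (EuclideanSpace.single b (1 : ℝ)))

/-- The Riemannian volume `√det(g_ab) du` of the domain of the chart at `x₀`, extended by zero. -/
def chartVolume (g : ∀ x : M, TangentSpace (𝓡 d) x → TangentSpace (𝓡 d) x → ℝ) (x₀ : M) :
    MeasureTheory.Measure M :=
  (((MeasureTheory.volume : MeasureTheory.Measure (EuclideanSpace ℝ (Fin d))).restrict
      (extChartAt (𝓡 d) x₀).target).withDensity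
    (fun u => ENNReal.ofReal (Real.sqrt (chartGram g x₀ u).det))).map (extChartAt (𝓡 d) x₀).symm

/-- The Riemannian volume measure: the least measure that dominates the volumes of all chart
domains. As these agree on overlaps, it restricts to each of them. -/
def riemannianVolume (g : ∀ x : M, TangentSpace (𝓡 d) x → TangentSpace (𝓡 d) x → ℝ) :
    MeasureTheory.Measure M :=
  ⨆ x₀ : M, chartVolume g x₀

end Volume

/-! ### Spin structures and the Dirac operator of a Riemannian manifold -/

section Spin

variable {n : ℕ} {N : Type*} [TopologicalSpace N] [ChartedSpace (EuclideanSpace ℝ (Fin n)) N]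
  [IsManifold (𝓡 n) ∞ N]

/-- Smooth Riemannian metrics on the `n`-manifold `N`. -/
abbrev RiemMetric (n : ℕ) (N : Type*) [TopologicalSpace N]
    [ChartedSpace (EuclideanSpace ℝ (Fin n)) N] [IsManifold (𝓡 n) ∞ N] : Type _ :=
  Bundle.ContMDiffRiemannianMetric (𝓡 n) ∞ (EuclideanSpace ℝ (Fin n))
    (fun x : N => TangentSpace (𝓡 n) x)

/-- The inner product on tangent spaces as a plain function. -/
def RiemMetric.form (g : RiemMetric n N) (x : N) (v w : TangentSpace (𝓡 n) x) : ℝ := g.inner x v w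

/-- A spin structure on the Riemannian manifold `(N, g)`, presented by a cocycle: local orthonormal
frames `f_i` on an open cover, and smooth lifts `s_ij` to the spin group of the transition functions
(`f_j = f_i · Θ(s_ij)`, `Θ` the double covering) with `s_ij s_jk = s_ik`. Smoothness of a map
to the spin group means smoothness of all its linear coordinates in the Clifford algebra.
For each point the choice of an index with the point in its domain is part of the data; it is used to
identify the fibres of the spinor bundle with the spinor module. -/
structure SpinStructure (ι : Type*) (g : RiemMetric n N) where
  dom : ι → Set N
  isOpen_dom : ∀ i, IsOpen (dom i)
  indexAt : N → ι
  mem_dom_at : ∀ x, x ∈ dom (indexAt x)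
  frame : ι → Fin n → ∀ x : N, TangentSpace (𝓡 n) x
  smooth_frame : ∀ i a, ContMDiffOn (𝓡 n) (𝓡 n).tangent ∞
    (fun x => (⟨x, frame i a x⟩ : TangentBundle (𝓡 n) N)) (dom i)
  orthonormal : ∀ i, ∀ x ∈ dom i, ∀ a b,
    g.form x (frame i a x) (frame i b x) = if a = b then 1 else 0
  lift : ι → ι → N → spinGroup (cliffordForm (Fin n))
  smooth_lift : ∀ i j (ℓ : Cl (Fin n) →ₗ[ℝ] ℝ),
    ContMDiffOn (𝓡 n) 𝓘(ℝ, ℝ) ∞ (fun x => ℓ (lift i j x : Cl (Fin n))) (dom i ∩ dom j)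
  lift_covers : ∀ i j, ∀ x ∈ dom i ∩ dom j, ∀ a,
    (lift i j x : Cl (Fin n)) * cliffordGen a =
      (∑ b, g.form x (frame j a x) (frame i b x) • cliffordGen b) * (lift i j x : Cl (Fin n))
  cocycle : ∀ i j k, ∀ x ∈ dom i ∩ dom j ∩ dom k, lift i j x * lift j k x = lift i k x

variable {ι : Type*} {g : RiemMetric n N} (P : SpinStructure ι g)
  {S : Type*} [NormedAddCommGroup S] [InnerProductSpace ℂ S] [FiniteDimensional ℂ S]

/-- Sections of the spinor bundle of `N` are functions `ψ : N → S`, the fibre at `x` being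
trivialised by the spin frame with index `indexAt x`. This is `ψ` in the spin frame `i`. -/
def SpinStructure.loc (ρ : SpinorModule (Fin n) S) (ψ : N → S) (i : ι) (x : N) : S :=
  ρ.act (P.lift i (P.indexAt x) x : Cl (Fin n)) (ψ x)

/-- Smooth spinors on `N`. -/
def SpinStructure.IsSmooth (ρ : SpinorModule (Fin n) S) (ψ : N → S) : Prop :=
  ∀ i, ContMDiffOn (𝓡 n) 𝓘(ℝ, S) ∞ (P.loc ρ ψ i) (P.dom i)

/-- The Dirac operator `∑ e_a · ∇_{e_a}` of `N`. -/
def SpinStructure.dirac (ρ : SpinorModule (Fin n) S) (ψ : N → S) (x : N) : S :=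
  ∑ a, ρ.gen a (frameSpinDeriv (𝓡 n) g.form (P.frame (P.indexAt x)) ρ
    (P.loc ρ ψ (P.indexAt x)) a x)

/-- The eigenvalues of the square of the Dirac operator of `N` (they are real). -/
def SpinStructure.diracSqEigenvalues (ρ : SpinorModule (Fin n) S) : Set ℝ :=
  {s | ∃ ψ : N → S, P.IsSmooth ρ ψ ∧ ψ ≠ 0 ∧ ∀ x, P.dirac ρ (P.dirac ρ ψ) x = s • ψ x}

end Spin

/-! ### The space `ℍ_c^{k+1}` -/

section Hyperbolic

/-- `sinh_c`. -/
def sinhC (c r : ℝ) : ℝ := if c = 0 then r else Real.sinh (c * r) / c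

/-- `coth_c`. -/
def cothC (c r : ℝ) : ℝ := if c = 0 then 1 / r else c * (Real.cosh (c * r) / Real.sinh (c * r))

/-- `sinh_c(r)/r`, with value `1` at `r = 0`. -/
def warp (c r : ℝ) : ℝ := if r = 0 then 1 else sinhC c r / r

variable {k : ℕ}

/-- `ℍ_c^{k+1}` is `ℝ^{k+1}` with the metric `dr² + sinh_c(r)² σ^k`, the distance to
`p₀ = 0` being `r = ‖x‖`: radial vectors keep their Euclidean length, vectors orthogonal to `x` are
stretched by `sinh_c(r)/r`. -/
def hypInner (c : ℝ) (x v w : EuclideanSpace ℝ (Fin (k + 1))) : ℝ :=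
  warp c ‖x‖ ^ 2 * inner ℝ v w + (1 - warp c ‖x‖ ^ 2) * (inner ℝ x v * inner ℝ x w / ‖x‖ ^ 2)

/-- `hypInner` as a metric on tangent spaces. -/
def hypMetric (c : ℝ) (x : EuclideanSpace ℝ (Fin (k + 1)))
    (v w : TangentSpace (𝓡 (k + 1)) x) : ℝ :=
  hypInner c x v w

/-- The global orthonormal frame of `ℍ_c^{k+1}` obtained from the standard basis of `ℝ^{k+1}` by
keeping radial parts and scaling the parts orthogonal to `x` by `r / sinh_c(r)`. -/
def hypVec (c : ℝ) (a : Fin (k + 1)) (x : EuclideanSpace ℝ (Fin (k + 1))) :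
    EuclideanSpace ℝ (Fin (k + 1)) :=
  (warp c ‖x‖)⁻¹ • EuclideanSpace.single a (1 : ℝ) +
    ((1 - (warp c ‖x‖)⁻¹) * (x a / ‖x‖ ^ 2)) • x

/-- `hypVec` as vector fields. -/
def hypFrame (c : ℝ) (a : Fin (k + 1)) (x : EuclideanSpace ℝ (Fin (k + 1))) :
    TangentSpace (𝓡 (k + 1)) x :=
  hypVec c a x

theorem warp_ne_zero (c r : ℝ) : warp c r ≠ 0 := by
  unfold warp sinhC
  by_cases hr : r = 0
  · simp [hr]
  · by_cases hc : c = 0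
    · simp [hr, hc]
    · simp [hr, hc, Real.sinh_eq_zero]

theorem hypFrame_orthonormal (c : ℝ) (a b : Fin (k + 1)) (x : EuclideanSpace ℝ (Fin (k + 1))) :
    hypMetric c x (hypFrame c a x) (hypFrame c b x) = if a = b then 1 else 0 := by
  change hypInner c x (hypVec c a x) (hypVec c b x) = _
  have hw := warp_ne_zero c ‖x‖
  have hab : inner ℝ (EuclideanSpace.single a (1 : ℝ)) (EuclideanSpace.single b (1 : ℝ))
      = (if a = b then 1 else 0 : ℝ) := by
    simp [EuclideanSpace.inner_single_left]
  by_cases hx : x = 0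
  · subst hx
    have h1 : warp c ‖(0 : EuclideanSpace ℝ (Fin (k + 1)))‖ = 1 := by simp [warp]
    simp only [hypInner, hypVec, h1]
    simpa using hab
  · have hr : ‖x‖ ≠ 0 := norm_ne_zero_iff.mpr hx
    simp only [hypInner, hypVec, inner_add_left, inner_add_right, inner_smul_left,
      inner_smul_right, hab, real_inner_self_eq_norm_sq, EuclideanSpace.inner_single_left,
      EuclideanSpace.inner_single_right, map_one, one_mul, conj_trivial]
    field_simp
    ring

/-- The components `x_a / r` of the radial unit field `∂_r` with respect to the frame `hypFrame`
(and with respect to the standard basis). -/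
def radialComp (x : EuclideanSpace ℝ (Fin (k + 1))) (a : Fin (k + 1)) : ℝ := x a / ‖x‖

theorem sum_radialComp (c : ℝ) (x : EuclideanSpace ℝ (Fin (k + 1))) :
    ∑ a, radialComp x a • hypVec c a x = ‖x‖⁻¹ • x := by
  have hw := warp_ne_zero c ‖x‖
  by_cases hx : x = 0
  · subst hx
    simp [radialComp]
  · have hr : ‖x‖ ≠ 0 := norm_ne_zero_iff.mpr hx
    have hs : ∑ a, x a ^ 2 = ‖x‖ ^ 2 := by
      rw [EuclideanSpace.norm_sq_eq]; simp
    have h1 : ∑ a, x a / ‖x‖ * ((1 - (warp c ‖x‖)⁻¹) * (x a / ‖x‖ ^ 2))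
        = (1 - (warp c ‖x‖)⁻¹) / ‖x‖ := by
      have : ∀ a, x a / ‖x‖ * ((1 - (warp c ‖x‖)⁻¹) * (x a / ‖x‖ ^ 2))
          = x a ^ 2 * ((1 - (warp c ‖x‖)⁻¹) / ‖x‖ ^ 3) := by
        intro a; field_simp
      rw [Finset.sum_congr rfl (fun a _ => this a), ← Finset.sum_mul, hs]
      field_simp
    simp only [radialComp, hypVec, smul_add, smul_smul, Finset.sum_add_distrib, ← Finset.sum_smul]
    rw [h1]
    ext b
    simp [Pi.single_apply]
    field_simp
    ring

end Hyperbolic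

/-! ### Spinors on `ℍ_c^{k+1} × N` -/

section Product

variable {n k : ℕ} {N : Type*} [TopologicalSpace N] [ChartedSpace (EuclideanSpace ℝ (Fin n)) N]
  [IsManifold (𝓡 n) ∞ N] {ι : Type*} {g : RiemMetric n N} (P : SpinStructure ι g)
  {S : Type*} [NormedAddCommGroup S] [InnerProductSpace ℂ S] [FiniteDimensional ℂ S]
  (ρ : SpinorModule (Fin (k + 1) ⊕ Fin n) S) (c : ℝ)

/-- The product metric on `ℍ_c^{k+1} × N`. -/
def prodMetric (g : RiemMetric n N) (c : ℝ) (p : EuclideanSpace ℝ (Fin (k + 1)) × N)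
    (v w : TangentSpace ((𝓡 (k + 1)).prod (𝓡 n)) p) : ℝ :=
  hypMetric c p.1 v.1 w.1 + g.form p.2 v.2 w.2

namespace SpinStructure

/-- The orthonormal frame of `ℍ_c^{k+1} × N` over `ℍ_c^{k+1} × dom i`. -/
def prodFrame (i : ι) : Fin (k + 1) ⊕ Fin n → ∀ p : EuclideanSpace ℝ (Fin (k + 1)) × N,
    TangentSpace ((𝓡 (k + 1)).prod (𝓡 n)) p
  | Sum.inl a => fun p => (hypFrame c a p.1, 0)
  | Sum.inr b => fun p => (0, P.frame i b p.2)

/-- The product spin structure on `ℍ_c^{k+1} × N` has the spin frames that lift `prodFrame`, with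
transition functions `s_ij ∈ Spin(n) → Spin(k+1+n)`. As for `N`, sections of its spinor bundle
are functions to `S`, the fibre at `(x, y)` being trivialised by the spin frame with index
`indexAt y`. This is `φ` in the spin frame `i`. -/
def prodLoc (φ : EuclideanSpace ℝ (Fin (k + 1)) × N → S) (i : ι)
    (p : EuclideanSpace ℝ (Fin (k + 1)) × N) : S :=
  ρ.act (cliffordInclRight (Fin (k + 1)) (Fin n) (P.lift i (P.indexAt p.2) p.2 : Cl (Fin n))) (φ p)

/-- The covariant derivative of `φ` in the direction of the `a`-th frame vector at `p` (of the frame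
with index `indexAt p.2`). -/
def prodDeriv (φ : EuclideanSpace ℝ (Fin (k + 1)) × N → S) (a : Fin (k + 1) ⊕ Fin n)
    (p : EuclideanSpace ℝ (Fin (k + 1)) × N) : S :=
  frameSpinDeriv ((𝓡 (k + 1)).prod (𝓡 n)) (prodMetric g c) (P.prodFrame c (P.indexAt p.2)) ρ
    (P.prodLoc ρ φ (P.indexAt p.2)) a p

/-- The Dirac operator `D` of `ℍ_c^{k+1} × N`. -/
def prodDirac (φ : EuclideanSpace ℝ (Fin (k + 1)) × N → S)
    (p : EuclideanSpace ℝ (Fin (k + 1)) × N) : S :=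
  ∑ a, ρ.gen a (P.prodDeriv ρ c φ a p)

/-- The partial Dirac operator `D^N = ∑ e_b · ∇_{e_b}` along `N`. -/
def diracN (φ : EuclideanSpace ℝ (Fin (k + 1)) × N → S)
    (p : EuclideanSpace ℝ (Fin (k + 1)) × N) : S :=
  ∑ b : Fin n, ρ.gen (Sum.inr b) (P.prodDeriv ρ c φ (Sum.inr b) p)

/-- The radial covariant derivative `∇φ/dr`. -/
def radialDeriv (φ : EuclideanSpace ℝ (Fin (k + 1)) × N → S)
    (p : EuclideanSpace ℝ (Fin (k + 1)) × N) : S :=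
  ∑ a : Fin (k + 1), radialComp p.1 a • P.prodDeriv ρ c φ (Sum.inl a) p

end SpinStructure

/-- Clifford multiplication by `∂_r`. -/
def radialMul (φ : EuclideanSpace ℝ (Fin (k + 1)) × N → S)
    (p : EuclideanSpace ℝ (Fin (k + 1)) × N) : S :=
  ∑ a : Fin (k + 1), radialComp p.1 a • ρ.gen (Sum.inl a) (φ p)

namespace SpinStructure

/-- The partial Dirac operator along the spheres `{r} × 𝕊^k × {y}`: the trace of `X · ∇_X`
over the tangent spaces of the spheres, which is the trace over the tangent space of
`ℍ_c^{k+1}` minus `∂_r · ∇/dr`. -/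
def partialDiracSphere (φ : EuclideanSpace ℝ (Fin (k + 1)) × N → S)
    (p : EuclideanSpace ℝ (Fin (k + 1)) × N) : S :=
  ∑ a : Fin (k + 1), ρ.gen (Sum.inl a) (P.prodDeriv ρ c φ (Sum.inl a) p) -
    radialMul ρ (P.radialDeriv ρ c φ) p

/-- The rescaled intrinsic Dirac operator `D^{𝕊^k} = sinh_c(r) D_int` of the spheres, where the
intrinsic Dirac operator and the partial one differ by half the mean curvature,
`D_int = D_∂ + ½ H ·` with `H = -k coth_c(r) ∂_r`. -/
def diracSphere (φ : EuclideanSpace ℝ (Fin (k + 1)) × N → S)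
    (p : EuclideanSpace ℝ (Fin (k + 1)) × N) : S :=
  sinhC c ‖p.1‖ • (P.partialDiracSphere ρ c φ p -
    ((k : ℝ) / 2 * cothC c ‖p.1‖) • radialMul ρ φ p)

/-- Nonzero smooth spinors `ψ` on `(ℍ_c^{k+1} ∖ {p₀}) × N`, parallel in the radial direction, with
`D^N ψ = lam ψ` and `(D^{𝕊^k})² ψ = rho² ψ`. -/
structure IsModeSpinor (rho lam : ℝ) (ψ : EuclideanSpace ℝ (Fin (k + 1)) × N → S) : Prop where
  smooth : ∀ i, ContMDiffOn ((𝓡 (k + 1)).prod (𝓡 n)) 𝓘(ℝ, S) ∞ (P.prodLoc ρ ψ i)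
    {p | p.1 ≠ 0 ∧ p.2 ∈ P.dom i}
  nonzero : ∃ p, p.1 ≠ 0 ∧ ψ p ≠ 0
  parallel : ∀ p, p.1 ≠ 0 → P.radialDeriv ρ c ψ p = 0
  diracN_eq : ∀ p, p.1 ≠ 0 → P.diracN ρ c ψ p = lam • ψ p
  diracSphere_sq_eq : ∀ p, p.1 ≠ 0 →
    P.diracSphere ρ c (P.diracSphere ρ c ψ) p = rho ^ 2 • ψ p

/-- On `r > r₀` the spinor `φ` has the form
`φ₁(r) ψ + φ₂(r) ∂_r · ψ + φ₃(r) Pψ + φ₄(r) ∂_r · Pψ` with `P = D^{𝕊^k} / rho`. -/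
def HasMode (rho lam r₀ : ℝ) (φ : EuclideanSpace ℝ (Fin (k + 1)) × N → S) : Prop :=
  ∃ (ψ : EuclideanSpace ℝ (Fin (k + 1)) × N → S) (φ₁ φ₂ φ₃ φ₄ : ℝ → ℂ),
    P.IsModeSpinor ρ c rho lam ψ ∧
    ∀ p, r₀ < ‖p.1‖ →
      φ p = φ₁ ‖p.1‖ • ψ p + φ₂ ‖p.1‖ • radialMul ρ ψ p
        + φ₃ ‖p.1‖ • (rho⁻¹ • P.diracSphere ρ c ψ p)
        + φ₄ ‖p.1‖ • radialMul ρ (fun q => rho⁻¹ • P.diracSphere ρ c ψ q) p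

end SpinStructure

/-- The `L²`-norm of `φ` over `{r > r₀} × N` for the Riemannian volume of `ℍ_c^{k+1} × N`. -/
def l2Norm [MeasurableSpace N] (g : RiemMetric n N) (c r₀ : ℝ)
    (φ : EuclideanSpace ℝ (Fin (k + 1)) × N → S) : ℝ≥0∞ :=
  (∫⁻ p in {p : EuclideanSpace ℝ (Fin (k + 1)) × N | r₀ < ‖p.1‖}, ‖φ p‖ₑ ^ 2
    ∂((riemannianVolume (hypMetric c)).prod (riemannianVolume g.form))) ^ (1 / 2 : ℝ)

/-- `φ` is an `L²`-solution of `Dφ = μφ` on `{r > r₀} × N` in the mode `(rho, lam)`. -/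
structure SpinStructure.IsModeSolution [MeasurableSpace N] (μ : ℂ) (rho lam r₀ : ℝ)
    (φ : EuclideanSpace ℝ (Fin (k + 1)) × N → S) : Prop where
  differentiable : ∀ i p, r₀ < ‖p.1‖ → p.2 ∈ P.dom i →
    MDifferentiableAt ((𝓡 (k + 1)).prod (𝓡 n)) 𝓘(ℝ, S) (P.prodLoc ρ φ i) p
  dirac_eq : ∀ p, r₀ < ‖p.1‖ → P.prodDirac ρ c φ p = μ • φ p
  l2 : l2Norm g c r₀ φ < ⊤
  mode : P.HasMode ρ c rho lam r₀ φ

end Product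

end

noncomputable section

open scoped Manifold ContDiff ENNReal
open MeasureTheory Metric
open Finset (sum_congr smul_sum sum_comm sum_add_distrib sum_sub_distrib mul_sum sum_mul sum_smul
  sum_neg_distrib)
open Matrix (mulVec_mulVec smul_mulVec one_mulVec add_mulVec sub_mulVec)
open ContinuousLinearMap (map_smul_of_tower)
open VectorField (lieBracket mlieBracket)
open Real (norm_of_nonneg norm_eq_abs)
open Complex (coe_smul)
open Fin (sum_univ_four)
open DFunLike (congr_fun)
open ENNReal (ofReal)
open EuclideanSpace (proj)

local notation "𝔼" m:max => EuclideanSpace ℝ (Fin m)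
local notation "𝔽" κ:max => EuclideanSpace ℝ κ
local notation "δ[" i "]" => EuclideanSpace.single i (1 : ℝ)
local notation "χ[" n "," y "]" => extChartAt (𝓡 n) y
local notation "𝓜" k:max n:max => ModelWithCorners.prod (𝓡 (k + 1)) (𝓡 n)
local notation "ℍ" k:max => EuclideanSpace ℝ (Fin (k + 1))
local notation "𝔡" κ:max => Fintype.card κ
local notation "𝓢" k:max n:max S:max => SpinorModule (Fin (k + 1) ⊕ Fin n) S

/-- The improvement step for recessive solutions of `f'' = (κ² + q) f`. -/
theorem norm_le_of_perturbed_exponential_step {F : Type*} [NormedAddCommGroup F] [NormedSpace ℂ F]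
    {κ : ℂ} {a Q R : ℝ} (hκ : κ.re = a) (ha : 0 < a) (hQ : 0 ≤ Q) (hR1 : 1 ≤ a * R)
    (hR2 : 2 * Q ≤ a * R) {q : ℝ → ℝ} (hq : ∀ r, R ≤ r → |q r| ≤ Q / r ^ 2) {f f' : ℝ → F}
    (hf : ∀ r, R ≤ r → HasDerivAt f (f' r) r)
    (hf' : ∀ r, R ≤ r → HasDerivAt f' ((κ ^ 2 + (q r : ℂ)) • f r) r)
    {M : ℝ} (hM : ∀ r, R ≤ r → ‖f r‖ ≤ M) (hM' : ∀ r, R ≤ r → ‖f' r‖ ≤ M)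
    {ε B : ℝ} (hε : 0 < ε) (hB : 0 ≤ B)
    (hfB : ∀ r, R ≤ r → ‖f r‖ ≤ B * (Real.exp (-a * (r - R)) + ε)) :
    ∀ r, R ≤ r → ‖f r‖ ≤ (‖f R‖ + B / 2) * (Real.exp (-a * (r - R)) + ε) := by
  have hR : 0 < R := by
    by_contra h
    push Not at h
    nlinarith
  have nexp : ∀ t : ℝ, ∀ z : ℂ, ‖Complex.exp (z * t)‖ = Real.exp (z.re * t) := by
    intro t z
    rw [Complex.norm_exp]; simp
  set η : ℝ → ℝ := fun r => Real.exp (-a * (r - R)) + ε with hη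
  have hη0 : ∀ r, 0 < η r := fun r => by positivity
  have hηanti : ∀ r t, r ≤ t → η t ≤ η r := by
    intro r t h
    simp only [hη]
    have : Real.exp (-a * (t - R)) ≤ Real.exp (-a * (r - R)) :=
      Real.exp_le_exp.mpr (by nlinarith)
    linarith
  set g : ℝ → F := fun r => f' r + κ • f r with hg
  have hgd : ∀ r, R ≤ r → HasDerivAt g (κ • g r + (q r : ℂ) • f r) r := by
    intro r hr
    have := (hf' r hr).add ((hf r hr).const_smul κ)
    refine this.congr_deriv ?_
    simp only [hg, smul_add, smul_smul, add_smul, pow_two]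
    abel
  have dexp : ∀ (z : ℂ) (r : ℝ), HasDerivAt (fun t : ℝ => Complex.exp (z * t))
      (z * Complex.exp (z * r)) r := by
    intro z r
    have h1 : HasDerivAt (fun t : ℝ => z * (t : ℂ)) z r := by
      simpa using (Complex.ofRealCLM.hasDerivAt (x := r)).const_mul z
    simpa [mul_comm] using h1.cexp
  -- bound on `g`
  have hgb : ∀ r, R ≤ r → ‖g r‖ ≤ Q * B / (a * r ^ 2) * η r := by
    intro r hr
    have hr0 : 0 < r := hR.trans_le hr
    set K : ℝ := Q * B / r ^ 2 * η r with hK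
    have hK0 : 0 ≤ K := by have := hη0 r; positivity
    have hd : ∀ t, R ≤ t → HasDerivAt (fun t : ℝ => Complex.exp (-κ * t) • g t)
        (Complex.exp (-κ * t) • ((q t : ℂ) • f t)) t := by
      intro t ht
      have := (dexp (-κ) t).smul (hgd t ht)
      refine this.congr_deriv ?_
      simp only [smul_add, smul_smul]
      module
    have hbound : ∀ t, r ≤ t →
        ‖Complex.exp (-κ * t) • ((q t : ℂ) • f t)‖ ≤ K * Real.exp (-a * t) := by
      intro t ht
      have ht' := hr.trans ht
      have ht0 : 0 < t := hr0.trans_le ht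
      rw [norm_smul, norm_smul, nexp]
      simp only [Complex.neg_re, hκ, Complex.norm_real, norm_eq_abs]
      have h1 : |q t| * ‖f t‖ ≤ Q / r ^ 2 * (B * η r) := by
        apply mul_le_mul _ _ (norm_nonneg _) (by positivity)
        · refine (hq t ht').trans ?_
          gcongr
        · refine (hfB t ht').trans ?_
          gcongr
          exact hηanti r t ht
      calc Real.exp (-a * t) * (|q t| * ‖f t‖) ≤ Real.exp (-a * t) * (Q / r ^ 2 * (B * η r)) := by
            gcongr
        _ = K * Real.exp (-a * t) := by rw [hK]; ring
    have hcmp : ∀ T, r ≤ T → ‖Complex.exp (-κ * T) • g T - Complex.exp (-κ * r) • g r‖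
        ≤ K / a * (Real.exp (-a * r) - Real.exp (-a * T)) := by
      intro T hT
      have := image_norm_le_of_norm_deriv_right_le_deriv_boundary (a := r) (b := T)
        (f := fun t : ℝ => Complex.exp (-κ * t) • g t - Complex.exp (-κ * r) • g r)
        (f' := fun t : ℝ => Complex.exp (-κ * t) • ((q t : ℂ) • f t))
        (B := fun t => K / a * (Real.exp (-a * r) - Real.exp (-a * t)))
        (B' := fun t => K * Real.exp (-a * t))
        (fun t ht => ((hd t (hr.trans ht.1)).sub_const _).continuousAt.continuousWithinAt)
        (fun t ht => ((hd t (hr.trans ht.1)).sub_const _).hasDerivWithinAt)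
        (by simp) ?_ (fun t ht => hbound t ht.1) (Set.right_mem_Icc.mpr hT)
      · exact this
      · intro t
        have h1 : HasDerivAt (fun t : ℝ => Real.exp (-a * t)) (Real.exp (-a * t) * (-a)) t := by
          simpa using ((hasDerivAt_id t).const_mul (-a)).exp
        have := (h1.const_sub (Real.exp (-a * r))).const_mul (K / a)
        refine this.congr_deriv ?_
        field_simp
    have hlim : ‖Complex.exp (-κ * r) • g r‖ ≤ K / a * Real.exp (-a * r) := by
      have hz : Filter.Tendsto (fun T : ℝ => ‖Complex.exp (-κ * T) • g T‖) Filter.atTop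
          (nhds 0) := by
        have hexp0 : Filter.Tendsto (fun T : ℝ => Real.exp (-a * T) * (M + ‖κ‖ * M))
            Filter.atTop (nhds 0) := by
          have : Filter.Tendsto (fun T : ℝ => Real.exp (-a * T)) Filter.atTop (nhds 0) := by
            apply Real.tendsto_exp_atBot.comp
            exact Filter.tendsto_id.const_mul_atTop_of_neg (by linarith)
          simpa using this.mul_const (M + ‖κ‖ * M)
        refine squeeze_zero' (Filter.Eventually.of_forall fun _ => norm_nonneg _) ?_ hexp0
        filter_upwards [Filter.eventually_ge_atTop R] with T hT
        rw [norm_smul, nexp]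
        simp only [Complex.neg_re, hκ]
        gcongr
        refine (norm_add_le _ _).trans ?_
        rw [norm_smul]
        gcongr
        · exact hM' T hT
        · exact hM T hT
      have : ∀ᶠ T in Filter.atTop, ‖Complex.exp (-κ * r) • g r‖ - ‖Complex.exp (-κ * (T : ℝ)) • g T‖
          ≤ K / a * Real.exp (-a * r) := by
        filter_upwards [Filter.eventually_ge_atTop r] with T hT
        have h1 := hcmp T hT
        have h2 := norm_sub_norm_le (Complex.exp (-κ * r) • g r) (Complex.exp (-κ * T) • g T)
        rw [norm_sub_rev] at h2
        have h3 : 0 ≤ K / a * Real.exp (-a * T) := by positivity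
        linarith [mul_sub (K / a) (Real.exp (-a * r)) (Real.exp (-a * T))]
      simpa using le_of_tendsto (tendsto_const_nhds.sub hz) this
    rw [norm_smul, nexp] at hlim
    simp only [Complex.neg_re, hκ] at hlim
    have hpos := Real.exp_pos (-a * r)
    have h2 : ‖g r‖ ≤ K / a := by
      rw [mul_comm] at hlim
      exact le_of_mul_le_mul_right hlim hpos
    refine h2.trans (le_of_eq ?_)
    rw [hK]; field_simp
  -- bound on `f`
  intro r hr
  have hr0 : 0 < r := hR.trans_le hr
  have hd : ∀ t, R ≤ t → HasDerivAt (fun t : ℝ => Complex.exp (κ * ((t - R : ℝ) : ℂ)) • f t)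
      (Complex.exp (κ * ((t - R : ℝ) : ℂ)) • g t) t := by
    intro t ht
    have h1 : HasDerivAt (fun t : ℝ => Complex.exp (κ * ((t - R : ℝ) : ℂ)))
        (κ * Complex.exp (κ * ((t - R : ℝ) : ℂ))) t := by
      have := (dexp κ (t - R)).scomp t ((hasDerivAt_id t).sub_const R)
      simpa [Function.comp_def] using this
    have := h1.smul (hf t ht)
    refine this.congr_deriv ?_
    simp only [hg, smul_add, smul_smul]
    module
  set Bd : ℝ → ℝ := fun t => ‖f R‖ + Q * B / a * (1 / R - 1 / t)
    + Q * B / a * (ε / (a * R ^ 2)) * Real.exp (a * (t - R)) with hBd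
  have hBdd : ∀ t, R ≤ t → HasDerivAt Bd (Q * B / a * (1 / t ^ 2)
      + Q * B / a * (ε / R ^ 2) * Real.exp (a * (t - R))) t := by
    intro t ht
    have ht0 : 0 < t := hR.trans_le ht
    have h1 : HasDerivAt (fun t : ℝ => Real.exp (a * (t - R))) (Real.exp (a * (t - R)) * a) t := by
      simpa using (((hasDerivAt_id t).sub_const R).const_mul a).exp
    have h2 : HasDerivAt (fun t : ℝ => 1 / t) (-(1 / t ^ 2)) t := by
      simpa using hasDerivAt_inv ht0.ne'
    have := (((h2.const_sub (1 / R)).const_mul (Q * B / a)).const_add ‖f R‖).add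
      (h1.const_mul (Q * B / a * (ε / (a * R ^ 2))))
    refine this.congr_deriv ?_
    field_simp
  have hmain := image_norm_le_of_norm_deriv_right_le_deriv_boundary' (a := R) (b := r)
    (f := fun t : ℝ => Complex.exp (κ * ((t - R : ℝ) : ℂ)) • f t)
    (f' := fun t => Complex.exp (κ * ((t - R : ℝ) : ℂ)) • g t) (B := Bd)
    (fun t ht => (hd t ht.1).continuousAt.continuousWithinAt)
    (fun t ht => (hd t ht.1).hasDerivWithinAt)
    (by simp [hBd]; positivity)
    (fun t ht => (hBdd t ht.1).continuousAt.continuousWithinAt)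
    (fun t ht => (hBdd t ht.1).hasDerivWithinAt) ?_ (Set.right_mem_Icc.mpr hr)
  · have hmain' : Real.exp (a * (r - R)) * ‖f r‖ ≤ Bd r := by
      have : ‖Complex.exp (κ * ((r - R : ℝ) : ℂ)) • f r‖ ≤ Bd r := hmain
      rwa [norm_smul, nexp, hκ] at this
    have hQ1 : Q * B / a * (1 / R - 1 / r) ≤ B / 2 := by
      have h1 : Q * B / a * (1 / R - 1 / r) ≤ Q * B / a * (1 / R) := by
        gcongr
        have : 0 < 1 / r := by positivity
        linarith
      refine h1.trans ?_
      rw [div_mul_div_comm, div_le_div_iff₀ (by positivity) (by norm_num)]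
      nlinarith
    have hQ2 : Q * B / a * (ε / (a * R ^ 2)) ≤ B / 2 * ε := by
      rw [div_mul_div_comm, div_le_iff₀ (by positivity)]
      have h3 : 2 * Q ≤ a * (a * R ^ 2) := by nlinarith [mul_nonneg (mul_nonneg ha.le hR.le) (sub_nonneg.mpr hR1)]
      have := mul_le_mul_of_nonneg_left h3 (mul_nonneg hB hε.le)
      nlinarith
    have hE := Real.exp_pos (a * (r - R))
    have hinv : Real.exp (-a * (r - R)) * Real.exp (a * (r - R)) = 1 := by
      rw [← Real.exp_add]; simp
    have h4 : Real.exp (a * (r - R)) * ‖f r‖ ≤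
        Real.exp (a * (r - R)) * ((‖f R‖ + B / 2) * η r) := by
      have : Real.exp (a * (r - R)) * ((‖f R‖ + B / 2) * η r) =
          (‖f R‖ + B / 2) * (1 + ε * Real.exp (a * (r - R))) := by
        simp only [hη]
        linear_combination (‖f R‖ + B / 2) * hinv
      rw [this]
      refine hmain'.trans ?_
      simp only [hBd]
      have h5 := mul_le_mul_of_nonneg_right hQ2 hE.le
      have h6 : 0 ≤ ‖f R‖ * (ε * Real.exp (a * (r - R))) := by positivity
      nlinarith
    exact le_of_mul_le_mul_left h4 hE
  · intro t ht
    have ht0 : 0 < t := hR.trans_le ht.1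
    rw [norm_smul, nexp, hκ]
    have h1 := hgb t ht.1
    have hinv : Real.exp (a * (t - R)) * Real.exp (-(a * (t - R))) = 1 := by
      rw [← Real.exp_add]; simp
    calc Real.exp (a * (t - R)) * ‖g t‖ ≤ Real.exp (a * (t - R)) * (Q * B / (a * t ^ 2) * η t) := by
          gcongr
      _ = Q * B / a * (1 / t ^ 2) + Q * B / a * (ε / t ^ 2) * Real.exp (a * (t - R)) := by
          simp only [hη]
          field_simp
          linear_combination (Q * B) * hinv
      _ ≤ _ := by
          have := ht.1
          gcongr

theorem norm_le_of_perturbed_exponential {F : Type*} [NormedAddCommGroup F] [NormedSpace ℂ F]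
    {κ : ℂ} {a Q R : ℝ} (hκ : κ.re = a) (ha : 0 < a) (hQ : 0 ≤ Q) (hR1 : 1 ≤ a * R)
    (hR2 : 2 * Q ≤ a * R) {q : ℝ → ℝ} (hq : ∀ r, R ≤ r → |q r| ≤ Q / r ^ 2) {f f' : ℝ → F}
    (hf : ∀ r, R ≤ r → HasDerivAt f (f' r) r)
    (hf' : ∀ r, R ≤ r → HasDerivAt f' ((κ ^ 2 + (q r : ℂ)) • f r) r)
    {M : ℝ} (hM : ∀ r, R ≤ r → ‖f r‖ ≤ M) (hM' : ∀ r, R ≤ r → ‖f' r‖ ≤ M)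
    {r : ℝ} (hr : R ≤ r) : ‖f r‖ ≤ 2 * Real.exp (-a * (r - R)) * ‖f R‖ := by
  have hM0 : 0 ≤ M := (norm_nonneg _).trans (hM R le_rfl)
  have key : ∀ ε, 0 < ε → ‖f r‖ ≤ 2 * ‖f R‖ * (Real.exp (-a * (r - R)) + ε) := by
    intro ε hε
    have hn : ∀ n : ℕ, ∀ r, R ≤ r →
        ‖f r‖ ≤ (2 * ‖f R‖ + (M / ε) * (1 / 2) ^ n) * (Real.exp (-a * (r - R)) + ε) := by
      intro n
      induction n with
      | zero =>
        intro r hr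
        have h1 : M ≤ (M / ε) * (Real.exp (-a * (r - R)) + ε) := by
          rw [mul_add, div_mul_cancel₀ _ hε.ne']
          have : 0 ≤ M / ε * Real.exp (-a * (r - R)) := by positivity
          linarith
        have h2 : 0 ≤ 2 * ‖f R‖ * (Real.exp (-a * (r - R)) + ε) := by positivity
        have := hM r hr
        simp only [pow_zero, mul_one]
        linarith [add_mul (2 * ‖f R‖) (M / ε) (Real.exp (-a * (r - R)) + ε)]
      | succ n ih =>
        intro r hr
        have := norm_le_of_perturbed_exponential_step hκ ha hQ hR1 hR2 hq hf hf' hM hM' hε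
          (by positivity) ih r hr
        refine this.trans (le_of_eq ?_)
        rw [pow_succ]
        ring
    have hlim : Filter.Tendsto (fun n : ℕ => (2 * ‖f R‖ + (M / ε) * (1 / 2 : ℝ) ^ n) *
        (Real.exp (-a * (r - R)) + ε)) Filter.atTop
        (nhds ((2 * ‖f R‖ + (M / ε) * 0) * (Real.exp (-a * (r - R)) + ε))) :=
      (((tendsto_pow_atTop_nhds_zero_of_lt_one (by norm_num) (by norm_num)).const_mul _).const_add
        _).mul_const _
    simpa using ge_of_tendsto' hlim (fun n => hn n r hr)
  have hlim : Filter.Tendsto (fun ε : ℝ => 2 * ‖f R‖ * (Real.exp (-a * (r - R)) + ε))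
      (nhdsWithin 0 (Set.Ioi 0)) (nhds (2 * ‖f R‖ * (Real.exp (-a * (r - R)) + 0))) := by
    refine Filter.Tendsto.mono_left ?_ nhdsWithin_le_nhds
    exact ((continuous_const.add continuous_id).const_mul _).tendsto _
  have := ge_of_tendsto hlim (Filter.eventually_of_mem self_mem_nhdsWithin fun ε hε => key ε hε)
  linarith [this]

/-! ### Clifford relations -/

/-- The relations `γ_a γ_b + γ_b γ_a = -2 δ_ab`. -/
structure CliffordRel {κ A : Type*} [Ring A] (γ : κ → A) : Prop where
  sq : ∀ a, γ a * γ a = -1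
  anti : ∀ a b, a ≠ b → γ a * γ b = -(γ b * γ a)

theorem CliffordRel.map {κ A B : Type*} [Ring A] [Ring B] {γ : κ → A} (h : CliffordRel γ)
    (f : A →+* B) : CliffordRel (fun a => f (γ a)) where
  sq a := by rw [← map_mul, h.sq]; simp
  anti a b hab := by rw [← map_mul, h.anti a b hab]; simp

section Words

variable {κ A : Type*} [Ring A] [Algebra ℝ A]

/-- The spans of the even and of the odd products of the generators in a list. -/
def parityWords (γ : κ → A) : List κ → Submodule ℝ A × Submodule ℝ A
  | [] => (Submodule.span ℝ {1}, ⊥)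
  | a :: l => ((parityWords γ l).1 ⊔ (parityWords γ l).2.map (LinearMap.mulLeft ℝ (γ a)),
      (parityWords γ l).2 ⊔ (parityWords γ l).1.map (LinearMap.mulLeft ℝ (γ a)))

theorem mem_parityWords_cons_fst {γ : κ → A} {a : κ} {l : List κ} {x : A} :
    x ∈ (parityWords γ (a :: l)).1 ↔
      ∃ p ∈ (parityWords γ l).1, ∃ q ∈ (parityWords γ l).2, x = p + γ a * q := by
  simp only [parityWords, Submodule.mem_sup, Submodule.mem_map, LinearMap.mulLeft_apply]
  constructor
  · rintro ⟨p, hp, _, ⟨q, hq, rfl⟩, rfl⟩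
    exact ⟨p, hp, q, hq, rfl⟩
  · rintro ⟨p, hp, q, hq, rfl⟩
    exact ⟨p, hp, _, ⟨q, hq, rfl⟩, rfl⟩

theorem mem_parityWords_cons_snd {γ : κ → A} {a : κ} {l : List κ} {x : A} :
    x ∈ (parityWords γ (a :: l)).2 ↔
      ∃ p ∈ (parityWords γ l).2, ∃ q ∈ (parityWords γ l).1, x = p + γ a * q := by
  simp only [parityWords, Submodule.mem_sup, Submodule.mem_map, LinearMap.mulLeft_apply]
  constructor
  · rintro ⟨p, hp, _, ⟨q, hq, rfl⟩, rfl⟩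
    exact ⟨p, hp, q, hq, rfl⟩
  · rintro ⟨p, hp, q, hq, rfl⟩
    exact ⟨p, hp, _, ⟨q, hq, rfl⟩, rfl⟩

theorem CliffordRel.parityWords_comm {γ : κ → A} (h : CliffordRel γ) (l : List κ) {b : κ}
    (hb : b ∉ l) : (∀ x ∈ (parityWords γ l).1, γ b * x = x * γ b) ∧
      (∀ x ∈ (parityWords γ l).2, γ b * x = -(x * γ b)) := by
  induction l with
  | nil =>
    refine ⟨fun x hx => ?_, fun x hx => ?_⟩
    · obtain ⟨r, rfl⟩ := Submodule.mem_span_singleton.mp hx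
      simp
    · obtain rfl : x = 0 := by simpa [parityWords] using hx
      simp
  | cons a l ih =>
    have hba : b ≠ a := fun e => hb (by simp [e])
    obtain ⟨ih1, ih2⟩ := ih (fun e => hb (by simp [e]))
    have hab := h.anti b a hba
    refine ⟨fun x hx => ?_, fun x hx => ?_⟩
    · obtain ⟨p, hp, q, hq, rfl⟩ := mem_parityWords_cons_fst.mp hx
      rw [mul_add, add_mul, ih1 p hp, ← mul_assoc, hab, neg_mul, mul_assoc, ih2 q hq]
      simp [mul_assoc]
    · obtain ⟨p, hp, q, hq, rfl⟩ := mem_parityWords_cons_snd.mp hx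
      rw [mul_add, add_mul, ih2 p hp, ← mul_assoc, hab, neg_mul, mul_assoc, ih1 q hq]
      simp [mul_assoc, add_comm]

theorem CliffordRel.mul_mem_parityWords {γ : κ → A} (h : CliffordRel γ) (l : List κ) {b : κ}
    (hb : b ∈ l) : (∀ x ∈ (parityWords γ l).1, γ b * x ∈ (parityWords γ l).2) ∧
      (∀ x ∈ (parityWords γ l).2, γ b * x ∈ (parityWords γ l).1) := by
  induction l with
  | nil => simp at hb
  | cons a l ih =>
    by_cases hba : b = a
    · subst hba
      refine ⟨fun x hx => ?_, fun x hx => ?_⟩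
      · obtain ⟨p, hp, q, hq, rfl⟩ := mem_parityWords_cons_fst.mp hx
        refine mem_parityWords_cons_snd.mpr ⟨-q, neg_mem hq, p, hp, ?_⟩
        rw [mul_add, ← mul_assoc, h.sq]; simp [add_comm]
      · obtain ⟨p, hp, q, hq, rfl⟩ := mem_parityWords_cons_snd.mp hx
        refine mem_parityWords_cons_fst.mpr ⟨-q, neg_mem hq, p, hp, ?_⟩
        rw [mul_add, ← mul_assoc, h.sq]; simp [add_comm]
    · obtain ⟨ih1, ih2⟩ := ih (by simpa [hba] using hb)
      have hab := h.anti b a hba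
      refine ⟨fun x hx => ?_, fun x hx => ?_⟩
      · obtain ⟨p, hp, q, hq, rfl⟩ := mem_parityWords_cons_fst.mp hx
        refine mem_parityWords_cons_snd.mpr ⟨_, ih1 p hp, -(γ b * q), neg_mem (ih2 q hq), ?_⟩
        rw [mul_add, ← mul_assoc, hab]; simp [mul_assoc]
      · obtain ⟨p, hp, q, hq, rfl⟩ := mem_parityWords_cons_snd.mp hx
        refine mem_parityWords_cons_fst.mpr ⟨_, ih2 p hp, -(γ b * q), neg_mem (ih1 q hq), ?_⟩
        rw [mul_add, ← mul_assoc, hab]; simp [mul_assoc]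

/-- An even element commuting with all generators is a scalar. -/
theorem CliffordRel.scalar_of_commute {γ : κ → A} (h : CliffordRel γ) (l : List κ)
    (hl : l.Nodup) {x : A} (hx : x ∈ (parityWords γ l).1) (hc : ∀ a, γ a * x = x * γ a) :
    ∃ r : ℝ, x = algebraMap ℝ A r := by
  induction l generalizing x with
  | nil =>
    obtain ⟨r, rfl⟩ := Submodule.mem_span_singleton.mp hx
    exact ⟨r, by rw [Algebra.algebraMap_eq_smul_one]⟩
  | cons a l ih =>
    obtain ⟨p, hp, q, hq, rfl⟩ := mem_parityWords_cons_fst.mp hx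
    have hal : a ∉ l := (List.nodup_cons.mp hl).1
    obtain ⟨h1, h2⟩ := h.parityWords_comm l hal
    have e := hc a
    rw [mul_add, add_mul, h1 p hp, add_right_inj, mul_assoc, ← mul_assoc, h.sq] at e
    have e2 : q * γ a = -(γ a * q) := by rw [h2 q hq, neg_neg]
    rw [e2, mul_neg, ← mul_assoc, h.sq] at e
    simp only [neg_mul, one_mul, neg_neg] at e
    have q0 : q = 0 := by
      have : (2 : ℝ) • q = 0 := by
        rw [two_smul]; nth_rewrite 1 [← e]; simp
      simpa using this
    subst q0
    simp only [mul_zero, add_zero] at hc ⊢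
    exact ih (List.nodup_cons.mp hl).2 hp hc

end Words

section Cl

variable {κ : Type*} [Fintype κ] [DecidableEq κ]

theorem cliffordRel_gen : CliffordRel (fun a : κ => cliffordGen a) where
  sq a := by
    simp only [cliffordGen, CliffordAlgebra.ι_sq_scalar]
    rw [QuadraticMap.weightedSumSquares_apply]
    simp [Pi.single_apply]
  anti a b hab := by
    have h := CliffordAlgebra.ι_mul_ι_add_swap (Q := cliffordForm κ) (Pi.single a (1 : ℝ))
      (Pi.single b 1)
    have h0 : QuadraticMap.polar (cliffordForm κ) (Pi.single a (1 : ℝ)) (Pi.single b 1) = 0 := by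
      simp only [QuadraticMap.polar, QuadraticMap.weightedSumSquares_apply, ← sum_sub_distrib]
      apply Finset.sum_eq_zero
      intro i _
      by_cases h1 : i = a <;> by_cases h2 : i = b <;> simp_all
    rw [h0, map_zero] at h
    exact eq_neg_of_add_eq_zero_left h

theorem cliffordι_eq_sum (v : κ → ℝ) :
    CliffordAlgebra.ι (cliffordForm κ) v = ∑ a, v a • cliffordGen a := by
  conv_lhs => rw [← Finset.univ_sum_single v]
  rw [map_sum]
  refine sum_congr rfl fun a _ => ?_
  rw [cliffordGen, ← map_smul]
  congr 1
  ext i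
  simp [Pi.single_apply]

theorem act_mem_parityWords {A : Type*} [Ring A] [Algebra ℝ A] (act : Cl κ →ₐ[ℝ] A) {x : Cl κ}
    (hx : x ∈ CliffordAlgebra.even (cliffordForm κ)) :
    act x ∈ (parityWords (fun a => act (cliffordGen a)) Finset.univ.toList).1 := by
  have hrel : CliffordRel (fun a => act (cliffordGen a)) := cliffordRel_gen.map act.toRingHom
  set l := (Finset.univ : Finset κ).toList
  have h1 : (1 : A) ∈ (parityWords (fun a => act (cliffordGen a)) l).1 := by
    generalize l = l
    induction l with
    | nil => exact Submodule.mem_span_singleton_self 1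
    | cons a l ih => exact mem_parityWords_cons_fst.mpr ⟨1, ih, 0, zero_mem _, by simp⟩
  have hb : ∀ b : κ, b ∈ l := by simp [l]
  have hv : ∀ v : κ → ℝ, (∀ x ∈ (parityWords (fun a => act (cliffordGen a)) l).1,
        act (CliffordAlgebra.ι _ v) * x ∈ (parityWords (fun a => act (cliffordGen a)) l).2) ∧
      (∀ x ∈ (parityWords (fun a => act (cliffordGen a)) l).2,
        act (CliffordAlgebra.ι _ v) * x ∈ (parityWords (fun a => act (cliffordGen a)) l).1) := by
    intro v
    constructor <;> intro x hx <;>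
      rw [cliffordι_eq_sum, map_sum, sum_mul] <;>
      refine Submodule.sum_mem _ fun a _ => ?_ <;> rw [map_smul, smul_mul_assoc] <;>
      refine Submodule.smul_mem _ _ ?_
    · exact (hrel.mul_mem_parityWords l (hb a)).1 x hx
    · exact (hrel.mul_mem_parityWords l (hb a)).2 x hx
  have hx' : x ∈ CliffordAlgebra.evenOdd (cliffordForm κ) 0 := hx
  clear hx
  induction x, hx' using CliffordAlgebra.even_induction with
  | algebraMap r =>
    rw [AlgHom.commutes, Algebra.algebraMap_eq_smul_one]
    exact Submodule.smul_mem _ _ h1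
  | add x y hx hy ihx ihy => rw [map_add]; exact add_mem ihx ihy
  | ι_mul_ι_mul m₁ m₂ x hx ih =>
    rw [map_mul, map_mul, mul_assoc]
    exact (hv m₁).2 _ ((hv m₂).1 _ ih)

/-- Elements anticommuting with all vectors commute with the even part. -/
theorem commute_act_of_even {A : Type*} [Ring A] [Algebra ℝ A] (act : Cl κ →ₐ[ℝ] A) {u : A}
    (hu : ∀ a, u * act (cliffordGen a) = -(act (cliffordGen a) * u)) {x : Cl κ}
    (hx : x ∈ CliffordAlgebra.even (cliffordForm κ)) : u * act x = act x * u := by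
  have hv : ∀ v, u * act (CliffordAlgebra.ι _ v) = -(act (CliffordAlgebra.ι _ v) * u) := by
    intro v
    rw [cliffordι_eq_sum, map_sum, mul_sum, sum_mul, ← sum_neg_distrib]
    refine sum_congr rfl fun a _ => ?_
    rw [map_smul, mul_smul_comm, hu, smul_mul_assoc, smul_neg]
  have hx' : x ∈ CliffordAlgebra.evenOdd (cliffordForm κ) 0 := hx
  clear hx
  induction x, hx' using CliffordAlgebra.even_induction with
  | algebraMap r => rw [AlgHom.commutes]; exact (Algebra.commutes r u).symm
  | add x y hx hy ihx ihy => rw [map_add, mul_add, add_mul, ihx, ihy]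
  | ι_mul_ι_mul m₁ m₂ x hx ih =>
    rw [map_mul, map_mul, ← mul_assoc, ← mul_assoc, hv, neg_mul, mul_assoc _ u, hv]
    simp only [mul_assoc, mul_neg, neg_neg]
    rw [ih]

variable {S : Type*} [NormedAddCommGroup S] [InnerProductSpace ℂ S]

theorem inner_act_left (act : Cl κ →ₐ[ℝ] Module.End ℂ S)
    (hskew : ∀ (a : κ) (s t : S),
      inner ℂ (act (cliffordGen a) s) t = -inner ℂ s (act (cliffordGen a) t)) (x : Cl κ) (s t : S) :
    inner ℂ (act x s) t = inner ℂ s (act (star x) t) := by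
  induction x using CliffordAlgebra.induction generalizing s t with
  | algebraMap r =>
    rw [CliffordAlgebra.star_algebraMap, AlgHom.commutes]
    simp only [Module.algebraMap_end_apply]
    rw [← coe_smul, ← coe_smul, inner_smul_left, inner_smul_right]
    simp
  | ι v =>
    rw [CliffordAlgebra.star_ι, cliffordι_eq_sum]
    simp only [map_sum, map_neg, map_smul, LinearMap.sum_apply, LinearMap.neg_apply,
      LinearMap.smul_apply, sum_inner, inner_neg_right, inner_sum, ← sum_neg_distrib]
    refine sum_congr rfl fun a _ => ?_
    rw [← coe_smul, ← coe_smul, inner_smul_left, inner_smul_right, hskew]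
    simp
  | mul x y hx hy => rw [map_mul, star_mul, map_mul]; simp [hx, hy]
  | add x y hx hy => rw [map_add, star_add, map_add]; rw [LinearMap.add_apply, LinearMap.add_apply, inner_add_left, inner_add_right, hx, hy]

end Cl

section Intertwiner

variable {κ : Type*} [DecidableEq κ] {V W : Type*} [AddCommGroup V] [Module ℂ V]
  [AddCommGroup W] [Module ℂ W]

theorem exists_sign_intertwiner {γ : κ → Module.End ℂ V} {γ' : κ → Module.End ℂ W}
    (h : CliffordRel γ) (h' : CliffordRel γ') (s : V) (T₀ : V →ₗ[ℂ] W) (hT₀ : T₀ s ≠ 0)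
    (J : Finset κ) :
    ∃ (T : V →ₗ[ℂ] W) (M : Finset κ), T s ≠ 0 ∧
      ∀ b ∈ J, ∀ v, T (γ b v) = (if b ∈ M then (-1 : ℂ) else 1) • γ' b (T v) := by
  have sq : ∀ b v, γ b (γ b v) = -v := fun b v => by
    rw [← Module.End.mul_apply, h.sq]; simp
  have sq' : ∀ b v, γ' b (γ' b v) = -v := fun b v => by
    rw [← Module.End.mul_apply, h'.sq]; simp
  have an : ∀ a b v, a ≠ b → γ a (γ b v) = -γ b (γ a v) := fun a b v hab => by
    rw [← Module.End.mul_apply, h.anti a b hab]; simp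
  have an' : ∀ a b v, a ≠ b → γ' a (γ' b v) = -γ' b (γ' a v) := fun a b v hab => by
    rw [← Module.End.mul_apply, h'.anti a b hab]; simp
  induction J using Finset.induction_on with
  | empty => exact ⟨T₀, ∅, hT₀, by simp⟩
  | insert b J hb ih =>
    obtain ⟨T, M, hT, hM⟩ := ih
    have key : ∀ ε : ℂ, ε = 1 ∨ ε = -1 → (T - ε • (γ' b ∘ₗ T ∘ₗ γ b)) s ≠ 0 →
        ∃ (T : V →ₗ[ℂ] W) (M : Finset κ), T s ≠ 0 ∧ ∀ a ∈ insert b J, ∀ v,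
          T (γ a v) = (if a ∈ M then (-1 : ℂ) else 1) • γ' a (T v) := by
      intro ε hε hs
      refine ⟨T - ε • (γ' b ∘ₗ T ∘ₗ γ b), if ε = 1 then M.erase b else insert b M, hs, ?_⟩
      intro a ha v
      by_cases hab : a = b
      · subst hab
        have hsgn : (if a ∈ (if ε = 1 then M.erase a else insert a M) then (-1 : ℂ) else 1) = ε := by
          rcases hε with rfl | rfl
          · simp
          · have : ¬ ((-1 : ℂ) = 1) := by norm_num
            simp [this]
        have hε2 : ε * ε = 1 := by rcases hε with rfl | rfl <;> norm_num
        rw [hsgn]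
        simp only [LinearMap.sub_apply, LinearMap.smul_apply, LinearMap.comp_apply, sq, sq', map_neg,
          map_sub, map_smul, smul_sub, smul_neg, smul_smul, hε2, one_smul]
        abel
      · have haJ : a ∈ J := by simpa [hab] using ha
        have hsgn : (a ∈ (if ε = 1 then M.erase b else insert b M)) ↔ a ∈ M := by
          split_ifs <;> simp [hab]
        simp only [hsgn]
        simp only [LinearMap.sub_apply, LinearMap.smul_apply, LinearMap.comp_apply, map_sub,
          map_smul, smul_sub]
        rw [hM a haJ, an b a v (Ne.symm hab), map_neg, hM a haJ, map_neg, map_smul,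
          an' b a _ (Ne.symm hab)]
        simp only [smul_neg, neg_neg, smul_comm ε]
    by_cases h1 : (T - (1 : ℂ) • (γ' b ∘ₗ T ∘ₗ γ b)) s = 0
    · apply key (-1) (Or.inr rfl)
      intro h2
      apply hT
      simp only [LinearMap.sub_apply, LinearMap.smul_apply] at h1 h2
      have h3 : (2 : ℂ) • T s = 0 := by
        rw [← add_zero (0 : W), ← h1]
        nth_rewrite 2 [h1]
        rw [← h2]
        module
      simpa using h3
    · exact key 1 (Or.inl rfl) h1

/-- Between two modules over a Clifford algebra there are many linear maps that commute with the
generators up to a common sign. -/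
theorem exists_intertwiner [Fintype κ] [Nontrivial W] {γ : κ → Module.End ℂ V} {γ' : κ → Module.End ℂ W}
    (h : CliffordRel γ) (h' : CliffordRel γ') {s : V} (hs : s ≠ 0) :
    ∃ (T : V →ₗ[ℂ] W) (ε : ℂ), ε * ε = 1 ∧ T s ≠ 0 ∧ ∀ b v, T (γ b v) = ε • γ' b (T v) := by
  have sq' : ∀ b v, γ' b (γ' b v) = -v := fun b v => by
    rw [← Module.End.mul_apply, h'.sq]; simp
  have an' : ∀ a b v, a ≠ b → γ' a (γ' b v) = -γ' b (γ' a v) := fun a b v hab => by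
    rw [← Module.End.mul_apply, h'.anti a b hab]; simp
  have hinj : ∀ b v, v ≠ 0 → γ' b v ≠ 0 := fun b v hv h0 => hv (by
    have := sq' b v
    rw [h0, map_zero] at this
    simpa using this.symm)
  obtain ⟨T₀, hT₀⟩ : ∃ T₀ : V →ₗ[ℂ] W, T₀ s ≠ 0 := by
    obtain ⟨f, hf⟩ := Submodule.exists_dual_map_eq_bot_of_notMem (p := (⊥ : Submodule ℂ V))
      (x := s) (by simpa using hs) inferInstance
    obtain ⟨w, hw⟩ := exists_ne (0 : W)
    exact ⟨f.smulRight w, by simpa [hw] using hf.1⟩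
  have main : ∀ (m : ℕ) (T : V →ₗ[ℂ] W) (M : Finset κ), M.card = m → T s ≠ 0 →
      (∀ b v, T (γ b v) = (if b ∈ M then (-1 : ℂ) else 1) • γ' b (T v)) →
      ∃ (T : V →ₗ[ℂ] W) (ε : ℂ), ε * ε = 1 ∧ T s ≠ 0 ∧ ∀ b v, T (γ b v) = ε • γ' b (T v) := by
    intro m
    induction m using Nat.strong_induction_on with
    | _ m ih =>
      intro T M hM hT hTM
      rcases M.eq_empty_or_nonempty with rfl | ⟨b, hb⟩
      · exact ⟨T, 1, by norm_num, hT, by simpa using hTM⟩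
      by_cases hM1 : M = {b}
      · refine ⟨γ' b ∘ₗ T, -1, by norm_num, hinj b _ hT, fun a v => ?_⟩
        simp only [LinearMap.comp_apply]
        rw [hTM a v, map_smul]
        by_cases hab : a = b
        · subst hab; simp [hb]
        · rw [an' b a _ (Ne.symm hab)]
          simp [hM1, hab]
      · obtain ⟨e, he, heb⟩ : ∃ e ∈ M, e ≠ b := by
          by_contra hcon
          push Not at hcon
          exact hM1 (Finset.eq_singleton_iff_unique_mem.mpr ⟨hb, hcon⟩)
        refine ih ((M.erase b).erase e).card ?_ (γ' e ∘ₗ γ' b ∘ₗ T) ((M.erase b).erase e) rfl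
          (hinj e _ (hinj b _ hT)) ?_
        · rw [← hM]
          exact (Finset.card_erase_le).trans_lt (Finset.card_erase_lt_of_mem hb)
        · intro a v
          simp only [LinearMap.comp_apply]
          rw [hTM a v, map_smul, map_smul]
          by_cases hab : a = b
          · subst hab
            rw [an' e a (γ' a (T v)) heb]
            simp [hb]
          · by_cases hae : a = e
            · subst hae
              rw [an' b a (T v) (Ne.symm hab)]
              simp [he]
            · rw [an' b a _ (Ne.symm hab), map_neg, an' e a _ (Ne.symm hae)]
              simp [hab, hae]
  obtain ⟨T, M, hT, hM⟩ := exists_sign_intertwiner h h' s T₀ hT₀ Finset.univ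
  exact main _ T M rfl hT (fun b v => hM b (Finset.mem_univ b) v)

end Intertwiner

/-! ### A pointwise estimate for first order elliptic inequalities -/

section Elliptic

theorem contDiff_of_tsupport_subset {E F : Type*} [NormedAddCommGroup E] [NormedSpace ℝ E]
    [NormedAddCommGroup F] [NormedSpace ℝ F] {f : E → F} {U : Set E} (hU : IsOpen U)
    (hf : ContDiffOn ℝ 1 f U) (hs : tsupport f ⊆ U) : ContDiff ℝ 1 f := by
  rw [contDiff_iff_contDiffAt]
  intro x
  by_cases hx : x ∈ tsupport f
  · exact hf.contDiffAt (hU.mem_nhds (hs hx))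
  · have : f =ᶠ[nhds x] fun _ => 0 := notMem_tsupport_iff_eventuallyEq.mp hx
    exact contDiffAt_const.congr_of_eventuallyEq this

theorem integral_fderiv_apply_eq_zero {E F : Type*} [NormedAddCommGroup E] [NormedSpace ℝ E]
    [FiniteDimensional ℝ E] [MeasurableSpace E] [BorelSpace E] (μ : Measure E)
    [μ.IsAddHaarMeasure] [NormedAddCommGroup F] [NormedSpace ℝ F] {f : E → F}
    (hf : ContDiff ℝ 1 f) (hs : HasCompactSupport f) (v : E) :
    ∫ x, fderiv ℝ f x v ∂μ = 0 := by
  have hint : Integrable (fun x => fderiv ℝ f x v) μ :=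
    ((hf.continuous_fderiv (by norm_num)).clm_apply continuous_const).integrable_of_hasCompactSupport
      (hs.fderiv_apply (𝕜 := ℝ) v)
  have := integral_smul_fderiv_eq_neg_fderiv_smul_of_integrable (μ := μ) (𝕜 := ℝ)
    (f := fun _ : E => (1 : ℝ)) (g := f) (v := v) (by simp) (by simpa using hint)
    (by simpa using hf.continuous.integrable_of_hasCompactSupport hs)
    (fun x _ => differentiableAt_const _) (fun x _ => hf.differentiable (by norm_num) x)
  simpa using this

variable {κ : Type*} [Fintype κ] {S : Type*} [NormedAddCommGroup S]
  [NormedSpace ℝ S]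

/-- Clifford multiplication by vectors. -/
def cliffordMul (γ : κ → S →L[ℝ] S) : 𝔽 κ →L[ℝ] S →L[ℝ] S :=
  ∑ a, (proj a : 𝔽 κ →L[ℝ] ℝ).smulRight (γ a)

theorem cliffordMul_apply (γ : κ → S →L[ℝ] S) (z : 𝔽 κ) :
    cliffordMul γ z = ∑ a, z a • γ a := by
  simp [cliffordMul]

variable [DecidableEq κ]

theorem cliffordMul_single (γ : κ → S →L[ℝ] S) (a : κ) :
    cliffordMul γ δ[a] = γ a := by
  simp [cliffordMul_apply]

theorem cliffordMul_sq {γ : κ → S →L[ℝ] S} (h : CliffordRel γ) (z : 𝔽 κ) (u : S) :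
    cliffordMul γ z (cliffordMul γ z u) = -(‖z‖ ^ 2 • u) := by
  have h1 : ∀ a b, γ a * γ b + γ b * γ a = if a = b then (-2 : ℝ) • (1 : S →L[ℝ] S) else 0 := by
    intro a b
    by_cases hab : a = b
    · subst hab
      rw [h.sq, if_pos rfl, neg_smul, two_smul]; abel
    · rw [h.anti a b hab, if_neg hab]; simp
  have h2 : (2 : ℝ) • (cliffordMul γ z * cliffordMul γ z) = (-2 * ‖z‖ ^ 2) • (1 : S →L[ℝ] S) := by
    have : (2 : ℝ) • (cliffordMul γ z * cliffordMul γ z)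
        = ∑ a, ∑ b, (z a * z b) • (γ a * γ b + γ b * γ a) := by
      simp only [smul_add, sum_add_distrib]
      rw [two_smul]
      have e : cliffordMul γ z * cliffordMul γ z = ∑ a, ∑ b, (z a * z b) • (γ a * γ b) := by
        rw [cliffordMul_apply, Finset.sum_mul_sum]
        simp only [smul_mul_smul_comm]
      congr 1
      rw [e, sum_comm]
      simp only [mul_comm]
    rw [this, EuclideanSpace.norm_sq_eq]
    simp only [h1, smul_ite, smul_zero, Finset.sum_ite_eq, Finset.mem_univ, if_true, smul_smul,
      ← sum_smul, mul_sum]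
    congr 1
    refine sum_congr rfl fun a _ => ?_
    simp; ring
  have h3 : cliffordMul γ z * cliffordMul γ z = (-‖z‖ ^ 2) • (1 : S →L[ℝ] S) := by
    have := congrArg (fun T => (1 / 2 : ℝ) • T) h2
    simp only [smul_smul] at this
    rw [show (1 / 2 : ℝ) * 2 = 1 by norm_num, one_smul] at this
    rw [this]; congr 1; ring
  have := congrArg (fun T : S →L[ℝ] S => T u) h3
  simpa using this

theorem sum_smul_single_euclidean (y : 𝔽 κ) :
    ∑ j, y j • (δ[j] : 𝔽 κ) = y := by
  ext i
  simp [Pi.single_apply]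

/-- The divergence of the vector field `∑ w Y_a Γ γ_a u`, computed at one point. -/
theorem divergence_identity {γ : κ → S →L[ℝ] S} (h : CliffordRel γ) (z : 𝔽 κ)
    (w : ℝ) (w' : 𝔽 κ →L[ℝ] ℝ) (Y : κ → 𝔽 κ)
    (Y' : κ → 𝔽 κ →L[ℝ] 𝔽 κ) (u : S)
    (u' : 𝔽 κ →L[ℝ] S) :
    ∑ a, ∑ j, ((w * Y a j) • (cliffordMul γ δ[j] (γ a u) + cliffordMul γ z (γ a (u' δ[j]))) +
        (w * (Y' a δ[j]) j + w' δ[j] * Y a j) • cliffordMul γ z (γ a u)) =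
      ∑ a, (w' δ[a]) • cliffordMul γ z (γ a u) - (w * 𝔡 κ) • u +
      (∑ a, (w' (Y a - δ[a])) • cliffordMul γ z (γ a u) +
       ∑ a, (w * ∑ j, (Y' a δ[j]) j) • cliffordMul γ z (γ a u) +
       ∑ a, w • cliffordMul γ (Y a - δ[a]) (γ a u) +
       w • cliffordMul γ z (∑ a, γ a (u' (Y a)))) := by
  have e1 : ∀ a, ∑ j, (w * Y a j) • cliffordMul γ δ[j] (γ a u)
      = w • cliffordMul γ (Y a) (γ a u) := by
    intro a
    conv_rhs => rw [← sum_smul_single_euclidean (Y a)]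
    simp only [map_sum, map_smul, _root_.sum_apply, _root_.smul_apply, smul_sum, smul_smul]
  have e2 : ∀ a, ∑ j, (w * Y a j) • cliffordMul γ z (γ a (u' δ[j]))
      = w • cliffordMul γ z (γ a (u' (Y a))) := by
    intro a
    conv_rhs => rw [← sum_smul_single_euclidean (Y a)]
    simp only [map_sum, map_smul, smul_sum, smul_smul]
  have e3 : ∀ a, ∑ j, (w' δ[j] * Y a j) • cliffordMul γ z (γ a u)
      = w' (Y a) • cliffordMul γ z (γ a u) := by
    intro a
    conv_rhs => rw [← sum_smul_single_euclidean (Y a)]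
    simp only [map_sum, map_smul, sum_smul, smul_eq_mul]
    exact sum_congr rfl fun j _ => by rw [mul_comm]
  have e4 : ∑ a, w • cliffordMul γ δ[a] (γ a u)
      = -((w * 𝔡 κ) • u) := by
    simp only [cliffordMul_single]
    have : ∀ a, γ a (γ a u) = -u := fun a => by
      rw [← mul_apply_eq_comp, h.sq]; simp
    simp [this, mul_smul, smul_comm w, Nat.cast_smul_eq_nsmul]
  simp only [smul_add, add_smul, sum_add_distrib, e1, e2, e3]
  simp only [map_sub, map_sum, _root_.sub_apply, smul_sub, sub_smul,
    sum_sub_distrib, e4, smul_sum, mul_sum, sum_smul]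
  abel

/-- The regularisation `√(|z|² + ε²)` of the norm. -/
def regNorm {E : Type*} [NormedAddCommGroup E] (ε : ℝ) (z : E) : ℝ := √(‖z‖ ^ 2 + ε ^ 2)

theorem regNorm_pos {E : Type*} [NormedAddCommGroup E] {ε : ℝ} (hε : 0 < ε) (z : E) :
    0 < regNorm ε z := Real.sqrt_pos.mpr (by positivity)

theorem regNorm_sq {E : Type*} [NormedAddCommGroup E] (ε : ℝ) (z : E) :
    regNorm ε z ^ 2 = ‖z‖ ^ 2 + ε ^ 2 := Real.sq_sqrt (by positivity)

theorem norm_le_regNorm {E : Type*} [NormedAddCommGroup E] (ε : ℝ) (z : E) :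
    ‖z‖ ≤ regNorm ε z := Real.le_sqrt_of_sq_le (by nlinarith [sq_nonneg ε])

theorem hasFDerivAt_regNorm_inv_pow {E : Type*} [NormedAddCommGroup E] [InnerProductSpace ℝ E]
    {ε : ℝ} (hε : 0 < ε) (d : ℕ) (z : E) :
    HasFDerivAt (fun z : E => (regNorm ε z ^ d)⁻¹)
      ((-(d : ℝ) / regNorm ε z ^ (d + 2)) • innerSL ℝ z) z := by
  have hp := regNorm_pos hε z
  have h1 : HasFDerivAt (fun z : E => ‖z‖ ^ 2 + ε ^ 2) ((2 : ℝ) • innerSL ℝ z) z := by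
    have := (hasStrictFDerivAt_norm_sq z).hasFDerivAt.add_const (ε ^ 2)
    refine this.congr_fderiv ?_
    ext v; simp
  have h2 : HasFDerivAt (regNorm (E := E) ε) ((1 / regNorm ε z) • innerSL ℝ z) z := by
    have := h1.sqrt (by positivity)
    refine this.congr_fderiv ?_
    rw [smul_smul]
    congr 1
    simp only [regNorm]
    field_simp
  have h3 := ((hasDerivAt_pow d (regNorm ε z)).inv (by positivity)).comp_hasFDerivAt z h2
  refine h3.congr_fderiv ?_
  rw [smul_smul]
  congr 1
  rcases d with _ | d
  · simp
  · simp only [Nat.cast_add, Nat.cast_one, Nat.add_sub_cancel]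
    field_simp
    ring

theorem contDiff_regNorm_inv_pow {E : Type*} [NormedAddCommGroup E] [InnerProductSpace ℝ E]
    {ε : ℝ} (hε : 0 < ε) (d : ℕ) : ContDiff ℝ 1 (fun z : E => (regNorm ε z ^ d)⁻¹) := by
  have h1 : ContDiff ℝ 1 (fun z : E => ‖z‖ ^ 2 + ε ^ 2) := (contDiff_norm_sq ℝ).add contDiff_const
  have h2 : ContDiff ℝ 1 (regNorm (E := E) ε) := h1.sqrt fun z => by positivity
  exact (h2.pow d).inv fun z => (pow_pos (regNorm_pos hε z) d).ne'

end Elliptic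

section EllipticBound

variable {κ : Type*} [Fintype κ] {S : Type*} [NormedAddCommGroup S] [NormedSpace ℝ S]

theorem norm_cliffordMul_le (γ : κ → S →L[ℝ] S) (z : 𝔽 κ) :
    ‖cliffordMul γ z‖ ≤ (∑ a, ‖γ a‖) * ‖z‖ := by
  rw [cliffordMul_apply, sum_mul]
  refine (norm_sum_le _ _).trans (Finset.sum_le_sum fun a _ => ?_)
  rw [norm_smul, mul_comm]
  gcongr
  exact PiLp.norm_apply_le z a

variable [DecidableEq κ]

/-- The error terms in `divergence_identity` for the regularised kernel. -/
theorem divergence_error_bound {γ : κ → S →L[ℝ] S} {ε : ℝ} (hε : 0 < ε) (z : 𝔽 κ)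
    (hz : ‖z‖ ≤ 1) {χ Cχ K : ℝ} (hχ0 : 0 ≤ χ) (hχ1 : χ ≤ 1) (hK : 0 ≤ K) (hC : 0 ≤ Cχ)
    (χ' : 𝔽 κ →L[ℝ] ℝ) (hχ' : ‖χ'‖ ≤ Cχ) (hχz : ‖z‖ < 1 / 2 → χ' = 0)
    (Y : κ → 𝔽 κ) (Y' : κ → 𝔽 κ →L[ℝ] 𝔽 κ)
    (hY : ∀ a, ‖Y a - δ[a]‖ ≤ K * ‖z‖) (hY' : ∀ a, ‖Y' a‖ ≤ K)
    (u : S) (u' : 𝔽 κ →L[ℝ] S) (hu : ‖∑ a, γ a (u' (Y a))‖ ≤ K * ‖u‖)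
    {w : ℝ} (hw : w = χ * (regNorm ε z ^ 𝔡 κ)⁻¹)
    {w' : 𝔽 κ →L[ℝ] ℝ} (hw' : w' = χ • ((-(𝔡 κ : ℝ) / regNorm ε z ^ (𝔡 κ + 2)) • innerSL ℝ z) +
      (regNorm ε z ^ 𝔡 κ)⁻¹ • χ') :
    ‖(regNorm ε z ^ 𝔡 κ)⁻¹ • ∑ a, χ' δ[a] • cliffordMul γ z (γ a u) +
      (∑ a, (w' (Y a - δ[a])) • cliffordMul γ z (γ a u) +
       ∑ a, (w * ∑ j, (Y' a δ[j]) j) • cliffordMul γ z (γ a u) +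
       ∑ a, w • cliffordMul γ (Y a - δ[a]) (γ a u) +
       w • cliffordMul γ z (∑ a, γ a (u' (Y a))))‖ ≤
      Cχ * (∑ a, ‖γ a‖) ^ 2 * 2 ^ 𝔡 κ * ‖u‖ +
      ((2 * 𝔡 κ + Cχ + 1) * (∑ a, ‖γ a‖) ^ 2 + ∑ a, ‖γ a‖) * K * (‖z‖ / ‖z‖ ^ 𝔡 κ) * ‖u‖ := by
  set c := ∑ a, ‖γ a‖ with hc
  set d := 𝔡 κ with hd
  set N := regNorm ε z with hN
  have hNp : 0 < N := regNorm_pos hε z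
  have hzN : ‖z‖ ≤ N := norm_le_regNorm ε z
  have hc0 : 0 ≤ c := Finset.sum_nonneg fun _ _ => norm_nonneg _
  set B := ‖z‖ / ‖z‖ ^ d with hB
  have hB0 : 0 ≤ B := by positivity
  have hkB : (N ^ d)⁻¹ * ‖z‖ ≤ B := by
    rcases (norm_nonneg z).eq_or_lt with h0 | h0
    · rw [← h0] at hB ⊢; simp [hB]
    · rw [hB, div_eq_inv_mul]
      gcongr
  have hΓ : ∀ y v, ‖cliffordMul γ y v‖ ≤ c * ‖y‖ * ‖v‖ := fun y v =>
    (ContinuousLinearMap.le_opNorm _ _).trans (by gcongr; exact norm_cliffordMul_le γ y)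
  have hsum : ∀ (f : κ → ℝ) (A : ℝ) (y : κ → 𝔽 κ) (D : ℝ), 0 ≤ A →
      (∀ a, |f a| ≤ A) → (∀ a, ‖y a‖ ≤ D) →
      ‖∑ a, f a • cliffordMul γ (y a) (γ a u)‖ ≤ A * (c ^ 2 * D * ‖u‖) := by
    intro f A y D hA hf hy
    have : A * (c ^ 2 * D * ‖u‖) = ∑ a, A * (c * D * (‖γ a‖ * ‖u‖)) := by
      rw [← mul_sum, ← mul_sum, ← sum_mul]; ring
    rw [this]
    refine (norm_sum_le _ _).trans (Finset.sum_le_sum fun a _ => ?_)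
    rw [norm_smul, norm_eq_abs]
    refine mul_le_mul (hf a) ((hΓ _ _).trans ?_) (norm_nonneg _) hA
    have hD : 0 ≤ D := (norm_nonneg _).trans (hy a)
    exact mul_le_mul (by gcongr; exact hy a) (ContinuousLinearMap.le_opNorm _ _)
      (norm_nonneg _) (by positivity)
  have hsingle : ∀ a, ‖(δ[a] : 𝔽 κ)‖ = 1 := by
    intro a; simp
  have hw0 : |w| ≤ (N ^ d)⁻¹ := by
    rw [hw, abs_mul, abs_of_nonneg hχ0, abs_of_nonneg (by positivity)]
    exact mul_le_of_le_one_left (by positivity) hχ1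
  -- the cutoff term
  have t0 : ‖(N ^ d)⁻¹ • ∑ a, χ' δ[a] • cliffordMul γ z (γ a u)‖ ≤ Cχ * c ^ 2 * 2 ^ d * ‖u‖ := by
    by_cases hz2 : ‖z‖ < 1 / 2
    · rw [hχz hz2]; simp; positivity
    push Not at hz2
    have h1 := hsum (fun a => χ' δ[a]) Cχ (fun _ => z) ‖z‖ hC
      (fun a => by
        have := χ'.le_opNorm δ[a]
        rw [hsingle, mul_one] at this
        exact this.trans hχ') (fun _ => le_rfl)
    rw [norm_smul, norm_eq_abs, abs_of_nonneg (by positivity)]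
    have h2 : B ≤ 2 ^ d := by
      rw [hB, div_le_iff₀ (by positivity), ← mul_pow]
      have : 1 ≤ (2 * ‖z‖) ^ d := one_le_pow₀ (by linarith)
      linarith
    calc (N ^ d)⁻¹ * _ ≤ (N ^ d)⁻¹ * (Cχ * (c ^ 2 * ‖z‖ * ‖u‖)) := by gcongr
      _ = Cχ * c ^ 2 * ((N ^ d)⁻¹ * ‖z‖) * ‖u‖ := by ring
      _ ≤ Cχ * c ^ 2 * 2 ^ d * ‖u‖ := by gcongr; exact hkB.trans h2
  have t1 : ‖∑ a, (w' (Y a - δ[a])) • cliffordMul γ z (γ a u)‖ ≤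
      (d + Cχ) * c ^ 2 * K * B * ‖u‖ := by
    have hwb : ‖w'‖ * ‖z‖ ≤ (d + Cχ) * (N ^ d)⁻¹ := by
      have h1 : ‖w'‖ ≤ d / N ^ (d + 2) * ‖z‖ + (N ^ d)⁻¹ * Cχ := by
        rw [hw']
        refine (norm_add_le _ _).trans (add_le_add ?_ ?_)
        · rw [norm_smul, norm_smul, innerSL_apply_norm, norm_eq_abs, norm_eq_abs,
            abs_of_nonneg hχ0, abs_div, abs_neg, Nat.abs_cast, abs_of_nonneg (by positivity)]
          exact mul_le_of_le_one_left (by positivity) hχ1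
        · rw [norm_smul, norm_eq_abs, abs_of_nonneg (by positivity)]
          gcongr
      have h2 : d / N ^ (d + 2) * ‖z‖ * ‖z‖ ≤ d * (N ^ d)⁻¹ := by
        rw [pow_add, div_mul_eq_mul_div, div_mul_eq_mul_div, div_le_iff₀ (by positivity)]
        have : (d : ℝ) * (N ^ d)⁻¹ * (N ^ d * N ^ 2) = d * N ^ 2 := by field_simp
        rw [this, mul_assoc, ← pow_two]
        gcongr
      have h3 : (N ^ d)⁻¹ * Cχ * ‖z‖ ≤ Cχ * (N ^ d)⁻¹ := by
        rw [mul_comm Cχ]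
        exact mul_le_of_le_one_right (by positivity) hz
      nlinarith [mul_le_mul_of_nonneg_right h1 (norm_nonneg z)]
    have h1 := hsum (fun a => w' (Y a - δ[a])) (‖w'‖ * (K * ‖z‖)) (fun _ => z)
      ‖z‖ (by positivity) (fun a => (w'.le_opNorm _).trans (by gcongr; exact hY a))
      (fun _ => le_rfl)
    refine h1.trans ?_
    calc ‖w'‖ * (K * ‖z‖) * (c ^ 2 * ‖z‖ * ‖u‖) = (‖w'‖ * ‖z‖) * (c ^ 2 * K * ‖z‖ * ‖u‖) := by ring
      _ ≤ ((d + Cχ) * (N ^ d)⁻¹) * (c ^ 2 * K * ‖z‖ * ‖u‖) := by gcongr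
      _ = (d + Cχ) * c ^ 2 * K * ((N ^ d)⁻¹ * ‖z‖) * ‖u‖ := by ring
      _ ≤ _ := by gcongr
  have t2 : ‖∑ a, (w * ∑ j, (Y' a δ[j]) j) • cliffordMul γ z (γ a u)‖ ≤
      d * c ^ 2 * K * B * ‖u‖ := by
    have h1 := hsum (fun a => w * ∑ j, (Y' a δ[j]) j) ((N ^ d)⁻¹ * (d * K))
      (fun _ => z) ‖z‖ (by positivity) (fun a => by
        rw [abs_mul]
        refine mul_le_mul hw0 ?_ (abs_nonneg _) (by positivity)
        refine (Finset.abs_sum_le_sum_abs _ _).trans ?_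
        have : ∀ j ∈ (Finset.univ : Finset κ), |(Y' a δ[j]) j| ≤ K := by
          intro j _
          refine (PiLp.norm_apply_le (Y' a δ[j]) j).trans ?_
          have := (Y' a).le_opNorm δ[j]
          rw [hsingle, mul_one] at this
          exact this.trans (hY' a)
        refine (Finset.sum_le_card_nsmul _ _ _ this).trans (le_of_eq ?_)
        rw [nsmul_eq_mul, Finset.card_univ]) (fun _ => le_rfl)
    refine h1.trans ?_
    calc (N ^ d)⁻¹ * (d * K) * (c ^ 2 * ‖z‖ * ‖u‖) = d * c ^ 2 * K * ((N ^ d)⁻¹ * ‖z‖) * ‖u‖ := by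
          ring
      _ ≤ _ := by gcongr
  have t3 : ‖∑ a, w • cliffordMul γ (Y a - δ[a]) (γ a u)‖ ≤ c ^ 2 * K * B * ‖u‖ := by
    have h1 := hsum (fun a => w) ((N ^ d)⁻¹) (fun a => Y a - δ[a]) (K * ‖z‖)
      (by positivity) (fun _ => hw0) hY
    refine h1.trans ?_
    calc (N ^ d)⁻¹ * (c ^ 2 * (K * ‖z‖) * ‖u‖) = c ^ 2 * K * ((N ^ d)⁻¹ * ‖z‖) * ‖u‖ := by ring
      _ ≤ _ := by gcongr
  have t4 : ‖w • cliffordMul γ z (∑ a, γ a (u' (Y a)))‖ ≤ c * K * B * ‖u‖ := by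
    rw [norm_smul, norm_eq_abs]
    calc |w| * _ ≤ (N ^ d)⁻¹ * (c * ‖z‖ * (K * ‖u‖)) := by
          refine mul_le_mul hw0 ((hΓ _ _).trans (by gcongr)) (norm_nonneg _) (by positivity)
      _ = c * K * ((N ^ d)⁻¹ * ‖z‖) * ‖u‖ := by ring
      _ ≤ _ := by gcongr
  refine (norm_add_le _ _).trans ?_
  refine (add_le_add t0 ((norm_add_le _ _).trans (add_le_add ((norm_add_le _ _).trans (add_le_add
    ((norm_add_le _ _).trans (add_le_add t1 t2)) t3)) t4))).trans (le_of_eq ?_)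
  ring

end EllipticBound

section EllipticBound

variable {κ : Type*} [Fintype κ] {S : Type*} [NormedAddCommGroup S] [NormedSpace ℝ S]

theorem integrable_regNorm_inv_pow :
    Integrable (fun y : 𝔽 κ => (regNorm 1 y ^ (𝔡 κ + 2))⁻¹) := by
  have h := integrable_rpow_neg_one_add_norm_sq (E := 𝔽 κ) (μ := volume)
    (r := (𝔡 κ : ℝ) + 2) (by simp)
  refine h.congr (Filter.Eventually.of_forall fun y => ?_)
  have hp : (0 : ℝ) ≤ 1 + ‖y‖ ^ 2 := by positivity
  simp only [regNorm, one_pow]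
  rw [add_comm (‖y‖ ^ 2), Real.sqrt_eq_rpow, ← Real.rpow_natCast _ (𝔡 κ + 2), ← Real.rpow_mul hp,
    ← Real.rpow_neg hp]
  congr 1
  push_cast
  ring

theorem integrableOn_norm_div_norm_pow [Nonempty κ] : IntegrableOn
    (fun z : 𝔽 κ => ‖z‖ / ‖z‖ ^ 𝔡 κ) (ball 0 1) := by
  rw [integrableOn_fun_norm_addHaar (μ := volume) (f := fun r : ℝ => r / r ^ 𝔡 κ)]
  have : IntegrableOn (fun _ : ℝ => (1 : ℝ)) (Set.Ioo 0 1) := by simp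
  refine this.congr_fun (fun r hr => ?_) measurableSet_Ioo
  have hr0 : (0 : ℝ) < r := hr.1
  have hd : 𝔡 κ = 𝔡 κ - 1 + 1 := (Nat.sub_add_cancel Fintype.card_pos).symm
  simp only [finrank_euclideanSpace, smul_eq_mul]
  rw [hd, pow_succ, Nat.add_sub_cancel]
  field_simp

/-- The total mass of the regularised kernel. -/
theorem integral_regNorm_inv_pow_pos :
    0 < ∫ y : 𝔽 κ, (regNorm 1 y ^ (𝔡 κ + 2))⁻¹ := by
  rw [integral_pos_iff_support_of_nonneg (fun y => by
    have := regNorm_pos one_pos y; positivity) integrable_regNorm_inv_pow]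
  have : Function.support (fun y : 𝔽 κ =>
      (regNorm 1 y ^ (𝔡 κ + 2))⁻¹) = Set.univ := by
    ext y
    have := regNorm_pos one_pos y
    simp only [Function.mem_support, Set.mem_univ, iff_true]
    positivity
  rw [this]
  exact isOpen_univ.measure_pos _ Set.univ_nonempty

theorem regNorm_smul {e : ℝ} (he : 0 < e) (z : 𝔽 κ) :
    regNorm 1 (e • z) = e * regNorm e⁻¹ z := by
  rw [regNorm, regNorm, ← Real.sqrt_sq he.le, ← Real.sqrt_mul (by positivity), norm_smul,
    norm_eq_abs, abs_of_pos (Real.sqrt_pos.mpr (by positivity)), Real.sqrt_sq he.le]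
  congr 1
  field_simp

theorem tendsto_norm_pow_mul_regNorm (m : ℝ) (hm : 0 < m) : Filter.Tendsto
    (fun y : 𝔽 κ => ‖y‖ ^ 𝔡 κ *
      (m⁻¹ * (regNorm 1 y ^ (𝔡 κ + 2))⁻¹)) (Bornology.cobounded _) (nhds 0) := by
  have h1 : Filter.Tendsto (fun y : 𝔽 κ => m⁻¹ * (‖y‖ ^ 2)⁻¹)
      (Bornology.cobounded _) (nhds (m⁻¹ * 0)) :=
    (((Filter.tendsto_pow_atTop two_ne_zero).comp
      tendsto_norm_cobounded_atTop).inv_tendsto_atTop).const_mul _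
  rw [mul_zero] at h1
  refine squeeze_zero' (Filter.Eventually.of_forall fun y => ?_) ?_ h1
  · have := regNorm_pos one_pos y; positivity
  · filter_upwards [(tendsto_norm_cobounded_atTop (E := 𝔽 κ)).eventually
      (Filter.eventually_gt_atTop 0)] with y hy
    have hN := norm_le_regNorm 1 y
    have hN0 := regNorm_pos one_pos y
    rw [mul_left_comm]
    refine mul_le_mul_of_nonneg_left ?_ (inv_nonneg.mpr hm.le)
    rw [← div_eq_mul_inv, ← one_div, div_le_div_iff₀ (by positivity) (by positivity), ← pow_add,
      one_mul]
    gcongr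

variable [DecidableEq κ]

/-- The divergence of the flux `w Y_a γ_z γ_a u`. -/
theorem sum_fderiv_flux {γ : κ → S →L[ℝ] S} (hγ : CliffordRel γ) {z : 𝔽 κ}
    {w : 𝔽 κ → ℝ} {w' : 𝔽 κ →L[ℝ] ℝ} (hw : HasFDerivAt w w' z)
    {Y : κ → 𝔽 κ → 𝔽 κ} (hY : ∀ a, DifferentiableAt ℝ (Y a) z)
    {u : 𝔽 κ → S} (hu : DifferentiableAt ℝ u z) :
    ∑ j, fderiv ℝ (fun z => ∑ a, (w z * Y a z j) • cliffordMul γ z (γ a (u z))) z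
      δ[j] =
      ∑ a, (w' δ[a]) • cliffordMul γ z (γ a (u z)) - (w z * 𝔡 κ) • u z +
      (∑ a, (w' (Y a z - δ[a])) • cliffordMul γ z (γ a (u z)) +
       ∑ a, (w z * ∑ j, (fderiv ℝ (Y a) z δ[j]) j) • cliffordMul γ z (γ a (u z)) +
       ∑ a, w z • cliffordMul γ (Y a z - δ[a]) (γ a (u z)) +
       w z • cliffordMul γ z (∑ a, γ a (fderiv ℝ u z (Y a z)))) := by
  have hdF : ∀ j, fderiv ℝ (fun z => ∑ a, (w z * Y a z j) • cliffordMul γ z (γ a (u z))) z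
      δ[j] = ∑ a, ((w z * Y a z j) • (cliffordMul γ δ[j] (γ a (u z)) +
            cliffordMul γ z (γ a (fderiv ℝ u z δ[j]))) +
          (w z * (fderiv ℝ (Y a) z δ[j]) j + w' δ[j] * Y a z j) • cliffordMul γ z (γ a (u z))) := by
    intro j
    have h1 : ∀ a, HasFDerivAt (fun z => Y a z j)
        ((proj (𝕜 := ℝ) j).comp (fderiv ℝ (Y a) z)) z := fun a =>
      (proj (𝕜 := ℝ) j).hasFDerivAt.comp z (hY a).hasFDerivAt
    have h2 : ∀ a, HasFDerivAt (fun z => γ a (u z)) ((γ a).comp (fderiv ℝ u z)) z := fun a =>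
      (γ a).hasFDerivAt.comp z hu.hasFDerivAt
    have h3 : HasFDerivAt
        (fun z => ∑ a, (w z * Y a z j) • cliffordMul γ z (γ a (u z))) _ z :=
      HasFDerivAt.fun_sum (u := Finset.univ) fun a _ =>
      ((hw.mul (h1 a)).smul ((cliffordMul γ).hasFDerivAt.clm_apply (h2 a)))
    rw [h3.fderiv]
    simp only [_root_.sum_apply, Pi.mul_apply, _root_.add_apply, _root_.smul_apply,
      ContinuousLinearMap.comp_apply, ContinuousLinearMap.flip_apply,
      ContinuousLinearMap.smulRight_apply, PiLp.proj_apply, smul_eq_mul]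
    refine sum_congr rfl fun a _ => ?_
    rw [add_comm (cliffordMul γ δ[j] (γ a (u z)))]
    congr 2
    ring
  exact (sum_congr rfl fun j _ => hdF j).trans (sum_comm.trans
    (divergence_identity hγ z (w z) w' (fun a => Y a z) (fun a => fderiv ℝ (Y a) z)
        (u z) (fderiv ℝ u z)))

theorem main_flux_term {γ : κ → S →L[ℝ] S} (hγ : CliffordRel γ) {ε : ℝ} (hε : 0 < ε)
    (z : 𝔽 κ) {χ w : ℝ} {χ' w' : 𝔽 κ →L[ℝ] ℝ}
    (hw : w = χ * (regNorm ε z ^ 𝔡 κ)⁻¹)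
    (hw' : w' = χ • ((-(𝔡 κ : ℝ) / regNorm ε z ^ (𝔡 κ + 2)) • innerSL ℝ z) +
      (regNorm ε z ^ 𝔡 κ)⁻¹ • χ') (u : S) :
    ∑ a, w' δ[a] • cliffordMul γ z (γ a u) - (w * 𝔡 κ) • u = (regNorm ε z ^ 𝔡 κ)⁻¹ •
        ∑ a, χ' δ[a] • cliffordMul γ z (γ a u) -
      (𝔡 κ * ε ^ 2 * (regNorm ε z ^ (𝔡 κ + 2))⁻¹) • (χ • u) := by
  set d := 𝔡 κ with hd
  have e1 : ∑ a, z a • cliffordMul γ z (γ a u) = -(‖z‖ ^ 2 • u) := by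
    rw [← cliffordMul_sq hγ]
    conv_rhs => rw [cliffordMul_apply γ z]
    simp [cliffordMul_apply, smul_sum, smul_smul, map_sum]
  have e2 : ∀ a, w' δ[a] = (χ * (-(d : ℝ) / regNorm ε z ^ (d + 2))) * z a +
      (regNorm ε z ^ d)⁻¹ * χ' δ[a] := by
    intro a
    simp only [hw', _root_.add_apply, _root_.smul_apply, innerSL_apply_apply, smul_eq_mul,
      EuclideanSpace.inner_single_right]
    simp
    ring
  simp only [e2, add_smul, sum_add_distrib, mul_smul _ (z _), mul_smul _ (χ' _), ← smul_sum, e1]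
  have hN := regNorm_pos hε z
  have hN2 := regNorm_sq ε z
  rw [smul_neg, smul_smul, smul_smul]
  have e3 : (w * d : ℝ) = (d * ε ^ 2 * (regNorm ε z ^ (d + 2))⁻¹) * χ -
      (χ * (-(d : ℝ) / regNorm ε z ^ (d + 2))) * ‖z‖ ^ 2 := by
    rw [hw, pow_add]
    field_simp
    linear_combination χ * d * hN2
  rw [e3]
  module

/-- The pointwise form of the mean value estimate. -/
theorem norm_core_add_divergence_le {γ : κ → S →L[ℝ] S} (hγ : CliffordRel γ) {ε : ℝ} (hε : 0 < ε)
    {z : 𝔽 κ} (hz : ‖z‖ ≤ 1) {χ : 𝔽 κ → ℝ} {Cχ K : ℝ}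
    (hχd : DifferentiableAt ℝ χ z) (hχ0 : 0 ≤ χ z) (hχ1 : χ z ≤ 1) (hK : 0 ≤ K) (hC : 0 ≤ Cχ)
    (hχ' : ‖fderiv ℝ χ z‖ ≤ Cχ) (hχz : ‖z‖ < 1 / 2 → fderiv ℝ χ z = 0)
    {Y : κ → 𝔽 κ → 𝔽 κ} (hYd : ∀ a, DifferentiableAt ℝ (Y a) z)
    (hY : ∀ a, ‖Y a z - δ[a]‖ ≤ K * ‖z‖) (hY' : ∀ a, ‖fderiv ℝ (Y a) z‖ ≤ K)
    {u : 𝔽 κ → S} (hud : DifferentiableAt ℝ u z)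
    (hu : ‖∑ a, γ a (fderiv ℝ u z (Y a z))‖ ≤ K * ‖u z‖) :
    ‖(𝔡 κ * ε ^ 2 * (regNorm ε z ^ (𝔡 κ + 2))⁻¹) • (χ z • u z) +
      ∑ j, fderiv ℝ (fun z => ∑ a, ((χ z * (regNorm ε z ^ 𝔡 κ)⁻¹) * Y a z j) •
        cliffordMul γ z (γ a (u z))) z δ[j]‖ ≤
      Cχ * (∑ a, ‖γ a‖) ^ 2 * 2 ^ 𝔡 κ * ‖u z‖ +
      ((2 * 𝔡 κ + Cχ + 1) * (∑ a, ‖γ a‖) ^ 2 + ∑ a, ‖γ a‖) * K * (‖z‖ / ‖z‖ ^ 𝔡 κ) * ‖u z‖ := by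
  have hwd : HasFDerivAt (fun z => χ z * (regNorm ε z ^ 𝔡 κ)⁻¹) _ z :=
    hχd.hasFDerivAt.mul (hasFDerivAt_regNorm_inv_pow hε (𝔡 κ) z)
  have herr := divergence_error_bound (γ := γ) hε z hz hχ0 hχ1 hK hC (fderiv ℝ χ z) hχ' hχz
    (fun a => Y a z) (fun a => fderiv ℝ (Y a) z) hY hY' (u z) (fderiv ℝ u z) hu rfl rfl
  rw [sum_fderiv_flux hγ hwd hYd hud, main_flux_term hγ hε z rfl rfl]
  refine le_trans (le_of_eq ?_) herr
  congr 1
  abel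

/-- The mean value estimate for the regularised kernel. -/
theorem norm_integral_regNorm_le [Nonempty κ] [CompleteSpace S] {γ : κ → S →L[ℝ] S}
    (hγ : CliffordRel γ) (χ : ContDiffBump (0 : 𝔽 κ)) (hin : χ.rIn = 1 / 2)
    (hout : χ.rOut = 1) {Cχ : ℝ} (hCχ : ∀ z, ‖fderiv ℝ χ z‖ ≤ Cχ) {K M : ℝ} (hK : 0 ≤ K)
    {Y : κ → 𝔽 κ → 𝔽 κ} {u : 𝔽 κ → S}
    (hY : ∀ a, ContDiffOn ℝ 1 (Y a) (ball 0 2)) (hu : ContDiffOn ℝ 1 u (ball 0 2))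
    (hY1 : ∀ z ∈ ball (0 : 𝔽 κ) 1, ∀ a, ‖Y a z - δ[a]‖ ≤ K * ‖z‖)
    (hY2 : ∀ z ∈ ball (0 : 𝔽 κ) 1, ∀ a, ‖fderiv ℝ (Y a) z‖ ≤ K)
    (hL : ∀ z ∈ ball (0 : 𝔽 κ) 1, ‖∑ a, γ a (fderiv ℝ u z (Y a z))‖ ≤ K * ‖u z‖)
    (huM : ∀ z ∈ ball (0 : 𝔽 κ) 1, ‖u z‖ ≤ M) {ε : ℝ} (hε : 0 < ε) :
    ‖∫ z, (𝔡 κ * ε ^ 2 * (regNorm ε z ^ (𝔡 κ + 2))⁻¹) • (χ z • u z)‖ ≤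
      ((2 * 𝔡 κ + Cχ + 1) * (∑ a, ‖γ a‖) ^ 2 + ∑ a, ‖γ a‖) *
        (∫ z in ball (0 : 𝔽 κ) 1, ‖z‖ / ‖z‖ ^ 𝔡 κ) * K * M +
      Cχ * (∑ a, ‖γ a‖) ^ 2 * 2 ^ 𝔡 κ * ∫ z in ball (0 : 𝔽 κ) 1, ‖u z‖ := by
  have hχd : ContDiff ℝ 1 χ := χ.contDiff
  have hCχ0 : 0 ≤ Cχ := (norm_nonneg _).trans (hCχ 0)
  have hc0 : 0 ≤ ∑ a, ‖γ a‖ := Finset.sum_nonneg fun _ _ => norm_nonneg _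
  have hbU : IsOpen (ball (0 : 𝔽 κ) 2) := isOpen_ball
  have hχs : tsupport χ ⊆ ball (0 : 𝔽 κ) 2 := by
    rw [χ.tsupport_eq, hout]
    exact closedBall_subset_ball (by norm_num)
  have hχs' : ∀ z, z ∉ ball (0 : 𝔽 κ) 1 → χ z = 0 ∧ fderiv ℝ χ z = 0 := by
    intro z hz
    have h0 : χ z = 0 := χ.zero_of_le_dist (by rw [hout]; simpa using hz)
    refine ⟨h0, ?_⟩
    have : IsLocalMin χ z := Filter.Eventually.of_forall fun y => by rw [h0]; exact χ.nonneg
    exact this.fderiv_eq_zero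
  have hcutC : ∀ f : 𝔽 κ → S, ContDiffOn ℝ 1 f (ball 0 2) → ContDiff ℝ 1 (fun z => χ z • f z) := by
    intro f hf
    refine contDiff_of_tsupport_subset hbU (hχd.contDiffOn.smul hf) ?_
    exact (tsupport_smul_subset_left _ _).trans hχs
  have hcutS : ∀ f : 𝔽 κ → S, HasCompactSupport (fun z => χ z • f z) :=
    fun f => χ.hasCompactSupport.smul_right
  have hInt : IntegrableOn (fun z => ‖u z‖) (ball (0 : 𝔽 κ) 1) := by
    have : ContinuousOn (fun z => ‖u z‖) (closedBall (0 : 𝔽 κ) 1) :=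
      (hu.continuousOn.mono (closedBall_subset_ball (by norm_num))).norm
    exact (this.integrableOn_compact (isCompact_closedBall _ _)).mono_set ball_subset_closedBall
  let G : κ → 𝔽 κ → S := fun j z => ∑ a,
    ((regNorm ε z ^ 𝔡 κ)⁻¹ * Y a z j) • cliffordMul γ z (γ a (u z))
  let F : κ → 𝔽 κ → S := fun j z => χ z • G j z
  have hGc : ∀ j, ContDiffOn ℝ 1 (G j) (ball 0 2) := by
    intro j
    refine ContDiffOn.sum fun a _ => ContDiffOn.smul ?_ ?_
    · refine (contDiff_regNorm_inv_pow hε _).contDiffOn.mul ?_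
      exact (proj (𝕜 := ℝ) j).contDiff.comp_contDiffOn (hY a)
    · exact (cliffordMul γ).contDiff.contDiffOn.clm_apply ((γ a).contDiff.comp_contDiffOn hu)
  have hFG : ∀ j, F j = fun z => ∑ a, ((χ z * (regNorm ε z ^ 𝔡 κ)⁻¹) * Y a z j) •
      cliffordMul γ z (γ a (u z)) := by
    intro j
    funext z
    simp only [F, G, smul_sum, smul_smul, mul_assoc]
  have hFc : ∀ j, ContDiff ℝ 1 (F j) := fun j => hcutC _ (hGc j)
  have hFs : ∀ j, HasCompactSupport (F j) := fun j => hcutS _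
  have hF' : ∀ j z, z ∉ ball (0 : 𝔽 κ) 1 → fderiv ℝ (F j) z = 0 := by
    intro j z hz
    obtain ⟨h1, h2⟩ := hχs' z hz
    by_cases hz2 : z ∈ ball (0 : 𝔽 κ) 2
    · have h3 := (hχd.differentiable (by norm_num) z).hasFDerivAt.smul
        (((hGc j).contDiffAt (hbU.mem_nhds hz2)).differentiableAt (by norm_num)).hasFDerivAt
      rw [h1, h2] at h3
      exact h3.fderiv.trans (by ext; simp)
    · have h3 : z ∉ tsupport (F j) := fun h => hz2 (hχs (tsupport_smul_subset_left _ _ h))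
      exact image_eq_zero_of_notMem_tsupport fun h => h3 (tsupport_fderiv_subset ℝ h)
  clear_value F G
  have hFint : ∀ j, Integrable (fun z => fderiv ℝ (F j) z δ[j]) := fun j =>
    (((hFc j).continuous_fderiv (by norm_num)).clm_apply
      continuous_const).integrable_of_hasCompactSupport ((hFs j).fderiv_apply (𝕜 := ℝ) _)
  have hF0 : ∫ z, ∑ j, fderiv ℝ (F j) z δ[j] = 0 := by
    rw [integral_finsetSum _ fun j _ => hFint j]
    exact Finset.sum_eq_zero fun j _ => integral_fderiv_apply_eq_zero volume (hFc j) (hFs j) _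
  let T : 𝔽 κ → S := fun z =>
    (𝔡 κ * ε ^ 2 * (regNorm ε z ^ (𝔡 κ + 2))⁻¹) • (χ z • u z)
  have hTint : Integrable T := by
    have h1 : Continuous T :=
      ((contDiff_regNorm_inv_pow hε _).continuous.const_mul _).smul (hcutC u hu).continuous
    exact h1.integrable_of_hasCompactSupport (hcutS u).smul_left
  have hzero : ∀ z, z ∉ ball (0 : 𝔽 κ) 1 → T z + ∑ j, fderiv ℝ (F j) z δ[j] = 0 := by
    intro z hz
    have h1 : T z = 0 := by
      simp only [T, (hχs' z hz).1, zero_smul, smul_zero]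
    rw [h1, zero_add]
    exact Finset.sum_eq_zero fun j _ => by rw [hF' j z hz, _root_.zero_apply]
  have hpt : ∀ z ∈ ball (0 : 𝔽 κ) 1, ‖T z + ∑ j, fderiv ℝ (F j) z δ[j]‖ ≤
      ((2 * 𝔡 κ + Cχ + 1) * (∑ a, ‖γ a‖) ^ 2 + ∑ a, ‖γ a‖) * K * M * (‖z‖ / ‖z‖ ^ 𝔡 κ) +
      Cχ * (∑ a, ‖γ a‖) ^ 2 * 2 ^ 𝔡 κ * ‖u z‖ := by
    intro z hz
    have hz2 := hbU.mem_nhds (ball_subset_ball (by norm_num : (1 : ℝ) ≤ 2) hz)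
    have hz1 : ‖z‖ ≤ 1 := by simpa using (mem_ball_zero_iff.mp hz).le
    have h1 := norm_core_add_divergence_le hγ hε hz1 (hχd.differentiable (by norm_num) z)
      χ.nonneg χ.le_one hK hCχ0 (hCχ z) (fun h => by
        have := χ.eventuallyEq_one_of_mem_ball (x := z) (by rw [hin]; simpa using h)
        rw [this.fderiv_eq]; exact fderiv_const_apply 1)
      (fun a => ((hY a).contDiffAt hz2).differentiableAt (by norm_num)) (hY1 z hz) (hY2 z hz)
      ((hu.contDiffAt hz2).differentiableAt (by norm_num)) (hL z hz)
    simp only [hFG]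
    refine h1.trans ?_
    have h2 := huM z hz
    rw [add_comm]
    gcongr ?_ + _
    rw [mul_right_comm _ M]
    gcongr
  have h1 : ∫ z, T z = ∫ z in ball (0 : 𝔽 κ) 1, (T z + ∑ j, fderiv ℝ (F j) z δ[j]) := by
    rw [setIntegral_eq_integral_of_forall_compl_eq_zero hzero,
      integral_add hTint (integrable_finsetSum _ fun j _ => hFint j), hF0, add_zero]
  have hB1 := (integrableOn_norm_div_norm_pow (κ := κ)).const_mul
    (((2 * 𝔡 κ + Cχ + 1) * (∑ a, ‖γ a‖) ^ 2 + ∑ a, ‖γ a‖) * K * M)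
  have hB2 := hInt.const_mul (Cχ * (∑ a, ‖γ a‖) ^ 2 * 2 ^ 𝔡 κ)
  change ‖∫ z, T z‖ ≤ _
  rw [h1]
  refine (norm_integral_le_of_norm_le (hB1.add hB2)
    ((ae_restrict_iff' measurableSet_ball).mpr (Filter.Eventually.of_forall hpt))).trans
    (le_of_eq ?_)
  rw [integral_add' hB1 hB2, integral_const_mul, integral_const_mul]
  ring

/-- The regularised kernels converge to a multiple of the Dirac measure. -/
theorem norm_le_of_forall_regNorm_le [CompleteSpace S] {G : 𝔽 κ → S}
    (hG : Continuous G) (hGs : HasCompactSupport G) (hκ : 0 < 𝔡 κ) {B : ℝ}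
    (h : ∀ ε : ℝ, 0 < ε → ‖∫ z, (𝔡 κ * ε ^ 2 * (regNorm ε z ^ (𝔡 κ + 2))⁻¹) • G z‖ ≤ B) :
    ‖G 0‖ ≤ B / (𝔡 κ * ∫ y : 𝔽 κ, (regNorm 1 y ^ (𝔡 κ + 2))⁻¹) := by
  have hm0 := integral_regNorm_inv_pow_pos (κ := κ)
  generalize hm : ∫ y : 𝔽 κ, (regNorm 1 y ^ (𝔡 κ + 2))⁻¹ = m at hm0 ⊢
  have hdm : 0 < (𝔡 κ : ℝ) * m := by positivity
  have hlim := tendsto_integral_comp_smul_smul_of_integrable (μ := volume)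
    (φ := fun y : 𝔽 κ => m⁻¹ * (regNorm 1 y ^ (𝔡 κ + 2))⁻¹)
    (fun y => by have := regNorm_pos one_pos y; positivity)
    (by rw [integral_const_mul, hm, inv_mul_cancel₀ hm0.ne'])
    (by simpa only [finrank_euclideanSpace] using tendsto_norm_pow_mul_regNorm m hm0)
    (hG.integrable_of_hasCompactSupport hGs) hG.continuousAt
  simp only [finrank_euclideanSpace] at hlim
  refine le_of_tendsto hlim.norm ?_
  filter_upwards [Filter.eventually_gt_atTop 0] with e he
  have h1 := h e⁻¹ (inv_pos.mpr he)
  have h2 : ∀ z : 𝔽 κ, 𝔡 κ * e⁻¹ ^ 2 * (regNorm e⁻¹ z ^ (𝔡 κ + 2))⁻¹ = (𝔡 κ * m) *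
        (e ^ 𝔡 κ * (m⁻¹ * (regNorm 1 (e • z) ^ (𝔡 κ + 2))⁻¹)) := by
    intro z
    have := regNorm_pos (inv_pos.mpr he) z
    rw [regNorm_smul he, mul_pow, pow_add]
    field_simp
    ring
  simp only [h2, mul_smul (𝔡 κ * m)] at h1
  rw [integral_smul, norm_smul, norm_eq_abs, abs_of_pos hdm] at h1
  rw [le_div_iff₀ hdm, mul_comm]
  exact h1

/-- **Mean value estimate.** Solutions of a first order elliptic differential inequality close to
the Dirac operator are bounded at the centre by `K sup |u| + ∫ |u|`. -/
theorem elliptic_center_bound [Nonempty κ] [CompleteSpace S] {γ : κ → S →L[ℝ] S}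
    (hγ : CliffordRel γ) :
    ∃ C : ℝ, 0 < C ∧ ∀ (K M : ℝ), 0 ≤ K → 0 ≤ M → ∀ (Y : κ → 𝔽 κ → 𝔽 κ) (u : 𝔽 κ → S),
      (∀ a, ContDiffOn ℝ 1 (Y a) (ball 0 2)) → ContDiffOn ℝ 1 u (ball 0 2) →
      (∀ z ∈ ball (0 : 𝔽 κ) 1, ∀ a, ‖Y a z - δ[a]‖ ≤ K * ‖z‖) →
      (∀ z ∈ ball (0 : 𝔽 κ) 1, ∀ a, ‖fderiv ℝ (Y a) z‖ ≤ K) →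
      (∀ z ∈ ball (0 : 𝔽 κ) 1, ‖∑ a, γ a (fderiv ℝ u z (Y a z))‖ ≤ K * ‖u z‖) →
      (∀ z ∈ ball (0 : 𝔽 κ) 1, ‖u z‖ ≤ M) →
      ‖u 0‖ ≤ C * (K * M + ∫ z in ball (0 : 𝔽 κ) 1, ‖u z‖) := by
  let χ : ContDiffBump (0 : 𝔽 κ) := ⟨1 / 2, 1, by norm_num, by norm_num⟩
  have hχd : ContDiff ℝ 1 χ := χ.contDiff
  obtain ⟨Cχ, hCχ⟩ : ∃ C, ∀ z, ‖fderiv ℝ χ z‖ ≤ C :=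
    (χ.hasCompactSupport.fderiv (𝕜 := ℝ)).exists_bound_of_continuous
      (hχd.continuous_fderiv (by norm_num))
  have hCχ0 : 0 ≤ Cχ := (norm_nonneg _).trans (hCχ 0)
  have hχin : χ.rIn = 1 / 2 := rfl
  have hχout : χ.rOut = 1 := rfl
  have hc0 : 0 ≤ ∑ a, ‖γ a‖ := Finset.sum_nonneg fun _ _ => norm_nonneg _
  have hb0 : 0 ≤ ∫ z in ball (0 : 𝔽 κ) 1, ‖z‖ / ‖z‖ ^ 𝔡 κ :=
    integral_nonneg fun z => by positivity
  have hd0 : (0 : ℝ) < 𝔡 κ := by exact_mod_cast Fintype.card_pos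
  have hdm : 0 < (𝔡 κ : ℝ) * ∫ y : 𝔽 κ, (regNorm 1 y ^ (𝔡 κ + 2))⁻¹ :=
    mul_pos hd0 integral_regNorm_inv_pow_pos
  have hA : 0 ≤ ((2 * 𝔡 κ + Cχ + 1) * (∑ a, ‖γ a‖) ^ 2 + ∑ a, ‖γ a‖) *
        (∫ z in ball (0 : 𝔽 κ) 1, ‖z‖ / ‖z‖ ^ 𝔡 κ) := by positivity
  have hB : 0 ≤ Cχ * (∑ a, ‖γ a‖) ^ 2 * 2 ^ 𝔡 κ := by positivity
  have hkey := fun (K M : ℝ) (hK : 0 ≤ K) Y u hY hu hY1 hY2 hL huM (ε : ℝ) (hε : 0 < ε) =>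
    norm_integral_regNorm_le (K := K) (M := M) (Y := Y) (u := u) hγ χ hχin hχout hCχ hK hY hu hY1
      hY2 hL huM hε
  clear_value χ
  generalize ((2 * 𝔡 κ + Cχ + 1) * (∑ a, ‖γ a‖) ^ 2 + ∑ a, ‖γ a‖) *
        (∫ z in ball (0 : 𝔽 κ) 1, ‖z‖ / ‖z‖ ^ 𝔡 κ) = A at hA hkey
  generalize Cχ * (∑ a, ‖γ a‖) ^ 2 * 2 ^ 𝔡 κ = B at hB hkey
  refine ⟨(A + B + 1) / ((𝔡 κ : ℝ) * ∫ y : 𝔽 κ, (regNorm 1 y ^ (𝔡 κ + 2))⁻¹), by positivity, ?_⟩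
  intro K M hK hM Y u hY hu hY1 hY2 hL huM
  have hχs : tsupport χ ⊆ ball (0 : 𝔽 κ) 2 := by
    rw [χ.tsupport_eq, hχout]
    exact closedBall_subset_ball (by norm_num)
  have hcut : ContDiff ℝ 1 (fun z => χ z • u z) :=
    contDiff_of_tsupport_subset isOpen_ball (hχd.contDiffOn.smul hu)
      ((tsupport_smul_subset_left _ _).trans hχs)
  have h := norm_le_of_forall_regNorm_le hcut.continuous χ.hasCompactSupport.smul_right
    Fintype.card_pos (hkey K M hK Y u hY hu hY1 hY2 hL huM)
  have hχ0 : χ 0 = 1 := χ.one_of_mem_closedBall (by simp [χ.rIn_pos.le])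
  rw [hχ0, one_smul] at h
  refine h.trans ?_
  rw [div_mul_eq_mul_div]
  have hI : 0 ≤ ∫ z in ball (0 : 𝔽 κ) 1, ‖u z‖ :=
    integral_nonneg fun _ => norm_nonneg _
  gcongr
  nlinarith [mul_nonneg hA hI, mul_nonneg hB (mul_nonneg hK hM), mul_nonneg hK hM]

end EllipticBound

section FrameGeometry

/-- Expansion of a vector in an orthonormal frame of a bilinear form. -/
theorem sum_smul_of_orthonormal {κ V : Type*} [Fintype κ] [DecidableEq κ] [AddCommGroup V]
    [Module ℝ V] [FiniteDimensional ℝ V] (hV : Module.finrank ℝ V = 𝔡 κ)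
    (B : V → V → ℝ) (hadd : ∀ v v' w, B (v + v') w = B v w + B v' w)
    (hsmul : ∀ (t : ℝ) v w, B (t • v) w = t * B v w)
    (e : κ → V) (he : ∀ a b, B (e a) (e b) = if a = b then 1 else 0) (v : V) :
    v = ∑ a, B v (e a) • e a := by
  have hsum : ∀ (f : κ → ℝ) b, B (∑ a, f a • e a) (e b) = f b := by
    intro f b
    let L : V →ₗ[ℝ] ℝ :=
      { toFun := fun v => B v (e b), map_add' := fun v w => hadd v w _, map_smul' := fun t v => hsmul t v _ }
    change L (∑ a, f a • e a) = f b
    rw [map_sum]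
    simp only [map_smul, smul_eq_mul]
    change ∑ a, f a * B (e a) (e b) = f b
    simp [he]
  have hli : LinearIndependent ℝ e := by
    rw [Fintype.linearIndependent_iff]
    intro f hf b
    rw [← hsum f b, hf]
    simpa using hsmul 0 0 (e b)
  have htop : Submodule.span ℝ (Set.range e) = ⊤ := by
    exact hli.span_eq_top_of_card_eq_finrank' hV.symm
  have hv : v ∈ Submodule.span ℝ (Set.range e) := htop ▸ Submodule.mem_top
  obtain ⟨f, rfl⟩ := (Submodule.mem_span_range_iff_exists_fun ℝ).mp hv
  exact sum_congr rfl fun a _ => by rw [hsum]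

variable {n : ℕ} {N : Type*} [TopologicalSpace N] [ChartedSpace (𝔼 n) N]
  [IsManifold (𝓡 n) ∞ N] {g : RiemMetric n N}

theorem RiemMetric.form_add_left (y : N) (v v' w : TangentSpace (𝓡 n) y) :
    g.form y (v + v') w = g.form y v w + g.form y v' w := by
  simp [RiemMetric.form]

theorem RiemMetric.form_smul_left (y : N) (t : ℝ) (v w : TangentSpace (𝓡 n) y) :
    g.form y (t • v) w = t * g.form y v w := by
  simp [RiemMetric.form]

theorem RiemMetric.form_comm (y : N) (v w : TangentSpace (𝓡 n) y) :
    g.form y v w = g.form y w v := g.symm y v w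

theorem RiemMetric.form_neg_left (y : N) (v w : TangentSpace (𝓡 n) y) :
    g.form y (-v) w = -g.form y v w := by
  simp [RiemMetric.form]

theorem RiemMetric.contMDiffOn_form {s : Set N} {m : ℕ∞ω} (hm : m ≤ ((⊤ : ℕ∞) : ℕ∞ω))
    {v w : ∀ y : N, TangentSpace (𝓡 n) y}
    (hv : ContMDiffOn (𝓡 n) (𝓡 n).tangent m (fun y => (⟨y, v y⟩ : TangentBundle (𝓡 n) N)) s)
    (hw : ContMDiffOn (𝓡 n) (𝓡 n).tangent m (fun y => (⟨y, w y⟩ : TangentBundle (𝓡 n) N)) s) :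
    ContMDiffOn (𝓡 n) 𝓘(ℝ, ℝ) m (fun y => g.form y (v y) (w y)) s := by
  have h : ContMDiffOn (𝓡 n) ((𝓡 n).prod 𝓘(ℝ, ℝ)) m
      (fun y => (⟨y, g.inner y (v y) (w y)⟩ : Bundle.TotalSpace ℝ (Bundle.Trivial N ℝ))) s := by
    apply ContMDiffOn.clm_bundle_apply₂ (F₁ := 𝔼 n)
      (F₂ := 𝔼 n)
    · exact (g.contMDiff.of_le hm).contMDiffOn
    · exact hv
    · exact hw
  intro y hy
  have := h y hy
  simp only [Bundle.contMDiffWithinAt_totalSpace] at this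
  exact this.2

instance : FiniteDimensional ℝ (𝔼 n) := inferInstance

variable {ι : Type*} (P : SpinStructure ι g)

namespace SpinStructure

theorem sum_form_smul_frame {i : ι} {y : N} (hy : y ∈ P.dom i) (v : TangentSpace (𝓡 n) y) :
    v = ∑ a, g.form y v (P.frame i a y) • P.frame i a y := by
  haveI : FiniteDimensional ℝ (TangentSpace (𝓡 n) y) :=
    inferInstanceAs (FiniteDimensional ℝ (𝔼 n))
  refine sum_smul_of_orthonormal (V := TangentSpace (𝓡 n) y) ?_ (g.form y)
    (RiemMetric.form_add_left y) (RiemMetric.form_smul_left y) _ (P.orthonormal i y hy) v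
  exact finrank_euclideanSpace (𝕜 := ℝ) (ι := Fin n)

/-- The coordinate expression of a frame vector field in the chart at `y₀`. -/
def coordFrame (y₀ : N) (i : ι) (a : Fin n) (u : 𝔼 n) :
    𝔼 n :=
  mfderiv (𝓡 n) 𝓘(ℝ, 𝔼 n) χ[n, y₀]
    (χ[n, y₀].symm u) (P.frame i a (χ[n, y₀].symm u))

/-- The part of the target of the chart at `y₀` on which the frame `i` is defined. -/
def coordDom (y₀ : N) (i : ι) : Set (𝔼 n) :=
  χ[n, y₀].target ∩ χ[n, y₀].symm ⁻¹' P.dom i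

theorem isOpen_coordDom (y₀ : N) (i : ι) : IsOpen (P.coordDom y₀ i) :=
  (continuousOn_extChartAt_symm y₀).isOpen_inter_preimage (isOpen_extChartAt_target y₀)
    (P.isOpen_dom i)

theorem contDiffOn_coordFrame (y₀ : N) (i : ι) (a : Fin n) :
    ContDiffOn ℝ ∞ (P.coordFrame y₀ i a) (P.coordDom y₀ i) := by
  have h1 := P.smooth_frame i a
  have h2 : ContMDiffOn (𝓡 n) 𝓘(ℝ, 𝔼 n) ∞
      (fun y => (mfderiv (𝓡 n) 𝓘(ℝ, 𝔼 n) χ[n, y₀] y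
        (P.frame i a y) : 𝔼 n))
      (P.dom i ∩ (chartAt (𝔼 n) y₀).source) := by
    have h3 := (Bundle.Trivialization.contMDiffOn_section_iff (n := ∞) (IB := 𝓡 n)
      (s := fun y => P.frame i a y)
      (trivializationAt (𝔼 n) (TangentSpace (𝓡 n)) y₀)
      (a := P.dom i ∩ (chartAt (𝔼 n) y₀).source)
      ((P.isOpen_dom i).inter (chartAt _ y₀).open_source) (by
        rw [TangentBundle.trivializationAt_baseSet]; exact Set.inter_subset_right)).mp
      (h1.mono Set.inter_subset_left)
    refine h3.congr fun y hy => ?_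
    have h4 : ∀ v : TangentSpace (𝓡 n) y, (trivializationAt (𝔼 n)
        (TangentSpace (𝓡 n)) y₀).continuousLinearMapAt ℝ y v =
        (trivializationAt (𝔼 n) (TangentSpace (𝓡 n)) y₀ ⟨y, v⟩).2 := by
      intro v
      rw [Bundle.Trivialization.continuousLinearMapAt_apply,
        Bundle.Trivialization.coe_linearMapAt_of_mem]
      rw [TangentBundle.trivializationAt_baseSet]; exact hy.2
    exact (DFunLike.congr_fun
      (TangentBundle.continuousLinearMapAt_trivializationAt hy.2) _).symm.trans (h4 _)
  have h4 := h2.comp ((contMDiffOn_extChartAt_symm (n := ∞) y₀).mono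
    (Set.inter_subset_left (t := χ[n, y₀].symm ⁻¹' P.dom i))) (fun u hu => by
      refine ⟨hu.2, ?_⟩
      rw [← extChartAt_source (𝓡 n)]
      exact χ[n, y₀].map_target hu.1)
  exact h4.contDiffOn

end SpinStructure
end FrameGeometry

section Koszul

variable {κ : Type*} [Fintype κ]

/-- The Koszul combination of structure functions. -/
def koszul (T : κ → κ → κ → ℝ) (a b c : κ) : ℝ := (1 / 2) * (T a b c - T b c a + T c a b)

theorem sum_rotate (f : κ → κ → κ → ℝ) :
    ∑ e, ∑ d, ∑ f', f e d f' = ∑ e, ∑ d, ∑ f', f d f' e :=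
  (sum_comm.trans (sum_congr rfl fun _ _ => sum_comm)).symm

/-- Transformation of the Koszul combination under a change of the orthonormal frame. -/
theorem koszul_transform {T T' : κ → κ → κ → ℝ} {R : κ → κ → ℝ} {D : κ → κ → κ → ℝ}
    (hD : ∀ a b c, ∑ f, R c f * D a b f = -∑ f, R b f * D a c f)
    (hT : ∀ a b c, T' a b c = ∑ f, R c f * D a b f - ∑ f, R c f * D b a f +
      ∑ e, ∑ d, ∑ f, R a e * R b d * R c f * T e d f) (a b c : κ) :
    koszul T' a b c = ∑ f, R c f * D a b f +
      ∑ e, ∑ d, ∑ f, R a e * R b d * R c f * koszul T e d f := by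
  have h1 : ∑ e, ∑ d, ∑ f, R b e * R c d * R a f * T e d f =
      ∑ e, ∑ d, ∑ f, R a e * R b d * R c f * T d f e := by
    rw [sum_rotate]
    exact sum_congr rfl fun e _ => sum_congr rfl fun d _ =>
      sum_congr rfl fun f _ => by ring
  have h2 : ∑ e, ∑ d, ∑ f, R c e * R a d * R b f * T e d f =
      ∑ e, ∑ d, ∑ f, R a e * R b d * R c f * T f e d := by
    rw [sum_rotate, sum_rotate]
    exact sum_congr rfl fun e _ => sum_congr rfl fun d _ =>
      sum_congr rfl fun f _ => by ring
  have h3 : ∑ e, ∑ d, ∑ f, R a e * R b d * R c f * koszul T e d f =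
      (1 / 2) * (∑ e, ∑ d, ∑ f, R a e * R b d * R c f * T e d f -
        ∑ e, ∑ d, ∑ f, R a e * R b d * R c f * T d f e +
        ∑ e, ∑ d, ∑ f, R a e * R b d * R c f * T f e d) := by
    simp only [← sum_sub_distrib, ← sum_add_distrib, mul_sum, koszul]
    exact sum_congr rfl fun e _ => sum_congr rfl fun d _ =>
      sum_congr rfl fun f _ => by ring
  rw [h3, ← h1, ← h2]
  simp only [koszul, hT]
  linarith [hD a b c, hD b c a, hD c a b]

end Koszul

theorem two_le_smooth : (2 : ℕ∞ω) ≤ ((⊤ : ℕ∞) : ℕ∞ω) :=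
  WithTop.coe_le_coe.mpr (le_top : (2 : ℕ∞) ≤ ⊤)

theorem mlieBracket_eq_lieBracket {E : Type*} [NormedAddCommGroup E] [NormedSpace ℝ E]
    (V W : ∀ x : E, TangentSpace 𝓘(ℝ, E) x) (x : E) :
    mlieBracket 𝓘(ℝ, E) V W x = lieBracket ℝ V W x := by
  rw [← VectorField.mlieBracketWithin_univ, VectorField.mlieBracketWithin_eq_lieBracketWithin]
  exact congrFun (VectorField.lieBracketWithin_univ (𝕜 := ℝ) (V := V) (W := W)) x

section FrameGeometry

variable {n : ℕ} {N : Type*} [TopologicalSpace N] [ChartedSpace (𝔼 n) N]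
  [IsManifold (𝓡 n) ∞ N] {g : RiemMetric n N} {ι : Type*} (P : SpinStructure ι g)

/-- Derivatives in the chart at `y₀`. -/
theorem mfderiv_eq_fderiv_chart {F : Type*} [NormedAddCommGroup F] [NormedSpace ℝ F] {f : N → F}
    {y₀ y : N} (hy : y ∈ χ[n, y₀].source) (hf : MDifferentiableAt (𝓡 n) 𝓘(ℝ, F) f y)
    (v : TangentSpace (𝓡 n) y) :
    (mfderiv (𝓡 n) 𝓘(ℝ, F) f y v : F) = fderiv ℝ (f ∘ χ[n, y₀].symm) (χ[n, y₀] y)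
        (mfderiv (𝓡 n) 𝓘(ℝ, 𝔼 n) χ[n, y₀] y v) := by
  have hy' : y ∈ (chartAt (𝔼 n) y₀).source := by
    rwa [← extChartAt_source (𝓡 n)]
  have hχ : MDifferentiableAt (𝓡 n) 𝓘(ℝ, 𝔼 n) χ[n, y₀] y :=
    mdifferentiableAt_extChartAt hy'
  have hu := χ[n, y₀].map_source hy
  have hsymm : MDifferentiableAt 𝓘(ℝ, 𝔼 n) (𝓡 n) χ[n, y₀].symm
      (χ[n, y₀] y) :=
    ((contMDiffOn_extChartAt_symm (n := 1) y₀).contMDiffAt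
      ((isOpen_extChartAt_target y₀).mem_nhds hu)).mdifferentiableAt one_ne_zero
  have hleft := χ[n, y₀].left_inv hy
  have hcomp : MDifferentiableAt 𝓘(ℝ, 𝔼 n) 𝓘(ℝ, F)
      (f ∘ χ[n, y₀].symm) (χ[n, y₀] y) :=
    MDifferentiableAt.comp _ (by rwa [hleft]) hsymm
  have heq : f =ᶠ[nhds y] (f ∘ χ[n, y₀].symm) ∘ χ[n, y₀] := by
    filter_upwards [(isOpen_extChartAt_source y₀).mem_nhds hy] with z hz
    simp only [Function.comp_apply, χ[n, y₀].left_inv hz]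
  rw [heq.mfderiv_eq, mfderiv_comp y hcomp hχ, mfderiv_eq_fderiv]
  rfl

namespace SpinStructure

/-- The structure functions `g([e_a, e_b], e_c)` of the frame `i`. -/
def frameBracket (i : ι) (y : N) (a b c : Fin n) : ℝ :=
  g.form y (mlieBracket (𝓡 n) (P.frame i a) (P.frame i b) y) (P.frame i c y)

theorem connCoeff_frame (i : ι) (a b c : Fin n) (y : N) :
    connCoeff (𝓡 n) g.form (P.frame i) a b c y = koszul (P.frameBracket i y) a b c := rfl

theorem frameBracket_swap (i : ι) (y : N) (a b c : Fin n) :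
    P.frameBracket i y a b c = -P.frameBracket i y b a c := by
  rw [frameBracket, VectorField.mlieBracket_swap_apply, RiemMetric.form_neg_left, frameBracket]

theorem koszul_frameBracket_swap (i : ι) (y : N) (a b c : Fin n) :
    koszul (P.frameBracket i y) a b c = -koszul (P.frameBracket i y) a c b := by
  simp only [koszul]
  rw [P.frameBracket_swap i y a c b, P.frameBracket_swap i y c b a, P.frameBracket_swap i y b a c]
  ring

theorem contMDiffOn_frameBracket (i : ι) (a b c : Fin n) :
    ContMDiffOn (𝓡 n) 𝓘(ℝ, ℝ) 1 (fun y => P.frameBracket i y a b c) (P.dom i) := by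
  refine RiemMetric.contMDiffOn_form (by exact_mod_cast le_top) ?_
    ((P.smooth_frame i c).of_le (by exact_mod_cast le_top))
  intro y hy
  have : IsManifold (𝓡 n) (minSmoothness ℝ 2) N :=
    IsManifold.of_le (n := ∞) (by rw [minSmoothness_of_isRCLikeNormedField]; exact two_le_smooth)
  have : IsManifold (𝓡 n) (((2 : ℕ∞) : ℕ∞ω) + 1) N :=
    IsManifold.of_le (n := ∞) (by exact_mod_cast le_top)
  have h : ∀ a, ContMDiffAt (𝓡 n) (𝓡 n).tangent ((2 : ℕ∞) : ℕ∞ω)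
      (fun x => (⟨x, P.frame i a x⟩ : TangentBundle (𝓡 n) N)) y := fun a =>
    ((P.smooth_frame i a).contMDiffAt ((P.isOpen_dom i).mem_nhds hy)).of_le
      (by exact_mod_cast le_top)
  exact (ContMDiffAt.mlieBracket_vectorField (m := 1) (h a) (h b) (by
    rw [minSmoothness_of_isRCLikeNormedField]; norm_num)).contMDiffWithinAt

theorem continuousOn_connCoeff (i : ι) (a b c : Fin n) :
    ContinuousOn (connCoeff (𝓡 n) g.form (P.frame i) a b c) (P.dom i) := by
  have h := fun a b c => (P.contMDiffOn_frameBracket i a b c).continuousOn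
  exact continuousOn_const.mul (((h a b c).sub (h b c a)).add (h c a b))

theorem mem_coordDom {y₀ y : N} (hy : y ∈ χ[n, y₀].source) {i : ι}
    (hi : y ∈ P.dom i) : χ[n, y₀] y ∈ P.coordDom y₀ i := by
  refine ⟨χ[n, y₀].map_source hy, ?_⟩
  rw [Set.mem_preimage, χ[n, y₀].left_inv hy]
  exact hi

theorem mfderiv_symm_inverse {y₀ : N} {u : 𝔼 n}
    (hu : u ∈ χ[n, y₀].target) :
    (mfderiv 𝓘(ℝ, 𝔼 n) (𝓡 n) χ[n, y₀].symm u).inverse = mfderiv (𝓡 n) 𝓘(ℝ, 𝔼 n) χ[n, y₀]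
        (χ[n, y₀].symm u) := by
  have h1 := mfderivWithin_extChartAt_symm_comp_mfderiv_extChartAt (I := 𝓡 n) hu
  have h2 := mfderiv_extChartAt_comp_mfderivWithin_extChartAt_symm (I := 𝓡 n) hu
  rw [ModelWithCorners.range_eq_univ, mfderivWithin_univ] at h1 h2
  exact ContinuousLinearMap.inverse_eq h1 h2

theorem mfderiv_chart_eq_sum {y₀ : N} {i : ι} {u : 𝔼 n}
    (hu : u ∈ P.coordDom y₀ i) (v : TangentSpace (𝓡 n) (χ[n, y₀].symm u)) :
    (mfderiv (𝓡 n) 𝓘(ℝ, 𝔼 n) χ[n, y₀]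
      (χ[n, y₀].symm u) v : 𝔼 n) =
      ∑ c, g.form _ v (P.frame i c (χ[n, y₀].symm u)) • P.coordFrame y₀ i c u := by
  let L : TangentSpace (𝓡 n) (χ[n, y₀].symm u) →L[ℝ] 𝔼 n :=
    mfderiv (𝓡 n) 𝓘(ℝ, 𝔼 n) χ[n, y₀]
      (χ[n, y₀].symm u)
  change L v = _
  conv_lhs => rw [P.sum_form_smul_frame hu.2 v, map_sum]
  refine sum_congr rfl fun c _ => ?_
  rw [map_smul]
  rfl

theorem lieBracket_coordFrame {y₀ : N} {i : ι} {u : 𝔼 n}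
    (hu : u ∈ P.coordDom y₀ i) (a b : Fin n) :
    lieBracket ℝ (P.coordFrame y₀ i a) (P.coordFrame y₀ i b) u =
      ∑ c, P.frameBracket i (χ[n, y₀].symm u) a b c • P.coordFrame y₀ i c u := by
  have : IsManifold (𝓡 n) (minSmoothness ℝ 2) N :=
    IsManifold.of_le (n := ∞) (by rw [minSmoothness_of_isRCLikeNormedField]; exact two_le_smooth)
  have : IsManifold 𝓘(ℝ, 𝔼 n) (minSmoothness ℝ 2)
    (𝔼 n) := inferInstance
  have hd : ∀ a, MDifferentiableAt (𝓡 n) (𝓡 n).tangent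
      (fun x => (⟨x, P.frame i a x⟩ : TangentBundle (𝓡 n) N)) (χ[n, y₀].symm u) :=
    fun a => ((P.smooth_frame i a).contMDiffAt ((P.isOpen_dom i).mem_nhds hu.2)).mdifferentiableAt
      (by simp)
  have hs : ContMDiffAt 𝓘(ℝ, 𝔼 n) (𝓡 n) ∞ χ[n, y₀].symm u :=
    (contMDiffOn_extChartAt_symm y₀).contMDiffAt ((isOpen_extChartAt_target y₀).mem_nhds hu.1)
  have h := VectorField.mpullback_mlieBracket (I := 𝓘(ℝ, 𝔼 n)) (I' := 𝓡 n)
    (hd a) (hd b) hs (by rw [minSmoothness_of_isRCLikeNormedField]; exact two_le_smooth)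
  have hpull : ∀ a, VectorField.mpullback 𝓘(ℝ, 𝔼 n) (𝓡 n)
      χ[n, y₀].symm (P.frame i a) =ᶠ[nhds u] P.coordFrame y₀ i a := by
    intro a
    filter_upwards [(isOpen_extChartAt_target y₀).mem_nhds hu.1] with u' hu'
    rw [VectorField.mpullback_apply, mfderiv_symm_inverse hu']
    rfl
  have h' := h.trans (mlieBracket_eq_lieBracket _ _ _)
  rw [(hpull a).lieBracket_vectorField_eq (hpull b)] at h'
  rw [← h', VectorField.mpullback_apply, mfderiv_symm_inverse hu.1]
  exact P.mfderiv_chart_eq_sum hu _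

/-- The matrix of the change from the frame `i` to the frame `j`. -/
def frameChange (i j : ι) (y : N) (b c : Fin n) : ℝ :=
  g.form y (P.frame j b y) (P.frame i c y)

theorem contMDiffOn_frameChange (i j : ι) (b c : Fin n) :
    ContMDiffOn (𝓡 n) 𝓘(ℝ, ℝ) ∞ (fun y => P.frameChange i j y b c) (P.dom i ∩ P.dom j) :=
  RiemMetric.contMDiffOn_form le_rfl ((P.smooth_frame j b).mono Set.inter_subset_right)
    ((P.smooth_frame i c).mono Set.inter_subset_left)

theorem frame_eq_sum_frameChange {i j : ι} {y : N} (hi : y ∈ P.dom i) (b : Fin n) :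
    P.frame j b y = ∑ c, P.frameChange i j y b c • P.frame i c y :=
  P.sum_form_smul_frame hi _

theorem sum_frameChange_mul {i j : ι} {y : N} (hi : y ∈ P.dom i) (hj : y ∈ P.dom j) (a b : Fin n) :
    ∑ c, P.frameChange i j y a c * P.frameChange i j y b c = if a = b then 1 else 0 := by
  rw [← P.orthonormal j y hj a b]
  conv_rhs => rw [RiemMetric.form_comm, P.frame_eq_sum_frameChange hi b]
  let L : TangentSpace (𝓡 n) y →ₗ[ℝ] ℝ :=
    { toFun := fun v => g.form y v (P.frame j a y)
      map_add' := fun v w => RiemMetric.form_add_left y v w _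
      map_smul' := fun t v => RiemMetric.form_smul_left y t v _ }
  change _ = L (∑ c, P.frameChange i j y b c • P.frame i c y)
  rw [map_sum]
  refine sum_congr rfl fun c _ => ?_
  rw [map_smul, smul_eq_mul, mul_comm]
  congr 1
  exact RiemMetric.form_comm y _ _

theorem sum_frameChange_mul' {i j : ι} {y : N} (hi : y ∈ P.dom i) (hj : y ∈ P.dom j)
    (c d : Fin n) :
    ∑ a, P.frameChange i j y a c * P.frameChange i j y a d = if c = d then 1 else 0 := by
  have h := P.sum_frameChange_mul hj hi c d
  rw [← h]
  refine sum_congr rfl fun a _ => ?_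
  simp only [frameChange]
  rw [RiemMetric.form_comm, RiemMetric.form_comm y (P.frame j a y) (P.frame i d y)]

theorem coordFrame_eq_sum_frameChange {y₀ : N} {i j : ι} {u : 𝔼 n}
    (hi : u ∈ P.coordDom y₀ i) (b : Fin n) : P.coordFrame y₀ j b u =
      ∑ c, P.frameChange i j (χ[n, y₀].symm u) b c • P.coordFrame y₀ i c u := by
  rw [coordFrame, P.frame_eq_sum_frameChange hi.2, map_sum]
  refine sum_congr rfl fun c _ => ?_
  rw [map_smul]
  rfl

theorem linearIndependent_coordFrame {y₀ : N} {i : ι} {u : 𝔼 n}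
    (hi : u ∈ P.coordDom y₀ i) : LinearIndependent ℝ fun a => P.coordFrame y₀ i a u := by
  rw [Fintype.linearIndependent_iff]
  intro f hf b
  have h2 := mfderivWithin_extChartAt_symm_comp_mfderiv_extChartAt (I := 𝓡 n) hi.1
  have h3 : mfderiv (𝓡 n) 𝓘(ℝ, 𝔼 n) χ[n, y₀]
      (χ[n, y₀].symm u) (∑ a, f a • P.frame i a (χ[n, y₀].symm u)) = 0 := by
    rw [map_sum]
    refine Eq.trans (sum_congr rfl fun c _ => ?_) hf
    rw [map_smul]
    rfl
  have h4 : ∑ a, f a • P.frame i a (χ[n, y₀].symm u) = 0 := by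
    have := congr_fun h2 (∑ a, f a • P.frame i a (χ[n, y₀].symm u))
    exact this.symm.trans ((congrArg (mfderivWithin 𝓘(ℝ, 𝔼 n) (𝓡 n)
      χ[n, y₀].symm (Set.range (𝓡 n)) u) h3).trans (ContinuousLinearMap.map_zero _))
  let L : TangentSpace (𝓡 n) (χ[n, y₀].symm u) →ₗ[ℝ] ℝ :=
    { toFun := fun v => g.form _ v (P.frame i b (χ[n, y₀].symm u))
      map_add' := fun v w => RiemMetric.form_add_left _ v w _
      map_smul' := fun t v => RiemMetric.form_smul_left _ t v _ }
  have h5 : L (∑ a, f a • P.frame i a (χ[n, y₀].symm u)) = f b := by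
    rw [map_sum]
    simp only [map_smul, smul_eq_mul]
    change ∑ a, f a * g.form _ (P.frame i a _) (P.frame i b _) = f b
    simp only [P.orthonormal i (χ[n, y₀].symm u) hi.2, mul_ite, mul_one, mul_zero,
      Finset.sum_ite_eq', Finset.mem_univ, if_true]
  rw [← h5, h4, map_zero]

end SpinStructure
end FrameGeometry

section GaugeAlgebra

variable {κ A : Type*} [Fintype κ] [DecidableEq κ] [Ring A] [Algebra ℝ A]

/-- The Clifford element `¼ ∑ Γ_bc e_b e_c`. -/
def spinElement (γ : κ → A) (Γ : κ → κ → ℝ) : A :=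
  (1 / 4 : ℝ) • ∑ b, ∑ c, Γ b c • (γ b * γ c)

theorem spinElement_mul_gen {γ : κ → A} (h : CliffordRel γ) {Γ : κ → κ → ℝ}
    (hΓ : ∀ b c, Γ b c = -Γ c b) (a : κ) :
    spinElement γ Γ * γ a = γ a * spinElement γ Γ + ∑ d, Γ a d • γ d := by
  have hanti : ∀ b c, γ b * γ c = -(γ c * γ b) - (if b = c then (2 : ℝ) else 0) • (1 : A) := by
    intro b c
    by_cases hbc : b = c
    · subst hbc
      rw [h.sq, if_pos rfl, two_smul]
      abel
    · rw [if_neg hbc, zero_smul, sub_zero, h.anti b c hbc]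
  have h3 : ∀ b d, γ b * γ d * γ a = γ a * (γ b * γ d) + (if b = a then (2 : ℝ) else 0) • γ d -
      (if d = a then (2 : ℝ) else 0) • γ b := by
    intro b d
    rw [mul_assoc, hanti d a, mul_sub, mul_neg, ← mul_assoc, hanti b a, sub_mul, neg_mul,
      smul_mul_assoc, one_mul, mul_smul_comm, mul_one, mul_assoc]
    abel
  have e1 : ∑ b, ∑ d, Γ b d • ((if b = a then (2 : ℝ) else 0) • γ d) = (2 : ℝ) • ∑ d, Γ a d • γ d := by
    rw [Finset.sum_eq_single a (fun b _ hb => by simp [hb]) (by simp), smul_sum]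
    exact sum_congr rfl fun d _ => by rw [if_pos rfl, smul_comm]
  have e2 : ∑ b, ∑ d, Γ b d • ((if d = a then (2 : ℝ) else 0) • γ b) =
      -((2 : ℝ) • ∑ d, Γ a d • γ d) := by
    rw [sum_comm, Finset.sum_eq_single a (fun b _ hb => by simp [hb]) (by simp),
      smul_sum, ← sum_neg_distrib]
    exact sum_congr rfl fun d _ => by rw [if_pos rfl, smul_comm, hΓ d a, neg_smul, smul_neg]
  simp only [spinElement, smul_mul_assoc, mul_smul_comm, sum_mul, mul_sum, h3,
    smul_sub, smul_add, sum_add_distrib, sum_sub_distrib]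
  rw [e1, e2]
  module

theorem gauge_commute {γ : κ → A} (h : CliffordRel γ) {U V A' : A} (hUV : U * V = 1)
    (hVU : V * U = 1) {R R' Γ Γ' : κ → κ → ℝ}
    (hU : ∀ a, U * γ a = ∑ c, R a c • (γ c * U))
    (hA : ∀ a, A' * γ a = ∑ c, R' a c • (γ c * U) + ∑ c, R a c • (γ c * A'))
    (hΓ : ∀ b c, Γ b c = -Γ c b) (hΓ' : ∀ b c, Γ' b c = -Γ' c b)
    (hR : ∀ c d, ∑ a, R a c * R a d = if c = d then 1 else 0)
    (hrel : ∀ a e, R' a e + ∑ c, R a c * Γ c e = ∑ d, Γ' a d * R d e) (c : κ) :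
    γ c * ((A' + spinElement γ Γ * U - U * spinElement γ Γ') * V) =
      ((A' + spinElement γ Γ * U - U * spinElement γ Γ') * V) * γ c := by
  set Z := A' + spinElement γ Γ * U - U * spinElement γ Γ' with hZ
  have hZγ : ∀ a, Z * γ a = ∑ c, R a c • (γ c * Z) := by
    intro a
    have e1 : spinElement γ Γ * U * γ a = ∑ c, R a c • (γ c * (spinElement γ Γ * U)) +
        ∑ e, (∑ c, R a c * Γ c e) • (γ e * U) := by
      rw [mul_assoc, hU, mul_sum]
      have : ∀ c, spinElement γ Γ * R a c • (γ c * U) = R a c • (γ c * (spinElement γ Γ * U)) +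
          ∑ e, (R a c * Γ c e) • (γ e * U) := by
        intro c
        rw [mul_smul_comm, ← mul_assoc, spinElement_mul_gen h hΓ, add_mul, smul_add, mul_assoc,
          sum_mul, smul_sum]
        congr 1
        exact sum_congr rfl fun e _ => by rw [smul_mul_assoc, smul_smul]
      rw [sum_congr rfl fun c _ => this c, sum_add_distrib, sum_comm]
      congr 1
      exact sum_congr rfl fun e _ => by rw [sum_smul]
    have e2 : U * spinElement γ Γ' * γ a = ∑ c, R a c • (γ c * (U * spinElement γ Γ')) +
        ∑ e, (∑ d, Γ' a d * R d e) • (γ e * U) := by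
      rw [mul_assoc, spinElement_mul_gen h hΓ', mul_add, ← mul_assoc, hU, sum_mul, mul_sum]
      congr 1
      · exact sum_congr rfl fun c _ => by rw [smul_mul_assoc, mul_assoc]
      · have : ∀ d, U * Γ' a d • γ d = ∑ e, (Γ' a d * R d e) • (γ e * U) := by
          intro d
          rw [mul_smul_comm, hU, smul_sum]
          exact sum_congr rfl fun e _ => by rw [smul_smul]
        rw [sum_congr rfl fun d _ => this d, sum_comm]
        exact sum_congr rfl fun e _ => by rw [sum_smul]
    rw [hZ, sub_mul, add_mul, hA, e1, e2]
    simp only [← hrel, add_smul, mul_sub, mul_add, smul_add, smul_sub, sum_add_distrib,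
      sum_sub_distrib]
    abel
  have hγV : ∀ c, V * γ c = ∑ a, R a c • (γ a * V) := by
    intro c
    have e1 : γ c * U = ∑ a, R a c • (U * γ a) := by
      have : ∀ a, R a c • (U * γ a) = ∑ d, (R a c * R a d) • (γ d * U) := by
        intro a
        rw [hU, smul_sum]
        exact sum_congr rfl fun d _ => by rw [smul_smul]
      rw [sum_congr rfl fun a _ => this a, sum_comm]
      simp only [← sum_smul, hR]
      simp
    calc V * γ c = V * (γ c * U) * V := by rw [mul_assoc, mul_assoc, hUV, mul_one]
      _ = ∑ a, R a c • (γ a * V) := by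
        rw [e1, mul_sum, sum_mul]
        refine sum_congr rfl fun a _ => ?_
        rw [mul_smul_comm, ← mul_assoc, hVU, one_mul, smul_mul_assoc]
  rw [mul_assoc Z, hγV, mul_sum]
  have : ∀ a, Z * R a c • (γ a * V) = ∑ d, (R a c * R a d) • (γ d * (Z * V)) := by
    intro a
    rw [mul_smul_comm, ← mul_assoc, hZγ, sum_mul, smul_sum]
    exact sum_congr rfl fun d _ => by rw [smul_mul_assoc, smul_smul, mul_assoc]
  rw [sum_congr rfl fun a _ => this a, sum_comm]
  simp only [← sum_smul, hR]
  simp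

end GaugeAlgebra

section GaugeKoszul

variable {n : ℕ} {N : Type*} [TopologicalSpace N] [ChartedSpace (𝔼 n) N]
  [IsManifold (𝓡 n) ∞ N] {g : RiemMetric n N} {ι : Type*} (P : SpinStructure ι g)

namespace SpinStructure

/-- The matrix of the change of frames in coordinates. -/
def coordChange (y₀ : N) (i j : ι) (b c : Fin n) (u : 𝔼 n) : ℝ :=
  P.frameChange i j (χ[n, y₀].symm u) b c

theorem contDiffOn_coordChange (y₀ : N) (i j : ι) (b c : Fin n) :
    ContDiffOn ℝ ∞ (P.coordChange y₀ i j b c) (P.coordDom y₀ i ∩ P.coordDom y₀ j) := by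
  have h := (P.contMDiffOn_frameChange i j b c).comp
    ((contMDiffOn_extChartAt_symm (n := ∞) y₀).mono
      (Set.inter_subset_left (t := χ[n, y₀].symm ⁻¹' (P.dom i ∩ P.dom j))))
    (fun u hu => hu.2)
  exact h.contDiffOn.mono fun u hu => ⟨hu.1.1, hu.1.2, hu.2.2⟩

/-- Transformation of the connection coefficients. -/
theorem koszul_frameBracket_transform {y₀ : N} {i j : ι} {u : 𝔼 n}
    (hi : u ∈ P.coordDom y₀ i) (hj : u ∈ P.coordDom y₀ j) (a b c : Fin n) :
    koszul (P.frameBracket j (χ[n, y₀].symm u)) a b c = ∑ f, P.coordChange y₀ i j c f u *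
        fderiv ℝ (P.coordChange y₀ i j b f) u (P.coordFrame y₀ j a u) +
      ∑ e, ∑ d, ∑ f, P.coordChange y₀ i j a e u * P.coordChange y₀ i j b d u *
        P.coordChange y₀ i j c f u * koszul (P.frameBracket i (χ[n, y₀].symm u)) e d f := by
  set F := P.coordFrame y₀ i with hF
  set G := P.coordFrame y₀ j with hG
  set R := P.coordChange y₀ i j with hR
  have hO : IsOpen (P.coordDom y₀ i ∩ P.coordDom y₀ j) :=
    (P.isOpen_coordDom y₀ i).inter (P.isOpen_coordDom y₀ j)
  have hRd : ∀ b c, DifferentiableAt ℝ (R b c) u := fun b c =>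
    ((P.contDiffOn_coordChange y₀ i j b c).contDiffAt (hO.mem_nhds ⟨hi, hj⟩)).differentiableAt
      (by simp)
  have hFd : ∀ a, DifferentiableAt ℝ (F a) u := fun a =>
    ((P.contDiffOn_coordFrame y₀ i a).contDiffAt
      ((P.isOpen_coordDom y₀ i).mem_nhds hi)).differentiableAt (by simp)
  have hGF : ∀ b, G b =ᶠ[nhds u] fun u => ∑ d, R b d u • F d u := by
    intro b
    filter_upwards [(P.isOpen_coordDom y₀ i).mem_nhds hi] with u hu
    exact P.coordFrame_eq_sum_frameChange hu b
  have hGu : ∀ b, G b u = ∑ d, R b d u • F d u := fun b => (hGF b).self_of_nhds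
  have hG' : ∀ b v, fderiv ℝ (G b) u v =
      ∑ d, fderiv ℝ (R b d) u v • F d u + ∑ d, R b d u • fderiv ℝ (F d) u v := by
    intro b v
    have h1 : HasFDerivAt (fun u => ∑ d, R b d u • F d u) _ u :=
      HasFDerivAt.fun_sum (u := Finset.univ) fun d _ =>
        (hRd b d).hasFDerivAt.smul (hFd d).hasFDerivAt
    rw [(hGF b).fderiv_eq, h1.fderiv]
    simp only [_root_.sum_apply, _root_.add_apply, _root_.smul_apply,
      ContinuousLinearMap.smulRight_apply, sum_add_distrib]
    rw [add_comm]
  have horth : ∀ a b, ∑ c, R a c u * R b c u = if a = b then 1 else 0 := fun a b =>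
    P.sum_frameChange_mul hi.2 hj.2 a b
  have hD : ∀ a b c, ∑ f, R c f u * fderiv ℝ (R b f) u (G a u) =
      -∑ f, R b f u * fderiv ℝ (R c f) u (G a u) := by
    intro a b c
    have h1 : HasFDerivAt (fun u => ∑ f, R b f u * R c f u) _ u :=
      HasFDerivAt.fun_sum (u := Finset.univ) fun f _ =>
        (hRd b f).hasFDerivAt.mul (hRd c f).hasFDerivAt
    have h2 : (fun u => ∑ f, R b f u * R c f u) =ᶠ[nhds u] fun _ => if b = c then (1 : ℝ) else 0 := by
      filter_upwards [hO.mem_nhds ⟨hi, hj⟩] with u hu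
      exact P.sum_frameChange_mul hu.1.2 hu.2.2 b c
    have h3 := congr_fun (h1.unique ((hasFDerivAt_const _ u).congr_of_eventuallyEq h2))
      (G a u)
    simp only [_root_.sum_apply, _root_.add_apply, _root_.smul_apply, smul_eq_mul,
      sum_add_distrib, _root_.zero_apply] at h3
    linarith
  refine koszul_transform (D := fun a b f => fderiv ℝ (R b f) u (G a u)) (R := fun a b => R a b u)
    hD (fun a b c => ?_) a b c
  -- the structure functions of the frame `j`
  have hbr : ∑ c, P.frameBracket j (χ[n, y₀].symm u) a b c • G c u =
      ∑ f, (fderiv ℝ (R b f) u (G a u) - fderiv ℝ (R a f) u (G b u) + ∑ e, ∑ d, R a e u * R b d u *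
          P.frameBracket i (χ[n, y₀].symm u) e d f) • F f u := by
    rw [← P.lieBracket_coordFrame hj a b, lieBracket, hG', hG']
    have e1 : ∀ a b, ∑ d, R b d u • fderiv ℝ (F d) u (G a u) =
        ∑ e, ∑ d, (R a e u * R b d u) • fderiv ℝ (F d) u (F e u) := by
      intro a b
      rw [sum_comm]
      refine sum_congr rfl fun d _ => ?_
      rw [hGu a, map_sum, smul_sum]
      refine sum_congr rfl fun e _ => ?_
      rw [map_smul, smul_smul, mul_comm]
    have e2 : ∑ e, ∑ d, (R a e u * R b d u) • fderiv ℝ (F d) u (F e u) -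
        ∑ e, ∑ d, (R b e u * R a d u) • fderiv ℝ (F d) u (F e u) =
        ∑ e, ∑ d, (R a e u * R b d u) • lieBracket ℝ (F e) (F d) u := by
      conv_lhs => arg 2; rw [sum_comm]
      simp only [← sum_sub_distrib]
      refine sum_congr rfl fun e _ => sum_congr rfl fun d _ => ?_
      rw [lieBracket, smul_sub, mul_comm (R b d u)]
    have e3 : ∑ e, ∑ d, (R a e u * R b d u) • lieBracket ℝ (F e) (F d) u =
        ∑ f, (∑ e, ∑ d, R a e u * R b d u * P.frameBracket i (χ[n, y₀].symm u) e d f) • F f u := by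
      simp only [sum_smul]
      rw [Finset.sum_comm' (t' := Finset.univ) (s' := fun _ => Finset.univ) (by simp)]
      rw [sum_comm]
      conv_rhs => rw [sum_comm]
      refine sum_congr rfl fun e _ => ?_
      conv_rhs => rw [sum_comm]
      refine sum_congr rfl fun d _ => ?_
      rw [P.lieBracket_coordFrame hi e d, smul_sum]
      exact sum_congr rfl fun f _ => by rw [smul_smul]
    rw [e1 a b, e1 b a]
    simp only [add_smul, sub_smul, sum_add_distrib, sum_sub_distrib]
    rw [← e3, ← e2]
    abel
  have hcoef : ∀ f, ∑ c, P.frameBracket j (χ[n, y₀].symm u) a b c * R c f u =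
      fderiv ℝ (R b f) u (G a u) - fderiv ℝ (R a f) u (G b u) + ∑ e, ∑ d, R a e u * R b d u *
          P.frameBracket i (χ[n, y₀].symm u) e d f := by
    have h1 : ∑ c, P.frameBracket j (χ[n, y₀].symm u) a b c • G c u =
        ∑ f, (∑ c, P.frameBracket j (χ[n, y₀].symm u) a b c * R c f u) • F f u := by
      simp only [hGu, smul_sum, smul_smul, sum_smul]
      rw [sum_comm]
    rw [h1] at hbr
    intro f
    have h2 := Fintype.linearIndependent_iff.mp (P.linearIndependent_coordFrame hi)
      (fun f => (∑ c, P.frameBracket j (χ[n, y₀].symm u) a b c * R c f u) -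
        (fderiv ℝ (R b f) u (G a u) - fderiv ℝ (R a f) u (G b u) +
        ∑ e, ∑ d, R a e u * R b d u * P.frameBracket i (χ[n, y₀].symm u) e d f)) (by
        simp only [sub_smul _ _ (P.coordFrame y₀ i _ u), sum_sub_distrib]
        exact sub_eq_zero.mpr hbr) f
    linarith
  have hT : P.frameBracket j (χ[n, y₀].symm u) a b c =
      ∑ f, R c f u * ∑ c', P.frameBracket j (χ[n, y₀].symm u) a b c' * R c' f u := by
    simp only [mul_sum]
    rw [sum_comm]
    have : ∀ c', ∑ f, R c f u * (P.frameBracket j (χ[n, y₀].symm u) a b c' *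
        R c' f u) = P.frameBracket j (χ[n, y₀].symm u) a b c' * (if c = c' then 1 else 0) := by
      intro c'
      rw [← horth, mul_sum]
      exact sum_congr rfl fun f _ => by ring
    rw [sum_congr rfl fun c' _ => this c']
    simp
  rw [hT]
  simp only [hcoef, mul_add, mul_sub, sum_add_distrib, sum_sub_distrib]
  congr 1
  simp only [mul_sum]
  rw [sum_comm]
  refine sum_congr rfl fun e _ => ?_
  rw [sum_comm]
  exact sum_congr rfl fun d _ => sum_congr rfl fun f _ => by ring

end SpinStructure
end GaugeKoszul

section SpinElement

variable {κ : Type*} [Fintype κ] [DecidableEq κ]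

theorem cliffordGen_mul_mem_even (b c : κ) :
    cliffordGen b * cliffordGen c ∈ CliffordAlgebra.even (cliffordForm κ) :=
  CliffordAlgebra.ι_mul_ι_mem_evenOdd_zero _ _ _

theorem spinElement_mem_even (Γ : κ → κ → ℝ) :
    spinElement (fun a : κ => cliffordGen a) Γ ∈ CliffordAlgebra.even (cliffordForm κ) :=
  Subalgebra.smul_mem _ (Subalgebra.sum_mem _ fun b _ => Subalgebra.sum_mem _ fun c _ =>
    Subalgebra.smul_mem _ (cliffordGen_mul_mem_even b c) _) _

theorem map_spinElement {A B : Type*} [Ring A] [Algebra ℝ A] [Ring B] [Algebra ℝ B]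
    (f : A →ₐ[ℝ] B) (γ : κ → A) (Γ : κ → κ → ℝ) :
    f (spinElement γ Γ) = spinElement (fun a => f (γ a)) Γ := by
  simp only [spinElement, map_smul, map_sum, map_mul]

variable {S : Type*} [NormedAddCommGroup S] [InnerProductSpace ℂ S]

theorem re_inner_spinElement {γ : κ → S →L[ℂ] S}
    (hskew : ∀ a s t, inner ℂ (γ a s) t = -inner ℂ s (γ a t)) {Γ : κ → κ → ℝ}
    (hΓ : ∀ b c, Γ b c = -Γ c b) (s : S) :
    (inner ℂ (spinElement γ Γ s) s).re = 0 := by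
  have hf : ∀ b c, (inner ℂ (γ b (γ c s)) s).re = (inner ℂ (γ c (γ b s)) s).re := by
    intro b c
    rw [hskew, hskew, neg_neg, ← inner_conj_symm, Complex.conj_re]
  have h1 : (inner ℂ (spinElement γ Γ s) s).re =
      (1 / 4 : ℝ) * ∑ b, ∑ c, Γ b c * (inner ℂ (γ b (γ c s)) s).re := by
    simp only [spinElement, _root_.smul_apply, _root_.sum_apply, mul_apply_eq_comp]
    rw [← coe_smul, inner_smul_left]
    simp only [Complex.conj_ofReal, Complex.re_ofReal_mul, sum_inner, Complex.re_sum]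
    congr 1
    refine sum_congr rfl fun b _ => sum_congr rfl fun c _ => ?_
    rw [← coe_smul, inner_smul_left, Complex.conj_ofReal, Complex.re_ofReal_mul]
  have h2 : ∑ b, ∑ c, Γ b c * (inner ℂ (γ b (γ c s)) s).re =
      -∑ b, ∑ c, Γ b c * (inner ℂ (γ b (γ c s)) s).re := by
    conv_lhs => rw [sum_comm]
    simp only [← sum_neg_distrib]
    refine sum_congr rfl fun b _ => sum_congr rfl fun c _ => ?_
    rw [hΓ c b, hf c b]
    ring
  rw [h1, self_eq_neg.mp h2, mul_zero]

/-- The spin group acts isometrically. -/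
theorem inner_act_spin (A : Cl κ →ₐ[ℝ] (S →L[ℂ] S))
    (hskew : ∀ a s t, inner ℂ (A (cliffordGen a) s) t = -inner ℂ s (A (cliffordGen a) t))
    (x : spinGroup (cliffordForm κ)) (s t : S) :
    inner ℂ (A (x : Cl κ) s) (A (x : Cl κ) t) = inner ℂ s t := by
  let A' : Cl κ →ₐ[ℝ] Module.End ℂ S :=
    { toFun := fun x => (A x : S →ₗ[ℂ] S)
      map_one' := by rw [map_one]; rfl
      map_mul' := fun x y => by rw [map_mul]; rfl
      map_zero' := by rw [map_zero]; rfl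
      map_add' := fun x y => by rw [map_add]; rfl
      commutes' := fun r => by rw [AlgHom.commutes]; rfl }
  have h := inner_act_left A' hskew (x : Cl κ) s (A' (x : Cl κ) t)
  rw [← Module.End.mul_apply, ← map_mul, spinGroup.star_mul_self_of_mem x.2] at h
  rw [map_one] at h
  exact h

end SpinElement

section Gauge

variable {n : ℕ} {N : Type*} [TopologicalSpace N] [ChartedSpace (𝔼 n) N]
  [IsManifold (𝓡 n) ∞ N] {g : RiemMetric n N} {ι : Type*} (P : SpinStructure ι g)
  {S : Type*} [NormedAddCommGroup S] [InnerProductSpace ℂ S] [FiniteDimensional ℂ S]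

/-- A family in a finite-dimensional algebra is smooth if its coordinates are. -/
theorem contDiffOn_algHom_comp {E F C : Type*} [NormedAddCommGroup E] [NormedSpace ℝ E]
    [NormedAddCommGroup F] [NormedSpace ℝ F] [FiniteDimensional ℝ F] [AddCommGroup C] [Module ℝ C]
    {m : ℕ∞ω} {f : E → C} {s : Set E} (hf : ∀ ℓ : C →ₗ[ℝ] ℝ, ContDiffOn ℝ m (fun u => ℓ (f u)) s)
    (A : C →ₗ[ℝ] F) : ContDiffOn ℝ m (fun u => A (f u)) s := by
  let b := Module.finBasis ℝ F
  have h : (fun u => A (f u)) = fun u => ∑ k, ((b.coord k).comp A) (f u) • b k := by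
    funext u
    exact (b.sum_repr (A (f u))).symm
  rw [h]
  exact ContDiffOn.sum fun k _ => (hf _).smul contDiffOn_const

/-- The derivative of a map into a subspace takes values in this subspace. -/
theorem fderiv_mem_of_eventually_mem {E F : Type*} [NormedAddCommGroup E] [NormedSpace ℝ E]
    [NormedAddCommGroup F] [NormedSpace ℝ F] [FiniteDimensional ℝ F] (W : Submodule ℝ F)
    {f : E → F} {u : E} (hf : DifferentiableAt ℝ f u) (hW : ∀ᶠ u' in nhds u, f u' ∈ W) (v : E) :
    fderiv ℝ f u v ∈ W := by
  by_contra hv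
  obtain ⟨ℓ, hℓ, hℓW⟩ := Submodule.exists_le_ker_of_notMem hv
  have h1 : HasFDerivAt (fun u => LinearMap.toContinuousLinearMap ℓ (f u)) _ u :=
    (LinearMap.toContinuousLinearMap ℓ).hasFDerivAt.comp u hf.hasFDerivAt
  have h2 : (fun u => LinearMap.toContinuousLinearMap ℓ (f u)) =ᶠ[nhds u] fun _ => 0 := by
    filter_upwards [hW] with u' hu'
    exact hℓW hu'
  have h3 := congr_fun (h1.unique ((hasFDerivAt_const _ u).congr_of_eventuallyEq h2)) v
  exact hℓ h3

instance : FiniteDimensional ℝ S := FiniteDimensional.complexToReal S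

instance finiteDimensional_clm_real : FiniteDimensional ℝ (S →L[ℂ] S) :=
  FiniteDimensional.complexToReal (S →L[ℂ] S)

namespace SpinStructure

variable (A : Cl (Fin n) →ₐ[ℝ] (S →L[ℂ] S))

theorem contDiffOn_lift (y₀ : N) (i j : ι) :
    ContDiffOn ℝ ∞ (fun u => A (P.lift i j (χ[n, y₀].symm u) : Cl (Fin n)))
      (P.coordDom y₀ i ∩ P.coordDom y₀ j) := by
  refine contDiffOn_algHom_comp (fun ℓ => ?_) A.toLinearMap
  have h := (P.smooth_lift i j ℓ).comp
    ((contMDiffOn_extChartAt_symm (n := ∞) y₀).mono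
      (Set.inter_subset_left (t := χ[n, y₀].symm ⁻¹' (P.dom i ∩ P.dom j))))
    (fun u hu => hu.2)
  exact h.contDiffOn.mono fun u hu => ⟨hu.1.1, hu.1.2, hu.2.2⟩

theorem lift_self {i : ι} {y : N} (hy : y ∈ P.dom i) : P.lift i i y = 1 := by
  have h := P.cocycle i i i y ⟨⟨hy, hy⟩, hy⟩
  exact mul_eq_left.mp h

theorem lift_mul_lift {i j : ι} {y : N} (hi : y ∈ P.dom i) (hj : y ∈ P.dom j) :
    (P.lift i j y : Cl (Fin n)) * (P.lift j i y : Cl (Fin n)) = 1 := by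
  have h := P.cocycle i j i y ⟨⟨hi, hj⟩, hi⟩
  rw [P.lift_self hi] at h
  exact congrArg Subtype.val h

theorem lift_mul_gen {y₀ : N} {i j : ι} {u : 𝔼 n}
    (hi : u ∈ P.coordDom y₀ i) (hj : u ∈ P.coordDom y₀ j) (a : Fin n) :
    A (P.lift i j (χ[n, y₀].symm u) : Cl (Fin n)) * A (cliffordGen a) =
      ∑ c, P.coordChange y₀ i j a c u •
        (A (cliffordGen c) * A (P.lift i j (χ[n, y₀].symm u) : Cl (Fin n))) := by
  rw [← map_mul, P.lift_covers i j _ ⟨hi.2, hj.2⟩ a, map_mul, map_sum, sum_mul]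
  refine sum_congr rfl fun c _ => ?_
  rw [map_smul, smul_mul_assoc]
  rfl

/-- The spin connection transforms like a connection under a change of the spin frame. -/
theorem gauge_identity [Nontrivial S]
    (hskew : ∀ a s t, inner ℂ (A (cliffordGen a) s) t = -inner ℂ s (A (cliffordGen a) t))
    {y₀ : N} {i j : ι} {u : 𝔼 n}
    (hi : u ∈ P.coordDom y₀ i) (hj : u ∈ P.coordDom y₀ j) (a : Fin n) :
    fderiv ℝ (fun u => A (P.lift i j (χ[n, y₀].symm u) : Cl (Fin n))) u
        (P.coordFrame y₀ j a u) +
      spinElement (fun b => A (cliffordGen b)) (fun d f => ∑ e, P.coordChange y₀ i j a e u *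
        koszul (P.frameBracket i (χ[n, y₀].symm u)) e d f) *
        A (P.lift i j (χ[n, y₀].symm u) : Cl (Fin n)) =
      A (P.lift i j (χ[n, y₀].symm u) : Cl (Fin n)) * spinElement (fun b => A (cliffordGen b))
          (koszul (P.frameBracket j (χ[n, y₀].symm u)) a) := by
  set y := χ[n, y₀].symm u with hy
  set Uf : 𝔼 n → (S →L[ℂ] S) :=
    fun u => A (P.lift i j (χ[n, y₀].symm u) : Cl (Fin n)) with hUf
  set v := P.coordFrame y₀ j a u with hv
  set Γ : Fin n → Fin n → ℝ := fun d f => ∑ e, P.coordChange y₀ i j a e u *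
        koszul (P.frameBracket i y) e d f with hΓd
  set Γ' : Fin n → Fin n → ℝ := koszul (P.frameBracket j y) a with hΓd'
  have hγ : CliffordRel (fun b => A (cliffordGen b)) := cliffordRel_gen.map A.toRingHom
  have hO : IsOpen (P.coordDom y₀ i ∩ P.coordDom y₀ j) :=
    (P.isOpen_coordDom y₀ i).inter (P.isOpen_coordDom y₀ j)
  have hUd : DifferentiableAt ℝ Uf u := ((P.contDiffOn_lift A y₀ i j).contDiffAt
    (hO.mem_nhds ⟨hi, hj⟩)).differentiableAt (by simp)
  have hRd : ∀ b c, DifferentiableAt ℝ (P.coordChange y₀ i j b c) u := fun b c =>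
    ((P.contDiffOn_coordChange y₀ i j b c).contDiffAt (hO.mem_nhds ⟨hi, hj⟩)).differentiableAt
      (by simp)
  have hUV : Uf u * A (P.lift j i y : Cl (Fin n)) = 1 := by
    rw [hUf, ← map_mul, P.lift_mul_lift hi.2 hj.2, map_one]
  have hVU : A (P.lift j i y : Cl (Fin n)) * Uf u = 1 := by
    rw [hUf, ← map_mul, P.lift_mul_lift hj.2 hi.2, map_one]
  have hΓ : ∀ b c, Γ b c = -Γ c b := by
    intro b c
    simp only [hΓd, ← sum_neg_distrib]
    refine sum_congr rfl fun e _ => ?_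
    rw [P.koszul_frameBracket_swap i y e b c]
    ring
  have hΓ' : ∀ b c, Γ' b c = -Γ' c b := fun b c => P.koszul_frameBracket_swap j y a b c
  have hA : ∀ b, fderiv ℝ Uf u v * A (cliffordGen b) =
      ∑ c, fderiv ℝ (P.coordChange y₀ i j b c) u v • (A (cliffordGen c) * Uf u) +
      ∑ c, P.coordChange y₀ i j b c u • (A (cliffordGen c) * fderiv ℝ Uf u v) := by
    intro b
    have h1 : HasFDerivAt (fun u => Uf u * A (cliffordGen b)) _ u :=
      hUd.hasFDerivAt.mul_const' _
    have h2 : HasFDerivAt (fun u => ∑ c, P.coordChange y₀ i j b c u • (A (cliffordGen c) * Uf u))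
        _ u := HasFDerivAt.fun_sum (u := Finset.univ) fun c _ =>
        (hRd b c).hasFDerivAt.smul (hUd.hasFDerivAt.const_mul (A (cliffordGen c)))
    have h3 : (fun u => Uf u * A (cliffordGen b)) =ᶠ[nhds u]
        fun u => ∑ c, P.coordChange y₀ i j b c u • (A (cliffordGen c) * Uf u) := by
      filter_upwards [hO.mem_nhds ⟨hi, hj⟩] with u' hu'
      exact P.lift_mul_gen A hu'.1 hu'.2 b
    have h4 := congr_fun (h1.unique (h2.congr_of_eventuallyEq h3)) v
    simp only [_root_.sum_apply, _root_.add_apply, _root_.smul_apply,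
      ContinuousLinearMap.smulRight_apply, sum_add_distrib, smul_eq_mul,
      op_smul_eq_mul] at h4
    rw [h4, add_comm]
  have hrel : ∀ b e, fderiv ℝ (P.coordChange y₀ i j b e) u v +
      ∑ c, P.coordChange y₀ i j b c u * Γ c e = ∑ d, Γ' b d * P.coordChange y₀ i j d e u := by
    intro b e
    have h1 : ∀ d, Γ' b d * P.coordChange y₀ i j d e u =
        ∑ f, (P.coordChange y₀ i j d f u * P.coordChange y₀ i j d e u) *
          (fderiv ℝ (P.coordChange y₀ i j b f) u v + ∑ c, P.coordChange y₀ i j b c u * Γ c f) := by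
      intro d
      simp only [hΓd']
      rw [P.koszul_frameBracket_transform hi hj a b d]
      simp only [mul_add, sum_add_distrib, add_mul, sum_mul, mul_sum, hΓd]
      congr 1
      · exact sum_congr rfl fun f _ => by ring
      · rw [sum_comm]
        rw [sum_congr rfl fun c _ => sum_comm, sum_comm]
        refine sum_congr rfl fun f _ => sum_congr rfl fun c _ =>
          sum_congr rfl fun e' _ => ?_
        ring
    have horth : ∀ f, ∑ d, P.coordChange y₀ i j d f u * P.coordChange y₀ i j d e u =
        if f = e then 1 else 0 := fun f => P.sum_frameChange_mul' hi.2 hj.2 f e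
    rw [sum_congr rfl fun d _ => h1 d, sum_comm]
    simp only [← sum_mul, horth]
    simp
  have hcomm := gauge_commute (A' := fderiv ℝ Uf u v) hγ hUV hVU
    (R := fun b c => P.coordChange y₀ i j b c u)
    (R' := fun b c => fderiv ℝ (P.coordChange y₀ i j b c) u v)
    (fun b => P.lift_mul_gen A hi hj b) hA hΓ hΓ'
    (fun c d => P.sum_frameChange_mul' hi.2 hj.2 c d) hrel
  set Z := fderiv ℝ Uf u v + spinElement (fun b => A (cliffordGen b)) Γ * Uf u -
    Uf u * spinElement (fun b => A (cliffordGen b)) Γ' with hZ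
  obtain ⟨x, hx, hxA⟩ : ∃ x ∈ CliffordAlgebra.even (cliffordForm (Fin n)),
      A x = Z * A (P.lift j i y : Cl (Fin n)) := by
    obtain ⟨x₁, hx₁, hx₁A⟩ : ∃ x ∈ CliffordAlgebra.even (cliffordForm (Fin n)),
        A x = fderiv ℝ Uf u v := by
      have := fderiv_mem_of_eventually_mem
        (((CliffordAlgebra.even (cliffordForm (Fin n))).toSubmodule).map A.toLinearMap) hUd
        (Filter.Eventually.of_forall fun u' =>
          ⟨_, spinGroup.mem_even (P.lift i j (χ[n, y₀].symm u')).2, rfl⟩) v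
      exact this
    have hlift : ∀ i j, (P.lift i j y : Cl (Fin n)) ∈
        CliffordAlgebra.even (cliffordForm (Fin n)) := fun i j =>
      spinGroup.mem_even (P.lift i j y).2
    refine ⟨(x₁ + spinElement (fun b => cliffordGen b) Γ * (P.lift i j y : Cl (Fin n)) -
      (P.lift i j y : Cl (Fin n)) * spinElement (fun b => cliffordGen b) Γ') *
      (P.lift j i y : Cl (Fin n)), ?_, ?_⟩
    · refine Subalgebra.mul_mem _ (Subalgebra.sub_mem _ (Subalgebra.add_mem _ hx₁ ?_) ?_)
        (hlift j i)
      · exact Subalgebra.mul_mem _ (spinElement_mem_even Γ) (hlift i j)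
      · exact Subalgebra.mul_mem _ (hlift i j) (spinElement_mem_even Γ')
    · rw [map_mul, map_sub, map_add, map_mul, map_mul, hx₁A, map_spinElement, map_spinElement]
  obtain ⟨r, hr⟩ := hγ.scalar_of_commute (Finset.univ : Finset (Fin n)).toList
    (Finset.nodup_toList _) (act_mem_parityWords A hx) (fun c => by rw [hxA]; exact hcomm c)
  have hZr : Z = r • Uf u := by
    calc Z = Z * A (P.lift j i y : Cl (Fin n)) * Uf u := by rw [mul_assoc, hVU, mul_one]
      _ = r • Uf u := by rw [← hxA, hr, Algebra.algebraMap_eq_smul_one, smul_mul_assoc, one_mul]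
  obtain ⟨t, ht⟩ := exists_ne (0 : S)
  have hnorm : ∀ u, inner ℂ (Uf u t) (Uf u t) = inner ℂ t t := fun u =>
    inner_act_spin A hskew _ t t
  have h1 : (inner ℂ (fderiv ℝ Uf u v t) (Uf u t)).re = 0 := by
    have hd : HasFDerivAt (fun u => Uf u t) _ u :=
      ((ContinuousLinearMap.apply ℂ S t).restrictScalars ℝ).hasFDerivAt.comp u hUd.hasFDerivAt
    have h2 := hd.inner ℂ hd
    have h3 : (fun u => inner ℂ (Uf u t) (Uf u t)) =ᶠ[nhds u] fun _ => inner ℂ t t :=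
      Filter.Eventually.of_forall hnorm
    have h4 := congr_fun (h2.unique ((hasFDerivAt_const _ u).congr_of_eventuallyEq h3)) v
    simp only [ContinuousLinearMap.comp_apply, fderivInnerCLM_apply, ContinuousLinearMap.prod_apply,
      ContinuousLinearMap.coe_restrictScalars', ContinuousLinearMap.apply_apply,
      _root_.zero_apply] at h4
    have h5 := congrArg Complex.re h4
    rw [Complex.add_re, ← inner_conj_symm, Complex.conj_re, Complex.zero_re] at h5
    linarith
  have h2 : (inner ℂ (spinElement (fun b => A (cliffordGen b)) Γ (Uf u t)) (Uf u t)).re = 0 :=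
    re_inner_spinElement hskew hΓ _
  have h3 : (inner ℂ (Uf u (spinElement (fun b => A (cliffordGen b)) Γ' t)) (Uf u t)).re = 0 := by
    rw [hUf, inner_act_spin A hskew]
    exact re_inner_spinElement hskew hΓ' t
  have h4 : r * ‖t‖ ^ 2 = 0 := by
    have h5 : (inner ℂ (Z t) (Uf u t)).re = 0 := by
      rw [hZ]
      simp only [_root_.add_apply, _root_.sub_apply, mul_apply_eq_comp, inner_add_left,
        inner_sub_left, Complex.add_re, Complex.sub_re, h1, h2, h3]
      norm_num
    rw [hZr, _root_.smul_apply, ← coe_smul, inner_smul_left, Complex.conj_ofReal,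
      Complex.re_ofReal_mul, hnorm, inner_self_eq_norm_sq_to_K] at h5
    rw [← h5]
    norm_cast
  have hr0 : r = 0 := by
    rcases mul_eq_zero.mp h4 with h | h
    · exact h
    · exact absurd (norm_eq_zero.mp (pow_eq_zero_iff two_ne_zero |>.mp h)) ht
  rw [hr0, zero_smul] at hZr
  exact sub_eq_zero.mp hZr

end SpinStructure
end Gauge

section FrameDirac

variable {n : ℕ} {N : Type*} [TopologicalSpace N] [ChartedSpace (𝔼 n) N]
  [IsManifold (𝓡 n) ∞ N] {g : RiemMetric n N} {ι : Type*} (P : SpinStructure ι g)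
  {S : Type*} [NormedAddCommGroup S] [InnerProductSpace ℂ S] [FiniteDimensional ℂ S]
  (A : Cl (Fin n) →ₐ[ℝ] (S →L[ℂ] S))

theorem spinElement_sum_smul {κ κ' B : Type*} [Fintype κ] [Fintype κ'] [Ring B] [Algebra ℝ B]
    (γ : κ → B) (r : κ' → ℝ) (K : κ' → κ → κ → ℝ) :
    spinElement γ (fun d f => ∑ e, r e * K e d f) = ∑ e, r e • spinElement γ (K e) := by
  simp only [spinElement, smul_sum, sum_smul, smul_smul]
  rw [Finset.sum_comm' (t' := Finset.univ) (s' := fun _ => Finset.univ) (by simp)]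
  conv_rhs => rw [sum_comm]
  rw [sum_comm]
  refine sum_congr rfl fun d _ => ?_
  conv_rhs => rw [sum_comm]
  refine sum_congr rfl fun f _ => sum_congr rfl fun e _ => ?_
  congr 1
  ring

namespace SpinStructure

/-- The Dirac operator in the spin frame `i`, for a representation of the Clifford algebra. -/
def frameDirac (i : ι) (σ : N → S) (y : N) : S :=
  ∑ b, A (cliffordGen b) ((show S from mfderiv (𝓡 n) 𝓘(ℝ, S) σ y (P.frame i b y)) +
    spinElement (fun c => A (cliffordGen c)) (koszul (P.frameBracket i y) b) (σ y))

theorem coordFrame_chart {y₀ y : N} (hy : y ∈ χ[n, y₀].source) (i : ι) (a : Fin n) :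
    P.coordFrame y₀ i a (χ[n, y₀] y) = mfderiv (𝓡 n) 𝓘(ℝ, 𝔼 n) χ[n, y₀] y (P.frame i a y) := by
  simp only [coordFrame]
  rw [χ[n, y₀].left_inv hy]

/-- **Gauge covariance** of the Dirac operator. -/
theorem frameDirac_gauge [Nontrivial S]
    (hskew : ∀ a s t, inner ℂ (A (cliffordGen a) s) t = -inner ℂ s (A (cliffordGen a) t))
    {i j : ι} {y : N} (hyi : y ∈ P.dom i) (hyj : y ∈ P.dom j) {σi σj : N → S}
    (hσj : MDifferentiableAt (𝓡 n) 𝓘(ℝ, S) σj y)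
    (hσi : σi =ᶠ[nhds y] fun y' => A (P.lift i j y' : Cl (Fin n)) (σj y')) :
    P.frameDirac A i σi y = A (P.lift i j y : Cl (Fin n)) (P.frameDirac A j σj y) := by
  have hy : y ∈ χ[n, y].source := mem_extChartAt_source y
  set u := χ[n, y] y with hu
  have hi : u ∈ P.coordDom y i := P.mem_coordDom hy hyi
  have hj : u ∈ P.coordDom y j := P.mem_coordDom hy hyj
  have hsu : χ[n, y].symm u = y := χ[n, y].left_inv hy
  set Uf : 𝔼 n → (S →L[ℂ] S) :=
    fun u => A (P.lift i j (χ[n, y].symm u) : Cl (Fin n)) with hUf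
  have hUu : Uf u = A (P.lift i j y : Cl (Fin n)) := by rw [hUf]; simp only [hsu]
  have hO : IsOpen (P.coordDom y i ∩ P.coordDom y j) :=
    (P.isOpen_coordDom y i).inter (P.isOpen_coordDom y j)
  have hUd : DifferentiableAt ℝ Uf u := ((P.contDiffOn_lift A y i j).contDiffAt
    (hO.mem_nhds ⟨hi, hj⟩)).differentiableAt (by simp)
  have hcs : Filter.Tendsto χ[n, y].symm (nhds u) (nhds y) := by
    have := continuousAt_extChartAt_symm (I := 𝓡 n) y
    rwa [ContinuousAt, ← hu, hsu] at this
  have hsm : MDifferentiableAt 𝓘(ℝ, 𝔼 n) (𝓡 n)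
      χ[n, y].symm u :=
    ((contMDiffOn_extChartAt_symm (n := 1) y).contMDiffAt
      ((isOpen_extChartAt_target y).mem_nhds hi.1)).mdifferentiableAt one_ne_zero
  have hτd : DifferentiableAt ℝ (σj ∘ χ[n, y].symm) u :=
    (MDifferentiableAt.comp u (I' := 𝓡 n) (by rw [hsu]; exact hσj) hsm).differentiableAt
  set τ := σj ∘ χ[n, y].symm with hτ
  have hτu : τ u = σj y := by rw [hτ, Function.comp_apply, hsu]
  have heq : (σi ∘ χ[n, y].symm) =ᶠ[nhds u] fun u' => Uf u' (τ u') :=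
    hcs.eventually hσi
  have hd : HasFDerivAt (fun u' => Uf u' (τ u')) _ u :=
    ((ContinuousLinearMap.restrictScalarsL ℂ S S ℝ ℝ).hasFDerivAt.comp u hUd.hasFDerivAt).clm_apply
      hτd.hasFDerivAt
  have hσid : MDifferentiableAt (𝓡 n) 𝓘(ℝ, S) σi y := by
    have h1 : MDifferentiableAt (𝓡 n) 𝓘(ℝ, S)
        ((fun u' => Uf u' (τ u')) ∘ χ[n, y]) y :=
      (MDifferentiableAt.comp y (I' := 𝓘(ℝ, 𝔼 n))
        hd.differentiableAt.mdifferentiableAt (mdifferentiableAt_extChartAt (mem_chart_source _ y)))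
    refine h1.congr_of_eventuallyEq ?_
    filter_upwards [hσi, (isOpen_extChartAt_source (I := 𝓡 n) y).mem_nhds hy] with z hz hz2
    rw [hz]
    simp only [Function.comp_apply, hUf, hτ, χ[n, y].left_inv hz2]
  have hσiu : σi y = Uf u (τ u) := by
    rw [hUu, hτu]; exact hσi.self_of_nhds
  have hdi : ∀ v, fderiv ℝ (σi ∘ χ[n, y].symm) u v =
      fderiv ℝ Uf u v (τ u) + Uf u (fderiv ℝ τ u v) := by
    intro v
    rw [heq.fderiv_eq, hd.fderiv, add_comm]
    rfl
  have hX : ∀ a, ∑ e, P.coordChange y i j a e u •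
      (fderiv ℝ (σi ∘ χ[n, y].symm) u (P.coordFrame y i e u) +
        spinElement (fun c => A (cliffordGen c)) (koszul (P.frameBracket i y) e) (σi y)) =
      Uf u (fderiv ℝ τ u (P.coordFrame y j a u) +
        spinElement (fun c => A (cliffordGen c)) (koszul (P.frameBracket j y) a) (σj y)) := by
    intro a
    have h1 := congr_fun (P.gauge_identity A hskew hi hj a) (τ u)
    rw [hsu, spinElement_sum_smul, ← hUf] at h1
    simp only [_root_.add_apply, mul_apply_eq_comp, _root_.sum_apply, _root_.smul_apply] at h1
    rw [map_add, ← hτu, ← hUu] at *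
    rw [← h1, P.coordFrame_eq_sum_frameChange hi a]
    simp only [smul_add, sum_add_distrib, hdi, hσiu, map_sum, map_smul, _root_.sum_apply,
      _root_.smul_apply, map_smul_of_tower]
    simp only [coordChange]
    abel
  rw [frameDirac, frameDirac]
  have e1 : ∀ (i : ι) (σ : N → S), MDifferentiableAt (𝓡 n) 𝓘(ℝ, S) σ y → ∀ b,
      (show S from mfderiv (𝓡 n) 𝓘(ℝ, S) σ y (P.frame i b y)) =
      fderiv ℝ (σ ∘ χ[n, y].symm) u (P.coordFrame y i b u) := by
    intro i σ hσ b
    rw [P.coordFrame_chart hy]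
    exact mfderiv_eq_fderiv_chart hy hσ _
  simp only [e1 i σi hσid, e1 j σj hσj, ← hτ]
  have hγU : ∀ a (s : S), Uf u (A (cliffordGen a) s) =
      ∑ c, P.coordChange y i j a c u • A (cliffordGen c) (Uf u s) := by
    intro a s
    have := congr_fun (P.lift_mul_gen A hi hj a) s
    simpa only [mul_apply_eq_comp, _root_.sum_apply, _root_.smul_apply] using this
  rw [← hUu, map_sum]
  simp only [hγU, ← hX]
  simp only [map_sum, map_smul_of_tower, smul_sum, smul_smul]
  have horth : ∀ c d, ∑ a, P.coordChange y i j a c u * P.coordChange y i j a d u =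
      if c = d then 1 else 0 := fun c d => P.sum_frameChange_mul' hi.2 hj.2 c d
  rw [sum_comm]
  refine sum_congr rfl fun c _ => ?_
  rw [sum_comm]
  simp only [← sum_smul, horth]
  simp [sum_add_distrib]

end SpinStructure
end FrameDirac

section ProductBracket

variable {n k : ℕ} {N : Type*} [TopologicalSpace N] [ChartedSpace (𝔼 n) N]
  [IsManifold (𝓡 n) ∞ N]

/-- The Lie bracket on a manifold without boundary, in the chart at the point. -/
theorem mlieBracket_eq_lieBracket_chart {E H M : Type*} [NormedAddCommGroup E] [NormedSpace ℝ E]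
    [TopologicalSpace H] {I : ModelWithCorners ℝ E H} [TopologicalSpace M] [ChartedSpace H M]
    [IsManifold I 1 M] [I.Boundaryless] (V W : ∀ p : M, TangentSpace I p) (p : M) :
    mlieBracket I V W p = lieBracket ℝ
      (fun u => (mfderiv I 𝓘(ℝ, E) (extChartAt I p) ((extChartAt I p).symm u)
        (V ((extChartAt I p).symm u)) : E))
      (fun u => (mfderiv I 𝓘(ℝ, E) (extChartAt I p) ((extChartAt I p).symm u)
        (W ((extChartAt I p).symm u)) : E)) (extChartAt I p p) := by
  have hpull : ∀ V : ∀ p : M, TangentSpace I p,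
      (VectorField.mpullbackWithin 𝓘(ℝ, E) I (extChartAt I p).symm V (Set.range I)) =ᶠ[nhds
        (extChartAt I p p)] (fun u => (mfderiv I 𝓘(ℝ, E) (extChartAt I p)
          ((extChartAt I p).symm u) (V ((extChartAt I p).symm u)) : E)) := by
    intro V
    filter_upwards [(isOpen_extChartAt_target p).mem_nhds (mem_extChartAt_target p)] with u hu
    rw [VectorField.mpullbackWithin_apply, ContinuousLinearMap.inverse_eq
      (mfderivWithin_extChartAt_symm_comp_mfderiv_extChartAt (I := I) hu)
      (mfderiv_extChartAt_comp_mfderivWithin_extChartAt_symm (I := I) hu)]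
    rfl
  refine Eq.trans ?_ (Filter.EventuallyEq.lieBracket_vectorField_eq (𝕜 := ℝ) (E := E)
    (hpull V) (hpull W))
  have h1 : mlieBracket I V W p = (mfderiv I 𝓘(ℝ, E) (extChartAt I p) p).inverse
      (VectorField.lieBracketWithin ℝ (E := E)
        (VectorField.mpullbackWithin 𝓘(ℝ, E) I (extChartAt I p).symm V (Set.range I))
        (VectorField.mpullbackWithin 𝓘(ℝ, E) I (extChartAt I p).symm W (Set.range I))
        ((extChartAt I p).symm ⁻¹' Set.univ ∩ Set.range I) (extChartAt I p p)) := rfl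
  have h2 : (mfderiv I 𝓘(ℝ, E) (extChartAt I p) p : E →L[ℝ] E) = ContinuousLinearMap.id ℝ E :=
    mfderiv_extChartAt_self
  have h3 : ∀ V W : E → E, VectorField.lieBracketWithin ℝ V W
      ((extChartAt I p).symm ⁻¹' Set.univ ∩ Set.range I) (extChartAt I p p) =
      lieBracket ℝ V W (extChartAt I p p) := by
    intro V W
    rw [Set.preimage_univ, Set.univ_inter, ModelWithCorners.range_eq_univ,
      VectorField.lieBracketWithin_univ]
  have h4 : ∀ z : E, (ContinuousLinearMap.id ℝ E).inverse z = z := fun z => by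
    rw [ContinuousLinearMap.inverse_id]; rfl
  exact h1.trans ((congrArg (fun L : E →L[ℝ] E => L.inverse _) h2).trans ((h4 _).trans (h3 _ _)))

theorem lieBracket_prod {E F : Type*} [NormedAddCommGroup E] [NormedSpace ℝ E]
    [NormedAddCommGroup F] [NormedSpace ℝ F] {v v' : E → E} {w w' : F → F} {x : E} {y : F}
    (hv : DifferentiableAt ℝ v x) (hv' : DifferentiableAt ℝ v' x) (hw : DifferentiableAt ℝ w y)
    (hw' : DifferentiableAt ℝ w' y) :
    lieBracket ℝ (fun p : E × F => (v p.1, w p.2)) (fun p => (v' p.1, w' p.2)) (x, y) =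
      (lieBracket ℝ v v' x, lieBracket ℝ w w' y) := by
  have h : ∀ {v : E → E} {w : F → F}, DifferentiableAt ℝ v x → DifferentiableAt ℝ w y →
      ∀ z, fderiv ℝ (fun p : E × F => (v p.1, w p.2)) (x, y) z =
        (fderiv ℝ v x z.1, fderiv ℝ w y z.2) := by
    intro v w hv hw z
    have h1 : HasFDerivAt (fun p : E × F => (v p.1, w p.2)) _ (x, y) :=
      (hv.hasFDerivAt.comp (x, y) hasFDerivAt_fst).prodMk
        (hw.hasFDerivAt.comp (x, y) hasFDerivAt_snd)
    rw [h1.fderiv]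
    rfl
  simp only [lieBracket, h hv hw, h hv' hw']
  rfl

theorem mlieBracket_prod {v v' : ℍ k → ℍ k}
    {w w' : ∀ y : N, TangentSpace (𝓡 n) y} {x : ℍ k} {y : N}
    (hv : DifferentiableAt ℝ v x) (hv' : DifferentiableAt ℝ v' x)
    (hw : DifferentiableAt ℝ (fun u => (mfderiv (𝓡 n) 𝓘(ℝ, 𝔼 n)
      χ[n, y] (χ[n, y].symm u) (w (χ[n, y].symm u)) :
        𝔼 n)) (χ[n, y] y))
    (hw' : DifferentiableAt ℝ (fun u => (mfderiv (𝓡 n) 𝓘(ℝ, 𝔼 n)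
      χ[n, y] (χ[n, y].symm u) (w' (χ[n, y].symm u)) :
        𝔼 n)) (χ[n, y] y)) :
    mlieBracket (𝓜 k n)
      (fun p : ℍ k × N =>
        ((v p.1, w p.2) : TangentSpace (𝓜 k n) p))
      (fun p => ((v' p.1, w' p.2) : TangentSpace (𝓜 k n) p)) (x, y) =
    ((lieBracket ℝ v v' x, mlieBracket (𝓡 n) w w' y) :
      ℍ k × 𝔼 n) := by
  have hone : IsManifold (𝓡 n) 1 N := IsManifold.of_le (n := ∞) (by exact_mod_cast le_top)
  refine (mlieBracket_eq_lieBracket_chart (I := 𝓜 k n) _ _ (x, y)).trans ?_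
  have hχ : ⇑(extChartAt (𝓜 k n) (x, y)) = Prod.map (id : ℍ k → ℍ k)
        χ[n, y] := by
    rw [extChartAt_prod]; rfl
  have hχs : ⇑(extChartAt (𝓜 k n) (x, y)).symm = Prod.map (id : ℍ k → ℍ k)
        χ[n, y].symm := by
    rw [extChartAt_prod]; rfl
  have hfield : ∀ (v : ℍ k → ℍ k)
      (w : ∀ y : N, TangentSpace (𝓡 n) y),
      (fun u => (mfderiv (𝓜 k n)
        𝓘(ℝ, ℍ k × 𝔼 n)
        (extChartAt (𝓜 k n) (x, y))
        ((extChartAt (𝓜 k n) (x, y)).symm u)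
        (v ((extChartAt (𝓜 k n) (x, y)).symm u).1, w ((extChartAt (𝓜 k n) (x, y)).symm u).2) :
            ℍ k × 𝔼 n)) =ᶠ[nhds
              ((x, χ[n, y] y) : ℍ k × 𝔼 n)]
      (fun u => (v u.1, (mfderiv (𝓡 n) 𝓘(ℝ, 𝔼 n)
        χ[n, y] (χ[n, y].symm u.2) (w (χ[n, y].symm u.2)) :
          𝔼 n))) := by
    intro v w
    have h0 : ∀ᶠ u in nhds ((x, χ[n, y] y) : ℍ k × 𝔼 n), u.2 ∈ χ[n, y].target :=
      continuous_snd.continuousAt.eventually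
        ((isOpen_extChartAt_target y).mem_nhds (mem_extChartAt_target y))
    filter_upwards [h0] with u hu
    have hsrc : χ[n, y].symm u.2 ∈ (chartAt (𝔼 n) y).source := by
      rw [← extChartAt_source (𝓡 n)]
      exact χ[n, y].map_target hu
    have h1 := mfderiv_prodMap (p := ((u.1, χ[n, y].symm u.2) :
        ℍ k × N)) (I := 𝓡 (k + 1)) (I' := 𝓡 n) (J := 𝓡 (k + 1))
      (J' := 𝓘(ℝ, 𝔼 n))
      (mdifferentiableAt_id (I := 𝓡 (k + 1)) (x := u.1)) (mdifferentiableAt_extChartAt hsrc)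
    rw [hχ, hχs]
    have h2 : mfderiv (𝓜 k n)
        𝓘(ℝ, ℍ k × 𝔼 n)
        (Prod.map (id : ℍ k → ℍ k)
          χ[n, y]) (u.1, χ[n, y].symm u.2) =
        (mfderiv (𝓡 (k + 1)) (𝓡 (k + 1))
          (id : ℍ k → ℍ k) u.1).prodMap
        (mfderiv (𝓡 n) 𝓘(ℝ, 𝔼 n) χ[n, y]
          (χ[n, y].symm u.2)) := by
      rw [modelWithCornersSelf_prod, ← chartedSpaceSelf_prod]
      exact h1
    exact (congr_fun h2 (v u.1, w (χ[n, y].symm u.2))).trans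
      (congrArg (fun z : ℍ k =>
        ((z, _) : ℍ k × 𝔼 n))
        (congr_fun (mfderiv_id (I := 𝓡 (k + 1)) (x := u.1)) (v u.1)))
  rw [hχ]
  change lieBracket ℝ _ _ ((x, χ[n, y] y) :
    ℍ k × 𝔼 n) = _
  rw [← hχ]
  rw [(hfield v w).lieBracket_vectorField_eq (hfield v' w'), lieBracket_prod hv hv' hw hw',
    mlieBracket_eq_lieBracket_chart]

end ProductBracket

section HyperbolicFrame

/-- The derivative of `sinhC c`. -/
def coshC (c r : ℝ) : ℝ := if c = 0 then 1 else Real.cosh (c * r)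

theorem hasDerivAt_sinhC (c r : ℝ) : HasDerivAt (sinhC c) (coshC c r) r := by
  by_cases hc : c = 0
  · have : sinhC c = id := by ext r; simp [sinhC, hc]
    rw [this, coshC, if_pos hc]
    exact hasDerivAt_id r
  · have : sinhC c = fun r => Real.sinh (c * r) / c := by ext r; simp [sinhC, hc]
    rw [this, coshC, if_neg hc]
    have h := (((hasDerivAt_id r).const_mul c).sinh).div_const c
    exact h.congr_deriv (by simp only [id]; field_simp)

theorem sinhC_pos {c r : ℝ} (hr : 0 < r) : 0 < sinhC c r := by
  unfold sinhC
  split_ifs with hc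
  · exact hr
  · rcases lt_or_gt_of_ne hc with h | h
    · exact div_pos_of_neg_of_neg (Real.sinh_neg_iff.mpr (mul_neg_of_neg_of_pos h hr)) h
    · exact div_pos (Real.sinh_pos_iff.mpr (mul_pos h hr)) h

theorem cothC_eq (c : ℝ) {r : ℝ} : cothC c r = coshC c r / sinhC c r := by
  unfold cothC coshC sinhC
  split_ifs with hc
  · rfl
  · field_simp

theorem hasDerivAt_coshC (c r : ℝ) : HasDerivAt (coshC c) (c ^ 2 * sinhC c r) r := by
  by_cases hc : c = 0
  · have : coshC c = fun _ => 1 := by ext r; simp [coshC, hc]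
    rw [this, hc]
    simpa using hasDerivAt_const r (1 : ℝ)
  · have : coshC c = fun r => Real.cosh (c * r) := by ext r; simp [coshC, hc]
    rw [this]
    have h := (((hasDerivAt_id r).const_mul c).cosh)
    exact h.congr_deriv (by simp only [id, sinhC, if_neg hc]; field_simp)

variable {k : ℕ}

theorem hasFDerivAt_comp_norm {E F : Type*} [NormedAddCommGroup E] [InnerProductSpace ℝ E]
    [NormedAddCommGroup F] [NormedSpace ℝ F]
    {f : ℝ → F} {f' : F} {x : E} (hx : x ≠ 0) (hf : HasDerivAt f f' ‖x‖) :
    HasFDerivAt (fun x : E => f ‖x‖) ((‖x‖⁻¹ • innerSL ℝ x).smulRight f') x := by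
  have h := hf.hasFDerivAt.comp x (((hasStrictFDerivAt_norm_sq x).hasFDerivAt.sqrt
    (by simpa using hx)).congr_of_eventuallyEq
      (Filter.Eventually.of_forall fun z => (Real.sqrt_sq (norm_nonneg z)).symm))
  refine h.congr_fderiv ?_
  ext v
  simp only [ContinuousLinearMap.smulRight_apply, _root_.smul_apply,
    Real.sqrt_sq (norm_nonneg x), ContinuousLinearMap.coe_comp, Function.comp_apply]
  have : ‖x‖ ≠ 0 := norm_ne_zero_iff.mpr hx
  rw [ContinuousLinearMap.toSpanSingleton_apply]
  congr 1
  simp only [smul_eq_mul, nsmul_eq_mul]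
  field_simp
  simp

variable {α β : ℝ → ℝ} {α' β' : ℝ} {x : ℍ k}

theorem hasFDerivAt_radialField (hx : x ≠ 0) (hα : HasDerivAt α α' ‖x‖)
    (hβ : HasDerivAt β β' ‖x‖) (b : Fin (k + 1)) :
    HasFDerivAt (fun x : ℍ k =>
        α ‖x‖ • δ[b] + (β ‖x‖ * x b) • x)
      ((((‖x‖⁻¹ • innerSL ℝ x).smulRight α').smulRight δ[b]) +
        ((β ‖x‖ * x b) • ContinuousLinearMap.id ℝ _ + (β ‖x‖ • (proj b : ℍ k →L[ℝ] ℝ) +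
            x b • (‖x‖⁻¹ • innerSL ℝ x).smulRight β').smulRight x)) x :=
  ((hasFDerivAt_comp_norm hx hα).smul_const _).add
    (((hasFDerivAt_comp_norm hx hβ).mul
      (proj b : ℍ k →L[ℝ] ℝ).hasFDerivAt).smul
        (hasFDerivAt_id x))

theorem lieBracket_radialField (hx : x ≠ 0) (hα : HasDerivAt α α' ‖x‖)
    (hβ : HasDerivAt β β' ‖x‖) (hαβ : α ‖x‖ + β ‖x‖ * ‖x‖ ^ 2 = 1) (hα0 : α ‖x‖ ≠ 0)
    (X : Fin (k + 1) → ℍ k → ℍ k)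
    (hX : ∀ a x, X a x = α ‖x‖ • δ[a] + (β ‖x‖ * x a) • x)
    (a b : Fin (k + 1)) :
    lieBracket ℝ (X a) (X b) x = (β ‖x‖ - α' / (‖x‖ * α ‖x‖)) • (x b • X a x - x a • X b x) := by
  have hXf : ∀ a, X a = fun x => α ‖x‖ • δ[a] + (β ‖x‖ * x a) • x :=
    fun a => funext (hX a)
  have hr : ‖x‖ ≠ 0 := norm_ne_zero_iff.mpr hx
  have hin : ∀ a, inner ℝ x (X a x) = x a := by
    intro a
    rw [hX, inner_add_right, inner_smul_right, inner_smul_right, real_inner_self_eq_norm_sq,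
      EuclideanSpace.inner_single_right]
    simp only [one_mul, conj_trivial]
    linear_combination x a * hαβ
  have hs : (δ[b] : ℍ k) a = (δ[a] : ℍ k) b := by
    simp [eq_comm]
  have hD : ∀ b v, fderiv ℝ (X b) x v = (‖x‖⁻¹ * inner ℝ x v * α') •
      δ[b] + ((β ‖x‖ * x b) • v + (β ‖x‖ * v b + x b * (‖x‖⁻¹ * inner ℝ x v * β')) • x) := by
    intro b v
    rw [hXf b, (hasFDerivAt_radialField hx hα hβ b).fderiv]
    simp
  rw [lieBracket, hD, hD, hin, hin]
  ext j
  simp only [hX, PiLp.add_apply, PiLp.sub_apply, PiLp.smul_apply, smul_eq_mul, hs]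
  field_simp
  ring

theorem differentiableAt_hypVec (c : ℝ) (hx : x ≠ 0) (b : Fin (k + 1)) :
    DifferentiableAt ℝ (hypVec c b) x ∧ ∀ a, lieBracket ℝ (hypVec c a) (hypVec c b) x =
      ((coshC c ‖x‖ - 1) / (sinhC c ‖x‖ * ‖x‖)) • (x b • hypVec c a x - x a • hypVec c b x) := by
  have hr : 0 < ‖x‖ := norm_pos_iff.mpr hx
  have hs := sinhC_pos (c := c) hr
  have hα : HasDerivAt (fun r => (warp c r)⁻¹)
      ((1 * sinhC c ‖x‖ - ‖x‖ * coshC c ‖x‖) / sinhC c ‖x‖ ^ 2) ‖x‖ := by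
    refine ((hasDerivAt_id ‖x‖).div (hasDerivAt_sinhC c ‖x‖) hs.ne').congr_of_eventuallyEq ?_
    filter_upwards [eventually_gt_nhds hr] with r hr
    simp [warp, hr.ne']
  have hβ : HasDerivAt (fun r => (1 - (warp c r)⁻¹) / r ^ 2) _ ‖x‖ :=
    (hα.const_sub 1).div (hasDerivAt_pow 2 ‖x‖) (by positivity)
  have hX : ∀ a (x : ℍ k), hypVec c a x = (warp c ‖x‖)⁻¹ • δ[a] +
        ((1 - (warp c ‖x‖)⁻¹) / ‖x‖ ^ 2 * x a) • x := by
    intro a x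
    rw [hypVec]
    congr 2
    ring
  have hw : (warp c ‖x‖)⁻¹ = ‖x‖ / sinhC c ‖x‖ := by simp [warp, hr.ne']
  refine ⟨?_, fun a => ?_⟩
  · have := hasFDerivAt_radialField hx hα hβ b
    rw [← (funext (hX b) : hypVec c b = _)] at this
    exact this.differentiableAt
  · rw [lieBracket_radialField hx hα hβ (by field_simp; ring) (inv_ne_zero (warp_ne_zero c _))
      (hypVec c) hX a b, hw]
    congr 1
    field_simp
    ring

end HyperbolicFrame

section ProductGeometry

variable {n k : ℕ} {N : Type*} [TopologicalSpace N] [ChartedSpace (𝔼 n) N]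
  [IsManifold (𝓡 n) ∞ N] {ι : Type*} {g : RiemMetric n N} (P : SpinStructure ι g)
  {x : ℍ k} {y : N} {i : ι}

/-- The components of `hypFrame` and `frame i` in the product frame. -/
def frameParts (c : ℝ) (i : ι) : Fin (k + 1) ⊕ Fin n → (ℍ k → ℍ k) × (∀ y : N, TangentSpace (𝓡 n) y)
  | Sum.inl a => (hypVec c a, 0)
  | Sum.inr b => (0, P.frame i b)

theorem mlieBracket_prodFrame (c : ℝ) (hx : x ≠ 0) (hy : y ∈ P.dom i)
    (A B : Fin (k + 1) ⊕ Fin n) :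
    mlieBracket (𝓜 k n) (P.prodFrame c i A) (P.prodFrame c i B)
      (x, y) = ((lieBracket ℝ (frameParts P c i A).1 (frameParts P c i B).1 x,
        mlieBracket (𝓡 n) (frameParts P c i A).2 (frameParts P c i B).2 y) :
          ℍ k × 𝔼 n) := by
  have h1 : ∀ A : Fin (k + 1) ⊕ Fin n, DifferentiableAt ℝ (frameParts P c i A).1 x := by
    rintro (a | b)
    · exact (differentiableAt_hypVec c hx a).1
    · exact differentiableAt_const (0 : ℍ k)
  have h2 : ∀ A : Fin (k + 1) ⊕ Fin n, DifferentiableAt ℝ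
      (fun u => (mfderiv (𝓡 n) 𝓘(ℝ, 𝔼 n)
      χ[n, y] (χ[n, y].symm u)
        ((frameParts P c i A).2 (χ[n, y].symm u)) :
        𝔼 n)) (χ[n, y] y) := by
    rintro (a | b)
    · simp only [frameParts]
      refine (differentiableAt_const (0 : 𝔼 n)).congr_of_eventuallyEq
        (Filter.Eventually.of_forall fun u => ?_)
      exact map_zero (mfderiv (𝓡 n) 𝓘(ℝ, 𝔼 n)
        χ[n, y] (χ[n, y].symm u))
    · exact ((P.contDiffOn_coordFrame y i b).contDiffAt ((P.isOpen_coordDom y i).mem_nhds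
        (P.mem_coordDom (mem_extChartAt_source y) hy))).differentiableAt (by simp)
  have hp : ∀ A : Fin (k + 1) ⊕ Fin n, P.prodFrame c i A = fun p =>
      (((frameParts P c i A).1 p.1, (frameParts P c i A).2 p.2) :
        TangentSpace (𝓜 k n) p) := by
    rintro (a | b) <;> rfl
  rw [hp A, hp B]
  exact mlieBracket_prod (h1 A) (h1 B) (h2 A) (h2 B)

end ProductGeometry

section ActL

variable {κ : Type*} [Fintype κ] {S : Type*} [NormedAddCommGroup S] [InnerProductSpace ℂ S]
  [FiniteDimensional ℂ S]

/-- The action of the Clifford algebra by continuous linear maps. -/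
def SpinorModule.actL (ρ : SpinorModule κ S) : Cl κ →ₐ[ℝ] (S →L[ℂ] S) :=
  ((Module.End.toContinuousLinearMap S).toAlgHom.restrictScalars ℝ).comp ρ.act

variable [DecidableEq κ]

/-- Clifford multiplication by a basis vector as a continuous linear map. -/
def SpinorModule.genL (ρ : SpinorModule κ S) (a : κ) : S →L[ℂ] S := ρ.actL (cliffordGen a)

theorem SpinorModule.genL_apply (ρ : SpinorModule κ S) (a : κ) (s : S) :
    ρ.genL a s = ρ.gen a s := rfl

theorem SpinorModule.cliffordRel_genL (ρ : SpinorModule κ S) : CliffordRel ρ.genL :=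
  cliffordRel_gen.map ρ.actL.toRingHom

theorem SpinorModule.inner_genL (ρ : SpinorModule κ S) (a : κ) (s t : S) :
    inner ℂ (ρ.genL a s) t = -inner ℂ s (ρ.genL a t) := ρ.skew _ s t

end ActL

section VecMul

variable {n k : ℕ} {S : Type*} [NormedAddCommGroup S] [InnerProductSpace ℂ S]
  [FiniteDimensional ℂ S] (ρ : 𝓢 k n S)

/-- Clifford multiplication by the vectors of `ℝ^{k+1}`. -/
def vecMul : ℍ k →L[ℝ] (S →L[ℂ] S) :=
  ∑ a, (proj a : ℍ k →L[ℝ] ℝ).smulRight (ρ.genL (Sum.inl a))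

theorem vecMul_apply (x : ℍ k) :
    vecMul ρ x = ∑ a, x a • ρ.genL (Sum.inl a) := by
  simp [vecMul]

theorem vecMul_single (a : Fin (k + 1)) :
    vecMul ρ δ[a] = ρ.genL (Sum.inl a) := by
  simp [vecMul_apply]

theorem genL_mul_vecMul (a : Fin (k + 1)) (x : ℍ k) :
    ρ.genL (Sum.inl a) * vecMul ρ x =
      -(vecMul ρ x * ρ.genL (Sum.inl a)) - (2 * x a) • (1 : S →L[ℂ] S) := by
  rw [vecMul_apply, mul_sum, sum_mul, ← sum_neg_distrib]
  have h : ∀ b, ρ.genL (Sum.inl a) * (x b • ρ.genL (Sum.inl b)) =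
      -(x b • ρ.genL (Sum.inl b) * ρ.genL (Sum.inl a)) -
        (if a = b then 2 * x b else 0) • (1 : S →L[ℂ] S) := by
    intro b
    rw [mul_smul_comm, smul_mul_assoc]
    by_cases hab : a = b
    · subst hab
      rw [ρ.cliffordRel_genL.sq, if_pos rfl]
      module
    · rw [ρ.cliffordRel_genL.anti _ _ (Sum.inl_injective.ne hab), if_neg hab]
      module
  rw [sum_congr rfl fun b _ => h b, sum_sub_distrib, ← sum_smul]
  simp

theorem vecMul_mul_self (x : ℍ k) :
    vecMul ρ x * vecMul ρ x = -(‖x‖ ^ 2 • (1 : S →L[ℂ] S)) := by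
  have h : vecMul ρ x * vecMul ρ x =
      -(vecMul ρ x * vecMul ρ x) - (2 * ‖x‖ ^ 2) • (1 : S →L[ℂ] S) := by
    conv_lhs => lhs; rw [vecMul_apply]
    rw [sum_mul]
    simp only [smul_mul_assoc, genL_mul_vecMul, smul_sub, smul_neg, smul_smul,
      sum_sub_distrib, sum_neg_distrib, ← sum_smul]
    congr 2
    · conv_rhs => rhs; rw [vecMul_apply]
      rw [mul_sum]
      simp
    · rw [EuclideanSpace.norm_sq_eq, mul_sum]
      refine sum_congr rfl fun a _ => ?_
      rw [norm_eq_abs, sq_abs]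
      ring
  have h2 : (2 : ℝ) • (vecMul ρ x * vecMul ρ x) = (2 : ℝ) • -(‖x‖ ^ 2 • (1 : S →L[ℂ] S)) := by
    rw [two_smul]
    nth_rewrite 1 [h]
    module
  exact smul_right_injective _ (two_ne_zero (α := ℝ)) h2

theorem vecMul_vecMul (x : ℍ k) (s : S) :
    vecMul ρ x (vecMul ρ x s) = -(‖x‖ ^ 2 • s) :=
  congr_fun (vecMul_mul_self ρ x) s

theorem genL_vecMul (a : Fin (k + 1)) (x : ℍ k) (s : S) :
    ρ.genL (Sum.inl a) (vecMul ρ x s) = -(vecMul ρ x (ρ.genL (Sum.inl a) s)) - (2 * x a) • s :=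
  congr_fun (genL_mul_vecMul ρ a x) s

theorem inner_vecMul (x : ℍ k) (s t : S) :
    inner ℂ (vecMul ρ x s) t = -inner ℂ s (vecMul ρ x t) := by
  simp only [vecMul_apply, _root_.sum_apply, _root_.smul_apply, sum_inner, inner_sum]
  rw [← sum_neg_distrib]
  refine sum_congr rfl fun a _ => ?_
  rw [inner_smul_left_eq_smul, inner_smul_right_eq_smul, ρ.inner_genL, smul_neg]

theorem radialMul_eq (Φ : ℍ k × N → S)
    (p : ℍ k × N) :
    radialMul ρ Φ p = ‖p.1‖⁻¹ • vecMul ρ p.1 (Φ p) := by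
  rw [vecMul_apply, radialMul, _root_.sum_apply, smul_sum]
  refine sum_congr rfl fun a _ => ?_
  rw [_root_.smul_apply, smul_smul, radialComp, div_eq_inv_mul]
  rfl

end VecMul

section ProductGeometry

variable {n k : ℕ} {N : Type*} [TopologicalSpace N] [ChartedSpace (𝔼 n) N]
  [IsManifold (𝓡 n) ∞ N] {ι : Type*} {g : RiemMetric n N} (P : SpinStructure ι g)
  {x : ℍ k} {y : N} {i : ι}

/-- The factor `(sinh_c' - 1)/(r sinh_c)` of the connection coefficients of `hypFrame`. -/
def hypFactor (c r : ℝ) : ℝ := (coshC c r - 1) / (sinhC c r * r)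

/-- The structure functions of the product frame. -/
def prodBracket (c : ℝ) (i : ι) (x : ℍ k) (y : N) :
    Fin (k + 1) ⊕ Fin n → Fin (k + 1) ⊕ Fin n → Fin (k + 1) ⊕ Fin n → ℝ
  | Sum.inl a, Sum.inl b, Sum.inl d => hypFactor c ‖x‖ *
      (x b * (if a = d then 1 else 0) - x a * (if b = d then 1 else 0))
  | Sum.inr a, Sum.inr b, Sum.inr d => P.frameBracket i y a b d
  | _, _, _ => 0

theorem hypInner_add_left (c : ℝ) (x v v' w : ℍ k) :
    hypInner c x (v + v') w = hypInner c x v w + hypInner c x v' w := by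
  simp only [hypInner, inner_add_left, inner_add_right]; ring

theorem hypInner_smul_left (c t : ℝ) (x v w : ℍ k) :
    hypInner c x (t • v) w = t * hypInner c x v w := by
  simp only [hypInner, real_inner_smul_left, real_inner_smul_right]; ring

theorem connCoeff_prod (c : ℝ) (hx : x ≠ 0) (hy : y ∈ P.dom i) (A B C : Fin (k + 1) ⊕ Fin n) :
    connCoeff (𝓜 k n) (prodMetric g c) (P.prodFrame c i) A B C (x, y) =
      koszul (prodBracket P c i x y) A B C := by
  have h0 : ∀ w, g.form y 0 w = 0 := fun w => by
    simpa using RiemMetric.form_smul_left (g := g) y 0 0 w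
  have h0' : ∀ w, g.form y w 0 = 0 := fun w => by rw [RiemMetric.form_comm, h0]
  have h1 : ∀ w, hypInner c x 0 w = 0 := fun w => by
    simpa using hypInner_smul_left c 0 x 0 w
  have h1' : ∀ w, hypInner c x w 0 = 0 := fun w => by simp [hypInner]
  have key : ∀ A B C : Fin (k + 1) ⊕ Fin n, prodMetric g c (x, y)
      (mlieBracket (𝓜 k n) (P.prodFrame c i A) (P.prodFrame c i B)
        (x, y)) (P.prodFrame c i C (x, y)) = prodBracket P c i x y A B C := by
    intro A B C
    have e1 : prodMetric g c (x, y)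
        (mlieBracket (𝓜 k n) (P.prodFrame c i A) (P.prodFrame c i B)
        (x, y)) (P.prodFrame c i C (x, y)) =
        hypInner c x (lieBracket ℝ (frameParts P c i A).1 (frameParts P c i B).1 x)
          ((frameParts P c i C).1 x) +
        g.form y (mlieBracket (𝓡 n) (frameParts P c i A).2 (frameParts P c i B).2 y)
          ((frameParts P c i C).2 y) := by
      have e2 := mlieBracket_prodFrame P c hx hy A B
      refine (congrArg (fun z : ℍ k × 𝔼 n =>
        prodMetric g c (x, y) z (P.prodFrame c i C (x, y))) e2).trans ?_
      rcases C with (a | a) <;> rfl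
    rw [e1]
    rcases A with (a | a) <;> rcases B with (b | b) <;> rcases C with (d | d) <;>
      simp only [frameParts, prodBracket, VectorField.lieBracket_zero_left,
        VectorField.lieBracket_zero_right, VectorField.mlieBracket_zero_left,
        VectorField.mlieBracket_zero_right, Pi.zero_apply, h0, h0', h1, h1', add_zero, zero_add]
    · have e3 := fun a => hypFrame_orthonormal c a d x
      rw [(differentiableAt_hypVec c hx b).2 a, hypInner_smul_left,
        show x b • hypVec c a x - x a • hypVec c b x =
          x b • hypVec c a x + (-x a) • hypVec c b x by module, hypInner_add_left, hypInner_smul_left, hypInner_smul_left, hypFactor]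
      have e4 : ∀ a, hypInner c x (hypVec c a x) (hypVec c d x) = if a = d then 1 else 0 := e3
      rw [e4, e4]
      ring
    · rfl
  simp only [connCoeff, koszul, key]

variable {S : Type*} [NormedAddCommGroup S] [InnerProductSpace ℂ S]
  [FiniteDimensional ℂ S] (ρ : 𝓢 k n S)

theorem frameSpinDeriv_inl (c : ℝ) (hx : x ≠ 0) (hy : y ∈ P.dom i)
    {σ : ℍ k × N → S}
    (hσ : MDifferentiableAt (𝓜 k n) 𝓘(ℝ, S) σ (x, y)) (a : Fin (k + 1)) :
    frameSpinDeriv (𝓜 k n) (prodMetric g c) (P.prodFrame c i) ρ σ (Sum.inl a)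
      (x, y) = fderiv ℝ (fun x' => σ (x', y)) x (hypVec c a x) -
        (hypFactor c ‖x‖ / 2) • (x a • σ (x, y) + ρ.genL (Sum.inl a) (vecMul ρ x (σ (x, y)))) := by
  have h1 : (show S from mfderiv (𝓜 k n) 𝓘(ℝ, S) σ (x, y)
      (P.prodFrame c i (Sum.inl a) (x, y))) = fderiv ℝ (fun x' => σ (x', y)) x (hypVec c a x) := by
    have h := mfderiv_prod_eq_add_apply (v := P.prodFrame c i (Sum.inl a) (x, y)) hσ
    refine h.trans ?_
    have h2 : (mfderiv (𝓡 n) 𝓘(ℝ, S) (fun z => σ (x, z)) y) (0 : 𝔼 n) = (0 : S) := map_zero _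
    rw [mfderiv_eq_fderiv]
    exact (congrArg (fun s : S => _ + s) h2).trans (add_zero _)
  rw [frameSpinDeriv, h1, sub_eq_add_neg]
  congr 1
  simp only [connCoeff_prod P c hx hy, Fintype.sum_sum_type, koszul, prodBracket]
  set s := σ (x, y)
  have h3 : ∀ b d : Fin (k + 1), (1 / 2 * (hypFactor c ‖x‖ *
      (x b * (if a = d then (1 : ℝ) else 0) - x a * (if b = d then 1 else 0)) - hypFactor c ‖x‖ *
      (x d * (if b = a then 1 else 0) - x b * (if d = a then 1 else 0)) + hypFactor c ‖x‖ *
      (x a * (if d = b then 1 else 0) - x d * (if a = b then 1 else 0)))) =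
      hypFactor c ‖x‖ * (x b * (if d = a then 1 else 0) - x d * (if b = a then 1 else 0)) := by
    intro b d
    simp only [eq_comm (a := a), eq_comm (a := d) (b := b)]
    ring
  simp only [h3]
  have h4 : ∀ b : Fin (k + 1), ∑ d, (hypFactor c ‖x‖ * (x b * (if d = a then 1 else 0) -
      x d * (if b = a then 1 else 0))) • ρ.gen (Sum.inl b) (ρ.gen (Sum.inl d) s) =
      hypFactor c ‖x‖ • (x b • ρ.genL (Sum.inl b) (ρ.genL (Sum.inl a) s) -
        (if b = a then (1 : ℝ) else 0) • ρ.genL (Sum.inl b) (vecMul ρ x s)) := by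
    intro b
    have e : ∀ d, (hypFactor c ‖x‖ * (x b * (if d = a then 1 else 0) -
      x d * (if b = a then 1 else 0))) • ρ.gen (Sum.inl b) (ρ.gen (Sum.inl d) s) =
      hypFactor c ‖x‖ • ((if d = a then x b • ρ.genL (Sum.inl b) (ρ.genL (Sum.inl d) s) else 0) -
        (if b = a then (1 : ℝ) else 0) • ρ.genL (Sum.inl b) (x d • ρ.genL (Sum.inl d) s)) := by
      intro d
      rw [map_smul_of_tower]
      simp only [ρ.genL_apply]
      split_ifs <;> module
    rw [sum_congr rfl fun d _ => e d, ← smul_sum, sum_sub_distrib, ← smul_sum, ← map_sum]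
    simp [vecMul_apply]
  have h5 : ∑ b : Fin (k + 1), (x b • ρ.genL (Sum.inl b) (ρ.genL (Sum.inl a) s) -
      (if b = a then (1 : ℝ) else 0) • ρ.genL (Sum.inl b) (vecMul ρ x s)) =
      -(2 : ℝ) • (x a • s + ρ.genL (Sum.inl a) (vecMul ρ x s)) := by
    rw [sum_sub_distrib]
    have e1 : ∑ b : Fin (k + 1), x b • ρ.genL (Sum.inl b) (ρ.genL (Sum.inl a) s) =
      vecMul ρ x (ρ.genL (Sum.inl a) s) := by simp [vecMul_apply]
    have e2 : ∑ b : Fin (k + 1), (if b = a then (1 : ℝ) else 0) •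
        ρ.genL (Sum.inl b) (vecMul ρ x s) = ρ.genL (Sum.inl a) (vecMul ρ x s) := by simp
    rw [e1, e2, genL_vecMul]
    module
  simp only [sum_add_distrib, h4, ← smul_sum, h5]
  simp
  module

theorem frameSpinDeriv_inr (c : ℝ) (hx : x ≠ 0) (hy : y ∈ P.dom i)
    {σ : ℍ k × N → S}
    (hσ : MDifferentiableAt (𝓜 k n) 𝓘(ℝ, S) σ (x, y)) (b : Fin n) :
    frameSpinDeriv (𝓜 k n) (prodMetric g c) (P.prodFrame c i) ρ σ (Sum.inr b)
      (x, y) = (show S from mfderiv (𝓡 n) 𝓘(ℝ, S) (fun y' => σ (x, y')) y (P.frame i b y)) +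
        spinElement (fun b => ρ.genL (Sum.inr b)) (koszul (P.frameBracket i y) b) (σ (x, y)) := by
  have h1 : (show S from mfderiv (𝓜 k n) 𝓘(ℝ, S) σ (x, y)
      (P.prodFrame c i (Sum.inr b) (x, y))) =
      (show S from mfderiv (𝓡 n) 𝓘(ℝ, S) (fun y' => σ (x, y')) y (P.frame i b y)) := by
    have h := mfderiv_prod_eq_add_apply (v := P.prodFrame c i (Sum.inr b) (x, y)) hσ
    refine h.trans ?_
    have h2 : (mfderiv (𝓡 (k + 1)) 𝓘(ℝ, S) (fun z => σ (z, y)) x)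
      (0 : ℍ k) = (0 : S) := map_zero _
    exact (congrArg (fun s : S => s + _) h2).trans (zero_add _)
  rw [frameSpinDeriv, h1]
  congr 1
  simp only [connCoeff_prod P c hx hy, Fintype.sum_sum_type, koszul, prodBracket, spinElement]
  simp [ρ.genL_apply, mul_apply_eq_comp]

end ProductGeometry

section DiracFormulas

variable {n k : ℕ} {N : Type*} [TopologicalSpace N] [ChartedSpace (𝔼 n) N]
  [IsManifold (𝓡 n) ∞ N] {ι : Type*} {g : RiemMetric n N} (P : SpinStructure ι g)
  {x : ℍ k} {y : N}
  {S : Type*} [NormedAddCommGroup S] [InnerProductSpace ℂ S]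
  [FiniteDimensional ℂ S] (ρ : 𝓢 k n S) (c : ℝ)

/-- The Dirac operator of flat `ℝ^{k+1}`. -/
def flatDirac (f : ℍ k → S) (x : ℍ k) : S :=
  ∑ a, ρ.genL (Sum.inl a) (fderiv ℝ f x δ[a])

/-- The representation of the Clifford algebra of `N` on the spinor module of the product. -/
def actRight : Cl (Fin n) →ₐ[ℝ] (S →L[ℂ] S) := ρ.actL.comp (cliffordInclRight (Fin (k + 1)) (Fin n))

theorem actRight_gen (b : Fin n) : actRight ρ (cliffordGen b) = ρ.genL (Sum.inr b) := by
  rw [actRight, AlgHom.comp_apply, cliffordInclRight, cliffordGen, CliffordAlgebra.map_apply_ι,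
    SpinorModule.genL, cliffordGen]
  congr 2
  change Sum.elim (0 : Fin (k + 1) → ℝ) (Pi.single b (1 : ℝ)) = _
  ext (a | a) <;> simp [Pi.single_apply]

namespace SpinStructure

theorem prodLoc_eq (Φ : ℍ k × N → S) (i : ι)
    (p : ℍ k × N) :
    P.prodLoc ρ Φ i p = actRight ρ (P.lift i (P.indexAt p.2) p.2 : Cl (Fin n)) (Φ p) := rfl

theorem prodLoc_self (Φ : ℍ k × N → S)
    (x : ℍ k) (y : N) :
    P.prodLoc ρ Φ (P.indexAt y) (x, y) = Φ (x, y) := by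
  rw [prodLoc_eq, P.lift_self (P.mem_dom_at y)]
  simp

variable {P ρ} {Φ : ℍ k × N → S}

theorem prodDeriv_inl (hx : x ≠ 0) (hΦ : MDifferentiableAt (𝓜 k n) 𝓘(ℝ, S)
    (P.prodLoc ρ Φ (P.indexAt y)) (x, y)) (a : Fin (k + 1)) :
    P.prodDeriv ρ c Φ (Sum.inl a) (x, y) =
      fderiv ℝ (fun x' => Φ (x', y)) x (hypVec c a x) - (hypFactor c ‖x‖ / 2) •
        (x a • Φ (x, y) + ρ.genL (Sum.inl a) (vecMul ρ x (Φ (x, y)))) := by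
  have h := frameSpinDeriv_inl P ρ c hx (P.mem_dom_at y) hΦ a
  simp only [P.prodLoc_self] at h
  exact h

theorem radialDeriv_eq (hx : x ≠ 0) (hΦ : MDifferentiableAt (𝓜 k n) 𝓘(ℝ, S)
    (P.prodLoc ρ Φ (P.indexAt y)) (x, y)) :
    P.radialDeriv ρ c Φ (x, y) = fderiv ℝ (fun x' => Φ (x', y)) x (‖x‖⁻¹ • x) := by
  have hr : ‖x‖ ≠ 0 := norm_ne_zero_iff.mpr hx
  simp only [radialDeriv, prodDeriv_inl c hx hΦ, smul_sub, sum_sub_distrib]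
  rw [← sum_radialComp c x, map_sum]
  simp only [map_smul]
  rw [sub_eq_self]
  simp only [smul_comm _ (hypFactor c ‖x‖ / 2), ← smul_sum, smul_add, sum_add_distrib]
  have h1 : ∑ a, radialComp x a • x a • Φ (x, y) = ‖x‖ • Φ (x, y) := by
    simp only [smul_smul, ← sum_smul, radialComp]
    congr 1
    have : ∑ a, x a ^ 2 = ‖x‖ ^ 2 := by rw [EuclideanSpace.norm_sq_eq]; simp
    rw [← mul_right_inj' hr, ← sq, ← this, mul_sum]
    exact sum_congr rfl fun a _ => by field_simp
  have h2 : ∑ a, radialComp x a • ρ.genL (Sum.inl a) (vecMul ρ x (Φ (x, y))) =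
      -(‖x‖ • Φ (x, y)) := by
    have : ∑ a, radialComp x a • ρ.genL (Sum.inl a) (vecMul ρ x (Φ (x, y))) =
        ‖x‖⁻¹ • vecMul ρ x (vecMul ρ x (Φ (x, y))) := by
      conv_rhs => rw [vecMul_apply ρ x, _root_.sum_apply, smul_sum]
      refine sum_congr rfl fun a _ => ?_
      rw [_root_.smul_apply, smul_smul, radialComp, div_eq_inv_mul, vecMul_apply]
    rw [this, vecMul_vecMul, smul_neg, smul_smul]
    congr 2
    field_simp
  rw [h1, h2, smul_neg, add_neg_cancel]

theorem sum_genL_prodDeriv (hx : x ≠ 0) (hΦ : MDifferentiableAt (𝓜 k n) 𝓘(ℝ, S)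
    (P.prodLoc ρ Φ (P.indexAt y)) (x, y)) :
    ∑ a : Fin (k + 1), ρ.gen (Sum.inl a) (P.prodDeriv ρ c Φ (Sum.inl a) (x, y)) =
      (warp c ‖x‖)⁻¹ • flatDirac ρ (fun x' => Φ (x', y)) x +
      ((1 - (warp c ‖x‖)⁻¹) / ‖x‖ ^ 2) • vecMul ρ x (fderiv ℝ (fun x' => Φ (x', y)) x x) +
      (k * hypFactor c ‖x‖ / 2) • vecMul ρ x (Φ (x, y)) := by
  set L := fderiv ℝ (fun x' => Φ (x', y)) x with hL
  have h : ∀ a : Fin (k + 1), ρ.gen (Sum.inl a) (P.prodDeriv ρ c Φ (Sum.inl a) (x, y)) =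
      (warp c ‖x‖)⁻¹ • ρ.genL (Sum.inl a) (L δ[a]) +
      ((1 - (warp c ‖x‖)⁻¹) / ‖x‖ ^ 2) • x a • ρ.genL (Sum.inl a) (L x) -
      (hypFactor c ‖x‖ / 2) • (x a • ρ.genL (Sum.inl a) (Φ (x, y)) - vecMul ρ x (Φ (x, y))) := by
    intro a
    rw [← ρ.genL_apply, prodDeriv_inl c hx hΦ, ← hL, hypVec]
    have e : ρ.genL (Sum.inl a) (ρ.genL (Sum.inl a) (vecMul ρ x (Φ (x, y)))) =
        -(vecMul ρ x (Φ (x, y))) :=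
      (congr_fun (ρ.cliffordRel_genL.sq (Sum.inl a)) _).trans rfl
    simp only [map_sub, map_add, map_smul, map_smul_of_tower, e]
    module
  rw [sum_congr rfl fun a _ => h a, sum_sub_distrib, sum_add_distrib,
    ← smul_sum, ← smul_sum, ← smul_sum, sum_sub_distrib]
  have e1 : ∀ s, ∑ a, x a • ρ.genL (Sum.inl a) s = vecMul ρ x s := fun s => by simp [vecMul_apply]
  rw [e1, e1, flatDirac, ← hL]
  simp only [Finset.sum_const, Finset.card_univ, Fintype.card_fin, ← Nat.cast_smul_eq_nsmul ℝ]
  push_cast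
  module

theorem diracSphere_eq (hx : x ≠ 0) (hΦ : MDifferentiableAt (𝓜 k n) 𝓘(ℝ, S)
    (P.prodLoc ρ Φ (P.indexAt y)) (x, y)) :
    P.diracSphere ρ c Φ (x, y) = ‖x‖ • flatDirac ρ (fun x' => Φ (x', y)) x -
      ‖x‖⁻¹ • vecMul ρ x (fderiv ℝ (fun x' => Φ (x', y)) x x) -
      ((k : ℝ) / 2 * ‖x‖⁻¹) • vecMul ρ x (Φ (x, y)) := by
  have hr : 0 < ‖x‖ := norm_pos_iff.mpr hx
  have hs := sinhC_pos (c := c) hr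
  rw [diracSphere, partialDiracSphere, sum_genL_prodDeriv c hx hΦ, radialMul_eq, radialMul_eq,
    radialDeriv_eq c hx hΦ, cothC_eq, hypFactor]
  simp only [map_smul, map_smul_of_tower, warp, if_neg hr.ne']
  simp only [smul_sub, smul_add, smul_smul]
  have e1 : sinhC c ‖x‖ * (sinhC c ‖x‖ / ‖x‖)⁻¹ = ‖x‖ := by field_simp
  rw [e1]
  have e2 : sinhC c ‖x‖ * ((1 - (sinhC c ‖x‖ / ‖x‖)⁻¹) / ‖x‖ ^ 2) =
    sinhC c ‖x‖ * (‖x‖⁻¹ * ‖x‖⁻¹) - ‖x‖⁻¹ := by field_simp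
  have e3 : sinhC c ‖x‖ * (k * ((coshC c ‖x‖ - 1) / (sinhC c ‖x‖ * ‖x‖)) / 2) =
    sinhC c ‖x‖ * ((k : ℝ) / 2 * (coshC c ‖x‖ / sinhC c ‖x‖) * ‖x‖⁻¹) - (k : ℝ) / 2 * ‖x‖⁻¹ := by
    field_simp
  rw [e2, e3]
  module

theorem prodDirac_eq (hx : x ≠ 0) (Φ : ℍ k × N → S) :
    P.prodDirac ρ c Φ (x, y) = radialMul ρ (P.radialDeriv ρ c Φ) (x, y) +
      (sinhC c ‖x‖)⁻¹ • P.diracSphere ρ c Φ (x, y) +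
      ((k : ℝ) / 2 * cothC c ‖x‖) • radialMul ρ Φ (x, y) + P.diracN ρ c Φ (x, y) := by
  have hr : 0 < ‖x‖ := norm_pos_iff.mpr hx
  have hs := sinhC_pos (c := c) hr
  rw [diracSphere, smul_smul, inv_mul_cancel₀ hs.ne', one_smul, partialDiracSphere, prodDirac,
    Fintype.sum_sum_type, diracN]
  abel

theorem diracN_eq_frameDirac (hx : x ≠ 0)
    (hΦ : MDifferentiableAt (𝓜 k n) 𝓘(ℝ, S)
      (P.prodLoc ρ Φ (P.indexAt y)) (x, y)) :
    P.diracN ρ c Φ (x, y) = P.frameDirac (actRight ρ) (P.indexAt y)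
      (fun y' => P.prodLoc ρ Φ (P.indexAt y) (x, y')) y := by
  rw [diracN, frameDirac]
  refine sum_congr rfl fun b _ => ?_
  have h := frameSpinDeriv_inr P ρ c hx (P.mem_dom_at y) hΦ b
  rw [actRight_gen, ← ρ.genL_apply]
  congr 1
  refine h.trans ?_
  simp only [actRight_gen]

end SpinStructure
end DiracFormulas

section ChartRep

variable {n k : ℕ} {N : Type*} [TopologicalSpace N] [ChartedSpace (𝔼 n) N]
  [IsManifold (𝓡 n) ∞ N] {ι : Type*} {g : RiemMetric n N} (P : SpinStructure ι g)
  {S : Type*} [NormedAddCommGroup S] [InnerProductSpace ℂ S]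
  [FiniteDimensional ℂ S] (ρ : 𝓢 k n S) (c : ℝ)

/-- The operator `D^{𝕊^k}` in coordinates. -/
def sphOp (σ : ℍ k × 𝔼 n → S)
    (q : ℍ k × 𝔼 n) : S :=
  ‖q.1‖ • (∑ a, ρ.genL (Sum.inl a) (fderiv ℝ σ q (δ[a], 0))) -
    ‖q.1‖⁻¹ • vecMul ρ q.1 (fderiv ℝ σ q (q.1, 0)) -
    ((k : ℝ) / 2 * ‖q.1‖⁻¹) • vecMul ρ q.1 (σ q)

/-- The operator `D^N` in coordinates. -/
def nOp (F : Fin n → 𝔼 n → 𝔼 n)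
    (W : Fin n → 𝔼 n → S →L[ℂ] S)
    (σ : ℍ k × 𝔼 n → S)
    (q : ℍ k × 𝔼 n) : S :=
  ∑ b, ρ.genL (Sum.inr b) (fderiv ℝ σ q (0, F b q.2) + W b q.2 (σ q))

/-- Clifford multiplication by `∂_r` in coordinates. -/
def radOp (σ : ℍ k × 𝔼 n → S)
    (q : ℍ k × 𝔼 n) : S :=
  ‖q.1‖⁻¹ • vecMul ρ q.1 (σ q)

theorem commute_actRight_even {x : Cl (Fin n)} (hx : x ∈ CliffordAlgebra.even (cliffordForm (Fin n)))
    (a : Fin (k + 1)) (s : S) :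
    actRight ρ x (ρ.genL (Sum.inl a) s) = ρ.genL (Sum.inl a) (actRight ρ x s) := by
  have h := commute_act_of_even (actRight ρ) (u := ρ.genL (Sum.inl a)) (fun b => by
    rw [actRight_gen]
    exact ρ.cliffordRel_genL.anti _ _ (by simp)) hx
  exact (congr_fun h s).symm

theorem commute_actRight_vecMul {x : Cl (Fin n)}
    (hx : x ∈ CliffordAlgebra.even (cliffordForm (Fin n)))
    (v : ℍ k) (s : S) :
    actRight ρ x (vecMul ρ v s) = vecMul ρ v (actRight ρ x s) := by
  simp only [vecMul_apply, _root_.sum_apply, _root_.smul_apply, map_sum,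
    map_smul_of_tower, commute_actRight_even ρ hx]

namespace SpinStructure

/-- A spinor in the spin frame `i` and in the chart at `y₀`. -/
def chartRep (Φ : ℍ k × N → S) (i : ι) (y₀ : N)
    (q : ℍ k × 𝔼 n) : S :=
  P.prodLoc ρ Φ i (q.1, χ[n, y₀].symm q.2)

/-- The domain of `chartRep` away from `p₀`. -/
def chartDom (k : ℕ) (i : ι) (y₀ : N) :
    Set (ℍ k × 𝔼 n) :=
  {q | q.1 ≠ 0 ∧ q.2 ∈ P.coordDom y₀ i}

theorem isOpen_chartDom (i : ι) (y₀ : N) : IsOpen (P.chartDom k i y₀) :=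
  (isOpen_ne.preimage continuous_fst).inter ((P.isOpen_coordDom y₀ i).preimage continuous_snd)

/-- Spinors that are smooth on `r > 0`. -/
def IsSmoothSpinor (Φ : ℍ k × N → S) : Prop :=
  ∀ i, ContMDiffOn (𝓜 k n) 𝓘(ℝ, S) ∞ (P.prodLoc ρ Φ i)
    {p | p.1 ≠ 0 ∧ p.2 ∈ P.dom i}

/-- Spinors that are differentiable at a point. -/
def SpinorDiffAt (Φ : ℍ k × N → S)
    (p : ℍ k × N) : Prop :=
  ∀ i, p.2 ∈ P.dom i → MDifferentiableAt (𝓜 k n) 𝓘(ℝ, S) (P.prodLoc ρ Φ i) p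

/-- The frame matrix of `N` in coordinates acts by the spin connection. -/
def spinConn (i : ι) (y₀ : N) (b : Fin n) (u : 𝔼 n) : S →L[ℂ] S :=
  spinElement (fun b => ρ.genL (Sum.inr b))
    (koszul (P.frameBracket i (χ[n, y₀].symm u)) b)

variable {P ρ}
variable {Φ : ℍ k × N → S}

theorem IsSmoothSpinor.diffAt (h : P.IsSmoothSpinor ρ Φ)
    {p : ℍ k × N} (hp : p.1 ≠ 0) : P.SpinorDiffAt ρ Φ p := by
  intro i hi
  refine ((h i).contMDiffAt (IsOpen.mem_nhds ?_ ⟨hp, hi⟩)).mdifferentiableAt (by simp)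
  exact (isOpen_ne.preimage continuous_fst).inter ((P.isOpen_dom i).preimage continuous_snd)

theorem IsSmoothSpinor.contDiffOn_chartRep (h : P.IsSmoothSpinor ρ Φ) (i : ι) (y₀ : N) :
    ContDiffOn ℝ ∞ (P.chartRep ρ Φ i y₀) (P.chartDom k i y₀) := by
  have h1 : ContMDiffOn 𝓘(ℝ, ℍ k × 𝔼 n)
      (𝓜 k n) ∞
      (fun q : ℍ k × 𝔼 n =>
        (q.1, χ[n, y₀].symm q.2)) (P.chartDom k i y₀) :=
    (contDiff_fst.contMDiff.contMDiffOn).prodMk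
      ((contMDiffOn_extChartAt_symm (n := ∞) y₀).comp contDiff_snd.contMDiff.contMDiffOn
        (fun q hq => hq.2.1))
  exact ((h i).comp h1 fun q hq => ⟨hq.1, hq.2.2⟩).contDiffOn

theorem isSmoothSpinor_of_contDiffOn_chartRep
    (h : ∀ i y₀, ContDiffOn ℝ ∞ (P.chartRep ρ Φ i y₀) (P.chartDom k i y₀)) :
    P.IsSmoothSpinor ρ Φ := by
  rintro i ⟨x, y⟩ ⟨hx, hy⟩
  have hys := mem_extChartAt_source (I := 𝓡 n) y
  have h1 : ContMDiffAt (𝓜 k n)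
      𝓘(ℝ, ℍ k × 𝔼 n) ∞
      (fun p : ℍ k × N => (p.1, χ[n, y] p.2)) (x, y) := by
    rw [modelWithCornersSelf_prod, ← chartedSpaceSelf_prod]
    exact contMDiffAt_fst.prodMk ((contMDiffAt_extChartAt (n := ∞)).comp (x, y) contMDiffAt_snd)
  have h2 : ContMDiffAt 𝓘(ℝ, ℍ k × 𝔼 n)
      𝓘(ℝ, S) ∞ (P.chartRep ρ Φ i y) (x, χ[n, y] y) :=
    ((h i y).contDiffAt ((P.isOpen_chartDom i y).mem_nhds
      ⟨hx, P.mem_coordDom hys hy⟩)).contMDiffAt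
  refine ((h2.comp (x, y) h1).congr_of_eventuallyEq ?_).contMDiffWithinAt
  have h3 : ∀ᶠ p : ℍ k × N in nhds (x, y), p.2 ∈ χ[n, y].source :=
    continuous_snd.continuousAt.eventually ((isOpen_extChartAt_source y).mem_nhds hys)
  filter_upwards [h3] with p hp
  simp only [Function.comp_apply, chartRep, χ[n, y].left_inv hp]

variable {x : ℍ k} {y y₀ : N} {i : ι}

theorem SpinorDiffAt.differentiableAt_chartRep (h : P.SpinorDiffAt ρ Φ (x, y))
    (hy : y ∈ χ[n, y₀].source) (hi : y ∈ P.dom i) :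
    DifferentiableAt ℝ (P.chartRep ρ Φ i y₀) (x, χ[n, y₀] y) := by
  have hsm : MDifferentiableAt 𝓘(ℝ, 𝔼 n) (𝓡 n)
      χ[n, y₀].symm (χ[n, y₀] y) :=
    ((contMDiffOn_extChartAt_symm (n := 1) y₀).contMDiffAt
      ((isOpen_extChartAt_target y₀).mem_nhds
        (χ[n, y₀].map_source hy))).mdifferentiableAt one_ne_zero
  have h1 : MDifferentiableAt 𝓘(ℝ, ℍ k × 𝔼 n)
      (𝓜 k n)
      (fun q : ℍ k × 𝔼 n =>
        (q.1, χ[n, y₀].symm q.2)) (x, χ[n, y₀] y) :=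
    (differentiableAt_fst.mdifferentiableAt).prodMk
      (MDifferentiableAt.comp (x, χ[n, y₀] y) (I' := 𝓘(ℝ, 𝔼 n)) hsm
        differentiableAt_snd.mdifferentiableAt)
  exact (MDifferentiableAt.comp (x, χ[n, y₀] y) (I' := 𝓜 k n)
    (by rw [χ[n, y₀].left_inv hy]; exact h i hi) h1).differentiableAt

theorem prodLoc_gauge {j : ι} (hi : y ∈ P.dom i) (hj : y ∈ P.dom j) :
    P.prodLoc ρ Φ i (x, y) = actRight ρ (P.lift i j y : Cl (Fin n)) (P.prodLoc ρ Φ j (x, y)) := by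
  rw [prodLoc_eq, prodLoc_eq, ← mul_apply_eq_comp, ← map_mul]
  congr 2
  have := P.cocycle i j (P.indexAt y) y ⟨⟨hi, hj⟩, P.mem_dom_at y⟩
  exact congrArg Subtype.val this.symm

theorem chartRep_apply_chart (hy : y ∈ χ[n, y₀].source) :
    P.chartRep ρ Φ i y₀ (x, χ[n, y₀] y) =
      actRight ρ (P.lift i (P.indexAt y) y : Cl (Fin n)) (Φ (x, y)) := by
  rw [chartRep, χ[n, y₀].left_inv hy]
  rfl

theorem chartRep_radialMul (q : ℍ k × 𝔼 n) :
    P.chartRep ρ (radialMul ρ Φ) i y₀ q = radOp ρ (P.chartRep ρ Φ i y₀) q := by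
  simp only [chartRep, prodLoc_eq, radOp, radialMul_eq, map_smul_of_tower]
  rw [commute_actRight_vecMul ρ (spinGroup.mem_even (P.lift i _ _).2)]

theorem fderiv_chartRep_inl (h : P.SpinorDiffAt ρ Φ (x, y))
    (hy : y ∈ χ[n, y₀].source) (hi : y ∈ P.dom i)
    (v : ℍ k) :
    fderiv ℝ (P.chartRep ρ Φ i y₀) (x, χ[n, y₀] y) (v, 0) =
      actRight ρ (P.lift i (P.indexAt y) y : Cl (Fin n))
        (fderiv ℝ (fun x' => Φ (x', y)) x v) := by
  have hd : ∀ i, y ∈ P.dom i → ∀ y₀ : N, y ∈ χ[n, y₀].source →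
      HasFDerivAt (fun x' => P.chartRep ρ Φ i y₀ (x', χ[n, y₀] y))
      ((fderiv ℝ (P.chartRep ρ Φ i y₀) (x, χ[n, y₀] y)).comp
        (ContinuousLinearMap.inl ℝ _ _)) x := fun i hi y₀ hy =>
    HasFDerivAt.comp (g := P.chartRep ρ Φ i y₀) x
      (h.differentiableAt_chartRep hy hi).hasFDerivAt
      (hasFDerivAt_prodMk_left (𝕜 := ℝ) x (χ[n, y₀] y))
  have h0 : DifferentiableAt ℝ (fun x' => Φ (x', y)) x := by
    refine (hd _ (P.mem_dom_at y) y (mem_extChartAt_source y)).differentiableAt.congr_of_eventuallyEq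
      (Filter.Eventually.of_forall fun x' => ?_)
    simp only [chartRep_apply_chart (mem_extChartAt_source (I := 𝓡 n) y),
      P.lift_self (P.mem_dom_at y)]
    simp
  have h1 := (hd i hi y₀ hy).unique (f₁' :=
    ((actRight ρ (P.lift i (P.indexAt y) y : Cl (Fin n))).restrictScalars ℝ).comp
      (fderiv ℝ (fun x' => Φ (x', y)) x)) (by
    simp only [chartRep_apply_chart hy]
    exact (((actRight ρ (P.lift i (P.indexAt y) y : Cl (Fin n))).restrictScalars ℝ).hasFDerivAt).comp
      x h0.hasFDerivAt)
  exact congr_fun h1 v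

theorem chartRep_diracSphere (hx : x ≠ 0) (h : P.SpinorDiffAt ρ Φ (x, y))
    (hy : y ∈ χ[n, y₀].source) (hi : y ∈ P.dom i) :
    P.chartRep ρ (P.diracSphere ρ c Φ) i y₀ (x, χ[n, y₀] y) =
      sphOp ρ (P.chartRep ρ Φ i y₀) (x, χ[n, y₀] y) := by
  have hev := spinGroup.mem_even (P.lift i (P.indexAt y) y).2
  rw [chartRep_apply_chart hy, diracSphere_eq c hx (h _ (P.mem_dom_at y)), sphOp]
  simp only [fderiv_chartRep_inl h hy hi, chartRep_apply_chart hy,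
    ← commute_actRight_vecMul ρ hev, ← commute_actRight_even ρ hev, map_sub, map_sum,
    map_smul_of_tower, flatDirac]

theorem chartRep_radialDeriv (hx : x ≠ 0) (h : P.SpinorDiffAt ρ Φ (x, y))
    (hy : y ∈ χ[n, y₀].source) (hi : y ∈ P.dom i) :
    P.chartRep ρ (P.radialDeriv ρ c Φ) i y₀ (x, χ[n, y₀] y) =
      fderiv ℝ (P.chartRep ρ Φ i y₀) (x, χ[n, y₀] y) (‖x‖⁻¹ • x, 0) := by
  rw [chartRep_apply_chart hy, radialDeriv_eq c hx (h _ (P.mem_dom_at y)),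
    fderiv_chartRep_inl h hy hi]

theorem chartRep_diracN (hx : x ≠ 0) (h : P.SpinorDiffAt ρ Φ (x, y))
    (hy : y ∈ χ[n, y₀].source) (hi : y ∈ P.dom i) :
    P.chartRep ρ (P.diracN ρ c Φ) i y₀ (x, χ[n, y₀] y) =
      nOp ρ (P.coordFrame y₀ i) (P.spinConn ρ i y₀) (P.chartRep ρ Φ i y₀)
        (x, χ[n, y₀] y) := by
  have := ρ.nontrivial
  have hdN : ∀ i, y ∈ P.dom i → MDifferentiableAt (𝓡 n) 𝓘(ℝ, S)
      (fun y' => P.prodLoc ρ Φ i (x, y')) y := fun i hi =>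
    MDifferentiableAt.comp y (I' := 𝓜 k n) (h i hi)
      (mdifferentiableAt_const.prodMk mdifferentiableAt_id)
  have hg := P.frameDirac_gauge (actRight ρ) (fun a s t => by
    rw [actRight_gen]; exact ρ.inner_genL _ s t) hi (P.mem_dom_at y) (hdN _ (P.mem_dom_at y))
    (σi := fun y' => P.prodLoc ρ Φ i (x, y')) (by
      filter_upwards [(P.isOpen_dom i).mem_nhds hi,
        (P.isOpen_dom _).mem_nhds (P.mem_dom_at y)] with y' hi' hj'
      exact prodLoc_gauge hi' hj')
  rw [chartRep_apply_chart hy, diracN_eq_frameDirac c hx (h _ (P.mem_dom_at y)), ← hg, frameDirac,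
    nOp]
  refine sum_congr rfl fun b _ => ?_
  rw [actRight_gen]
  congr 1
  simp only [actRight_gen]
  congr 1
  · rw [P.coordFrame_chart hy]
    refine (mfderiv_eq_fderiv_chart hy (hdN i hi) _).trans ?_
    have h1 : HasFDerivAt ((fun y' => P.prodLoc ρ Φ i (x, y')) ∘ χ[n, y₀].symm)
      ((fderiv ℝ (P.chartRep ρ Φ i y₀) (x, χ[n, y₀] y)).comp
        (ContinuousLinearMap.inr ℝ _ _)) (χ[n, y₀] y) :=
      (h.differentiableAt_chartRep hy hi).hasFDerivAt.comp _ (hasFDerivAt_prodMk_right x _)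
    rw [h1.fderiv]
    rfl
  · simp only [spinConn, chartRep, χ[n, y₀].left_inv hy]

end SpinStructure
end ChartRep

section FlatOperators

variable {n k : ℕ} {S : Type*} [NormedAddCommGroup S] [InnerProductSpace ℂ S]
  [FiniteDimensional ℂ S] {ρ : 𝓢 k n S}
  {σ : ℍ k × 𝔼 n → S}
  {q : ℍ k × 𝔼 n}

/-- Clifford multiplication by the first component of a vector. -/
def vecMulFst (ρ : 𝓢 k n S) :
    ℍ k × 𝔼 n →L[ℝ] (S →L[ℝ] S) :=
  ((ContinuousLinearMap.restrictScalarsL ℂ S S ℝ ℝ).comp (vecMul ρ)).comp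
    (ContinuousLinearMap.fst ℝ _ _)

theorem vecMulFst_apply (w : ℍ k × 𝔼 n) (s : S) :
    vecMulFst ρ w s = vecMul ρ w.1 s := rfl

theorem hasFDerivAt_norm_inv {E : Type*} [NormedAddCommGroup E] [InnerProductSpace ℝ E] {x : E}
    (hx : x ≠ 0) : HasFDerivAt (fun x : E => ‖x‖⁻¹)
      (-(‖x‖⁻¹ ^ 3) • (innerSL ℝ x : E →L[ℝ] ℝ)) x := by
  have hr : ‖x‖ ≠ 0 := norm_ne_zero_iff.mpr hx
  refine (hasFDerivAt_comp_norm hx (hasDerivAt_inv hr)).congr_fderiv ?_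
  ext v
  simp
  field_simp

theorem hasFDerivAt_radOp (hq : q.1 ≠ 0) (hσ : DifferentiableAt ℝ σ q)
    (w : ℍ k × 𝔼 n) :
    fderiv ℝ (radOp ρ σ) q w = ‖q.1‖⁻¹ • vecMul ρ q.1 (fderiv ℝ σ q w) +
      ‖q.1‖⁻¹ • vecMul ρ w.1 (σ q) - (‖q.1‖⁻¹ ^ 3 * inner ℝ q.1 w.1) • vecMul ρ q.1 (σ q) := by
  have h1 : HasFDerivAt (fun q : ℍ k × 𝔼 n =>
      ‖q.1‖⁻¹) ((-(‖q.1‖⁻¹ ^ 3) • (innerSL ℝ q.1 : _ →L[ℝ] ℝ)).comp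
        (ContinuousLinearMap.fst ℝ _ _)) q := (hasFDerivAt_norm_inv hq).comp q hasFDerivAt_fst
  have h2 : HasFDerivAt (fun q : ℍ k × 𝔼 n =>
      (vecMul ρ q.1).restrictScalars ℝ)
      (vecMulFst ρ) q :=
    (vecMulFst ρ).hasFDerivAt
  have h : HasFDerivAt (radOp ρ σ) _ q := h1.smul (h2.clm_apply hσ.hasFDerivAt)
  rw [h.fderiv]
  simp [mul_comm, vecMulFst_apply]
  module

theorem sphOp_radOp (hq : q.1 ≠ 0) (hσ : DifferentiableAt ℝ σ q) :
    sphOp ρ (radOp ρ σ) q = -radOp ρ (sphOp ρ σ) q := by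
  have hr : ‖q.1‖ ≠ 0 := norm_ne_zero_iff.mpr hq
  have e0 : ∀ s, ∑ a, q.1 a • ρ.genL (Sum.inl a) s = vecMul ρ q.1 s := fun s => by
    simp [vecMul_apply]
  set D := fderiv ℝ σ q
  have e1 : ∑ a, vecMul ρ q.1 (ρ.genL (Sum.inl a) (D (δ[a], 0))) =
      vecMul ρ q.1 (∑ a, ρ.genL (Sum.inl a) (D (δ[a], 0))) := by
    rw [map_sum]
  have e2 : ∑ a, q.1 a • D (δ[a], 0) = D (q.1, 0) := by
    conv_rhs => rw [← sum_smul_single_euclidean q.1]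
    have : ((∑ j, q.1 j • δ[j], 0) :
        ℍ k × 𝔼 n) =
        ∑ j, q.1 j • (δ[j], 0) := by
      ext j <;> simp [Prod.fst_sum, Prod.snd_sum]
    rw [this, map_sum]
    simp only [map_smul]
  have e3 : ∑ a, ρ.genL (Sum.inl a)
      (fderiv ℝ (radOp ρ σ) q (δ[a], 0)) =
      -(‖q.1‖⁻¹ • vecMul ρ q.1 (∑ a, ρ.genL (Sum.inl a) (D (δ[a], 0)))) -
      (2 * ‖q.1‖⁻¹) • D (q.1, 0) - (k * ‖q.1‖⁻¹) • σ q := by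
    have : ∀ a, ρ.genL (Sum.inl a)
        (fderiv ℝ (radOp ρ σ) q (δ[a], 0)) =
        -(‖q.1‖⁻¹ • vecMul ρ q.1 (ρ.genL (Sum.inl a) (D (δ[a], 0)))) -
        (2 * ‖q.1‖⁻¹) • q.1 a • D (δ[a], 0) - ‖q.1‖⁻¹ • σ q -
        ‖q.1‖⁻¹ ^ 3 • q.1 a • ρ.genL (Sum.inl a) (vecMul ρ q.1 (σ q)) := by
      intro a
      have sq : ρ.genL (Sum.inl a) (ρ.genL (Sum.inl a) (σ q)) = -σ q :=
        (congr_fun (ρ.cliffordRel_genL.sq (Sum.inl a)) _).trans rfl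
      rw [hasFDerivAt_radOp hq hσ]
      simp only [map_add, map_sub, map_smul_of_tower, vecMul_single,
        genL_vecMul, sq, EuclideanSpace.inner_single_right]
      simp
      module
    rw [sum_congr rfl fun a _ => this a]
    simp only [sum_sub_distrib, sum_neg_distrib, ← smul_sum, e0, e1, e2,
      vecMul_vecMul, Finset.sum_const, Finset.card_univ, Fintype.card_fin,
      ← Nat.cast_smul_eq_nsmul ℝ]
    have : ‖q.1‖⁻¹ ^ 3 • -(‖q.1‖ ^ 2 • σ q) = -(‖q.1‖⁻¹ • σ q) := by
      rw [smul_neg, smul_smul]; congr 2; field_simp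
    rw [this]
    push_cast
    module
  have e4 : fderiv ℝ (radOp ρ σ) q (q.1, 0) = ‖q.1‖⁻¹ • vecMul ρ q.1 (D (q.1, 0)) := by
    rw [hasFDerivAt_radOp hq hσ, real_inner_self_eq_norm_sq]
    have : ‖q.1‖⁻¹ ^ 3 * ‖q.1‖ ^ 2 = ‖q.1‖⁻¹ := by field_simp
    rw [this]
    abel
  rw [sphOp, e3, e4, radOp, radOp, sphOp]
  simp only [map_sub, map_smul_of_tower, vecMul_vecMul, smul_sub, smul_neg, smul_smul]
  match_scalars <;> field_simp <;> ring

theorem nOp_radOp {F : Fin n → 𝔼 n → 𝔼 n}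
    {W : Fin n → 𝔼 n → S →L[ℂ] S}
    (hW : ∀ b u (a : Fin (k + 1)) s, W b u (ρ.genL (Sum.inl a) s) = ρ.genL (Sum.inl a) (W b u s))
    (hq : q.1 ≠ 0) (hσ : DifferentiableAt ℝ σ q) :
    nOp ρ F W (radOp ρ σ) q = -radOp ρ (nOp ρ F W σ) q := by
  have hW' : ∀ b u v s, W b u (vecMul ρ v s) = vecMul ρ v (W b u s) := fun b u v s => by
    simp only [vecMul_apply, _root_.sum_apply, _root_.smul_apply, map_sum, map_smul_of_tower, hW]
  have hg : ∀ b v s, ρ.genL (Sum.inr b) (vecMul ρ v s) = -vecMul ρ v (ρ.genL (Sum.inr b) s) := by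
    intro b v s
    simp only [vecMul_apply, _root_.sum_apply, _root_.smul_apply, map_sum, map_smul_of_tower]
    rw [← sum_neg_distrib]
    refine sum_congr rfl fun a _ => ?_
    rw [← smul_neg]
    congr 1
    exact congr_fun (ρ.cliffordRel_genL.anti (Sum.inr b) (Sum.inl a) (by simp)) s
  simp only [nOp, radOp]
  rw [map_sum, smul_sum, ← sum_neg_distrib]
  refine sum_congr rfl fun b _ => ?_
  rw [hasFDerivAt_radOp hq hσ]
  simp only [map_add, map_sub, map_smul_of_tower, hW', hg, inner_zero_right,
    map_zero, mul_zero, zero_smul, smul_zero, _root_.zero_apply]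
  module

theorem contDiffOn_sphOp {U : Set (ℍ k × 𝔼 n)}
    (hU : IsOpen U) (h0 : ∀ q ∈ U, q.1 ≠ 0) (hσ : ContDiffOn ℝ ∞ σ U) :
    ContDiffOn ℝ ∞ (sphOp ρ σ) U := by
  have hD : ContDiffOn ℝ ∞ (fderiv ℝ σ) U := hσ.fderiv_of_isOpen hU (by simp)
  have hn : ContDiffOn ℝ ∞ (fun q : ℍ k × 𝔼 n =>
      ‖q.1‖) U := contDiff_fst.contDiffOn.norm ℝ h0
  have hni : ContDiffOn ℝ ∞ (fun q : ℍ k × 𝔼 n =>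
      ‖q.1‖⁻¹) U := hn.inv fun q hq => norm_ne_zero_iff.mpr (h0 q hq)
  have hv : ContDiff ℝ ∞ (fun q : ℍ k × 𝔼 n =>
      (vecMul ρ q.1).restrictScalars ℝ) :=
    (vecMulFst (n := n) ρ).contDiff
  refine ((hn.smul (ContDiffOn.sum fun a _ => ?_)).sub (hni.smul (hv.contDiffOn.clm_apply
    (hD.clm_apply ?_)))).sub ((contDiffOn_const.mul hni).smul (hv.contDiffOn.clm_apply hσ))
  · exact ((ρ.genL (Sum.inl a)).restrictScalars ℝ).contDiff.comp_contDiffOn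
      (hD.clm_apply contDiffOn_const)
  · exact contDiff_fst.contDiffOn.prodMk contDiffOn_const

theorem contDiffOn_radOp {U : Set (ℍ k × 𝔼 n)}
    (h0 : ∀ q ∈ U, q.1 ≠ 0) (hσ : ContDiffOn ℝ ∞ σ U) :
    ContDiffOn ℝ ∞ (radOp ρ σ) U := by
  have hv : ContDiff ℝ ∞ (fun q : ℍ k × 𝔼 n =>
      (vecMul ρ q.1).restrictScalars ℝ) :=
    (vecMulFst (n := n) ρ).contDiff
  exact ((contDiff_fst.contDiffOn.norm ℝ h0).inv fun q hq => norm_ne_zero_iff.mpr (h0 q hq)).smul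
    (hv.contDiffOn.clm_apply hσ)

/-- `D^N` anticommutes with `D^{𝕊^k}`, on eigenspinors of `D^N`. -/
theorem nOp_sphOp {F : Fin n → 𝔼 n → 𝔼 n}
    {W : Fin n → 𝔼 n → S →L[ℂ] S}
    (hW : ∀ b u (a : Fin (k + 1)) s, W b u (ρ.genL (Sum.inl a) s) = ρ.genL (Sum.inl a) (W b u s))
    {U : Set (ℍ k × 𝔼 n)}
    (hU : IsOpen U) (h0 : ∀ q ∈ U, q.1 ≠ 0) (hσ : ContDiffOn ℝ ∞ σ U) (hq : q ∈ U) {lam : ℝ}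
    (hlam : ∀ q ∈ U, nOp ρ F W σ q = lam • σ q) :
    nOp ρ F W (sphOp ρ σ) q = -lam • sphOp ρ σ q := by
  have hW' : ∀ b u v s, W b u (vecMul ρ v s) = vecMul ρ v (W b u s) := fun b u v s => by
    simp only [vecMul_apply, _root_.sum_apply, _root_.smul_apply, map_sum, map_smul_of_tower, hW]
  have hgl : ∀ b a s, ρ.genL (Sum.inr b) (ρ.genL (Sum.inl a) s) =
      -ρ.genL (Sum.inl a) (ρ.genL (Sum.inr b) s) := fun b a s =>
    congr_fun (ρ.cliffordRel_genL.anti (Sum.inr b) (Sum.inl a) (by simp)) s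
  have hg : ∀ b v s, ρ.genL (Sum.inr b) (vecMul ρ v s) = -vecMul ρ v (ρ.genL (Sum.inr b) s) := by
    intro b v s
    simp only [vecMul_apply, _root_.sum_apply, _root_.smul_apply, map_sum,
      map_smul_of_tower, hgl, smul_neg, sum_neg_distrib]
  have hUq := hU.mem_nhds hq
  have hσq : DifferentiableAt ℝ σ q := (hσ.contDiffAt hUq).differentiableAt (by simp)
  have hDd : DifferentiableAt ℝ (fderiv ℝ σ) q :=
    ((hσ.fderiv_of_isOpen hU (m := ∞) (by simp)).contDiffAt hUq).differentiableAt (by simp)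
  have hsym : ∀ v w, fderiv ℝ (fderiv ℝ σ) q v w = fderiv ℝ (fderiv ℝ σ) q w v :=
    (hσ.contDiffAt hUq).isSymmSndFDerivAt (by
      rw [minSmoothness_of_isRCLikeNormedField]; exact two_le_smooth)
  set D := fderiv ℝ σ with hD
  set D2 := fderiv ℝ D q with hD2
  obtain ⟨x, u⟩ := q
  have hline : ∀ v : ℍ k × 𝔼 n, HasDerivAt (fun t : ℝ => (x, u) + t • v) v 0 := fun v => by
    simpa using ((hasDerivAt_id (0 : ℝ)).smul_const v).const_add (x, u)
  have hD' : ∀ v w, HasDerivAt (fun t : ℝ => D ((x, u) + t • v) w) (D2 v w) 0 := fun v w => by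
    have h1 : HasFDerivAt D D2 ((x, u) + (0 : ℝ) • v) := by simpa using hDd.hasFDerivAt
    exact (((ContinuousLinearMap.apply ℝ S w).hasFDerivAt.comp _ h1).comp_hasDerivAt 0 (hline v))
  have hσ' : ∀ v, HasDerivAt (fun t : ℝ => σ ((x, u) + t • v)) (D (x, u) v) 0 := fun v => by
    have h1 : HasFDerivAt σ (D (x, u)) ((x, u) + (0 : ℝ) • v) := by simpa using hσq.hasFDerivAt
    exact h1.comp_hasDerivAt 0 (hline v)
  have hcl : ∀ (T : S →L[ℂ] S) {f : ℝ → S} {f' : S}, HasDerivAt f f' 0 →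
      HasDerivAt (fun t => T (f t)) (T f') 0 := fun T f f' hf =>
    (T.restrictScalars ℝ).hasFDerivAt.comp_hasDerivAt 0 hf
  -- derivatives of `sphOp σ` along `N`
  have hS : ∀ w, fderiv ℝ (sphOp ρ σ) (x, u) (0, w) =
      ‖x‖ • (∑ a, ρ.genL (Sum.inl a) (D2 (δ[a], 0) (0, w))) -
      ‖x‖⁻¹ • vecMul ρ x (D2 (x, 0) (0, w)) -
      ((k : ℝ) / 2 * ‖x‖⁻¹) • vecMul ρ x (D (x, u) (0, w)) := by
    intro w
    have h1 : HasFDerivAt (sphOp ρ σ) (fderiv ℝ (sphOp ρ σ) (x, u))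
        ((x, u) + (0 : ℝ) • ((0, w) : ℍ k × 𝔼 n)) := by
      simpa using (((contDiffOn_sphOp hU h0 hσ).contDiffAt hUq).differentiableAt
        (by simp)).hasFDerivAt
    have h2 := h1.comp_hasDerivAt 0 (hline (0, w))
    have h3 : HasDerivAt (fun t : ℝ => sphOp ρ σ ((x, u) + t • (0, w)))
        (‖x‖ • (∑ a, ρ.genL (Sum.inl a) (D2 (0, w) (δ[a], 0))) -
        ‖x‖⁻¹ • vecMul ρ x (D2 (0, w) (x, 0)) -
        ((k : ℝ) / 2 * ‖x‖⁻¹) • vecMul ρ x (D (x, u) (0, w))) 0 := by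
      have := (((HasDerivAt.fun_sum (u := Finset.univ) fun a _ => hcl (ρ.genL (Sum.inl a))
        (hD' (0, w) (δ[a], 0))).const_smul ‖x‖).sub
        ((hcl (vecMul ρ x) (hD' (0, w) (x, 0))).const_smul ‖x‖⁻¹)).sub
        ((hcl (vecMul ρ x) (hσ' (0, w))).const_smul ((k : ℝ) / 2 * ‖x‖⁻¹))
      refine this.congr_of_eventuallyEq (Filter.Eventually.of_forall fun t => ?_)
      simp [sphOp, hD]
    rw [h2.unique h3]
    simp only [hsym (0, w)]
  have hN : ∀ v, ∑ b, ρ.genL (Sum.inr b) (D2 (v, 0) (0, F b u) + W b u (D (x, u) (v, 0))) =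
      lam • D (x, u) (v, 0) := by
    intro v
    have h3 : HasDerivAt (fun t : ℝ => nOp ρ F W σ ((x, u) + t • (v, 0)))
        (∑ b, ρ.genL (Sum.inr b) (D2 (v, 0) (0, F b u) + W b u (D (x, u) (v, 0)))) 0 := by
      have := HasDerivAt.fun_sum (u := Finset.univ) fun b _ => hcl (ρ.genL (Sum.inr b))
        ((hD' (v, 0) (0, F b u)).add (hcl (W b u) (hσ' (v, 0))))
      refine this.congr_of_eventuallyEq (Filter.Eventually.of_forall fun t => ?_)
      simp [nOp, hD]
    refine h3.unique (((hσ' (v, 0)).const_smul lam).congr_of_eventuallyEq ?_)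
    have : Filter.Tendsto (fun t : ℝ => (x, u) + t • ((v, 0) :
        ℍ k × 𝔼 n)) (nhds 0) (nhds (x, u)) := by
      simpa using (hline (v, 0)).continuousAt.tendsto
    filter_upwards [this.eventually hUq] with t ht
    exact hlam _ ht
  have hN0 : ∑ b, ρ.genL (Sum.inr b) (D (x, u) (0, F b u) + W b u (σ (x, u))) = lam • σ (x, u) :=
    hlam _ hq
  have hr : ∀ b, ρ.genL (Sum.inr b) (fderiv ℝ (sphOp ρ σ) (x, u) (0, F b u) +
      W b u (sphOp ρ σ (x, u))) =
      -(‖x‖ • (∑ a, ρ.genL (Sum.inl a) (ρ.genL (Sum.inr b)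
        (D2 (δ[a], 0) (0, F b u) + W b u (D (x, u) (δ[a], 0))))) -
      ‖x‖⁻¹ • vecMul ρ x (ρ.genL (Sum.inr b) (D2 (x, 0) (0, F b u) + W b u (D (x, u) (x, 0)))) -
      ((k : ℝ) / 2 * ‖x‖⁻¹) • vecMul ρ x (ρ.genL (Sum.inr b)
        (D (x, u) (0, F b u) + W b u (σ (x, u))))) := by
    intro b
    rw [hS, sphOp, ← hD]
    simp only [map_add, map_sub, map_sum, map_smul_of_tower, hW, hW', hg, hgl,
      sum_add_distrib, sum_neg_distrib]
    module
  rw [nOp]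
  simp only [hr]
  rw [sum_neg_distrib, sum_sub_distrib, sum_sub_distrib, ← smul_sum,
    ← smul_sum, ← smul_sum, sum_comm]
  simp only [← map_sum, hN, hN0, sphOp, ← hD]
  simp only [map_smul_of_tower, ← smul_sum]
  module

end FlatOperators

section Homogeneous

variable {n k : ℕ} {N S : Type*} [NormedAddCommGroup S] [InnerProductSpace ℂ S]
  [FiniteDimensional ℂ S] {Φ : ℍ k × N → S}

/-- Spinors that are constant along the rays from `p₀`. -/
def SpinStructure.IsHomogeneous (Φ : ℍ k × N → S) : Prop :=
  ∀ (t : ℝ), 0 < t → ∀ x, x ≠ 0 → ∀ y, Φ (t • x, y) = Φ (x, y)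

theorem SpinStructure.IsHomogeneous.radialMul (ρ : 𝓢 k n S)
    (hh : SpinStructure.IsHomogeneous Φ) : SpinStructure.IsHomogeneous (radialMul ρ Φ) := by
  intro t ht x hx y
  rw [radialMul_eq, radialMul_eq, hh t ht x hx y]
  simp only [map_smul, _root_.smul_apply, norm_smul, norm_eq_abs, abs_of_pos ht, smul_smul]
  congr 1
  field_simp

end Homogeneous

section ModeAlgebra

variable {n k : ℕ} {N : Type*} [TopologicalSpace N] [ChartedSpace (𝔼 n) N]
  [IsManifold (𝓡 n) ∞ N] {ι : Type*} {g : RiemMetric n N} {P : SpinStructure ι g}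
  {S : Type*} [NormedAddCommGroup S] [InnerProductSpace ℂ S]
  [FiniteDimensional ℂ S] {ρ : 𝓢 k n S} {c : ℝ}
  {Φ : ℍ k × N → S}
  {x : ℍ k} {y y₀ : N} {i : ι}

namespace SpinStructure

theorem spinConn_genL (b : Fin n) (u : 𝔼 n) (a : Fin (k + 1)) (s : S) :
    P.spinConn ρ i y₀ b u (ρ.genL (Sum.inl a) s) = ρ.genL (Sum.inl a) (P.spinConn ρ i y₀ b u s) := by
  have h : P.spinConn ρ i y₀ b u = actRight ρ (spinElement (fun b => cliffordGen b)
      (koszul (P.frameBracket i (χ[n, y₀].symm u)) b)) := by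
    rw [map_spinElement, spinConn]
    simp only [actRight_gen]
  rw [h]
  exact commute_actRight_even ρ (spinElement_mem_even _) a s

theorem chartRep_self (Φ : ℍ k × N → S)
    (x : ℍ k) (y : N) :
    P.chartRep ρ Φ (P.indexAt y) y (x, χ[n, y] y) = Φ (x, y) := by
  rw [chartRep_apply_chart (mem_extChartAt_source y), P.lift_self (P.mem_dom_at y)]
  simp

theorem mem_chartDom_self (hx : x ≠ 0) (y : N) :
    (x, χ[n, y] y) ∈ P.chartDom k (P.indexAt y) y :=
  ⟨hx, P.mem_coordDom (mem_extChartAt_source y) (P.mem_dom_at y)⟩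

theorem exists_of_mem_chartDom {q : ℍ k × 𝔼 n}
    (hq : q ∈ P.chartDom k i y₀) : ∃ y ∈ χ[n, y₀].source, y ∈ P.dom i ∧ q = (q.1, χ[n, y₀] y) :=
  ⟨χ[n, y₀].symm q.2, χ[n, y₀].map_target hq.2.1, hq.2.2, by
    rw [χ[n, y₀].right_inv hq.2.1]⟩

theorem IsSmoothSpinor.radialMul (h : P.IsSmoothSpinor ρ Φ) :
    P.IsSmoothSpinor ρ (radialMul ρ Φ) := by
  refine isSmoothSpinor_of_contDiffOn_chartRep fun i y₀ => ?_
  rw [funext (chartRep_radialMul (P := P) (ρ := ρ) (Φ := Φ) (y₀ := y₀) (i := i))]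
  exact contDiffOn_radOp (fun _ hq => hq.1) (h.contDiffOn_chartRep i y₀)

theorem IsSmoothSpinor.eqOn_chartRep_diracSphere (h : P.IsSmoothSpinor ρ Φ) :
    Set.EqOn (P.chartRep ρ (P.diracSphere ρ c Φ) i y₀) (sphOp ρ (P.chartRep ρ Φ i y₀))
      (P.chartDom k i y₀) := by
  intro q hq
  obtain ⟨y, hy, hi, e⟩ := exists_of_mem_chartDom hq
  rw [e]
  exact chartRep_diracSphere c hq.1 (h.diffAt hq.1) hy hi

theorem IsSmoothSpinor.diracSphere (h : P.IsSmoothSpinor ρ Φ) :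
    P.IsSmoothSpinor ρ (P.diracSphere ρ c Φ) :=
  isSmoothSpinor_of_contDiffOn_chartRep fun i y₀ =>
    (contDiffOn_sphOp (P.isOpen_chartDom i y₀) (fun q hq => hq.1)
      (h.contDiffOn_chartRep i y₀)).congr h.eqOn_chartRep_diracSphere

theorem IsSmoothSpinor.const_smul (h : P.IsSmoothSpinor ρ Φ) (t : ℝ) :
    P.IsSmoothSpinor ρ (fun p => t • Φ p) := by
  intro i
  refine ((contMDiffOn_const (I' := 𝓘(ℝ, ℝ)) (c := t)).smul (h i)).congr fun p hp => ?_
  simp only [prodLoc_eq, map_smul_of_tower]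
  rfl

theorem diracSphere_radialMul (hx : x ≠ 0) (h : P.IsSmoothSpinor ρ Φ) :
    P.diracSphere ρ c (radialMul ρ Φ) (x, y) = -radialMul ρ (P.diracSphere ρ c Φ) (x, y) := by
  have hy := mem_extChartAt_source (I := 𝓡 n) y
  have hi := P.mem_dom_at y
  have hd := (h.diffAt (p := (x, y)) hx)
  rw [← P.chartRep_self (ρ := ρ) (P.diracSphere ρ c (_root_.radialMul ρ Φ)) x y,
    ← P.chartRep_self (ρ := ρ) (_root_.radialMul ρ (P.diracSphere ρ c Φ)) x y,
    chartRep_diracSphere c hx (h.radialMul.diffAt hx) hy hi, chartRep_radialMul,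
    funext (chartRep_radialMul (P := P) (ρ := ρ) (Φ := Φ)),
    sphOp_radOp hx (hd.differentiableAt_chartRep hy hi), radOp, radOp,
    chartRep_diracSphere c hx hd hy hi]

theorem diracN_radialMul (hx : x ≠ 0) (h : P.IsSmoothSpinor ρ Φ) :
    P.diracN ρ c (radialMul ρ Φ) (x, y) = -radialMul ρ (P.diracN ρ c Φ) (x, y) := by
  have hy := mem_extChartAt_source (I := 𝓡 n) y
  have hi := P.mem_dom_at y
  have hd := (h.diffAt (p := (x, y)) hx)
  rw [← P.chartRep_self (ρ := ρ) (P.diracN ρ c (_root_.radialMul ρ Φ)) x y,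
    ← P.chartRep_self (ρ := ρ) (_root_.radialMul ρ (P.diracN ρ c Φ)) x y,
    chartRep_diracN c hx (h.radialMul.diffAt hx) hy hi, chartRep_radialMul,
    funext (chartRep_radialMul (P := P) (ρ := ρ) (Φ := Φ)),
    nOp_radOp (spinConn_genL) hx (hd.differentiableAt_chartRep hy hi), radOp, radOp,
    chartRep_diracN c hx hd hy hi]

theorem diracN_diracSphere {lam : ℝ} (hx : x ≠ 0) (h : P.IsSmoothSpinor ρ Φ)
    (hlam : ∀ p, p.1 ≠ 0 → P.diracN ρ c Φ p = lam • Φ p) :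
    P.diracN ρ c (P.diracSphere ρ c Φ) (x, y) = -lam • P.diracSphere ρ c Φ (x, y) := by
  have hy := mem_extChartAt_source (I := 𝓡 n) y
  have hi := P.mem_dom_at y
  have hd := (h.diffAt (p := (x, y)) hx)
  have hnhds := (P.isOpen_chartDom (P.indexAt y) y).mem_nhds (mem_chartDom_self (P := P) hx y)
  have hloc : P.chartRep ρ (P.diracSphere ρ c Φ) (P.indexAt y) y =ᶠ[nhds (x, χ[n, y] y)]
      sphOp ρ (P.chartRep ρ Φ (P.indexAt y) y) :=
    Filter.eventuallyEq_of_mem hnhds h.eqOn_chartRep_diracSphere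
  have key := nOp_sphOp (ρ := ρ) (F := P.coordFrame y (P.indexAt y))
    (W := P.spinConn ρ (P.indexAt y) y) spinConn_genL (P.isOpen_chartDom (P.indexAt y) y)
    (fun q hq => hq.1) (h.contDiffOn_chartRep _ _) (mem_chartDom_self (P := P) hx y) (lam := lam)
    (by
      intro q hq
      obtain ⟨y', hy', hi', e⟩ := exists_of_mem_chartDom hq
      rw [e, ← chartRep_diracN c hq.1 (h.diffAt hq.1) hy' hi', chartRep_apply_chart hy',
        chartRep_apply_chart hy', hlam _ hq.1, map_smul_of_tower])
  rw [← P.chartRep_self (ρ := ρ) (P.diracN ρ c (P.diracSphere ρ c Φ)) x y,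
    ← P.chartRep_self (ρ := ρ) (P.diracSphere ρ c Φ) x y,
    chartRep_diracN c hx (h.diracSphere.diffAt hx) hy hi, chartRep_diracSphere c hx hd hy hi, ← key,
    nOp, nOp, hloc.fderiv_eq, hloc.self_of_nhds]

/-! ### Spinors that are constant along rays -/

theorem SpinorDiffAt.differentiableAt (h : P.SpinorDiffAt ρ Φ (x, y)) :
    DifferentiableAt ℝ (fun x' => Φ (x', y)) x := by
  have h1 : HasFDerivAt (fun x' => P.chartRep ρ Φ (P.indexAt y) y (x', χ[n, y] y)) _ x :=
    HasFDerivAt.comp (g := P.chartRep ρ Φ (P.indexAt y) y) x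
      (h.differentiableAt_chartRep (mem_extChartAt_source y) (P.mem_dom_at y)).hasFDerivAt
      (hasFDerivAt_prodMk_left (𝕜 := ℝ) x (χ[n, y] y))
  refine h1.differentiableAt.congr_of_eventuallyEq (Filter.Eventually.of_forall fun x' => ?_)
  simp only [chartRep_self]

theorem isHomogeneous_of_radialDeriv (h : P.IsSmoothSpinor ρ Φ)
    (h0 : ∀ p, p.1 ≠ 0 → P.radialDeriv ρ c Φ p = 0) : IsHomogeneous Φ := by
  intro t ht x hx y
  have hz : ∀ x, x ≠ 0 → fderiv ℝ (fun x' => Φ (x', y)) x x = 0 := by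
    intro x hx
    have h1 := h0 (x, y) hx
    rw [radialDeriv_eq c hx (h.diffAt hx _ (P.mem_dom_at y)), map_smul] at h1
    exact (smul_eq_zero.mp h1).resolve_left (inv_ne_zero (norm_ne_zero_iff.mpr hx))
  have hd : ∀ s : ℝ, HasDerivAt (fun s : ℝ => Φ (Real.exp s • x, y)) 0 s := by
    intro s
    have hx' : Real.exp s • x ≠ 0 := smul_ne_zero (Real.exp_pos s).ne' hx
    have h1 := ((h.diffAt (p := (Real.exp s • x, y)) hx').differentiableAt).hasFDerivAt.comp_hasDerivAt
      s ((Real.hasDerivAt_exp s).smul_const x)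
    rwa [hz _ hx'] at h1
  have h2 := is_const_of_deriv_eq_zero (fun s => (hd s).differentiableAt) (fun s => (hd s).deriv)
    (Real.log t) 0
  simpa [Real.exp_log ht] using h2

theorem IsHomogeneous.radialDeriv (hh : IsHomogeneous Φ) (h : P.SpinorDiffAt ρ Φ (x, y))
    (hx : x ≠ 0) : P.radialDeriv ρ c Φ (x, y) = 0 := by
  rw [radialDeriv_eq c hx (h _ (P.mem_dom_at y)), map_smul]
  have hd := h.differentiableAt
  have h1 : HasDerivAt (fun t : ℝ => Φ (t • x, y)) (fderiv ℝ (fun x' => Φ (x', y)) x x) 1 := by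
    have h2 : HasFDerivAt (fun x' => Φ (x', y)) (fderiv ℝ (fun x' => Φ (x', y)) x) ((1 : ℝ) • x) := by
      rw [one_smul]; exact hd.hasFDerivAt
    simpa [Function.comp_def] using
      h2.comp_hasDerivAt (1 : ℝ) ((hasDerivAt_id (1 : ℝ)).smul_const x)
  have h3 : HasDerivAt (fun t : ℝ => Φ (t • x, y)) 0 1 := by
    refine (hasDerivAt_const (1 : ℝ) (Φ (x, y))).congr_of_eventuallyEq ?_
    filter_upwards [eventually_gt_nhds (zero_lt_one' ℝ)] with t ht
    exact hh t ht x hx y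
  rw [h1.unique h3, smul_zero]

theorem IsHomogeneous.diracSphere (hh : IsHomogeneous Φ) (h : P.IsSmoothSpinor ρ Φ) :
    IsHomogeneous (P.diracSphere ρ c Φ) := by
  intro t ht x hx y
  have hx' : t • x ≠ 0 := smul_ne_zero ht.ne' hx
  have hD : ∀ v, fderiv ℝ (fun x' => Φ (x', y)) x v =
      t • fderiv ℝ (fun x' => Φ (x', y)) (t • x) v := by
    intro v
    have h1 : HasFDerivAt (fun x' => Φ (t • x', y)) _ x :=
      (h.diffAt (p := (t • x, y)) hx').differentiableAt.hasFDerivAt.comp x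
        ((hasFDerivAt_id x).const_smul t)
    have h2 : (fun x' => Φ (x', y)) =ᶠ[nhds x] fun x' => Φ (t • x', y) := by
      filter_upwards [isOpen_ne.mem_nhds hx] with x' hx'
      exact (hh t ht x' hx' y).symm
    rw [h2.fderiv_eq, h1.fderiv]
    simp
  rw [diracSphere_eq c hx' (h.diffAt hx' _ (P.mem_dom_at y)),
    diracSphere_eq c hx (h.diffAt hx _ (P.mem_dom_at y)), hh t ht x hx y]
  simp only [flatDirac, hD, map_smul_of_tower, norm_smul, norm_eq_abs,
    abs_of_pos ht, map_smul, _root_.smul_apply, ← smul_sum, smul_smul]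
  congr 1
  · congr 1
    · congr 1
      ring
    · congr 1
      field_simp
  · congr 1
    field_simp

/-! ### Radial combinations -/

variable {J : Type*} [Fintype J]

theorem hasFDerivAt_chartRep_sum {v : J → ℍ k × N → S}
    {b : J → ℝ → ℂ} {b' : J → ℂ} (hv : ∀ j, P.IsSmoothSpinor ρ (v j)) (hx : x ≠ 0)
    (hb : ∀ j, HasDerivAt (b j) (b' j) ‖x‖) (hy : y ∈ χ[n, y₀].source)
    (hi : y ∈ P.dom i) (w : ℍ k × 𝔼 n) :
    fderiv ℝ (P.chartRep ρ (fun p => ∑ j, b j ‖p.1‖ • v j p) i y₀) (x, χ[n, y₀] y) w =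
      ∑ j, (b j ‖x‖ • fderiv ℝ (P.chartRep ρ (v j) i y₀) (x, χ[n, y₀] y) w +
        (‖x‖⁻¹ * inner ℝ x w.1) • b' j • P.chartRep ρ (v j) i y₀ (x, χ[n, y₀] y)) := by
  have h1 : P.chartRep ρ (fun p => ∑ j, b j ‖p.1‖ • v j p) i y₀ =
      fun q => ∑ j, b j ‖q.1‖ • P.chartRep ρ (v j) i y₀ q := by
    ext q
    simp only [chartRep, prodLoc_eq, map_sum, map_smul]
  have h2 : ∀ j, HasFDerivAt (fun q : ℍ k × 𝔼 n =>
      b j ‖q.1‖) _ (x, χ[n, y₀] y) := fun j =>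
    HasFDerivAt.comp (g := fun x : ℍ k => b j ‖x‖) _
      (hasFDerivAt_comp_norm hx (hb j)) hasFDerivAt_fst
  have h3 : HasFDerivAt (fun q : ℍ k × 𝔼 n =>
      ∑ j, b j ‖q.1‖ • P.chartRep ρ (v j) i y₀ q) _ (x, χ[n, y₀] y) :=
    HasFDerivAt.fun_sum (u := Finset.univ) fun j _ => (h2 j).smul
      (((hv j).diffAt (p := (x, y)) hx).differentiableAt_chartRep hy hi).hasFDerivAt
  rw [h1, h3.fderiv, _root_.sum_apply]
  refine sum_congr rfl fun j _ => ?_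
  rw [_root_.add_apply]
  congr 1
  exact smul_assoc (‖x‖⁻¹ * inner ℝ x w.1) (b' j)
    (P.chartRep ρ (v j) i y₀ (x, χ[n, y₀] y))

theorem spinorDiffAt_sum {v : J → ℍ k × N → S}
    {b : J → ℝ → ℂ} {b' : J → ℂ} (hv : ∀ j, P.IsSmoothSpinor ρ (v j)) (hx : x ≠ 0)
    (hb : ∀ j, HasDerivAt (b j) (b' j) ‖x‖) :
    P.SpinorDiffAt ρ (fun p => ∑ j, b j ‖p.1‖ • v j p) (x, y) := by
  intro i hi
  have h1 : P.prodLoc ρ (fun p => ∑ j, b j ‖p.1‖ • v j p) i =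
      fun p => ∑ j, b j ‖p.1‖ • P.prodLoc ρ (v j) i p := by
    ext q
    simp only [prodLoc_eq, map_sum, map_smul]
  rw [h1]
  have h2 : ∀ j, MDifferentiableAt (𝓜 k n) 𝓘(ℝ, S)
      (fun p : ℍ k × N => b j ‖p.1‖ • P.prodLoc ρ (v j) i p) (x, y) := by
    intro j
    have h3 : MDifferentiableAt (𝓜 k n) 𝓘(ℝ, ℂ)
        (fun p : ℍ k × N => b j ‖p.1‖) (x, y) :=
      MDifferentiableAt.comp (I' := 𝓡 (k + 1))
        (g := fun x : ℍ k => b j ‖x‖) (x, y)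
        (hasFDerivAt_comp_norm hx (hb j)).differentiableAt.mdifferentiableAt mdifferentiableAt_fst
    have h4 : Differentiable ℝ (fun z : ℂ × S => z.1 • z.2) :=
      differentiable_fst.smul differentiable_snd
    exact MDifferentiableAt.comp (I' := 𝓘(ℝ, ℂ × S)) (x, y) h4.differentiableAt.mdifferentiableAt
      (h3.prodMk_space ((hv j).diffAt (p := (x, y)) hx i hi))
  classical
  have h4 : ∀ T : Finset J, MDifferentiableAt (𝓜 k n) 𝓘(ℝ, S)
      (fun p : ℍ k × N => ∑ j ∈ T, b j ‖p.1‖ • P.prodLoc ρ (v j) i p)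
      (x, y) := by
    intro T
    induction T using Finset.induction with
    | empty => simpa using mdifferentiableAt_const
    | insert a T ha ih =>
      simp only [Finset.sum_insert ha]
      exact (h2 a).add ih
  exact h4 Finset.univ

theorem diracSphere_sum {v : J → ℍ k × N → S}
    {b : J → ℝ → ℂ} {b' : J → ℂ} (hv : ∀ j, P.IsSmoothSpinor ρ (v j)) (hx : x ≠ 0)
    (hb : ∀ j, HasDerivAt (b j) (b' j) ‖x‖) :
    P.diracSphere ρ c (fun p => ∑ j, b j ‖p.1‖ • v j p) (x, y) =
      ∑ j, b j ‖x‖ • P.diracSphere ρ c (v j) (x, y) := by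
  have hy := mem_extChartAt_source (I := 𝓡 n) y
  have hi := P.mem_dom_at y
  have hr : ‖x‖ ≠ 0 := norm_ne_zero_iff.mpr hx
  have e : ∀ j, P.diracSphere ρ c (v j) (x, y) =
      sphOp ρ (P.chartRep ρ (v j) (P.indexAt y) y) (x, χ[n, y] y) := fun j => by
    rw [← chartRep_diracSphere c hx ((hv j).diffAt hx) hy hi, chartRep_self]
  simp only [e]
  refine (P.chartRep_self (ρ := ρ) _ x y).symm.trans ?_
  rw [chartRep_diracSphere c hx (spinorDiffAt_sum hv hx hb) hy hi]
  simp only [sphOp, hasFDerivAt_chartRep_sum hv hx hb hy hi, chartRep_self]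
  simp only [map_sum, map_add, map_smul, map_smul_of_tower, smul_sum,
    real_inner_self_eq_norm_sq, EuclideanSpace.inner_single_right]
  rw [sum_comm, ← sum_sub_distrib, ← sum_sub_distrib]
  refine sum_congr rfl fun j _ => ?_
  simp only [smul_add, sum_add_distrib, smul_sub]
  have e2 : ∑ a, ‖x‖ • (‖x‖⁻¹ * (1 * (starRingEnd ℝ) (x a))) • b' j • ρ.genL (Sum.inl a) (v j (x, y)) =
      b' j • vecMul ρ x (v j (x, y)) := by
    simp only [vecMul_apply, _root_.sum_apply, _root_.smul_apply, smul_sum]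
    refine sum_congr rfl fun a _ => ?_
    rw [smul_smul, smul_comm (b' j)]
    congr 1
    simp
    field_simp
  have e3 : ‖x‖⁻¹ • (‖x‖⁻¹ * ‖x‖ ^ 2) • b' j • vecMul ρ x (v j (x, y)) =
      b' j • vecMul ρ x (v j (x, y)) := by
    rw [smul_smul]
    have : ‖x‖⁻¹ * (‖x‖⁻¹ * ‖x‖ ^ 2) = 1 := by field_simp
    rw [this, one_smul]
  rw [e2, e3, smul_sum]
  simp only [smul_comm (b j ‖x‖)]
  abel

theorem diracN_sum {v : J → ℍ k × N → S}
    {b : J → ℝ → ℂ} {b' : J → ℂ} (hv : ∀ j, P.IsSmoothSpinor ρ (v j)) (hx : x ≠ 0)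
    (hb : ∀ j, HasDerivAt (b j) (b' j) ‖x‖) :
    P.diracN ρ c (fun p => ∑ j, b j ‖p.1‖ • v j p) (x, y) =
      ∑ j, b j ‖x‖ • P.diracN ρ c (v j) (x, y) := by
  have hy := mem_extChartAt_source (I := 𝓡 n) y
  have hi := P.mem_dom_at y
  have e : ∀ j, P.diracN ρ c (v j) (x, y) =
      nOp ρ (P.coordFrame y (P.indexAt y)) (P.spinConn ρ (P.indexAt y) y)
        (P.chartRep ρ (v j) (P.indexAt y) y) (x, χ[n, y] y) := fun j => by
    rw [← chartRep_diracN c hx ((hv j).diffAt hx) hy hi, chartRep_self]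
  simp only [e]
  refine (P.chartRep_self (ρ := ρ) _ x y).symm.trans ?_
  rw [chartRep_diracN c hx (spinorDiffAt_sum hv hx hb) hy hi]
  simp only [nOp, hasFDerivAt_chartRep_sum hv hx hb hy hi, chartRep_self]
  simp only [map_sum, map_add, map_smul, inner_zero_right, mul_zero, zero_smul, add_zero, smul_sum]
  conv_rhs => rw [sum_comm]
  simp only [smul_add, sum_add_distrib]

theorem radialDeriv_sum {v : J → ℍ k × N → S}
    {b : J → ℝ → ℂ} {b' : J → ℂ} (hv : ∀ j, P.IsSmoothSpinor ρ (v j))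
    (hh : ∀ j, IsHomogeneous (v j)) (hx : x ≠ 0)
    (hb : ∀ j, HasDerivAt (b j) (b' j) ‖x‖) :
    P.radialDeriv ρ c (fun p => ∑ j, b j ‖p.1‖ • v j p) (x, y) = ∑ j, b' j • v j (x, y) := by
  have hy := mem_extChartAt_source (I := 𝓡 n) y
  have hi := P.mem_dom_at y
  have hr : ‖x‖ ≠ 0 := norm_ne_zero_iff.mpr hx
  refine (P.chartRep_self (ρ := ρ) _ x y).symm.trans ?_
  rw [chartRep_radialDeriv c hx (spinorDiffAt_sum hv hx hb) hy hi]
  simp only [hasFDerivAt_chartRep_sum hv hx hb hy hi, chartRep_self]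
  refine sum_congr rfl fun j _ => ?_
  rw [← chartRep_radialDeriv c hx ((hv j).diffAt hx) hy hi, chartRep_self,
    (hh j).radialDeriv ((hv j).diffAt hx) hx, smul_zero, zero_add, inner_smul_right,
    real_inner_self_eq_norm_sq]
  have : ‖x‖⁻¹ * (‖x‖⁻¹ * ‖x‖ ^ 2) = 1 := by field_simp
  rw [this, one_smul]

end SpinStructure
end ModeAlgebra

section Volume

variable {n k : ℕ} {N : Type*} [TopologicalSpace N] [ChartedSpace (𝔼 n) N]

theorem iSup_measure_apply_eq_zero {α ι : Type*} [MeasurableSpace α] (m : ι → Measure α) {A : Set α}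
    (hA : MeasurableSet A) (h : ∀ i, m i A = 0) : (⨆ i, m i) A = 0 := by
  have h1 : (⨆ i, m i) ≤ (⨆ i, m i).restrict Aᶜ := by
    refine iSup_le fun i => ?_
    rw [← Measure.restrict_eq_self_of_ae_mem (μ := m i) (s := Aᶜ)
      (by rw [ae_iff]; simpa using h i)]
    exact Measure.restrict_mono_measure (le_iSup m i) _
  have h2 := h1 A
  rw [Measure.restrict_apply hA] at h2
  simpa using h2

theorem sFinite_riemannianVolume [IsManifold (𝓡 n) ∞ N] [CompactSpace N] [MeasurableSpace N]
    [BorelSpace N] (g : RiemMetric n N) : SFinite (riemannianVolume g.form) := by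
  obtain ⟨F, hF⟩ := (isCompact_univ : IsCompact (Set.univ : Set N)).elim_finite_subcover
    (fun y : N => χ[n, y].source) (fun y => isOpen_extChartAt_source y)
    (fun y _ => Set.mem_iUnion.mpr ⟨y, mem_extChartAt_source y⟩)
  have hae : ∀ y : N, ∀ f : 𝔼 n → ℝ≥0∞, AEMeasurable χ[n, y].symm
      (((volume : Measure (𝔼 n)).restrict χ[n, y].target).withDensity f) := fun y f =>
    ((continuousOn_extChartAt_symm y).aemeasurable
      (isOpen_extChartAt_target y).measurableSet).mono_ac (withDensity_absolutelyContinuous _ _)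
  have hae0 : ∀ y : N, AEMeasurable χ[n, y].symm
      ((volume : Measure (𝔼 n)).restrict χ[n, y].target) := fun y =>
    (continuousOn_extChartAt_symm y).aemeasurable (isOpen_extChartAt_target y).measurableSet
  let m : Measure N := Measure.sum fun y : F =>
    ((volume : Measure (𝔼 n)).restrict (extChartAt (𝓡 n) (y : N)).target).map
      (extChartAt (𝓡 n) (y : N)).symm
  refine @sFinite_of_absolutelyContinuous _ _ (riemannianVolume g.form) m ?_ ?_
  · infer_instance
  refine Measure.AbsolutelyContinuous.mk fun A hA hmA => iSup_measure_apply_eq_zero _ hA fun y₁ => ?_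
  rw [chartVolume, Measure.map_apply_of_aemeasurable (hae _ _) hA]
  refine withDensity_absolutelyContinuous _ _ ?_
  have h0 : ∀ y ∈ F, volume (χ[n, y].symm ⁻¹' A ∩ χ[n, y].target) = 0 := by
    intro y hy
    rw [Measure.sum_apply _ hA, ENNReal.tsum_eq_zero] at hmA
    have := hmA ⟨y, hy⟩
    rwa [Measure.map_apply_of_aemeasurable (hae0 _) hA,
      Measure.restrict_apply₀' (isOpen_extChartAt_target y).measurableSet.nullMeasurableSet] at this
  rw [Measure.restrict_apply₀' (isOpen_extChartAt_target y₁).measurableSet.nullMeasurableSet]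
  have hone : IsManifold (𝓡 n) 1 N := IsManifold.of_le (n := ∞) (by exact_mod_cast le_top)
  refine measure_mono_null (t := ⋃ y ∈ F, (χ[n, y₁] ∘ χ[n, y].symm) ''
    (χ[n, y].symm ⁻¹' A ∩
      (χ[n, y].symm ≫ χ[n, y₁]).source)) ?_
    ((measure_biUnion_null_iff F.countable_toSet).mpr fun y hy => ?_)
  · rintro u ⟨hu, hut⟩
    obtain ⟨y, hy⟩ := Set.mem_iUnion.mp (hF (Set.mem_univ (χ[n, y₁].symm u)))
    obtain ⟨hyF, hys⟩ := Set.mem_iUnion.mp hy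
    refine Set.mem_iUnion₂.mpr ⟨y, hyF, χ[n, y] (χ[n, y₁].symm u), ⟨?_, ?_⟩, ?_⟩
    · rw [Set.mem_preimage, χ[n, y].left_inv hys]
      exact hu
    · rw [PartialEquiv.trans_source, PartialEquiv.symm_source]
      refine ⟨χ[n, y].map_source hys, ?_⟩
      rw [Set.mem_preimage, χ[n, y].left_inv hys]
      exact χ[n, y₁].map_target hut
    · rw [Function.comp_apply, χ[n, y].left_inv hys, χ[n, y₁].right_inv hut]
  · refine addHaar_image_eq_zero_of_differentiableOn_of_addHaar_eq_zero volume ?_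
      (measure_mono_null ?_ (h0 y hy))
    · have h1 := contDiffOn_ext_coord_change (I := 𝓡 n) (n := 1) y₁ y
      exact (h1.differentiableOn one_ne_zero).mono fun u hu => by
        simpa [PartialEquiv.trans_source] using hu.2
    · rintro u ⟨hu, hus⟩
      rw [PartialEquiv.trans_source, PartialEquiv.symm_source] at hus
      exact ⟨hu, hus.1⟩

theorem SpinStructure.exists_lintegral_ball_le [IsManifold (𝓡 n) ∞ N] [MeasurableSpace N]
    [BorelSpace N] {g : RiemMetric n N} {ι : Type*} (P : SpinStructure ι g) (i : ι) (y₀ : N)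
    {u₀ : 𝔼 n} (hu₀ : u₀ ∈ P.coordDom y₀ i) :
    ∃ ε > 0, ball u₀ ε ⊆ P.coordDom y₀ i ∧ ∃ δ > 0, ∀ f : N → ℝ≥0∞, Measurable f →
      ofReal δ * ∫⁻ u in ball u₀ ε, f (χ[n, y₀].symm u) ≤ ∫⁻ y, f y ∂riemannianVolume g.form := by
  let F : 𝔼 n → Matrix (Fin n) (Fin n) ℝ := fun u => Matrix.of fun a b => P.coordFrame y₀ i b u a
  have hFc : ContinuousOn (fun u => (F u).det) (P.coordDom y₀ i) := by
    refine (continuous_id.matrix_det (A := id)).comp_continuousOn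
      (continuousOn_pi.mpr fun a => continuousOn_pi.mpr fun b => ?_)
    exact (proj a : 𝔼 n →L[ℝ] ℝ).continuous.comp_continuousOn
      (P.contDiffOn_coordFrame y₀ i b).continuousOn
  have hdet : ∀ u ∈ P.coordDom y₀ i, (F u).det ^ 2 * (chartGram g.form y₀ u).det = 1 := by
    intro u hu
    have h1 : (F u).transpose * chartGram g.form y₀ u * F u = 1 := by
      let L : 𝔼 n →L[ℝ] TangentSpace (𝓡 n) (χ[n, y₀].symm u) :=
        mfderiv 𝓘(ℝ, 𝔼 n) (𝓡 n) χ[n, y₀].symm u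
      have hL : ∀ b, L (P.coordFrame y₀ i b u) = P.frame i b (χ[n, y₀].symm u) := by
        intro b
        have h2 := mfderivWithin_extChartAt_symm_comp_mfderiv_extChartAt (I := 𝓡 n) hu.1
        rw [ModelWithCorners.range_eq_univ, mfderivWithin_univ] at h2
        exact congr_fun h2 (P.frame i b (χ[n, y₀].symm u))
      let B : 𝔼 n →ₗ[ℝ] 𝔼 n →ₗ[ℝ] ℝ := LinearMap.mk₂ ℝ (fun v w => g.form _ (L v) (L w))
        (fun v v' w => by rw [map_add, RiemMetric.form_add_left])
        (fun t v w => by rw [map_smul, RiemMetric.form_smul_left]; rfl)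
        (fun v w w' => by
          rw [map_add, RiemMetric.form_comm, RiemMetric.form_add_left, RiemMetric.form_comm,
            RiemMetric.form_comm _ (L w')])
        (fun t v w => by
          rw [map_smul, RiemMetric.form_comm, RiemMetric.form_smul_left, RiemMetric.form_comm]; rfl)
      ext a b
      have h4 : B (P.coordFrame y₀ i a u) (P.coordFrame y₀ i b u) = if a = b then 1 else 0 :=
        (congrArg₂ (g.form _) (hL a) (hL b)).trans (P.orthonormal i _ hu.2 a b)
      rw [← sum_smul_single_euclidean (P.coordFrame y₀ i a u),
        ← sum_smul_single_euclidean (P.coordFrame y₀ i b u)] at h4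
      simp only [map_sum, map_smul, LinearMap.sum_apply, LinearMap.smul_apply, smul_eq_mul] at h4
      rw [Matrix.one_apply, ← h4, Matrix.mul_apply]
      refine sum_congr rfl fun d _ => ?_
      rw [Matrix.mul_apply, mul_comm]
      congr 1
    have h3 := congrArg Matrix.det h1
    rw [Matrix.det_mul, Matrix.det_mul, Matrix.det_transpose, Matrix.det_one] at h3
    linear_combination h3
  obtain ⟨K, hK, hev⟩ : ∃ K > 0, ∀ᶠ u in nhds u₀, |(F u).det| ≤ K := by
    refine ⟨|(F u₀).det| + 1, by positivity, ?_⟩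
    have := ((hFc.continuousAt ((P.isOpen_coordDom y₀ i).mem_nhds hu₀)).abs).eventually_lt_const
      (lt_add_one _)
    exact this.mono fun u hu => hu.le
  obtain ⟨ε, hε, hball⟩ := Metric.eventually_nhds_iff_ball.mp
    (hev.and ((P.isOpen_coordDom y₀ i).mem_nhds hu₀))
  refine ⟨ε, hε, fun u hu => (hball u hu).2, K⁻¹, by positivity, fun f hf => ?_⟩
  have hB : MeasurableSet (ball u₀ ε) := isOpen_ball.measurableSet
  have hBt : ball u₀ ε ⊆ χ[n, y₀].target := fun u hu => (hball u hu).2.1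
  have hle : ofReal K⁻¹ • (volume : Measure (𝔼 n)).restrict (ball u₀ ε) ≤
      ((volume : Measure (𝔼 n)).restrict χ[n, y₀].target).withDensity
        (fun u => ofReal (Real.sqrt (chartGram g.form y₀ u).det)) := by
    refine Measure.le_iff.mpr fun s hs => ?_
    rw [withDensity_apply _ hs, Measure.smul_apply, Measure.restrict_apply hs, smul_eq_mul,
      Measure.restrict_restrict hs]
    refine le_trans ?_ (lintegral_mono_set (Set.inter_subset_inter_right s hBt))
    rw [← setLIntegral_const]
    refine setLIntegral_mono' (hs.inter hB) fun u hu => ENNReal.ofReal_le_ofReal ?_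
    have h1 := hdet u (hball u hu.2).2
    have h2 := (hball u hu.2).1
    refine Real.le_sqrt_of_sq_le ?_
    have h3 : 0 < (F u).det ^ 2 := by
      rcases (sq_nonneg (F u).det).lt_or_eq with h | h
      · exact h
      · rw [← h] at h1; simp at h1
    rw [inv_pow, inv_le_iff_one_le_mul₀ (by positivity), ← h1, mul_comm]
    have h4 : (F u).det ^ 2 ≤ K ^ 2 := sq_le_sq' (by linarith [abs_le.mp h2]) (abs_le.mp h2).2
    have h5 : 0 ≤ (chartGram g.form y₀ u).det := by
      by_contra h
      push Not at h
      nlinarith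
    nlinarith
  have hae : AEMeasurable χ[n, y₀].symm
      (((volume : Measure (𝔼 n)).restrict χ[n, y₀].target).withDensity
        (fun u => ofReal (Real.sqrt (chartGram g.form y₀ u).det))) :=
    ((continuousOn_extChartAt_symm y₀).aemeasurable
      (isOpen_extChartAt_target y₀).measurableSet).mono_ac (withDensity_absolutelyContinuous _ _)
  have h6 : ∫⁻ y, f y ∂(ofReal K⁻¹ • (volume : Measure (𝔼 n)).restrict (ball u₀ ε)).map
      χ[n, y₀].symm ≤ ∫⁻ y, f y ∂riemannianVolume g.form :=
    lintegral_mono' ((Measure.map_mono_of_aemeasurable hle hae).trans (le_iSup (chartVolume g.form) y₀)) le_rfl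
  rwa [lintegral_map' hf.aemeasurable (hae.mono_measure hle), lintegral_smul_measure, smul_eq_mul]
    at h6

end Volume

section HyperbolicVolume

variable {k : ℕ}

theorem measurable_warp (c : ℝ) : Measurable (warp c) := by
  refine Measurable.ite (measurableSet_singleton 0) measurable_const ?_
  exact (continuous_iff_continuousAt.mpr fun r =>
    (hasDerivAt_sinhC c r).continuousAt).measurable.div measurable_id

theorem warp_pos (c : ℝ) {r : ℝ} (hr : 0 ≤ r) : 0 < warp c r := by
  unfold warp
  split_ifs with h
  · exact one_pos
  · exact div_pos (sinhC_pos (lt_of_le_of_ne hr (Ne.symm h))) (lt_of_le_of_ne hr (Ne.symm h))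

theorem riemannianVolume_hypMetric (c : ℝ) :
    riemannianVolume (hypMetric (k := k) c) =
      (volume : Measure (ℍ k)).withDensity fun x => ofReal (warp c ‖x‖ ^ k) := by
  have h : ∀ x₀ : ℍ k, chartVolume (hypMetric (k := k) c) x₀ =
      (volume : Measure (ℍ k)).withDensity fun x => ofReal (warp c ‖x‖ ^ k) := by
    intro x₀
    have h1 : extChartAt (𝓡 (k + 1)) x₀ = PartialEquiv.refl _ :=
      extChartAt_model_space_eq_id ℝ x₀
    have h2 : ∀ u, (chartGram (hypMetric (k := k) c) x₀ u).det = (warp c ‖u‖ ^ k) ^ 2 := by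
      intro u
      have hw := warp_ne_zero c ‖u‖
      have h3 : chartGram (hypMetric (k := k) c) x₀ u = (warp c ‖u‖ ^ 2) •
          (1 + Matrix.replicateCol Unit (fun a => (1 - warp c ‖u‖ ^ 2) /
            (warp c ‖u‖ ^ 2 * ‖u‖ ^ 2) * u a) * Matrix.replicateRow Unit (fun a => u a)) := by
        ext a b
        have h4 : ∀ e : PartialEquiv (ℍ k) (ℍ k), e = PartialEquiv.refl _ → ∀ v w,
            hypMetric c (e.symm u)
              (mfderiv 𝓘(ℝ, ℍ k) (𝓡 (k + 1)) e.symm u v)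
              (mfderiv 𝓘(ℝ, ℍ k) (𝓡 (k + 1)) e.symm u w) = hypInner c u v w := by
          rintro _ rfl v w
          have h5 : mfderiv 𝓘(ℝ, ℍ k) (𝓡 (k + 1))
              (PartialEquiv.refl (ℍ k)).symm u = ContinuousLinearMap.id ℝ (ℍ k) :=
            mfderiv_id
          exact congrArg₂ (hypInner c u) (congr_fun h5 v) (congr_fun h5 w)
        refine (h4 _ h1 δ[a] δ[b]).trans ?_
        have h6 : inner ℝ δ[a] δ[b] = (1 : Matrix (Fin (k + 1)) (Fin (k + 1)) ℝ) a b := by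
          simp [EuclideanSpace.inner_single_left, Matrix.one_apply]
        have h7 : ∀ a, inner ℝ u δ[a] = u a := fun a => by
          simp [EuclideanSpace.inner_single_right]
        rw [hypInner, h6, h7, h7]
        simp only [Matrix.smul_apply, Matrix.add_apply, Matrix.mul_apply, smul_eq_mul]
        simp
        by_cases hu : u = 0
        · subst hu; simp
        · field_simp
      rw [h3, Matrix.det_smul, Matrix.det_one_add_replicateCol_mul_replicateRow, Fintype.card_fin]
      by_cases hu : u = 0
      · subst hu; simp [warp]
      have hr : ‖u‖ ≠ 0 := norm_ne_zero_iff.mpr hu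
      have h5 : (fun a => u a) ⬝ᵥ (fun a => (1 - warp c ‖u‖ ^ 2) /
          (warp c ‖u‖ ^ 2 * ‖u‖ ^ 2) * u a) = (1 - warp c ‖u‖ ^ 2) / warp c ‖u‖ ^ 2 := by
        have : ‖u‖ ^ 2 = ∑ a, u a * u a := by
          rw [EuclideanSpace.norm_sq_eq]; simp [sq]
        simp only [dotProduct, mul_left_comm _ ((1 - warp c ‖u‖ ^ 2) / _), ← mul_sum, ← this]
        field_simp
      rw [h5]
      field_simp
      ring
    rw [chartVolume]
    simp only [h2, h1]
    simp [Real.sqrt_sq (pow_nonneg (warp_pos c (norm_nonneg _)).le k)]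
  rw [riemannianVolume]
  simp only [h, ciSup_const]

end HyperbolicVolume

section L2Chart

variable {n k : ℕ} {N : Type*} [TopologicalSpace N] [ChartedSpace (𝔼 n) N]
  [IsManifold (𝓡 n) ∞ N] {ι : Type*} {g : RiemMetric n N} {P : SpinStructure ι g}
  {S : Type*} [NormedAddCommGroup S] [InnerProductSpace ℂ S]
  [FiniteDimensional ℂ S] {ρ : 𝓢 k n S} {c rho lam r₀ : ℝ} {μ : ℂ}
  {Φ Ψ φ : ℍ k × N → S} {v : Fin 4 → ℍ k × N → S}

theorem norm_actRight_spin (ρ : 𝓢 k n S)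
    (x : spinGroup (cliffordForm (Fin n))) (s : S) : ‖actRight ρ (x : Cl (Fin n)) s‖ = ‖s‖ := by
  have h := inner_act_spin (actRight ρ) (fun a s t => by
    rw [actRight_gen]; exact ρ.inner_genL _ s t) x s s
  rw [inner_self_eq_norm_sq_to_K, inner_self_eq_norm_sq_to_K] at h
  have h2 : ‖actRight ρ (x : Cl (Fin n)) s‖ ^ 2 = ‖s‖ ^ 2 := by exact_mod_cast h
  exact (pow_left_inj₀ (norm_nonneg _) (norm_nonneg _) two_ne_zero).mp h2

namespace SpinStructure

theorem norm_prodLoc (i : ι) (p : ℍ k × N) : ‖P.prodLoc ρ Φ i p‖ = ‖Φ p‖ :=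
  norm_actRight_spin ρ _ _

theorem norm_chartRep (i : ι) (y₀ : N) (q : ℍ k × 𝔼 n) :
    ‖P.chartRep ρ Φ i y₀ q‖ = ‖Φ (q.1, χ[n, y₀].symm q.2)‖ :=
  norm_prodLoc i _

theorem SpinorDiffAt.continuousAt_norm {p : ℍ k × N} (h : P.SpinorDiffAt ρ Φ p) :
    ContinuousAt (fun p => ‖Φ p‖) p := by
  have h1 := (h (P.indexAt p.2) (P.mem_dom_at _)).continuousAt.norm
  simpa only [norm_prodLoc] using h1

theorem measurable_indicator_enorm [MeasurableSpace N] [BorelSpace N] {r₀ : ℝ}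
    (h : ∀ p : ℍ k × N, r₀ < ‖p.1‖ → P.SpinorDiffAt ρ Φ p) :
    Measurable ({p : ℍ k × N | r₀ < ‖p.1‖}.indicator fun p => ‖Φ p‖ₑ ^ 2) := by
  classical
  have hA : IsOpen {p : ℍ k × N | r₀ < ‖p.1‖} :=
    isOpen_lt continuous_const continuous_fst.norm
  rw [← Set.piecewise_eq_indicator]
  refine ContinuousOn.measurable_piecewise (fun p hp => ?_) continuousOn_const hA.measurableSet
  have h1 : ContinuousAt (fun p => ‖Φ p‖ₑ) p := by
    simpa only [Function.comp_def, ofReal_norm] using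
      (ENNReal.continuous_ofReal.continuousAt.comp ((h p hp).continuousAt_norm))
  exact ((ENNReal.continuous_pow 2).continuousAt.comp h1).continuousWithinAt

theorem measurable_indicator_chart {r₀ : ℝ}
    (h : ∀ p : ℍ k × N, r₀ < ‖p.1‖ → P.SpinorDiffAt ρ Φ p) {y₀ : N} {B : Set (𝔼 n)}
    (hB : IsOpen B) (hBt : B ⊆ χ[n, y₀].target) :
    Measurable ({q : ℍ k × 𝔼 n | r₀ < ‖q.1‖ ∧ q.2 ∈ B}.indicator fun q =>
      ‖Φ (q.1, χ[n, y₀].symm q.2)‖ₑ ^ 2 * ofReal (warp c ‖q.1‖ ^ k)) := by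
  classical
  have hA : IsOpen {q : ℍ k × 𝔼 n | r₀ < ‖q.1‖ ∧ q.2 ∈ B} :=
    (isOpen_lt continuous_const continuous_fst.norm).inter (hB.preimage continuous_snd)
  have h2 : Measurable ({q : ℍ k × 𝔼 n | r₀ < ‖q.1‖ ∧ q.2 ∈ B}.indicator fun q =>
      ‖Φ (q.1, χ[n, y₀].symm q.2)‖ₑ ^ 2) := by
    rw [← Set.piecewise_eq_indicator]
    refine ContinuousOn.measurable_piecewise (fun q hq => ?_) continuousOn_const hA.measurableSet
    have h0 : ContinuousAt (fun q : ℍ k × 𝔼 n =>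
        (q.1, χ[n, y₀].symm q.2)) q :=
      continuous_fst.continuousAt.prodMk (((continuousOn_extChartAt_symm y₀).continuousAt
        ((isOpen_extChartAt_target y₀).mem_nhds (hBt hq.2))).comp continuous_snd.continuousAt)
    have h1 : ContinuousAt (fun q : ℍ k × 𝔼 n =>
        ‖Φ (q.1, χ[n, y₀].symm q.2)‖ₑ) q := by
      have h3 := (h (q.1, χ[n, y₀].symm q.2) hq.1).continuousAt_norm
      have h4 := ENNReal.continuous_ofReal.continuousAt.comp
        (ContinuousAt.comp (g := fun p => ‖Φ p‖) (f := fun q : ℍ k × 𝔼 n =>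
          (q.1, χ[n, y₀].symm q.2)) (x := q) h3 h0)
      simpa only [Function.comp_def, ofReal_norm] using h4
    exact ((ENNReal.continuous_pow 2).continuousAt.comp h1).continuousWithinAt
  have h3 : Measurable fun q : ℍ k × 𝔼 n => ofReal (warp c ‖q.1‖ ^ k) :=
    (((measurable_warp c).comp measurable_fst.norm).pow_const k).ennreal_ofReal
  have e : ({q : ℍ k × 𝔼 n | r₀ < ‖q.1‖ ∧ q.2 ∈ B}.indicator fun q =>
      ‖Φ (q.1, χ[n, y₀].symm q.2)‖ₑ ^ 2 * ofReal (warp c ‖q.1‖ ^ k)) =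
      fun q => ({q : ℍ k × 𝔼 n | r₀ < ‖q.1‖ ∧ q.2 ∈ B}.indicator fun q =>
      ‖Φ (q.1, χ[n, y₀].symm q.2)‖ₑ ^ 2) q * ofReal (warp c ‖q.1‖ ^ k) := by
    ext q
    rw [Set.indicator_mul_left]
  rw [e]
  exact h2.mul h3

/-- The `L²`-norm controls the `L²`-norms in charts. -/
theorem exists_l2_chart_bound [CompactSpace N] [MeasurableSpace N] [BorelSpace N]
    (P : SpinStructure ι g) (ρ : 𝓢 k n S) (c : ℝ) (i : ι) {y₀ : N}
    {u₀ : 𝔼 n} (hu₀ : u₀ ∈ P.coordDom y₀ i) :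
    ∃ ε > 0, ball u₀ ε ⊆ P.coordDom y₀ i ∧ ∃ D : ℝ, 0 < D ∧ ∀ (r₀ : ℝ) (Φ : ℍ k × N → S),
      (∀ p : ℍ k × N, r₀ < ‖p.1‖ → P.SpinorDiffAt ρ Φ p) →
      ∫⁻ q in {q : ℍ k × 𝔼 n | r₀ < ‖q.1‖ ∧ q.2 ∈ ball u₀ ε},
        ‖Φ (q.1, χ[n, y₀].symm q.2)‖ₑ ^ 2 * ofReal (warp c ‖q.1‖ ^ k) ≤
      ofReal D * l2Norm g c r₀ Φ ^ 2 := by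
  obtain ⟨ε, hε, hball, δ, hδ, hf⟩ := P.exists_lintegral_ball_le i y₀ hu₀
  refine ⟨ε, hε, hball, δ⁻¹, by positivity, fun r₀ Φ h => ?_⟩
  have := sFinite_riemannianVolume g
  have hA : IsOpen {p : ℍ k × N | r₀ < ‖p.1‖} :=
    isOpen_lt continuous_const continuous_fst.norm
  have hA' : IsOpen {q : ℍ k × 𝔼 n | r₀ < ‖q.1‖ ∧ q.2 ∈ ball u₀ ε} :=
    (isOpen_lt continuous_const continuous_fst.norm).inter (isOpen_ball.preimage continuous_snd)
  have hm := measurable_indicator_enorm (Φ := Φ) h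
  set f := {p : ℍ k × N | r₀ < ‖p.1‖}.indicator fun p => ‖Φ p‖ₑ ^ 2 with hfdef
  have e1 : l2Norm g c r₀ Φ ^ 2 = ∫⁻ p, f p
      ∂((riemannianVolume (hypMetric (k := k) c)).prod (riemannianVolume g.form)) := by
    rw [l2Norm, ← ENNReal.rpow_natCast, ← ENNReal.rpow_mul, lintegral_indicator hA.measurableSet]
    norm_num
  have hwm : Measurable fun x : ℍ k => ofReal (warp c ‖x‖ ^ k) :=
    (((measurable_warp c).comp measurable_norm).pow_const k).ennreal_ofReal
  rw [e1, lintegral_prod _ hm.aemeasurable, riemannianVolume_hypMetric,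
    lintegral_withDensity_eq_lintegral_mul_non_measurable _ hwm
      (Filter.Eventually.of_forall fun x => ENNReal.ofReal_lt_top)]
  rw [← lintegral_indicator hA'.measurableSet, Measure.volume_eq_prod,
    lintegral_prod _ (measurable_indicator_chart h isOpen_ball fun u hu => (hball hu).1).aemeasurable,
    ← lintegral_const_mul' _ _ ENNReal.ofReal_ne_top]
  refine lintegral_mono fun x => ?_
  have h1 := hf (fun y => f (x, y)) (hm.comp measurable_prodMk_left)
  have h2 : ∫⁻ u in ball u₀ ε, f (x, χ[n, y₀].symm u) ≤
      ofReal δ⁻¹ * ∫⁻ y, f (x, y) ∂riemannianVolume g.form := by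
    rw [ENNReal.ofReal_inv_of_pos hδ]
    have h0 : ofReal δ ≠ 0 := by simpa using hδ
    calc _ = (ofReal δ)⁻¹ * (ofReal δ * ∫⁻ u in ball u₀ ε, f (x, χ[n, y₀].symm u)) := by
          rw [← mul_assoc, ENNReal.inv_mul_cancel h0 ENNReal.ofReal_ne_top, one_mul]
      _ ≤ _ := by gcongr
  calc _ = ofReal (warp c ‖x‖ ^ k) * ∫⁻ u in ball u₀ ε, f (x, χ[n, y₀].symm u) := by
        rw [← lintegral_const_mul' _ _ ENNReal.ofReal_ne_top,
          ← lintegral_indicator isOpen_ball.measurableSet]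
        refine lintegral_congr fun u => ?_
        simp only [Set.indicator, Set.mem_ofPred_eq, hfdef]
        by_cases h1 : r₀ < ‖x‖ <;> by_cases h2 : u ∈ ball u₀ ε <;>
          simp [h1, h2, mul_comm, -mem_ball]
    _ ≤ ofReal (warp c ‖x‖ ^ k) * (ofReal δ⁻¹ *
        ∫⁻ y, f (x, y) ∂riemannianVolume g.form) := by gcongr
    _ = _ := by simp only [Pi.mul_apply]; ring

end SpinStructure

/-- An integrable function is integrable along rays in a dense set of directions. -/
theorem exists_ray_lintegral_lt_top {E : Type*} [NormedAddCommGroup E] [NormedSpace ℝ E]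
    [FiniteDimensional ℝ E] [Nontrivial E] [MeasurableSpace E] [BorelSpace E] (ν : Measure E)
    [ν.IsAddHaarMeasure] {f : E → ℝ≥0∞} (hf : Measurable f) (hfi : ∫⁻ x, f x ∂ν ≠ ⊤)
    {U : Set (sphere (0 : E) 1)} (hU : IsOpen U) (hne : U.Nonempty) :
    ∃ θ ∈ U, ∫⁻ r in Set.Ioi (0 : ℝ),
      ofReal (r ^ (Module.finrank ℝ E - 1)) * f (r • (θ : E)) < ⊤ := by
  set m := Module.finrank ℝ E - 1
  have hG : Measurable fun p : sphere (0 : E) 1 × Set.Ioi (0 : ℝ) => f (p.2.1 • p.1.1) := by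
    apply hf.comp
    exact (continuous_subtype_val.comp continuous_snd |>.smul
      (continuous_subtype_val.comp continuous_fst)).measurable
  have h1 : ∫⁻ p, f (p.2.1 • p.1.1) ∂(ν.toSphere.prod (Measure.volumeIoiPow m)) ≠ ⊤ := by
    rw [← (Measure.measurePreserving_homeomorphUnitSphereProd ν).lintegral_comp_emb
      (homeomorphUnitSphereProd E).measurableEmbedding]
    have e : ∀ x : ({0}ᶜ : Set E), f (((homeomorphUnitSphereProd E) x).2.1 •
        ((homeomorphUnitSphereProd E) x).1.1) = f x := fun x => by
      have := congrArg Subtype.val ((homeomorphUnitSphereProd E).symm_apply_apply x)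
      rw [homeomorphUnitSphereProd_symm_apply_coe] at this
      rw [this]
    simp only [e]
    rw [lintegral_subtype_comap (measurableSet_singleton 0).compl f]
    exact ((setLIntegral_le_lintegral _ _).trans_lt hfi.lt_top).ne
  rw [lintegral_prod _ hG.aemeasurable] at h1
  have h2 := ae_lt_top hG.lintegral_prod_right' h1
  obtain ⟨θ, hθ, hθU⟩ := (Measure.dense_of_ae h2).exists_mem_open hU hne
  refine ⟨θ, hθU, ?_⟩
  have hm : Measurable fun r : Set.Ioi (0 : ℝ) => ofReal (r.1 ^ m) :=
    (measurable_subtype_coe.pow_const m).ennreal_ofReal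
  have h3 : ∫⁻ r : Set.Ioi (0 : ℝ), f (r.1 • θ.1) ∂Measure.volumeIoiPow m < ⊤ := hθ
  have hm3 : Measurable fun r : Set.Ioi (0 : ℝ) => f (r.1 • θ.1) := hG.comp measurable_prodMk_left
  rw [Measure.volumeIoiPow, lintegral_withDensity_eq_lintegral_mul _ hm hm3] at h3
  rw [← lintegral_subtype_comap measurableSet_Ioi]
  exact h3

/-- A square integrable spinor is square integrable along a dense set of radial rays. -/
theorem SpinStructure.exists_ray_l2 [CompactSpace N] [MeasurableSpace N] [BorelSpace N] {r₀ : ℝ}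
    (hr₀ : 0 ≤ r₀) (h : ∀ p : ℍ k × N, r₀ < ‖p.1‖ → P.SpinorDiffAt ρ Φ p)
    (hl2 : l2Norm g c r₀ Φ < ⊤) {x₀ : ℍ k} (hx₀ : ‖x₀‖ = 1) {y₀ : N}
    {V : Set (ℍ k × N)} (hV : V ∈ nhds (x₀, y₀)) :
    ∃ p ∈ V, ‖p.1‖ = 1 ∧
      ∫⁻ r in Set.Ioi r₀, ‖Φ (r • p.1, p.2)‖ₑ ^ 2 * ofReal (sinhC c r ^ k) < ⊤ := by
  set χ := χ[n, y₀]
  have hu₀ : χ y₀ ∈ P.coordDom y₀ (P.indexAt y₀) :=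
    P.mem_coordDom (mem_extChartAt_source y₀) (P.mem_dom_at y₀)
  obtain ⟨ε, hε, hball, D, hD, hb⟩ := exists_l2_chart_bound P ρ c (P.indexAt y₀) hu₀
  have hBt : ball (χ y₀) ε ⊆ χ.target := fun u hu => (hball hu).1
  have hm := measurable_indicator_chart (c := c) h isOpen_ball hBt
  set f := {q : ℍ k × 𝔼 n | r₀ < ‖q.1‖ ∧ q.2 ∈ ball (χ y₀) ε}.indicator fun q =>
      ‖Φ (q.1, χ.symm q.2)‖ₑ ^ 2 * ofReal (warp c ‖q.1‖ ^ k) with hf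
  have hA' : IsOpen {q : ℍ k × 𝔼 n | r₀ < ‖q.1‖ ∧ q.2 ∈ ball (χ y₀) ε} :=
    (isOpen_lt continuous_const continuous_fst.norm).inter (isOpen_ball.preimage continuous_snd)
  have h1 : ∫⁻ q, f q ≠ ⊤ := by
    rw [lintegral_indicator hA'.measurableSet]
    exact ((hb r₀ Φ h).trans_lt (ENNReal.mul_lt_top ENNReal.ofReal_lt_top
      (ENNReal.pow_lt_top hl2))).ne
  rw [Measure.volume_eq_prod, lintegral_prod_symm _ hm.aemeasurable] at h1
  have h2 := ae_lt_top hm.lintegral_prod_left' h1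
  have hV' : (fun q : ℍ k × 𝔼 n => (q.1, χ.symm q.2)) ⁻¹' V ∈ nhds (x₀, χ y₀) := by
    have hc : ContinuousAt (fun q : ℍ k × 𝔼 n => (q.1, χ.symm q.2)) (x₀, χ y₀) :=
      continuous_fst.continuousAt.prodMk (ContinuousAt.comp (x := (x₀, χ y₀))
        ((continuousOn_extChartAt_symm y₀).continuousAt
          ((isOpen_extChartAt_target y₀).mem_nhds (mem_extChartAt_target y₀)))
        continuous_snd.continuousAt)
    apply hc
    simpa [χ] using hV
  obtain ⟨A, hA, hxA, B, hB, huB, hAB⟩ : ∃ A : Set (ℍ k), IsOpen A ∧ x₀ ∈ A ∧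
      ∃ B : Set (𝔼 n), IsOpen B ∧ χ y₀ ∈ B ∧ ∀ x ∈ A, ∀ u ∈ B, (x, χ.symm u) ∈ V := by
    obtain ⟨A, B, hA, hx, hB, hu, hAB⟩ := mem_nhds_prod_iff'.mp hV'
    exact ⟨A, hA, hx, B, hB, hu, fun x hx u hu => hAB (Set.mk_mem_prod hx hu)⟩
  obtain ⟨u, hu, huB⟩ := (Measure.dense_of_ae h2).exists_mem_open
    (hB.inter isOpen_ball) ⟨χ y₀, huB, mem_ball_self hε⟩
  have hm2 : Measurable fun x : ℍ k => f (x, u) := hm.comp measurable_prodMk_right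
  obtain ⟨θ, hθA, hθ⟩ := exists_ray_lintegral_lt_top (volume : Measure (ℍ k)) hm2 hu.ne
    (hA.preimage continuous_subtype_val) ⟨⟨x₀, by simpa using hx₀⟩, hxA⟩
  have hθ1 : ‖(θ : ℍ k)‖ = 1 := by simp
  refine ⟨(θ, χ.symm u), hAB _ hθA _ huB.1, hθ1, lt_of_le_of_lt ?_ hθ⟩
  refine le_trans ?_ (lintegral_mono_set (Set.Ioi_subset_Ioi hr₀))
  refine setLIntegral_mono' measurableSet_Ioi fun r hr => ?_
  have hr0 : 0 < r := hr₀.trans_lt hr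
  have hn : ‖r • (θ : ℍ k)‖ = r := by rw [norm_smul, hθ1, mul_one, norm_of_nonneg hr0.le]
  rw [hf, Set.indicator_of_mem (by exact ⟨by rw [hn]; exact hr, huB.2⟩)]
  simp only [hn, finrank_euclideanSpace, Fintype.card_fin, Nat.add_sub_cancel]
  rw [mul_left_comm, ← ENNReal.ofReal_mul (by positivity), ← mul_pow]
  have : r * warp c r = sinhC c r := by
    rw [warp, if_neg hr0.ne']; field_simp
  rw [this]

theorem exists_finset_ker_le {V W Z : Type*} [AddCommGroup V] [Module ℂ V] [FiniteDimensional ℂ V]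
    [AddCommGroup W] [Module ℂ W] (J : Z → V →ₗ[ℂ] W) (G : Set Z) :
    ∃ F : Finset Z, ↑F ⊆ G ∧ ∀ b, (∀ z ∈ F, J z b = 0) → ∀ z ∈ G, J z b = 0 := by
  classical
  obtain ⟨K, ⟨F, hF, rfl⟩, hmin⟩ := (wellFounded_lt (α := Submodule ℂ V)).has_min
    {K | ∃ F : Finset Z, ↑F ⊆ G ∧ K = ⨅ z ∈ F, LinearMap.ker (J z)} ⟨_, ∅, by simp, rfl⟩
  refine ⟨F, hF, fun b hb z hz => ?_⟩
  by_contra hne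
  have hF' : ((insert z F : Finset Z) : Set Z) ⊆ G := by
    simpa [Set.insert_subset_iff] using ⟨hz, hF⟩
  generalize hi : insert z F = F' at hF'
  refine hmin (⨅ z ∈ F', LinearMap.ker (J z)) ⟨F', hF', rfl⟩ ?_
  refine lt_of_le_of_ne (iInf_le_iInf_of_subset (by simp [← hi])) fun h => hne ?_
  have h1 : b ∈ ⨅ z ∈ F, LinearMap.ker (J z) := by simpa [Submodule.mem_iInf] using hb
  rw [← h] at h1
  simp only [Submodule.mem_iInf, LinearMap.mem_ker] at h1
  exact h1 z (hi ▸ Finset.mem_insert_self _ _)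

theorem LinearMap.exists_pseudoinverse {V U : Type*} [AddCommGroup V] [Module ℂ V]
    [AddCommGroup U] [Module ℂ U] (f : V →ₗ[ℂ] U) : ∃ L : U →ₗ[ℂ] V, ∀ b, f (L (f b)) = f b := by
  obtain ⟨r, hr⟩ := f.rangeRestrict.exists_rightInverse_of_surjective f.range_rangeRestrict
  obtain ⟨L, hL⟩ := r.exists_extend
  refine ⟨L, fun b => ?_⟩
  have h1 : L (f b) = r (f.rangeRestrict b) := by rw [← hL]; rfl
  rw [h1]
  exact congrArg Subtype.val (LinearMap.congr_fun hr (f.rangeRestrict b))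

/-- Clifford multiplication by `∂_r` on the coefficients of a spinor in a mode. -/
def modeRad : Matrix (Fin 4) (Fin 4) ℂ := !![0, -1, 0, 0; 1, 0, 0, 0; 0, 0, 0, -1; 0, 0, 1, 0]

/-- The Dirac operator of the spheres on the coefficients of a spinor in a mode. -/
def modeSph (rho : ℝ) : Matrix (Fin 4) (Fin 4) ℂ :=
  (rho : ℂ) • !![0, 0, 1, 0; 0, 0, 0, -1; 1, 0, 0, 0; 0, -1, 0, 0]

/-- The partial Dirac operator along `N` on the coefficients of a spinor in a mode. -/
def modeN (lam : ℝ) : Matrix (Fin 4) (Fin 4) ℂ :=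
  (lam : ℂ) • !![1, 0, 0, 0; 0, -1, 0, 0; 0, 0, -1, 0; 0, 0, 0, 1]

def modeA (lam : ℝ) (μ : ℂ) : Matrix (Fin 4) (Fin 4) ℂ := modeRad * (modeN lam - μ • 1)

def modeB (rho : ℝ) : Matrix (Fin 4) (Fin 4) ℂ := modeRad * modeSph rho

theorem modeRad_sq : modeRad * modeRad = -1 := by
  ext i j
  fin_cases i <;> fin_cases j <;> simp [modeRad, Matrix.mul_apply, sum_univ_four]

theorem modeB_sq (rho : ℝ) : modeB rho * modeB rho = (rho : ℂ) ^ 2 • 1 := by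
  ext i j
  fin_cases i <;> fin_cases j <;>
    simp [modeB, modeSph, modeRad, Matrix.mul_apply, sum_univ_four, sq]

theorem modeA_eq (lam : ℝ) (μ : ℂ) : modeA lam μ = !![0, lam + μ, 0, 0; lam - μ, 0, 0, 0;
    0, 0, 0, μ - lam; 0, 0, -lam - μ, 0] := by
  ext i j
  simp only [modeA, Matrix.mul_apply, sum_univ_four, Matrix.sub_apply, Matrix.smul_apply,
    Matrix.one_apply]
  fin_cases i <;> fin_cases j <;> simp [modeN, modeRad] <;> ring

theorem modeA_sq (lam : ℝ) (μ : ℂ) : modeA lam μ * modeA lam μ = ((lam : ℂ) ^ 2 - μ ^ 2) • 1 := by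
  rw [modeA_eq]
  ext i j
  fin_cases i <;> fin_cases j <;> simp [Matrix.mul_apply, sum_univ_four] <;> ring

theorem modeB_mul_modeA (rho lam : ℝ) (μ : ℂ) :
    modeB rho * modeA lam μ = -(modeA lam μ * modeB rho) := by
  rw [modeA_eq]
  ext i j
  fin_cases i <;> fin_cases j <;>
    simp [modeB, modeSph, modeRad, Matrix.mul_apply, sum_univ_four] <;> ring

namespace SpinStructure

/-- The spinor with the given coefficients, at a point. -/
def modeEval (v : Fin 4 → ℍ k × N → S) (p : ℍ k × N) : (Fin 4 → ℂ) →ₗ[ℂ] S :=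
  Fintype.linearCombination ℂ (fun j => v j p)

theorem modeEval_apply (p : ℍ k × N) (b : Fin 4 → ℂ) :
    modeEval v p b = ∑ j, b j • v j p := Fintype.linearCombination_apply _ _ _

theorem modeEval_mulVec (p : ℍ k × N) (A : Matrix (Fin 4) (Fin 4) ℂ) (b : Fin 4 → ℂ) :
    modeEval v p (A.mulVec b) = ∑ j, b j • ∑ i, A i j • v i p := by
  simp only [modeEval_apply, Matrix.mulVec, dotProduct, sum_smul, smul_sum, smul_smul]
  rw [sum_comm]
  simp only [mul_comm]

variable (P ρ c rho lam) in
/-- The spinors `ψ`, `∂_r · ψ`, `Pψ`, `∂_r · Pψ` of a mode and the action of the operators on them. -/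
structure IsModeBasis (v : Fin 4 → ℍ k × N → S) : Prop where
  smooth : ∀ j, P.IsSmoothSpinor ρ (v j)
  homogeneous : ∀ j, IsHomogeneous (v j)
  rad_eq : ∀ j p, p.1 ≠ 0 → radialMul ρ (v j) p = ∑ i, modeRad i j • v i p
  sph_eq : ∀ j p, p.1 ≠ 0 → P.diracSphere ρ c (v j) p = ∑ i, modeSph rho i j • v i p
  diracN_eq : ∀ j p, p.1 ≠ 0 → P.diracN ρ c (v j) p = ∑ i, modeN lam i j • v i p

theorem diracSphere_eq_zero_of_dim_eq_zero (hk : k = 0) {x : ℍ k} {y : N} (hx : x ≠ 0)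
    (h : P.SpinorDiffAt ρ Φ (x, y)) : P.diracSphere ρ c Φ (x, y) = 0 := by
  subst hk
  rw [diracSphere_eq c hx (h _ (P.mem_dom_at y))]
  have hx0 : x = x 0 • EuclideanSpace.single (0 : Fin 1) (1 : ℝ) := by
    ext a; fin_cases a; simp
  have hn : ‖x‖ ^ 2 = x 0 ^ 2 := by rw [EuclideanSpace.norm_sq_eq]; simp
  have hn0 : ‖x‖ ≠ 0 := norm_ne_zero_iff.mpr hx
  have h1 : fderiv ℝ (fun x' => Φ (x', y)) x x =
      x 0 • fderiv ℝ (fun x' => Φ (x', y)) x (EuclideanSpace.single (0 : Fin 1) (1 : ℝ)) := by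
    conv_lhs => rw [hx0, map_smul]
    rw [← hx0]
  rw [h1]
  simp only [flatDirac, vecMul_apply, Fin.sum_univ_succ, Fin.sum_univ_zero, add_zero, Nat.cast_zero, zero_div, zero_mul, zero_smul, sub_zero, _root_.smul_apply,
    map_smul_of_tower, smul_smul]
  rw [← sub_smul]
  have : ‖x‖ - ‖x‖⁻¹ * (x 0 * x 0) = 0 := by
    field_simp
    linarith
  rw [this, zero_smul]

theorem diracSphere_const_smul {x : ℍ k} {y : N} (hx : x ≠ 0)
    (h : P.IsSmoothSpinor ρ Φ) (t : ℝ) :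
    P.diracSphere ρ c (fun p => t • Φ p) (x, y) = t • P.diracSphere ρ c Φ (x, y) := by
  have := diracSphere_sum (c := c) (y := y) (v := fun _ : Unit => Φ) (b := fun _ _ => (t : ℂ))
    (b' := fun _ => 0) (fun _ => h) hx (fun _ => hasDerivAt_const _ _)
  simpa using this

theorem diracN_const_smul {x : ℍ k} {y : N} (hx : x ≠ 0)
    (h : P.IsSmoothSpinor ρ Φ) (t : ℝ) :
    P.diracN ρ c (fun p => t • Φ p) (x, y) = t • P.diracN ρ c Φ (x, y) := by
  have := diracN_sum (c := c) (y := y) (v := fun _ : Unit => Φ) (b := fun _ _ => (t : ℂ))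
    (b' := fun _ => 0) (fun _ => h) hx (fun _ => hasDerivAt_const _ _)
  simpa using this

theorem radialMul_radialMul {p : ℍ k × N} (hp : p.1 ≠ 0) :
    radialMul ρ (radialMul ρ Φ) p = -Φ p := by
  have hn : ‖p.1‖ ≠ 0 := norm_ne_zero_iff.mpr hp
  rw [radialMul_eq, radialMul_eq, map_smul_of_tower, vecMul_vecMul, smul_neg,
    smul_neg, smul_smul, smul_smul]
  have : ‖p.1‖⁻¹ * ‖p.1‖⁻¹ * ‖p.1‖ ^ 2 = 1 := by field_simp
  rw [this, one_smul]

theorem IsModeSpinor.isModeBasis {ψ : ℍ k × N → S} (h : P.IsModeSpinor ρ c rho lam ψ)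
    (hrho : rho = 0 → k = 0) :
    P.IsModeBasis ρ c rho lam ![ψ, radialMul ρ ψ, fun q => rho⁻¹ • P.diracSphere ρ c ψ q,
      radialMul ρ (fun q => rho⁻¹ • P.diracSphere ρ c ψ q)] := by
  have s0 : P.IsSmoothSpinor ρ ψ := h.smooth
  have s1 := s0.radialMul
  have sD : P.IsSmoothSpinor ρ (P.diracSphere ρ c ψ) := s0.diracSphere
  have s2 := sD.const_smul rho⁻¹
  have s3 := s2.radialMul
  have h0 := isHomogeneous_of_radialDeriv s0 h.parallel
  have hD : IsHomogeneous (P.diracSphere ρ c ψ) := h0.diracSphere s0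
  have h2 : IsHomogeneous (fun q => rho⁻¹ • P.diracSphere ρ c ψ q) := fun t ht x hx y => by
    simp only [hD t ht x hx y]
  have d0 : ∀ p : ℍ k × N, p.1 ≠ 0 → P.diracSphere ρ c ψ p =
      rho • rho⁻¹ • P.diracSphere ρ c ψ p := by
    rintro ⟨x, y⟩ hp
    by_cases hr : rho = 0
    · rw [diracSphere_eq_zero_of_dim_eq_zero (hrho hr) hp (s0.diffAt hp)]; simp
    · rw [smul_smul, mul_inv_cancel₀ hr, one_smul]
  have d2 : ∀ p : ℍ k × N, p.1 ≠ 0 →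
      P.diracSphere ρ c (fun q => rho⁻¹ • P.diracSphere ρ c ψ q) p = rho • ψ p := by
    rintro ⟨x, y⟩ hp
    rw [diracSphere_const_smul hp sD, h.diracSphere_sq_eq _ hp, smul_smul]
    congr 1
    by_cases hr : rho = 0
    · simp [hr]
    · field_simp
  have n2 : ∀ p : ℍ k × N, p.1 ≠ 0 → P.diracN ρ c (fun q => rho⁻¹ • P.diracSphere ρ c ψ q) p =
        -lam • rho⁻¹ • P.diracSphere ρ c ψ p := by
    rintro ⟨x, y⟩ hp
    rw [diracN_const_smul hp sD, diracN_diracSphere hp s0 h.diracN_eq, smul_comm]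
  have rm : ∀ (Ψ Ψ' : ℍ k × N → S) (t : ℝ) (p : ℍ k × N), Ψ p = t • Ψ' p →
      radialMul ρ Ψ p = t • radialMul ρ Ψ' p := fun Ψ Ψ' t p e => by
    rw [radialMul_eq, radialMul_eq, e, map_smul_of_tower, smul_comm]
  constructor
  · intro j; fin_cases j <;> assumption
  · intro j; fin_cases j
    exacts [h0, h0.radialMul ρ, h2, h2.radialMul ρ]
  · intro j p hp
    fin_cases j <;> simp [modeRad, sum_univ_four, radialMul_radialMul hp]
  · rintro j ⟨x, y⟩ hp
    fin_cases j
    · simpa [modeSph, sum_univ_four] using d0 _ hp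
    · simpa [modeSph, sum_univ_four, diracSphere_radialMul hp s0] using rm _ _ _ _ (d0 _ hp)
    · simpa [modeSph, sum_univ_four] using d2 _ hp
    · simpa [modeSph, sum_univ_four, diracSphere_radialMul hp s2] using rm _ _ _ _ (d2 _ hp)
  · rintro j ⟨x, y⟩ hp
    fin_cases j
    · simpa [modeN, sum_univ_four] using h.diracN_eq _ hp
    · simpa [modeN, sum_univ_four, diracN_radialMul hp s0] using
        rm _ _ _ _ (h.diracN_eq _ hp)
    · simpa [modeN, sum_univ_four] using n2 _ hp
    · have := rm _ (fun q => rho⁻¹ • P.diracSphere ρ c ψ q) _ _ (n2 _ hp)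
      simp only [neg_smul] at this
      simp [modeN, sum_univ_four, diracN_radialMul hp s2, this]

end SpinStructure

/-- The coefficient matrix of the radial equation in a mode; the sign `ε` is that of `D^N - μ`. -/
def modeGen (ε : ℂ) (k : ℕ) (c rho lam : ℝ) (μ : ℂ) (r : ℝ) : Matrix (Fin 4) (Fin 4) ℂ :=
  ε • modeA lam μ + ((sinhC c r)⁻¹ : ℂ) • modeB rho - ((k / 2 * cothC c r : ℝ) : ℂ) • 1

namespace SpinStructure

theorem prodDeriv_congr {p : ℍ k × N} (h : Φ =ᶠ[nhds p] Ψ) (a : Fin (k + 1) ⊕ Fin n) :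
    P.prodDeriv ρ c Φ a p = P.prodDeriv ρ c Ψ a p := by
  have h1 : P.prodLoc ρ Φ (P.indexAt p.2) =ᶠ[nhds p] P.prodLoc ρ Ψ (P.indexAt p.2) := by
    filter_upwards [h] with q hq
    simp only [prodLoc_eq, hq]
  simp only [prodDeriv, frameSpinDeriv, h1.mfderiv_eq, h1.self_of_nhds]
  rfl

theorem radialDeriv_congr {p : ℍ k × N} (h : Φ =ᶠ[nhds p] Ψ) :
    P.radialDeriv ρ c Φ p = P.radialDeriv ρ c Ψ p := by
  simp only [radialDeriv, prodDeriv_congr h]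

theorem prodDirac_congr {p : ℍ k × N} (h : Φ =ᶠ[nhds p] Ψ) :
    P.prodDirac ρ c Φ p = P.prodDirac ρ c Ψ p := by
  simp only [prodDirac, prodDeriv_congr h]

theorem diracN_congr {p : ℍ k × N} (h : Φ =ᶠ[nhds p] Ψ) :
    P.diracN ρ c Φ p = P.diracN ρ c Ψ p := by
  simp only [diracN, prodDeriv_congr h]

theorem diracSphere_congr {p : ℍ k × N} (h : Φ =ᶠ[nhds p] Ψ) :
    P.diracSphere ρ c Φ p = P.diracSphere ρ c Ψ p := by
  simp only [diracSphere, partialDiracSphere, radialMul, radialDeriv_congr h, prodDeriv_congr h,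
    h.self_of_nhds]

theorem eventuallyEq_of_ne_zero (h : ∀ p : ℍ k × N, p.1 ≠ 0 → Φ p = Ψ p)
    {p : ℍ k × N} (hp : p.1 ≠ 0) : Φ =ᶠ[nhds p] Ψ := by
  filter_upwards [(isOpen_ne.preimage continuous_fst).mem_nhds hp] with q hq using h q hq

section Operators

variable {b : ℝ → Fin 4 → ℂ} {b' : Fin 4 → ℂ}
  {x : ℍ k} {y : N}

theorem IsModeBasis.modeEval_rad (hv : P.IsModeBasis ρ c rho lam v)
    {p : ℍ k × N} (hp : p.1 ≠ 0) (d : Fin 4 → ℂ) :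
    modeEval v p (modeRad.mulVec d) = ‖p.1‖⁻¹ • vecMul ρ p.1 (modeEval v p d) := by
  rw [modeEval_mulVec, modeEval_apply, map_sum, smul_sum]
  refine sum_congr rfl fun j _ => ?_
  rw [← hv.rad_eq j p hp, radialMul_eq, map_smul, smul_comm]

theorem IsModeBasis.spinorDiffAt (hv : P.IsModeBasis ρ c rho lam v)
    (hx : x ≠ 0) (hb : HasDerivAt b b' ‖x‖) :
    P.SpinorDiffAt ρ (fun p => modeEval v p (b ‖p.1‖)) (x, y) := by
  simp only [modeEval_apply]
  exact spinorDiffAt_sum (b := fun j r => b r j) hv.smooth hx (hasDerivAt_pi.mp hb)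

theorem IsModeBasis.diracSphere_modeEval (hv : P.IsModeBasis ρ c rho lam v)
    (hx : x ≠ 0) (hb : HasDerivAt b b' ‖x‖) :
    P.diracSphere ρ c (fun p => modeEval v p (b ‖p.1‖)) (x, y) =
      modeEval v (x, y) ((modeSph rho).mulVec (b ‖x‖)) := by
  rw [modeEval_mulVec]
  simp only [modeEval_apply]
  rw [diracSphere_sum (b := fun j r => b r j) hv.smooth hx (hasDerivAt_pi.mp hb)]
  exact sum_congr rfl fun j _ => by rw [hv.sph_eq j _ hx]

theorem IsModeBasis.diracN_modeEval (hv : P.IsModeBasis ρ c rho lam v)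
    (hx : x ≠ 0) (hb : HasDerivAt b b' ‖x‖) :
    P.diracN ρ c (fun p => modeEval v p (b ‖p.1‖)) (x, y) =
      modeEval v (x, y) ((modeN lam).mulVec (b ‖x‖)) := by
  rw [modeEval_mulVec]
  simp only [modeEval_apply]
  rw [diracN_sum (b := fun j r => b r j) hv.smooth hx (hasDerivAt_pi.mp hb)]
  exact sum_congr rfl fun j _ => by rw [hv.diracN_eq j _ hx]

theorem IsModeBasis.radialDeriv_modeEval (hv : P.IsModeBasis ρ c rho lam v)
    (hx : x ≠ 0) (hb : HasDerivAt b b' ‖x‖) :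
    P.radialDeriv ρ c (fun p => modeEval v p (b ‖p.1‖)) (x, y) = modeEval v (x, y) b' := by
  simp only [modeEval_apply]
  exact radialDeriv_sum (b := fun j r => b r j) hv.smooth hv.homogeneous hx (hasDerivAt_pi.mp hb)

theorem IsModeBasis.modeEval_smul (hv : P.IsModeBasis ρ c rho lam v)
    {t : ℝ} (ht : 0 < t) (hx : x ≠ 0) (d : Fin 4 → ℂ) :
    modeEval v (t • x, y) d = modeEval v (x, y) d := by
  simp only [modeEval_apply, hv.homogeneous _ t ht x hx y]

theorem IsModeBasis.modeEval_sph_eq_zero (hv : P.IsModeBasis ρ c rho lam v) {d : Fin 4 → ℂ}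
    (hd : ∀ p : ℍ k × N, p.1 ≠ 0 → modeEval v p d = 0) {p : ℍ k × N} (hp : p.1 ≠ 0) :
    modeEval v p ((modeSph rho).mulVec d) = 0 := by
  obtain ⟨x, y⟩ := p
  rw [← hv.diracSphere_modeEval hp (hasDerivAt_const ‖x‖ d),
    diracSphere_congr (eventuallyEq_of_ne_zero (Ψ := fun _ => 0) hd hp)]
  simpa using diracSphere_sum (P := P) (ρ := ρ) (c := c) (y := y) (J := Empty) (v := fun _ _ => 0)
    (b := fun _ _ => 0) (b' := fun _ => 0) (fun j => j.elim) hp (fun j => j.elim)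

theorem IsModeBasis.modeEval_modeN_eq_zero (hv : P.IsModeBasis ρ c rho lam v) {d : Fin 4 → ℂ}
    (hd : ∀ p : ℍ k × N, p.1 ≠ 0 → modeEval v p d = 0) {p : ℍ k × N} (hp : p.1 ≠ 0) :
    modeEval v p ((modeN lam).mulVec d) = 0 := by
  obtain ⟨x, y⟩ := p
  rw [← hv.diracN_modeEval hp (hasDerivAt_const ‖x‖ d),
    diracN_congr (eventuallyEq_of_ne_zero (Ψ := fun _ => 0) hd hp)]
  simpa using diracN_sum (P := P) (ρ := ρ) (c := c) (y := y) (J := Empty) (v := fun _ _ => 0)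
    (b := fun _ _ => 0) (b' := fun _ => 0) (fun j => j.elim) hp (fun j => j.elim)

theorem IsModeBasis.modeEval_modeB_eq_zero (hv : P.IsModeBasis ρ c rho lam v) {d : Fin 4 → ℂ}
    (hd : ∀ p : ℍ k × N, p.1 ≠ 0 → modeEval v p d = 0) {p : ℍ k × N} (hp : p.1 ≠ 0) :
    modeEval v p ((modeB rho).mulVec d) = 0 := by
  rw [modeB, ← mulVec_mulVec, hv.modeEval_rad hp, hv.modeEval_sph_eq_zero hd hp]
  simp

theorem IsModeBasis.modeEval_modeA_eq_zero (hv : P.IsModeBasis ρ c rho lam v) {d : Fin 4 → ℂ}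
    (hd : ∀ p : ℍ k × N, p.1 ≠ 0 → modeEval v p d = 0) {p : ℍ k × N} (hp : p.1 ≠ 0) :
    modeEval v p ((modeA lam μ).mulVec d) = 0 := by
  rw [modeA, ← mulVec_mulVec, hv.modeEval_rad hp, sub_mulVec, map_sub,
    hv.modeEval_modeN_eq_zero hd hp, smul_mulVec, one_mulVec, map_smul, hd p hp]
  simp

/-- The radial equation satisfied by the coefficients of a solution. -/
theorem IsModeBasis.modeEval_deriv_eq (hv : P.IsModeBasis ρ c rho lam v)
    (hx : x ≠ 0) (hb : HasDerivAt b b' ‖x‖)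
    (hD : P.prodDirac ρ c (fun p => modeEval v p (b ‖p.1‖)) (x, y) =
      μ • modeEval v (x, y) (b ‖x‖)) :
    modeEval v (x, y) b' = modeEval v (x, y) ((modeGen 1 k c rho lam μ ‖x‖).mulVec (b ‖x‖)) := by
  have hn : ‖x‖ ≠ 0 := norm_ne_zero_iff.mpr hx
  rw [prodDirac_eq c hx, radialMul_eq, radialMul_eq, hv.radialDeriv_modeEval hx hb,
    hv.diracSphere_modeEval hx hb, hv.diracN_modeEval hx hb] at hD
  simp only at hD
  rw [← hv.modeEval_rad (p := (x, y)) hx, ← hv.modeEval_rad (p := (x, y)) hx] at hD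
  have h1 : modeEval v (x, y) (modeRad.mulVec b') = modeEval v (x, y)
      (μ • b ‖x‖ - ((sinhC c ‖x‖)⁻¹ : ℂ) • (modeSph rho).mulVec (b ‖x‖) -
        ((k / 2 * cothC c ‖x‖ : ℝ) : ℂ) • modeRad.mulVec (b ‖x‖) - (modeN lam).mulVec (b ‖x‖)) := by
    simp only [map_sub, map_smul]
    rw [← hD]
    simp only [← coe_smul, Complex.ofReal_inv]
    abel
  have h2 := congrArg (fun s => ‖x‖⁻¹ • vecMul ρ x s) h1
  rw [← hv.modeEval_rad (p := (x, y)) hx, ← hv.modeEval_rad (p := (x, y)) hx,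
    mulVec_mulVec, modeRad_sq] at h2
  have h3 : (modeGen 1 k c rho lam μ ‖x‖).mulVec (b ‖x‖) = -modeRad.mulVec
      (μ • b ‖x‖ - ((sinhC c ‖x‖)⁻¹ : ℂ) • (modeSph rho).mulVec (b ‖x‖) -
        ((k / 2 * cothC c ‖x‖ : ℝ) : ℂ) • modeRad.mulVec (b ‖x‖) - (modeN lam).mulVec (b ‖x‖)) := by
    simp only [modeGen, modeA, modeB, Matrix.mulVec_sub, Matrix.mulVec_smul, mulVec_mulVec,
      modeRad_sq, add_mulVec, sub_mulVec, smul_mulVec, one_mulVec,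
      Matrix.neg_mulVec, Matrix.mul_sub, Matrix.mul_smul, Matrix.mul_one, one_smul, smul_neg]
    abel
  rw [h3, map_neg, ← h2, Matrix.neg_mulVec, one_mulVec, map_neg, neg_neg]

end Operators

/-- Coefficients with respect to a mode basis that vary differentiably with the radius. The
projection `Pr` removes the indeterminacy of coefficients when the basis is linearly dependent. -/
structure IsModeCoeff (k : ℕ) {n : ℕ} {N S : Type*} [NormedAddCommGroup S] [InnerProductSpace ℂ S]
    (c rho lam r₀ : ℝ) (μ : ℂ) (v : Fin 4 → ℍ k × N → S)
    (Pr : (Fin 4 → ℂ) →ₗ[ℂ] (Fin 4 → ℂ)) (a : ℝ → Fin 4 → ℂ) : Prop where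
  proj : ∀ (p : ℍ k × N) (b : Fin 4 → ℂ), p.1 ≠ 0 → modeEval v p (Pr b) = modeEval v p b
  proj_coeff : ∀ r, r₀ < r → Pr (a r) = a r
  hasDerivAt : ∀ r, r₀ < r → HasDerivAt a (Pr ((modeGen 1 k c rho lam μ r).mulVec (a r))) r
  l2 : ∫⁻ r in Set.Ioi r₀, ‖a r‖ₑ ^ 2 * ofReal (sinhC c r ^ k) < ⊤

theorem IsModeSolution.exists_coeff [CompactSpace N] [MeasurableSpace N] [BorelSpace N]
    (hr₀ : 0 < r₀) (h : P.IsModeSolution ρ c μ rho lam r₀ φ) (hrho : rho = 0 → k = 0) :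
    ∃ (v : Fin 4 → ℍ k × N → S) (Pr : (Fin 4 → ℂ) →ₗ[ℂ] (Fin 4 → ℂ)) (a : ℝ → Fin 4 → ℂ),
      P.IsModeBasis ρ c rho lam v ∧ IsModeCoeff k (n := n) c rho lam r₀ μ v Pr a ∧
      ∀ p, r₀ < ‖p.1‖ → φ p = modeEval v p (a ‖p.1‖) := by
  classical
  obtain ⟨ψ, φ₁, φ₂, φ₃, φ₄, hψ, hφ⟩ := h.mode
  have hdiff : ∀ p : ℍ k × N, r₀ < ‖p.1‖ → P.SpinorDiffAt ρ φ p :=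
    fun p hp i hi => h.differentiable i p hp hi
  obtain ⟨v, hv, β, hβ⟩ : ∃ v, P.IsModeBasis ρ c rho lam v ∧ ∃ β : ℝ → Fin 4 → ℂ,
      ∀ p, r₀ < ‖p.1‖ → φ p = modeEval v p (β ‖p.1‖) := by
    refine ⟨_, hψ.isModeBasis hrho, fun r => ![φ₁ r, φ₂ r, φ₃ r, φ₄ r], fun p hp => ?_⟩
    simpa [modeEval_apply, sum_univ_four] using hφ p hp
  have hunit : ∀ p : ℍ k × N, p.1 ≠ 0 → ∃ x₀ : ℍ k, ‖x₀‖ = 1 ∧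
      ∀ d, modeEval v p d = modeEval v (x₀, p.2) d := by
    rintro ⟨x, y⟩ hp
    have hp' : 0 < ‖x‖ := norm_pos_iff.mpr hp
    refine ⟨‖x‖⁻¹ • x, by rw [norm_smul, norm_inv, norm_norm, inv_mul_cancel₀ hp'.ne'], fun d => ?_⟩
    exact (hv.modeEval_smul (inv_pos.mpr hp') hp d).symm
  have hβ1 : ∀ (x : ℍ k) (y : N) (r : ℝ), ‖x‖ = 1 → r₀ < r →
      φ (r • x, y) = modeEval v (x, y) (β r) := by
    intro x y r hx hr
    have hr' := hr₀.trans hr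
    have hx' : x ≠ 0 := by rintro rfl; simp at hx
    have hn : ‖r • x‖ = r := by rw [norm_smul, hx, mul_one, norm_of_nonneg hr'.le]
    have := hβ (r • x, y) (by simpa only [hn] using hr)
    simp only [hn] at this
    rw [this, hv.modeEval_smul hr' hx']
  obtain ⟨F, hFG, hF⟩ := exists_finset_ker_le (modeEval v) {p : ℍ k × N | ‖p.1‖ = 1 ∧
    ∫⁻ r in Set.Ioi r₀, ‖φ (r • p.1, p.2)‖ₑ ^ 2 * ofReal (sinhC c r ^ k) < ⊤}
  let f : (Fin 4 → ℂ) →ₗ[ℂ] (F → S) := LinearMap.pi fun z => modeEval v z.1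
  obtain ⟨L, hL⟩ := f.exists_pseudoinverse
  let a : ℝ → Fin 4 → ℂ := fun r => L fun z : F => φ (r • z.1.1, z.1.2)
  have hFn : ∀ z : F, ‖z.1.1‖ = 1 := fun z => (hFG z.2).1
  have haβ : ∀ r, r₀ < r → a r = L (f (β r)) := fun r hr => by
    simp only [a]
    congr 1
    ext1 z
    exact hβ1 _ _ r (hFn z) hr
  have hsep : ∀ d, f d = 0 → ∀ p : ℍ k × N, p.1 ≠ 0 → modeEval v p d = 0 := by
    intro d hd p hp
    obtain ⟨x₀, hx₀, e⟩ := hunit p hp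
    rw [e]
    by_contra hne
    have hx0 : x₀ ≠ 0 := by rintro rfl; simp at hx₀
    have hc := (hv.spinorDiffAt (y := p.2) hx0 (hasDerivAt_const ‖x₀‖ d)).continuousAt_norm
    have hV := hc.eventually (lt_mem_nhds (norm_pos_iff.mpr hne))
    obtain ⟨z, hzV, hz1, hz⟩ := exists_ray_l2 hr₀.le hdiff h.l2 hx₀ hV
    have := hF d (fun z hz => congrFun hd ⟨z, hz⟩) z ⟨hz1, hz⟩
    rw [Set.mem_ofPred_eq, this] at hzV
    simp at hzV
  have hproj : ∀ (p : ℍ k × N) (b : Fin 4 → ℂ), p.1 ≠ 0 →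
      modeEval v p ((L ∘ₗ f) b) = modeEval v p b := by
    intro p b hp
    rw [← sub_eq_zero, ← map_sub]
    refine hsep _ ?_ p hp
    rw [map_sub, LinearMap.comp_apply, hL, sub_self]
  have hφa : ∀ p, r₀ < ‖p.1‖ → φ p = modeEval v p (a ‖p.1‖) := fun p hp => by
    have hp0 : p.1 ≠ 0 := norm_pos_iff.mp (hr₀.trans hp)
    rw [hβ p hp, haβ _ hp]
    exact (hproj p _ hp0).symm
  have hray : ∀ (r : ℝ) (z : F), r₀ < r →
      DifferentiableAt ℝ (fun r : ℝ => φ (r • z.1.1, z.1.2)) r := by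
    intro r z hr
    have hn : ‖r • z.1.1‖ = r := by
      rw [norm_smul, hFn z, mul_one, norm_of_nonneg (hr₀.trans hr).le]
    have h1 := (hdiff (r • z.1.1, z.1.2) (by simpa only [hn] using hr)).differentiableAt
    exact DifferentiableAt.comp (f := fun r : ℝ => r • z.1.1) r h1 (differentiableAt_id.smul_const z.1.1)
  have hLc : Continuous L := L.continuous_of_finiteDimensional
  have hda : ∀ r, r₀ < r → DifferentiableAt ℝ a r := fun r hr => by
    have h1 : DifferentiableAt ℝ (fun r : ℝ => fun z : F => φ (r • z.1.1, z.1.2)) r :=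
      differentiableAt_pi.mpr fun z => hray r z hr
    exact ((L.toContinuousLinearMap.restrictScalars ℝ).differentiableAt).comp r h1
  have hpa : ∀ r, r₀ < r → (L ∘ₗ f) (a r) = a r := fun r hr => by
    rw [haβ r hr, LinearMap.comp_apply, hL]
  refine ⟨v, L ∘ₗ f, a, hv, ⟨hproj, hpa, fun r hr => ?_, ?_⟩, hφa⟩
  · obtain ⟨a', ha'⟩ : ∃ a', HasDerivAt a a' r := ⟨_, (hda r hr).hasDerivAt⟩
    have hr' : 0 < r := hr₀.trans hr
    have h1 : f a' = f ((modeGen 1 k c rho lam μ r).mulVec (a r)) := by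
      ext1 z
      change modeEval v z.1 a' = modeEval v z.1 _
      obtain ⟨⟨x, y⟩, hz⟩ := z
      have hx1 : ‖x‖ = 1 := hFn ⟨⟨x, y⟩, hz⟩
      have hx0 : x ≠ 0 := by rintro rfl; simp at hx1
      have hn : ‖r • x‖ = r := by rw [norm_smul, hx1, mul_one, norm_of_nonneg hr'.le]
      have hrx : r • x ≠ 0 := smul_ne_zero hr'.ne' hx0
      have hb : HasDerivAt a a' ‖r • x‖ := by rw [hn]; exact ha'
      have he : φ =ᶠ[nhds (r • x, y)] fun p => modeEval v p (a ‖p.1‖) := by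
        filter_upwards [(isOpen_lt continuous_const continuous_fst.norm).mem_nhds
          (show r₀ < ‖((r • x, y) : ℍ k × N).1‖ by simpa only [hn] using hr)] with q hq
        exact hφa q hq
      have hD := h.dirac_eq (r • x, y) (by simpa only [hn] using hr)
      rw [prodDirac_congr he, he.self_of_nhds] at hD
      have := hv.modeEval_deriv_eq hrx hb hD
      rw [hn, hv.modeEval_smul hr' hx0, hv.modeEval_smul hr' hx0] at this
      exact this
    have h2 : (L ∘ₗ f) a' = a' := by
      have h3 : HasDerivAt (fun r => (L ∘ₗ f) (a r)) ((L ∘ₗ f) a') r :=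
        (((L ∘ₗ f).toContinuousLinearMap.restrictScalars ℝ).hasFDerivAt).comp_hasDerivAt r ha'
      refine (h3.congr_of_eventuallyEq ?_).unique ha' |>.symm ▸ rfl
      filter_upwards [lt_mem_nhds hr] with s hs
      exact (hpa s hs).symm
    rw [LinearMap.comp_apply, ← h1, ← LinearMap.comp_apply, h2]
    exact ha'
  · obtain ⟨C, hC0, hC⟩ : ∃ C : NNReal, True ∧ ∀ w : F → S, ‖L w‖ₑ ≤ C * ‖w‖ₑ :=
      ⟨‖L.toContinuousLinearMap‖₊, trivial, fun w => by
        have := L.toContinuousLinearMap.le_opNNNorm w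
        rw [enorm_eq_nnnorm, enorm_eq_nnnorm]
        exact_mod_cast this⟩
    have h1 : ∀ r, ‖a r‖ₑ ^ 2 ≤ (C : ℝ≥0∞) ^ 2 * ∑ z : F, ‖φ (r • z.1.1, z.1.2)‖ₑ ^ 2 := by
      intro r
      refine (pow_le_pow_left₀ zero_le (hC _) 2).trans ?_
      rw [mul_pow]
      gcongr
      by_cases hF0 : Nonempty F
      · obtain ⟨z, hz⟩ : ∃ z : F, ‖fun z : F => φ (r • z.1.1, z.1.2)‖ = ‖φ (r • z.1.1, z.1.2)‖ := by
          obtain ⟨z, hz⟩ := Finite.exists_max fun z : F => ‖φ (r • z.1.1, z.1.2)‖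
          exact ⟨z, le_antisymm ((pi_norm_le_iff_of_nonneg (norm_nonneg _)).mpr hz)
            (norm_le_pi_norm (fun z : F => φ (r • z.1.1, z.1.2)) z)⟩
        have hz' : ‖fun z : F => φ (r • z.1.1, z.1.2)‖ₑ = ‖φ (r • z.1.1, z.1.2)‖ₑ := by
          rw [← ofReal_norm, ← ofReal_norm, hz]
        rw [hz']
        exact Finset.single_le_sum (f := fun z : F => ‖φ (r • z.1.1, z.1.2)‖ₑ ^ 2)
          (fun _ _ => zero_le) (Finset.mem_univ z)
      · have := not_nonempty_iff.mp hF0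
        have : (fun z : F => φ (r • z.1.1, z.1.2)) = 0 := Subsingleton.elim _ _
        rw [this]; simp
    calc ∫⁻ r in Set.Ioi r₀, ‖a r‖ₑ ^ 2 * ofReal (sinhC c r ^ k)
        ≤ ∫⁻ r in Set.Ioi r₀, (C : ℝ≥0∞) ^ 2 * ∑ z : F,
            ‖φ (r • z.1.1, z.1.2)‖ₑ ^ 2 * ofReal (sinhC c r ^ k) := by
          refine lintegral_mono fun r => ?_
          rw [← sum_mul, ← mul_assoc]
          gcongr
          exact h1 r
      _ = (C : ℝ≥0∞) ^ 2 * ∑ z : F, ∫⁻ r in Set.Ioi r₀,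
            ‖φ (r • z.1.1, z.1.2)‖ₑ ^ 2 * ofReal (sinhC c r ^ k) := by
          rw [lintegral_const_mul' _ _ (by simp), lintegral_finsetSum']
          intro z _
          refine AEMeasurable.mul (f := fun r => ‖φ (r • z.1.1, z.1.2)‖ₑ ^ 2) ?_ ?_
          · refine ContinuousOn.aemeasurable (fun r hr => ?_) measurableSet_Ioi
            exact ((ENNReal.continuous_pow 2).continuousAt.comp
              (continuous_enorm.continuousAt.comp (hray r z hr).continuousAt)).continuousWithinAt
          · exact ((continuous_iff_continuousAt.mpr fun r =>
              (hasDerivAt_sinhC c r).continuousAt).pow k).measurable.ennreal_ofReal.aemeasurable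
      _ < ⊤ := by
          refine ENNReal.mul_lt_top (by simp) ?_
          exact ENNReal.sum_lt_top.mpr fun z _ => (hFG z.2).2

end SpinStructure
end L2Chart

theorem le_sinhC {c r : ℝ} (hc : 0 ≤ c) (hr : 0 ≤ r) : r ≤ sinhC c r := by
  unfold sinhC
  split_ifs with h
  · exact le_rfl
  · have hc' : 0 < c := lt_of_le_of_ne hc (Ne.symm h)
    rw [le_div_iff₀ hc', mul_comm]
    exact Real.self_le_sinh_iff.mpr (by positivity)

theorem coshC_pos (c r : ℝ) : 0 < coshC c r := by
  unfold coshC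
  split_ifs
  exacts [one_pos, Real.cosh_pos _]

theorem sq_mul_coshC_le {c r : ℝ} (hc : 0 ≤ c) (hr : 0 ≤ r) :
    r ^ 2 * coshC c r ≤ 2 * sinhC c r ^ 2 := by
  unfold sinhC coshC
  split_ifs with h
  · nlinarith [sq_nonneg r]
  · have hc' : 0 < c := lt_of_le_of_ne hc (Ne.symm h)
    set x := c * r / 2 with hx
    have hx0 : 0 ≤ x := by positivity
    have e : c * r = 2 * x := by rw [hx]; ring
    have h1 : x ≤ Real.sinh x := Real.self_le_sinh_iff.mpr hx0
    have h2 : Real.cosh (2 * x) ≤ 2 * Real.cosh x ^ 2 := by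
      rw [Real.cosh_two_mul]; nlinarith [Real.cosh_sq x]
    rw [div_pow, mul_div_assoc', le_div_iff₀ (by positivity)]
    calc r ^ 2 * Real.cosh (c * r) * c ^ 2 = (2 * x) ^ 2 * Real.cosh (2 * x) := by rw [← e]; ring
      _ ≤ (2 * Real.sinh x) ^ 2 * (2 * Real.cosh x ^ 2) := by gcongr
      _ = 2 * Real.sinh (c * r) ^ 2 := by rw [e, Real.sinh_two_mul]; ring

/-- A function with `‖w'‖ ≤ K ‖w‖` is bounded at infinity if it is square integrable. -/
theorem exists_bound_of_norm_deriv_le {F : Type*} [NormedAddCommGroup F] [NormedSpace ℝ F]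
    {w w' : ℝ → F} {r₀ R K : ℝ} (hR : r₀ < R) (hw : ∀ r, r₀ < r → HasDerivAt w (w' r) r)
    (hK : ∀ r, R ≤ r → ‖w' r‖ ≤ K * ‖w r‖) (hl2 : ∫⁻ r in Set.Ioi r₀, ‖w r‖ₑ ^ 2 < ⊤) :
    ∃ M, ∀ r, R ≤ r → ‖w r‖ ≤ M := by
  set I := ∫⁻ r in Set.Ioi r₀, ‖w r‖ₑ ^ 2
  set E := Real.exp |K|
  refine ⟨√(ofReal E ^ 2 * I).toReal, fun r hr => ?_⟩
  have h1 : ∀ t ∈ Set.Ioc r (r + 1), ‖w r‖ ≤ E * ‖w t‖ := by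
    intro t ht
    have hd : ∀ τ ∈ Set.Icc 0 (t - r), HasDerivAt (fun τ => w (t - τ)) (-w' (t - τ)) τ := by
      intro τ hτ
      have h2 := (hw (t - τ) (by linarith [hτ.2])).scomp τ ((hasDerivAt_id τ).const_sub t)
      simpa [Function.comp_def] using h2
    have h3 := norm_le_gronwallBound_of_norm_deriv_right_le (f := fun τ => w (t - τ))
      (f' := fun τ => -w' (t - τ)) (δ := ‖w t‖) (K := K) (ε := 0) (a := 0) (b := t - r)
      (fun τ hτ => (hd τ hτ).continuousAt.continuousWithinAt)
      (fun τ hτ => (hd τ ⟨hτ.1, hτ.2.le⟩).hasDerivWithinAt) (by simp)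
      (fun τ hτ => by
        rw [norm_neg, add_zero]
        exact hK _ (by linarith [hτ.2])) (t - r) ⟨by linarith [ht.1], le_rfl⟩
    rw [gronwallBound_ε0] at h3
    simp only [sub_sub_cancel, sub_zero] at h3
    rw [mul_comm]
    refine h3.trans ?_
    refine mul_le_mul_of_nonneg_left (Real.exp_le_exp.mpr ?_) (norm_nonneg _)
    calc K * (t - r) ≤ |K| * (t - r) := by
          gcongr
          · linarith [ht.1]
          · exact le_abs_self K
      _ ≤ |K| * 1 := by gcongr; linarith [ht.2]
      _ = |K| := mul_one _
  have h2 : ‖w r‖ₑ ^ 2 ≤ ofReal E ^ 2 * I := by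
    calc ‖w r‖ₑ ^ 2 = ∫⁻ _ in Set.Ioc r (r + 1), ‖w r‖ₑ ^ 2 := by simp
      _ ≤ ∫⁻ t in Set.Ioc r (r + 1), ofReal E ^ 2 * ‖w t‖ₑ ^ 2 := by
          refine setLIntegral_mono' measurableSet_Ioc fun t ht => ?_
          rw [← mul_pow, ← ofReal_norm, ← ofReal_norm, ← ENNReal.ofReal_mul (Real.exp_pos _).le]
          gcongr
          exact h1 t ht
      _ = ofReal E ^ 2 * ∫⁻ t in Set.Ioc r (r + 1), ‖w t‖ₑ ^ 2 :=
          lintegral_const_mul' _ _ (by simp)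
      _ ≤ _ := by
          gcongr
          exact lintegral_mono_set fun t ht => lt_of_lt_of_le hR (hr.trans ht.1.le)
  have h3 : ofReal E ^ 2 * I ≠ ⊤ := (ENNReal.mul_lt_top (by simp) hl2).ne
  refine Real.le_sqrt_of_sq_le ?_
  have h4 := ENNReal.toReal_mono h3 h2
  simpa using h4

theorem LinearMap.hasDerivAt_comp {F : Type*} [NormedAddCommGroup F] [NormedSpace ℂ F]
    (T : (Fin 4 → ℂ) →ₗ[ℂ] F) {w : ℝ → Fin 4 → ℂ} {w' : Fin 4 → ℂ} {r : ℝ}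
    (hw : HasDerivAt w w' r) : HasDerivAt (fun r => T (w r)) (T w') r :=
  ((T.toContinuousLinearMap.restrictScalars ℝ).hasFDerivAt).comp_hasDerivAt r hw

/-- The projections onto the eigenspaces of `modeB`, up to the degenerate case `rho = 0`. -/
def modeProj (rho σ : ℝ) : Matrix (Fin 4) (Fin 4) ℂ :=
  (1 / 2 : ℂ) • (1 + ((σ * rho⁻¹ : ℝ) : ℂ) • modeB rho)

theorem modeProj_mul_modeB {rho σ : ℝ} (hσ : σ ^ 2 = 1) :
    modeProj rho σ * modeB rho = ((σ * rho : ℝ) : ℂ) • modeProj rho σ := by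
  by_cases hr : rho = 0
  · have : modeB rho = 0 := by simp [modeB, modeSph, hr]
    rw [this, hr]
    simp
  · have hr' : (rho : ℂ) ≠ 0 := by exact_mod_cast hr
    have hσ' : (σ : ℂ) ^ 2 = 1 := by exact_mod_cast hσ
    rw [modeProj, Matrix.smul_mul, add_mul, one_mul, Matrix.smul_mul, modeB_sq, smul_comm _ (1 / 2 : ℂ)]
    congr 1
    rw [smul_add, smul_smul, smul_smul, add_comm]
    congr 1
    · congr 1
      push_cast
      field_simp
    · have : ((σ * rho : ℝ) : ℂ) * ((σ * rho⁻¹ : ℝ) : ℂ) = 1 := by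
        push_cast
        field_simp
        exact hσ'
      rw [this, one_smul]

theorem modeProj_add (rho : ℝ) : modeProj rho 1 + modeProj rho (-1) = 1 := by
  rw [modeProj, modeProj, ← smul_add]
  simp only [neg_mul, one_mul, Complex.ofReal_neg, neg_smul]
  rw [add_add_add_comm, add_neg_cancel, add_zero, ← two_smul ℂ, smul_smul]
  norm_num

section Decay

variable {n k : ℕ} {N : Type*} {S : Type*} [NormedAddCommGroup S] [InnerProductSpace ℂ S]
  {c rho lam r₀ : ℝ} {μ : ℂ} {v : Fin 4 → ℍ k × N → S}
  {Pr : (Fin 4 → ℂ) →ₗ[ℂ] (Fin 4 → ℂ)} {a : ℝ → Fin 4 → ℂ}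

namespace SpinStructure

/-- The coefficients after rescaling by `sinh_c(r)^{k/2}`. -/
def scaledCoeff (k : ℕ) (c : ℝ) (a : ℝ → Fin 4 → ℂ) (r : ℝ) : Fin 4 → ℂ :=
  (sinhC c r ^ ((k : ℝ) / 2)) • a r

theorem IsModeCoeff.hasDerivAt_scaledCoeff
    (h : IsModeCoeff k (n := n) c rho lam r₀ μ v Pr a) (hr₀ : 0 < r₀) {r : ℝ} (hr : r₀ < r) :
    HasDerivAt (scaledCoeff k c a) (Pr ((modeA lam μ + ((sinhC c r)⁻¹ : ℂ) • modeB rho).mulVec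
      (scaledCoeff k c a r))) r := by
  have hs : 0 < sinhC c r := sinhC_pos (hr₀.trans hr)
  have h1 := ((hasDerivAt_sinhC c r).rpow_const (p := (k : ℝ) / 2) (Or.inl hs.ne')).smul
    (h.hasDerivAt r hr)
  refine h1.congr_deriv ?_
  have e : coshC c r * (k / 2) * sinhC c r ^ ((k : ℝ) / 2 - 1) =
      sinhC c r ^ ((k : ℝ) / 2) * (k / 2 * cothC c r) := by
    rw [Real.rpow_sub_one hs.ne', cothC_eq]; ring
  rw [e]
  simp only [scaledCoeff, modeGen, one_smul, sub_mulVec, map_sub, smul_mulVec,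
    one_mulVec, Matrix.mulVec_smul, LinearMap.map_smul_of_tower,
    h.proj_coeff r hr, smul_sub]
  rw [coe_smul, smul_smul, sub_add_cancel]

theorem norm_scaledCoeff_sq {r : ℝ} (hr : 0 < r) :
    ‖scaledCoeff k c a r‖ₑ ^ 2 = ‖a r‖ₑ ^ 2 * ofReal (sinhC c r ^ k) := by
  have hs : 0 < sinhC c r := sinhC_pos hr
  rw [scaledCoeff, enorm_smul, mul_pow, mul_comm, Real.enorm_eq_ofReal (by positivity),
    ← ENNReal.ofReal_pow (by positivity), ← Real.rpow_natCast (_ ^ _), ← Real.rpow_mul hs.le]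
  congr 2
  rw [← Real.rpow_natCast]
  congr 1
  push_cast
  ring

theorem IsModeCoeff.exists_scaledCoeff_bound
    (h : IsModeCoeff k (n := n) c rho lam r₀ μ v Pr a) (hc : 0 ≤ c) (hr₀ : 0 < r₀) {R : ℝ}
    (hR : r₀ < R) : ∃ M, ∀ r, R ≤ r → ‖scaledCoeff k c a r‖ ≤ M := by
  set TA := (Pr ∘ₗ (modeA lam μ).mulVecLin).toContinuousLinearMap
  set TB := (Pr ∘ₗ (modeB rho).mulVecLin).toContinuousLinearMap
  refine exists_bound_of_norm_deriv_le (K := ‖TA‖ + R⁻¹ * ‖TB‖) hR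
    (fun r hr => h.hasDerivAt_scaledCoeff hr₀ hr) (fun r hr => ?_) ?_
  · have hR0 : 0 < R := hr₀.trans hR
    have hs : R ≤ sinhC c r := hr.trans (le_sinhC hc (hR0.le.trans hr))
    have e : Pr ((modeA lam μ + ((sinhC c r)⁻¹ : ℂ) • modeB rho).mulVec (scaledCoeff k c a r)) =
        TA (scaledCoeff k c a r) + ((sinhC c r)⁻¹ : ℂ) • TB (scaledCoeff k c a r) := by
      rw [add_mulVec, smul_mulVec, map_add, map_smul]; rfl
    rw [e, add_mul, mul_assoc]
    refine (norm_add_le _ _).trans (add_le_add (TA.le_opNorm _) ?_)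
    rw [norm_smul]
    refine mul_le_mul ?_ (TB.le_opNorm _) (norm_nonneg _) (by positivity)
    rw [norm_inv, Complex.norm_real, norm_of_nonneg (hR0.le.trans hs)]
    gcongr
  · refine lt_of_eq_of_lt (setLIntegral_congr_fun measurableSet_Ioi fun r hr => ?_) h.l2
    exact norm_scaledCoeff_sq (hr₀.trans hr)

end SpinStructure

variable [FiniteDimensional ℂ S] {ρ : 𝓢 k n S} [TopologicalSpace N]
  [ChartedSpace (𝔼 n) N] [IsManifold (𝓡 n) ∞ N] {ι : Type*} {g : RiemMetric n N}
  {P : SpinStructure ι g}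

namespace SpinStructure

/-- Exponential decay of the two parts of a solution in a mode. -/
theorem IsModeCoeff.norm_modeEval_le (h : IsModeCoeff k (n := n) c rho lam r₀ μ v Pr a)
    (hv : P.IsModeBasis ρ c rho lam v) (hc : 0 ≤ c) (hr₀ : 0 < r₀) {R : ℝ} (hR : r₀ < R)
    {κ : ℂ} (hκ : κ ^ 2 = (lam : ℂ) ^ 2 - μ ^ 2) (hκ0 : 0 < κ.re) (hR1 : 1 ≤ κ.re * R)
    (hR2 : 2 * (rho ^ 2 + 2 * |rho|) ≤ κ.re * R) {σ : ℝ} (hσ : σ ^ 2 = 1) {z : ℍ k × N}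
    (hz : z.1 ≠ 0) {r : ℝ} (hr : R ≤ r) :
    ‖modeEval v z ((modeProj rho σ).mulVec (scaledCoeff k c a r))‖ ≤
      2 * Real.exp (-κ.re * (r - R)) *
        ‖modeEval v z ((modeProj rho σ).mulVec (scaledCoeff k c a R))‖ := by
  have hR0 : 0 < R := hr₀.trans hR
  set w := scaledCoeff k c a
  set T := modeEval v z ∘ₗ (modeProj rho σ).mulVecLin with hT
  set TA := T ∘ₗ (modeA lam μ).mulVecLin with hTA
  have hσ1 : |σ| = 1 := by
    rw [← sq_eq_sq₀ (abs_nonneg σ) zero_le_one, sq_abs, hσ, one_pow]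
  have hnullB : ∀ u, (∀ p : ℍ k × N, p.1 ≠ 0 → modeEval v p u = 0) → T u = 0 := by
    intro u hu
    change modeEval v z ((modeProj rho σ).mulVec u) = 0
    rw [modeProj, smul_mulVec, add_mulVec, one_mulVec, smul_mulVec,
      map_smul, map_add, map_smul, hu z hz, hv.modeEval_modeB_eq_zero hu hz, smul_zero, add_zero,
      smul_zero]
  have hPr : ∀ u, T (Pr u) = T u := fun u => by
    rw [← sub_eq_zero, ← map_sub]
    exact hnullB _ fun p hp => by rw [map_sub, h.proj p u hp, sub_self]
  have hPrA : ∀ u, TA (Pr u) = TA u := fun u => by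
    rw [← sub_eq_zero, ← map_sub]
    refine hnullB _ fun p hp => ?_
    exact hv.modeEval_modeA_eq_zero (fun p hp => by rw [map_sub, h.proj p u hp, sub_self]) hp
  have hTB : ∀ u, T ((modeB rho).mulVec u) = ((σ * rho : ℝ) : ℂ) • T u := fun u => by
    simp only [hT, LinearMap.comp_apply, Matrix.mulVecLin_apply, mulVec_mulVec,
      modeProj_mul_modeB hσ, smul_mulVec, map_smul]
  have hTAA : ∀ u, TA ((modeA lam μ).mulVec u) = κ ^ 2 • T u := fun u => by
    simp only [hTA, hT, LinearMap.comp_apply, Matrix.mulVecLin_apply]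
    rw [mulVec_mulVec _ (modeA lam μ), modeA_sq, hκ, smul_mulVec, one_mulVec,
      Matrix.mulVec_smul, map_smul]
  have hTAB : ∀ u, TA ((modeB rho).mulVec u) = -(((σ * rho : ℝ) : ℂ) • TA u) := fun u => by
    simp only [hTA, LinearMap.comp_apply, Matrix.mulVecLin_apply]
    rw [mulVec_mulVec, ← hTB, ← neg_neg (modeA lam μ * modeB rho), ← modeB_mul_modeA,
      Matrix.neg_mulVec, map_neg, mulVec_mulVec]
  have hw : ∀ r, R ≤ r → HasDerivAt w (Pr ((modeA lam μ + ((sinhC c r)⁻¹ : ℂ) • modeB rho).mulVec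
      (w r))) r := fun r hr => h.hasDerivAt_scaledCoeff hr₀ (hR.trans_le hr)
  have hs0 : ∀ r, R ≤ r → 0 < sinhC c r := fun r hr => sinhC_pos (hR0.trans_le hr)
  set τ : ℝ := σ * rho with hτ
  have hf : ∀ r, R ≤ r → HasDerivAt (fun r => T (w r))
      (TA (w r) + ((τ / sinhC c r : ℝ) : ℂ) • T (w r)) r := fun r hr => by
    refine (T.hasDerivAt_comp (hw r hr)).congr_deriv ?_
    have e : ((τ / sinhC c r : ℝ) : ℂ) = ((sinhC c r)⁻¹ : ℂ) * (τ : ℂ) := by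
      push_cast
      rw [div_eq_inv_mul]
    rw [hPr, add_mulVec, smul_mulVec, map_add, map_smul, hTB, smul_smul, e]
    rfl
  have hg : ∀ r, R ≤ r → HasDerivAt (fun r => TA (w r))
      (κ ^ 2 • T (w r) - ((τ / sinhC c r : ℝ) : ℂ) • TA (w r)) r := fun r hr => by
    refine (TA.hasDerivAt_comp (hw r hr)).congr_deriv ?_
    have e : ((τ / sinhC c r : ℝ) : ℂ) = ((sinhC c r)⁻¹ : ℂ) * (τ : ℂ) := by
      push_cast
      rw [div_eq_inv_mul]
    rw [hPrA, add_mulVec, smul_mulVec, map_add, map_smul, hTAA, hTAB, smul_neg,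
      smul_smul, ← sub_eq_add_neg, e]
  obtain ⟨M, hM⟩ := h.exists_scaledCoeff_bound hc hr₀ hR
  have hM0 : 0 ≤ M := (norm_nonneg _).trans (hM R le_rfl)
  have hbT : ∀ r, R ≤ r → ‖T (w r)‖ ≤ ‖T.toContinuousLinearMap‖ * M := fun r hr =>
    (T.toContinuousLinearMap.le_opNorm _).trans (by gcongr; exact hM r hr)
  have hbA : ∀ r, R ≤ r → ‖TA (w r)‖ ≤ ‖TA.toContinuousLinearMap‖ * M := fun r hr =>
    (TA.toContinuousLinearMap.le_opNorm _).trans (by gcongr; exact hM r hr)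
  set q : ℝ → ℝ := fun r => (rho ^ 2 - τ * coshC c r) / sinhC c r ^ 2 with hq
  refine norm_le_of_perturbed_exponential (κ := κ) (a := κ.re) (Q := rho ^ 2 + 2 * |rho|) rfl hκ0
    (by positivity) hR1 hR2 (q := q) (f := fun r => T (w r))
    (f' := fun r => TA (w r) + ((τ / sinhC c r : ℝ) : ℂ) • T (w r))
    (M := ‖TA.toContinuousLinearMap‖ * M + (|rho| / R + 1) * (‖T.toContinuousLinearMap‖ * M))
    (fun r hr => ?_) hf (fun r hr => ?_) (fun r hr => ?_) (fun r hr => ?_) hr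
  · have hr0 : 0 < r := hR0.trans_le hr
    have hs := hs0 r hr
    rw [hq, abs_div, abs_of_pos (pow_pos hs 2), div_le_div_iff₀ (by positivity) (by positivity)]
    have h1 : |rho ^ 2 - τ * coshC c r| ≤ rho ^ 2 + |rho| * coshC c r := by
      refine (abs_sub _ _).trans ?_
      rw [abs_mul, abs_of_nonneg (sq_nonneg rho), hτ, abs_mul, hσ1, one_mul,
        abs_of_pos (coshC_pos c r)]
    have h2 := sq_mul_coshC_le hc hr0.le
    have h3 : r ^ 2 ≤ sinhC c r ^ 2 := by
      have := le_sinhC hc hr0.le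
      gcongr
    calc _ ≤ (rho ^ 2 + |rho| * coshC c r) * r ^ 2 := by gcongr
      _ = rho ^ 2 * r ^ 2 + |rho| * (r ^ 2 * coshC c r) := by ring
      _ ≤ rho ^ 2 * sinhC c r ^ 2 + |rho| * (2 * sinhC c r ^ 2) := by gcongr
      _ = _ := by ring
  · have hs := hs0 r hr
    have h1 : HasDerivAt (fun r => ((τ / sinhC c r : ℝ) : ℂ))
        ((-(τ * coshC c r) / sinhC c r ^ 2 : ℝ) : ℂ) r := by
      refine HasDerivAt.ofReal_comp ?_
      refine ((hasDerivAt_const r τ).fun_div (hasDerivAt_sinhC c r) hs.ne').congr_deriv ?_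
      simp
    refine ((hg r hr).add (h1.smul (hf r hr))).congr_deriv ?_
    have hσ' : τ ^ 2 = rho ^ 2 := by rw [hτ, mul_pow, hσ, one_mul]
    have e : (q r : ℂ) = ((τ / sinhC c r : ℝ) : ℂ) * ((τ / sinhC c r : ℝ) : ℂ) +
        ((-(τ * coshC c r) / sinhC c r ^ 2 : ℝ) : ℂ) := by
      rw [← Complex.ofReal_mul, ← Complex.ofReal_add]
      congr 1
      simp only [hq]
      rw [← hσ']
      field_simp
      ring
    rw [e, add_smul, add_smul, mul_smul, smul_add]
    abel
  · refine (hbT r hr).trans ?_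
    have h1 : 0 ≤ ‖TA.toContinuousLinearMap‖ * M := by positivity
    have h2 : 0 ≤ |rho| / R * (‖T.toContinuousLinearMap‖ * M) := by positivity
    linarith
  · have hs := hs0 r hr
    have h1 : |τ / sinhC c r| ≤ |rho| / R := by
      rw [abs_div, hτ, abs_mul, hσ1, one_mul, abs_of_pos hs]
      gcongr
      exact hr.trans (le_sinhC hc (hR0.le.trans hr))
    have h2 : ‖((τ / sinhC c r : ℝ) : ℂ) • T (w r)‖ ≤
        |rho| / R * (‖T.toContinuousLinearMap‖ * M) := by
      rw [norm_smul, Complex.norm_real, norm_eq_abs]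
      exact mul_le_mul h1 (hbT r hr) (norm_nonneg _) (by positivity)
    have h3 : 0 ≤ ‖T.toContinuousLinearMap‖ * M := by positivity
    refine (norm_add_le _ _).trans ?_
    linarith [hbA r hr]

end SpinStructure
end Decay

theorem re_pos_of_sq_eq {lam₀ lam : ℝ} {μ κ : ℂ} (h : lam₀ ^ 2 ≤ lam ^ 2)
    (hμ : μ.im ≠ 0 ∨ μ ∈ Complex.ofReal '' Set.Ioo (-lam₀) lam₀)
    (hκ : κ ^ 2 = (lam : ℂ) ^ 2 - μ ^ 2) (hκ0 : 0 ≤ κ.re) : 0 < κ.re := by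
  refine lt_of_le_of_ne hκ0 fun h0 => ?_
  have e1 := congrArg Complex.re hκ
  have e2 := congrArg Complex.im hκ
  simp [sq, ← h0] at e1 e2
  rcases hμ with hμ | ⟨t, ht, rfl⟩
  · have : μ.re = 0 := by
      have : μ.re * μ.im = 0 := by linarith
      exact (mul_eq_zero.mp this).resolve_right hμ
    rw [this] at e1
    nlinarith [mul_self_pos.mpr hμ, mul_self_nonneg κ.im, mul_self_nonneg lam]
  · simp at e1
    have : t ^ 2 < lam₀ ^ 2 := sq_lt_sq' ht.1 ht.2
    nlinarith [mul_self_nonneg κ.im]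

theorem re_le_re_of_sq_eq {lam₀ lam : ℝ} {μ κ₀ κ : ℂ} (h : lam₀ ^ 2 ≤ lam ^ 2)
    (hκ₀ : κ₀ ^ 2 = (lam₀ : ℂ) ^ 2 - μ ^ 2) (hκ : κ ^ 2 = (lam : ℂ) ^ 2 - μ ^ 2)
    (hpos : 0 < κ.re) : κ₀.re ≤ κ.re := by
  have e1 := congrArg Complex.re hκ
  have e2 := congrArg Complex.im hκ
  have e3 := congrArg Complex.re hκ₀
  have e4 := congrArg Complex.im hκ₀
  simp [sq] at e1 e2 e3 e4
  have e5 : κ.re * κ.im = κ₀.re * κ₀.im := by linarith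
  have e6 : κ₀.re ^ 2 - κ₀.im ^ 2 ≤ κ.re ^ 2 - κ.im ^ 2 := by nlinarith
  have e7 : 0 ≤ (κ.re ^ 2 - κ₀.re ^ 2) * (κ.re ^ 2 + κ₀.im ^ 2) := by
    have e8 : (κ.re ^ 2 - κ₀.re ^ 2) * (κ.re ^ 2 + κ₀.im ^ 2) =
        κ.re ^ 2 * ((κ.re ^ 2 - κ.im ^ 2) - (κ₀.re ^ 2 - κ₀.im ^ 2)) +
          ((κ.re * κ.im) ^ 2 - (κ₀.re * κ₀.im) ^ 2) := by ring
    rw [e8, e5, sub_self, add_zero]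
    exact mul_nonneg (sq_nonneg _) (by linarith)
  have e9 : 0 ≤ κ.re ^ 2 - κ₀.re ^ 2 := nonneg_of_mul_nonneg_left e7 (by positivity)
  exact (abs_le.mp (abs_le_of_sq_le_sq (sub_nonneg.mp e9) hpos.le)).2

section SpectralBound

variable {n k : ℕ} {S SN : Type*} [NormedAddCommGroup S] [InnerProductSpace ℂ S]
  [FiniteDimensional ℂ S] {ρ : 𝓢 k n S}
  [NormedAddCommGroup SN] [InnerProductSpace ℂ SN] [FiniteDimensional ℂ SN]
  {ρN : SpinorModule (Fin n) SN}

/-- A map that intertwines Clifford multiplication up to a sign intertwines the action of even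
elements. -/
theorem intertwines_even {T : S →L[ℂ] SN} {ε : ℂ} (hε : ε * ε = 1)
    (hT : ∀ b s, T (ρ.genL (Sum.inr b) s) = ε • ρN.genL b (T s)) {x : Cl (Fin n)}
    (hx : x ∈ CliffordAlgebra.even (cliffordForm (Fin n))) (s : S) :
    T (actRight ρ x s) = ρN.actL x (T s) := by
  have hv : ∀ v s, T (actRight ρ (CliffordAlgebra.ι _ v) s) =
      ε • ρN.actL (CliffordAlgebra.ι _ v) (T s) := by
    intro v s
    rw [cliffordι_eq_sum, map_sum, map_sum, _root_.sum_apply, _root_.sum_apply, map_sum, smul_sum]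
    refine sum_congr rfl fun b _ => ?_
    rw [map_smul, map_smul, _root_.smul_apply, _root_.smul_apply,
      map_smul_of_tower, actRight_gen, hT, smul_comm]
    rfl
  have hx' : x ∈ CliffordAlgebra.evenOdd (cliffordForm (Fin n)) 0 := hx
  clear hx
  induction x, hx' using CliffordAlgebra.even_induction generalizing s with
  | algebraMap r =>
    rw [AlgHom.commutes, AlgHom.commutes, Algebra.algebraMap_eq_smul_one,
      Algebra.algebraMap_eq_smul_one]
    simp [map_smul_of_tower]
  | add x y hx hy ihx ihy =>
    rw [map_add, map_add, _root_.add_apply, _root_.add_apply, map_add, ihx, ihy]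
  | ι_mul_ι_mul m₁ m₂ x hx ih =>
    rw [map_mul, map_mul, map_mul, map_mul, mul_apply_eq_comp, mul_apply_eq_comp,
      mul_apply_eq_comp, mul_apply_eq_comp, hv, hv, map_smul, smul_smul, hε, one_smul, ih]

variable {N : Type*} [TopologicalSpace N] [ChartedSpace (𝔼 n) N]
  [IsManifold (𝓡 n) ∞ N] {ι : Type*} {g : RiemMetric n N} {P : SpinStructure ι g}
  {c rho lam : ℝ} {ψ : ℍ k × N → S}

namespace SpinStructure

theorem dirac_eq_frameDirac (φ : N → SN) (y : N) :
    P.dirac ρN φ y = P.frameDirac ρN.actL (P.indexAt y) (P.loc ρN φ (P.indexAt y)) y := by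
  rw [dirac, frameDirac]
  refine sum_congr rfl fun b _ => ?_
  change ρN.genL b _ = ρN.genL b _
  congr 1
  simp only [frameSpinDeriv, spinElement, connCoeff_frame]
  simp [mul_apply_eq_comp]
  rfl

theorem IsModeSpinor.sq_mem_diracSqEigenvalues (h : P.IsModeSpinor ρ c rho lam ψ) :
    lam ^ 2 ∈ P.diracSqEigenvalues ρN := by
  obtain ⟨⟨x, y₀⟩, hx, h0⟩ := h.nonzero
  have := ρN.nontrivial
  have hs : P.IsSmoothSpinor ρ ψ := h.smooth
  obtain ⟨T₀, ε, hε, hT0, hT⟩ := exists_intertwiner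
    (γ := fun b : Fin n => (ρ.gen (Sum.inr b) : Module.End ℂ S)) (γ' := fun b => ρN.gen b)
    ⟨fun a => (cliffordRel_gen.map ρ.act.toRingHom).sq _, fun a b hab => (cliffordRel_gen.map ρ.act.toRingHom).anti _ _
      (by simpa using hab)⟩ (cliffordRel_gen.map ρN.act.toRingHom) h0
  set T := T₀.toContinuousLinearMap
  have key : ∀ t : ℂ, (∀ i y, P.loc ρN (fun y => t • T (ψ (x, y))) i y =
      t • T (P.prodLoc ρ ψ i (x, y))) := by
    intro t i y
    rw [prodLoc_eq]
    simp only
    rw [intertwines_even (T := T) hε hT (spinGroup.mem_even (P.lift i (P.indexAt y) y).2)]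
    exact map_smul (ρN.act _) t _
  have hsm : ∀ i, ContMDiffOn (𝓡 n) 𝓘(ℝ, S) ∞ (fun y => P.prodLoc ρ ψ i (x, y)) (P.dom i) := by
    intro i y hy
    exact (h.smooth i (x, y) ⟨hx, hy⟩).comp (f := fun y : N => ((x, y) : ℍ k × N)) y
      (contMDiffAt_const.prodMk contMDiffAt_id).contMDiffWithinAt fun y' hy' => ⟨hx, hy'⟩
  have hD : ∀ t : ℂ, P.dirac ρN (fun y => t • T (ψ (x, y))) =
      fun y => (ε * lam * t) • T (ψ (x, y)) := by
    intro t
    ext1 y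
    rw [dirac_eq_frameDirac]
    have e1 := h.diracN_eq (x, y) hx
    rw [diracN_eq_frameDirac c hx (hs.diffAt (p := (x, y)) hx _ (P.mem_dom_at y))] at e1
    set i := P.indexAt y
    set σ : N → S := fun y' => P.prodLoc ρ ψ i (x, y')
    have hσ : MDifferentiableAt (𝓡 n) 𝓘(ℝ, S) σ y :=
      ((hsm i).contMDiffAt ((P.isOpen_dom i).mem_nhds (P.mem_dom_at y))).mdifferentiableAt (by simp)
    have e2 : P.loc ρN (fun y => t • T (ψ (x, y))) i = fun y' => t • T (σ y') := funext (key t i)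
    let L : S →L[ℝ] SN := (t • T).restrictScalars ℝ
    have e3 : ∀ v : TangentSpace (𝓡 n) y, (show SN from mfderiv (𝓡 n) 𝓘(ℝ, SN)
        (fun y' => t • T (σ y')) y v) = t • T (show S from mfderiv (𝓡 n) 𝓘(ℝ, S) σ y v) := by
      intro v
      have h1 := (L.hasMFDerivAt (x := σ y)).comp y hσ.hasMFDerivAt
      have h2 : mfderiv (𝓡 n) 𝓘(ℝ, SN) (fun y' => t • T (σ y')) y = _ := h1.mfderiv
      rw [h2]
      rfl
    have e4 : T (ψ (x, y)) = T (σ y) := by rw [← P.prodLoc_self ρ ψ x y]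
    have e5 := congrArg (fun s => (ε * t) • T s) e1
    rw [map_smul_of_tower, ← coe_smul, smul_smul] at e5
    have hT' : ∀ b s, T (ρ.genL (Sum.inr b) s) = ε • ρN.genL b (T s) := hT
    have e6 : ∀ b (d : S), ρN.genL b (t • T d + spinElement (fun c => ρN.actL (cliffordGen c))
        (koszul (P.frameBracket i y) b) (t • T (σ y))) = (ε * t) • T (actRight ρ (cliffordGen b)
          (d + spinElement (fun c => actRight ρ (cliffordGen c))
            (koszul (P.frameBracket i y) b) (σ y))) := by
      intro b d
      have hev := intertwines_even (T := T) hε hT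
        (spinElement_mem_even (koszul (P.frameBracket i y) b)) (σ y)
      rw [map_spinElement, map_spinElement] at hev
      rw [actRight_gen, hT', smul_smul, mul_right_comm, hε, one_mul, map_add T, hev]
      simp only [map_smul, map_add, smul_add]
    rw [mul_right_comm, ← e5, e2, frameDirac, frameDirac, map_sum, smul_sum]
    refine sum_congr rfl fun b _ => ?_
    exact (congrArg (fun z => ρN.genL b (z + _)) (e3 _)).trans (e6 b _)
  refine ⟨fun y => T (ψ (x, y)), ?_, fun h => hT0 (congrFun h y₀), fun y => ?_⟩
  · intro i
    have e : P.loc ρN (fun y => T (ψ (x, y))) i = fun y => T (P.prodLoc ρ ψ i (x, y)) := by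
      funext y
      simpa using key 1 i y
    rw [e]
    exact (T.restrictScalars ℝ).contMDiff.comp_contMDiffOn (hsm i)
  · have e := hD 1
    simp only [one_smul, mul_one] at e
    have e2 : ε * lam * (ε * lam) = ((lam ^ 2 : ℝ) : ℂ) := by
      push_cast
      linear_combination (lam : ℂ) ^ 2 * hε
    rw [e, hD, e2]
    exact coe_smul _ _

end SpinStructure
end SpectralBound

section LocalElliptic

variable {κ : Type*} [Fintype κ] [DecidableEq κ] [Nonempty κ] {S : Type*} [NormedAddCommGroup S]
  [NormedSpace ℝ S] [CompleteSpace S] {γ : κ → S →L[ℝ] S}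

/-- The linear map sending the standard basis to the given vectors. -/
def frameMap {V : Type*} [NormedAddCommGroup V] [NormedSpace ℝ V] (F : κ → V) :
    𝔽 κ →L[ℝ] V :=
  ∑ a, (proj a : 𝔽 κ →L[ℝ] ℝ).smulRight (F a)

theorem frameMap_single {V : Type*} [NormedAddCommGroup V] [NormedSpace ℝ V] (F : κ → V) (a : κ) :
    frameMap F δ[a] = F a := by
  simp [frameMap, _root_.sum_apply, ite_smul]

theorem frameMap_basis : frameMap (fun a : κ => δ[a]) = 1 := by
  ext z a
  simp [frameMap, _root_.sum_apply, Finset.sum_apply, Pi.single_apply]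

theorem integrableOn_ball_of_bound {V : Type*} [NormedAddCommGroup V] [NormedSpace ℝ V]
    [FiniteDimensional ℝ V] [MeasurableSpace V] [BorelSpace V] (ν : Measure V)
    [ν.IsAddHaarMeasure] {f : V → ℝ} {p : V} {δ M : ℝ} (hf : ContinuousOn f (ball p δ))
    (hM : ∀ z ∈ ball p δ, ‖f z‖ ≤ M) : IntegrableOn f (ball p δ) ν := by
  have : IsFiniteMeasure (ν.restrict (ball p δ)) := ⟨by simpa using measure_ball_lt_top⟩
  exact Integrable.of_bound (hf.aestronglyMeasurable measurableSet_ball) M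
    ((ae_restrict_mem measurableSet_ball).mono hM)

set_option maxHeartbeats 1000000 in
theorem elliptic_bound_at_origin (hγ : CliffordRel γ)
    {F : κ → 𝔽 κ → 𝔽 κ} {O : Set (𝔽 κ)}
    (hO : O ∈ nhds 0) (hF : ∀ a, ContDiffOn ℝ 1 (F a) O)
    (hF0 : ∀ a, F a 0 = δ[a]) :
    ∃ ε > 0, ball 0 (8 * ε) ⊆ O ∧ ∀ K, 0 ≤ K → ∃ C > 0, ∀ u : 𝔽 κ → S,
      ContDiffOn ℝ 1 u (ball 0 (8 * ε)) → ∀ p ∈ ball (0 : 𝔽 κ) ε,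
      ∀ δ, 0 < δ → δ ≤ ε → ∀ M, 0 ≤ M →
      (∀ z ∈ ball p (2 * δ), ‖∑ a, γ a (fderiv ℝ u z (F a z))‖ ≤ K * ‖u z‖) →
      (∀ z ∈ ball p (2 * δ), ‖u z‖ ≤ M) →
      ‖u p‖ ≤ C * (δ * M + (δ ^ 𝔡 κ)⁻¹ * ∫ z in ball p (2 * δ), ‖u z‖) := by
  obtain ⟨C₀, hC₀, hell⟩ := elliptic_center_bound hγ
  set W : 𝔽 κ → (𝔽 κ →L[ℝ] 𝔽 κ) :=
    fun p => frameMap fun a => F a p with hW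
  have hFc : ∀ a, ContDiffAt ℝ 1 (F a) 0 := fun a => (hF a).contDiffAt hO
  have hW0 : W 0 = 1 := by
    simp only [hW, hF0]; exact frameMap_basis
  have hWc : ContinuousAt W 0 := by
    simp only [hW, frameMap]
    refine tendsto_finsetSum _ fun a _ => ?_
    exact (((ContinuousLinearMap.smulRightL ℝ _ _ (proj a :
      𝔽 κ →L[ℝ] ℝ)).continuous.continuousAt).comp (hFc a).continuousAt)
  have hWi : ContinuousAt (fun p => Ring.inverse (W p)) 0 := by
    have h1 := NormedRing.inverse_continuousAt
      (1 : (𝔽 κ →L[ℝ] 𝔽 κ)ˣ)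
    have h2 : ContinuousAt Ring.inverse (W 0) := by rw [hW0]; exact h1
    exact ContinuousAt.comp h2 hWc
  have hWd : ContinuousAt (fun p => |(W p).det|) 0 :=
    (ContinuousLinearMap.continuous_det.continuousAt.comp hWc).abs
  set L : ℝ := ∑ a, (‖fderiv ℝ (F a) 0‖ + 1) with hL
  have hL0 : 0 ≤ L := by positivity
  have hFd : ∀ᶠ p in nhds (0 : 𝔽 κ), ∀ a, ‖fderiv ℝ (F a) p‖ ≤ L := by
    refine Filter.eventually_all.mpr fun a => ?_
    have h1 : ContinuousAt (fun p => ‖fderiv ℝ (F a) p‖) 0 :=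
      ((hFc a).fderiv_right (m := 0) (by norm_num)).continuousAt.norm
    filter_upwards [h1.eventually (gt_mem_nhds (lt_add_one _))] with p hp
    exact hp.le.trans (Finset.single_le_sum (f := fun a => ‖fderiv ℝ (F a) 0‖ + 1)
      (fun _ _ => by positivity) (Finset.mem_univ a))
  have hev : ∀ᶠ p in nhds (0 : 𝔽 κ), interior O ∈ nhds p ∧ ‖W p‖ < 2 ∧
      IsUnit (W p) ∧ ‖Ring.inverse (W p)‖ < 2 ∧ 1 / 2 < |(W p).det| ∧
      ∀ a, ‖fderiv ℝ (F a) p‖ ≤ L := by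
    have n1 : ‖(1 : 𝔽 κ →L[ℝ] 𝔽 κ)‖ < 2 :=
      (ContinuousLinearMap.norm_id_le).trans_lt one_lt_two
    have n2 : 1 / 2 < |(W 0).det| := by
      rw [hW0, ContinuousLinearMap.det, ContinuousLinearMap.toLinearMap_one, map_one]; norm_num
    refine (isOpen_interior.eventually_mem (mem_interior_iff_mem_nhds.mpr hO) |>.mono fun p hp =>
      isOpen_interior.mem_nhds hp).and ((hWc.norm.eventually (gt_mem_nhds (by simpa only [hW0] using n1))).and
      ((hWc.eventually (by rw [hW0]; exact Units.nhds 1)).and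
      ((hWi.norm.eventually (gt_mem_nhds (by simpa only [hW0, Ring.inverse_one] using n1))).and
      ((hWd.eventually (lt_mem_nhds n2)).and hFd))))
  obtain ⟨η, hη, hball⟩ := Metric.eventually_nhds_iff_ball.mp hev
  refine ⟨η / 8, by positivity, ?_, fun K hK => ⟨C₀ * (max K (4 * L) + 2), by positivity, ?_⟩⟩
  · rw [mul_div_cancel₀ _ (by norm_num)]
    exact fun p hp => interior_subset (mem_of_mem_nhds (hball p hp).1)
  rw [mul_div_cancel₀ _ (by norm_num)]
  intro u hu p hp δ hδ hδη M hM heq hbd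
  have hp1 : ‖p‖ < η / 8 := by simpa using hp
  obtain ⟨-, hWn, hWu, hVn, hWdet, -⟩ := hball p (by rw [mem_ball_zero_iff]; linarith)
  set V := Ring.inverse (W p) with hV
  have hWV : ∀ x, W p (V x) = x := fun x => by
    rw [← mul_apply_eq_comp, Ring.mul_inverse_cancel _ hWu]; rfl
  have hVW : ∀ x, V (W p x) = x := fun x => by
    rw [← mul_apply_eq_comp, Ring.inverse_mul_cancel _ hWu]; rfl
  set A : 𝔽 κ → 𝔽 κ := fun z => p + (δ • W p) z with hA
  have hAd : ∀ z, HasFDerivAt A (δ • W p) z := fun z => (δ • W p).hasFDerivAt.const_add p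
  have hAn : ∀ z, ‖(δ • W p) z‖ ≤ 2 * δ * ‖z‖ := fun z => by
    rw [_root_.smul_apply, norm_smul, norm_of_nonneg hδ.le]
    have := ((W p).le_opNorm z).trans (mul_le_mul_of_nonneg_right hWn.le (norm_nonneg z))
    nlinarith
  have hAη : ∀ z ∈ ball (0 : 𝔽 κ) 2, A z ∈ ball (0 : 𝔽 κ) η := by
    intro z hz
    rw [mem_ball_zero_iff] at hz ⊢
    have h1 := norm_add_le p ((δ • W p) z)
    have h2 := hAn z
    have h3 : 2 * δ * ‖z‖ ≤ 2 * δ * 2 := by gcongr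
    simp only [hA]
    linarith
  have hAδ : ∀ z ∈ ball (0 : 𝔽 κ) 1, A z ∈ ball p (2 * δ) := by
    intro z hz
    rw [mem_ball_zero_iff] at hz
    rw [mem_ball, dist_eq_norm]
    simp only [hA, add_sub_cancel_left]
    refine (hAn z).trans_lt ?_
    nlinarith
  have hsub12 : ball (0 : 𝔽 κ) 1 ⊆ ball 0 2 := ball_subset_ball one_le_two
  have hFat : ∀ q ∈ ball (0 : 𝔽 κ) η, ∀ a, ContDiffAt ℝ 1 (F a) q := fun q hq a =>
    (hF a).contDiffAt (Filter.mem_of_superset (hball q hq).1 interior_subset)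
  have hAc : ContDiff ℝ 1 A := contDiff_const.add (δ • W p).contDiff
  set Y : κ → 𝔽 κ → 𝔽 κ := fun a z => V (F a (A z)) with hY
  have hYc : ∀ a, ContDiffOn ℝ 1 (Y a) (ball 0 2) := fun a z hz =>
    (V.contDiff.contDiffAt.comp z ((hFat _ (hAη z hz) a).comp z hAc.contDiffAt)).contDiffWithinAt
  have hvc : ContDiffOn ℝ 1 (fun z => u (A z)) (ball 0 2) :=
    hu.comp hAc.contDiffOn fun z hz => hAη z hz
  have hYd : ∀ z ∈ ball (0 : 𝔽 κ) 2, ∀ a,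
      HasFDerivAt (Y a) (V ∘L (fderiv ℝ (F a) (A z)) ∘L (δ • W p)) z := fun z hz a =>
    V.hasFDerivAt.comp z ((((hFat _ (hAη z hz) a).differentiableAt (by norm_num)).hasFDerivAt).comp z
      (hAd z))
  have hδW : ‖δ • W p‖ ≤ 2 * δ := by
    rw [norm_smul, norm_of_nonneg hδ.le]; nlinarith
  have hYn : ∀ z ∈ ball (0 : 𝔽 κ) 2, ∀ a, ‖fderiv ℝ (Y a) z‖ ≤ δ * (4 * L) := by
    intro z hz a
    rw [(hYd z hz a).fderiv]
    calc _ ≤ ‖V‖ * (‖fderiv ℝ (F a) (A z)‖ * ‖δ • W p‖) :=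
          (ContinuousLinearMap.opNorm_comp_le _ _).trans
            (mul_le_mul_of_nonneg_left (ContinuousLinearMap.opNorm_comp_le _ _) (norm_nonneg _))
      _ ≤ 2 * (L * (2 * δ)) := by
          gcongr
          exact (hball _ (hAη z hz)).2.2.2.2.2 a
      _ = δ * (4 * L) := by ring
  have hY0 : ∀ a, Y a 0 = δ[a] := fun a => by
    simp only [hY, hA, map_zero, add_zero]
    rw [← hVW δ[a]]
    congr 1
    exact (frameMap_single (fun a => F a p) a).symm
  set K' := δ * max K (4 * L) with hK'
  have hK0 : 0 ≤ K' := by positivity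
  have hK4 : δ * (4 * L) ≤ K' := mul_le_mul_of_nonneg_left (le_max_right _ _) hδ.le
  have hud : ∀ z ∈ ball (0 : 𝔽 κ) 1, ∀ a,
      fderiv ℝ (fun z => u (A z)) z (Y a z) = δ • fderiv ℝ u (A z) (F a (A z)) := by
    intro z hz a
    have h1 : DifferentiableAt ℝ u (A z) := (hu.contDiffAt (isOpen_ball.mem_nhds
      (hAη z (hsub12 hz)))).differentiableAt (by norm_num)
    have h2 : HasFDerivAt (fun z => u (A z)) ((fderiv ℝ u (A z)) ∘L (δ • W p)) z :=
      h1.hasFDerivAt.comp z (hAd z)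
    rw [h2.fderiv]
    simp only [ContinuousLinearMap.comp_apply, hY, _root_.smul_apply, hWV, map_smul]
  have h0 := hell K' M hK0 hM Y (fun z => u (A z)) hYc hvc
    (fun z hz a => by
      rw [← hY0 a]
      have h1 := (convex_ball (0 : 𝔽 κ) 1).norm_image_sub_le_of_norm_fderiv_le
        (f := Y a) (C := δ * (4 * L)) (fun z hz => (hYd z (hsub12 hz) a).differentiableAt)
        (fun z hz => hYn z (hsub12 hz) a) (mem_ball_self one_pos) hz
      rw [sub_zero] at h1
      exact h1.trans (by gcongr))
    (fun z hz a => (hYn z (hsub12 hz) a).trans hK4)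
    (fun z hz => by
      simp only [hud z hz, map_smul]
      rw [← smul_sum, norm_smul, norm_of_nonneg hδ.le, hK', mul_assoc]
      gcongr
      exact (heq _ (hAδ z hz)).trans (by gcongr; exact le_max_left _ _))
    (fun z hz => hbd _ (hAδ z hz))
  have hdet : δ ^ 𝔡 κ / 2 ≤ |(δ • W p).det| := by
    have e : (δ • W p).det = δ ^ 𝔡 κ * (W p).det := by
      rw [ContinuousLinearMap.det, ContinuousLinearMap.toLinearMap_smul, LinearMap.det_smul,
        finrank_euclideanSpace]
    rw [e, abs_mul, abs_of_pos (by positivity)]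
    have : 0 < δ ^ 𝔡 κ := by positivity
    nlinarith
  have hinj : Function.Injective A := fun z z' h => by
    have h1 : δ • W p z = δ • W p z' := by simpa [hA] using h
    rw [← hVW z, smul_right_injective _ hδ.ne' h1, hVW]
  have hint : ∫ z in ball (0 : 𝔽 κ) 1, ‖u (A z)‖ ≤
      2 * (δ ^ 𝔡 κ)⁻¹ * ∫ z in ball p (2 * δ), ‖u z‖ := by
    have h1 := integral_image_eq_integral_abs_det_fderiv_smul volume
      (measurableSet_ball (x := (0 : 𝔽 κ)) (ε := 1))
      (fun z _ => (hAd z).hasFDerivWithinAt) hinj.injOn (fun z => ‖u z‖)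
    simp only [smul_eq_mul] at h1
    rw [integral_const_mul] at h1
    have hsub : ball p (2 * δ) ⊆ ball 0 η := fun q hq => by
      rw [mem_ball, dist_eq_norm] at hq
      rw [mem_ball_zero_iff]
      have := norm_add_le p (q - p)
      rw [add_sub_cancel] at this
      linarith
    have hi : IntegrableOn (fun z => ‖u z‖) (ball p (2 * δ)) := by
      exact integrableOn_ball_of_bound _ (hu.continuousOn.mono hsub).norm fun z hz => by
        rw [norm_norm]
        exact hbd z hz
    have h2 : ∫ z in A '' ball 0 1, ‖u z‖ ≤ ∫ z in ball p (2 * δ), ‖u z‖ :=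
      setIntegral_mono_set hi (Filter.Eventually.of_forall fun z => norm_nonneg _)
        (Filter.Eventually.of_forall (Set.image_subset_iff.mpr hAδ))
    rw [h1] at h2
    have hI : 0 ≤ ∫ z in ball (0 : 𝔽 κ) 1, ‖u (A z)‖ :=
      integral_nonneg fun z => norm_nonneg _
    have h3 := (mul_le_mul_of_nonneg_right hdet hI).trans h2
    have hδd : 0 < δ ^ 𝔡 κ := by positivity
    rw [mul_comm 2, mul_assoc, inv_mul_eq_div, le_div_iff₀ hδd]
    linarith
  have hA0 : A 0 = p := by simp [hA]
  rw [hA0] at h0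
  refine h0.trans ?_
  have hI : 0 ≤ (δ ^ 𝔡 κ)⁻¹ * ∫ z in ball p (2 * δ), ‖u z‖ := by positivity
  have hδM : 0 ≤ δ * M := by positivity
  have hmax : 0 ≤ max K (4 * L) := hK.trans (le_max_left _ _)
  rw [mul_assoc C₀]
  refine mul_le_mul_of_nonneg_left ?_ hC₀.le
  rw [hK']
  have e1 : 0 ≤ max K (4 * L) * ((δ ^ 𝔡 κ)⁻¹ * ∫ z in ball p (2 * δ), ‖u z‖) := by
    positivity
  nlinarith

set_option maxHeartbeats 600000 in
theorem elliptic_bound_local {V : Type*} [NormedAddCommGroup V] [NormedSpace ℝ V]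
    [FiniteDimensional ℝ V] [MeasurableSpace V] [BorelSpace V] (ν : Measure V)
    [ν.IsAddHaarMeasure] (hγ : CliffordRel γ) {F : κ → V → V} {O : Set V} {q₀ : V}
    (hO : O ∈ nhds q₀) (hF : ∀ a, ContDiffOn ℝ 1 (F a) O) (T : 𝔽 κ ≃L[ℝ] V)
    (hT : ∀ a, T δ[a] = F a q₀) :
    ∃ ε > 0, ball q₀ (2 * ε) ⊆ O ∧ ∀ K, 0 ≤ K → ∃ C > 0, ∀ u : V → S, ContDiffOn ℝ 1 u O →
      ∀ p ∈ ball q₀ ε, ∀ δ, 0 < δ → δ ≤ ε → ∀ M, 0 ≤ M →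
      (∀ z ∈ ball p δ, ‖∑ a, γ a (fderiv ℝ u z (F a z))‖ ≤ K * ‖u z‖) →
      (∀ z ∈ ball p δ, ‖u z‖ ≤ M) →
      ‖u p‖ ≤ C * (δ * M + (δ ^ 𝔡 κ)⁻¹ * ∫ z in ball p δ, ‖u z‖ ∂ν) := by
  set A : 𝔽 κ ≃ₜ V := T.toHomeomorph.trans (Homeomorph.addLeft q₀) with hAdef
  have hA : ∀ ζ, A ζ = q₀ + T ζ := fun ζ => rfl
  have hAc : ContDiff ℝ 1 A := contDiff_const.add T.contDiff
  have hA0 : A 0 = q₀ := by rw [hA, map_zero, add_zero]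
  obtain ⟨ε₁, hε₁, hball, hC⟩ := elliptic_bound_at_origin hγ
    (F := fun a ζ => T.symm (F a (A ζ))) (O := A ⁻¹' O)
    (A.continuous.continuousAt.preimage_mem_nhds (by rwa [hA0]))
    (fun a => T.symm.contDiff.comp_contDiffOn ((hF a).comp hAc.contDiffOn fun _ h => h))
    (fun a => by rw [hA0, ← hT, T.symm_apply_apply])
  obtain ⟨η, hη, hηO⟩ := Metric.mem_nhds_iff.mp hO
  obtain ⟨cν, hmap⟩ : ∃ cν : ℝ≥0∞, (volume : Measure (𝔽 κ)).map A = cν • ν := by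
    have h2 := Measure.isAddLeftInvariant_eq_smul
      ((volume : Measure (𝔽 κ)).map T) ν
    refine ⟨(Measure.addHaarScalarFactor ((volume : Measure (𝔽 κ)).map T) ν :), ?_⟩
    have e : (A : 𝔽 κ → V) = (fun z => q₀ + z) ∘ T := rfl
    rw [e, ← Measure.map_map (measurable_const_add q₀) T.continuous.measurable,
      map_add_left_eq_self]
    exact h2
  set τ : ℝ := ‖(T : 𝔽 κ →L[ℝ] V)‖ + 1 with hτ
  set τ' : ℝ := ‖(T.symm : V →L[ℝ] 𝔽 κ)‖ + 1 with hτ'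
  have hτ1 : 1 ≤ τ := by rw [hτ]; linarith [norm_nonneg (T : 𝔽 κ →L[ℝ] V)]
  have hτ1' : 1 ≤ τ' := by rw [hτ']; linarith [norm_nonneg (T.symm : V →L[ℝ] 𝔽 κ)]
  refine ⟨min (ε₁ / τ') (η / 2), lt_min (by positivity) (by positivity),
    (ball_subset_ball (by linarith [min_le_right (ε₁ / τ') (η / 2)])).trans hηO, fun K hK => ?_⟩
  obtain ⟨C, hCpos, hC⟩ := hC K hK
  refine ⟨C * (1 + (2 * τ) ^ 𝔡 κ * cν.toReal), by positivity, ?_⟩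
  intro u hu p hp δ hδ hδε M hM heq hbd
  set ζ := A.symm p with hζ
  have hAζ : A ζ = p := A.apply_symm_apply p
  have hζn : ζ ∈ ball (0 : 𝔽 κ) ε₁ := by
    have h1 : T ζ = p - q₀ := by rw [← hAζ, hA, add_sub_cancel_left]
    have h2 : ζ = T.symm (p - q₀) := by rw [← h1, T.symm_apply_apply]
    rw [mem_ball, dist_eq_norm] at hp
    rw [mem_ball_zero_iff, h2]
    calc _ ≤ ‖(T.symm : V →L[ℝ] 𝔽 κ)‖ * ‖p - q₀‖ :=
          (T.symm : V →L[ℝ] 𝔽 κ).le_opNorm _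
      _ ≤ τ' * ‖p - q₀‖ := by gcongr; linarith
      _ < τ' * (ε₁ / τ') := by gcongr; exact hp.trans_le (min_le_left _ _)
      _ = ε₁ := by field_simp
  set δ' := δ / (2 * τ) with hδ'
  have hδ'pos : 0 < δ' := by positivity
  have hδε₁ : δ' ≤ ε₁ := by
    have h1 : δ' ≤ δ := div_le_self hδ.le (by linarith)
    have h2 : ε₁ / τ' ≤ ε₁ := div_le_self hε₁.le hτ1'
    linarith [min_le_left (ε₁ / τ') (η / 2)]
  have hAball : ∀ z ∈ ball ζ (2 * δ'), A z ∈ ball p δ := by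
    intro z hz
    rw [mem_ball, dist_eq_norm] at hz ⊢
    rw [← hAζ, hA, hA, add_sub_add_left_eq_sub, ← map_sub]
    calc _ ≤ ‖(T : 𝔽 κ →L[ℝ] V)‖ * ‖z - ζ‖ :=
          (T : 𝔽 κ →L[ℝ] V).le_opNorm _
      _ ≤ τ * ‖z - ζ‖ := by gcongr; linarith
      _ < τ * (2 * δ') := by gcongr
      _ = δ := by rw [hδ']; field_simp
  have hpO : ball p δ ⊆ O := by
    intro z hz
    refine hηO ?_
    rw [mem_ball] at hz hp ⊢
    linarith [dist_triangle z p q₀, min_le_right (ε₁ / τ') (η / 2)]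
  have hAO : ball (0 : 𝔽 κ) (8 * ε₁) ⊆ A ⁻¹' O := hball
  have h0 := hC (fun ζ => u (A ζ)) (hu.comp hAc.contDiffOn hAO) ζ hζn δ' hδ'pos hδε₁ M hM
    (fun z hz => by
      have h1 : DifferentiableAt ℝ u (A z) := ((hu.mono hpO).contDiffAt (isOpen_ball.mem_nhds
        (hAball z hz))).differentiableAt (by norm_num)
      have h2 : HasFDerivAt A (T : 𝔽 κ →L[ℝ] V) z :=
        (T : 𝔽 κ →L[ℝ] V).hasFDerivAt.const_add q₀
      have h3 : HasFDerivAt (fun ζ => u (A ζ)) ((fderiv ℝ u (A z)) ∘L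
        (T : 𝔽 κ →L[ℝ] V)) z := h1.hasFDerivAt.comp z h2
      rw [h3.fderiv]
      simpa using heq _ (hAball z hz))
    (fun z hz => hbd _ (hAball z hz))
  have hint : ∫ z in ball ζ (2 * δ'), ‖u (A z)‖ ≤ cν.toReal * ∫ z in ball p δ, ‖u z‖ ∂ν := by
    have h1 := A.measurableEmbedding.setIntegral_map (μ := volume) (fun z => ‖u z‖)
      (A '' ball ζ (2 * δ'))
    rw [Set.preimage_image_eq _ A.injective] at h1
    rw [← h1, hmap, Measure.restrict_smul, integral_smul_measure, smul_eq_mul]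
    refine mul_le_mul_of_nonneg_left ?_ ENNReal.toReal_nonneg
    refine setIntegral_mono_set ?_ (Filter.Eventually.of_forall fun z => norm_nonneg _)
      (Filter.Eventually.of_forall (Set.image_subset_iff.mpr hAball))
    exact integrableOn_ball_of_bound ν (hu.continuousOn.mono hpO).norm fun z hz => by
      rw [norm_norm]; exact hbd z hz
  rw [hAζ] at h0
  refine h0.trans ?_
  rw [mul_assoc]
  refine mul_le_mul_of_nonneg_left ?_ hCpos.le
  set I := ∫ z in ball p δ, ‖u z‖ ∂ν
  have hI : 0 ≤ I := integral_nonneg fun z => norm_nonneg _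
  have e1 : (δ' ^ 𝔡 κ)⁻¹ = (2 * τ) ^ 𝔡 κ * (δ ^ 𝔡 κ)⁻¹ := by
    rw [hδ', div_pow, inv_div, div_eq_mul_inv]
  have h1 : δ' * M ≤ δ * M := by
    gcongr
    exact div_le_self hδ.le (by linarith)
  have h2 : (δ' ^ 𝔡 κ)⁻¹ * ∫ z in ball ζ (2 * δ'), ‖u (A z)‖ ≤
      ((2 * τ) ^ 𝔡 κ * cν.toReal) * ((δ ^ 𝔡 κ)⁻¹ * I) := by
    rw [e1]
    calc _ ≤ (2 * τ) ^ 𝔡 κ * (δ ^ 𝔡 κ)⁻¹ * (cν.toReal * I) := by gcongr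
      _ = _ := by ring
  have h3 : 0 ≤ δ * M := by positivity
  have h4 : 0 ≤ (δ ^ 𝔡 κ)⁻¹ * I := by positivity
  have h5 : 0 ≤ (2 * τ) ^ 𝔡 κ * cν.toReal := by positivity
  nlinarith [mul_nonneg h5 h3]

end LocalElliptic

section TwistedSolution

variable {n k : ℕ} {N : Type*} [TopologicalSpace N] [ChartedSpace (𝔼 n) N]
  [IsManifold (𝓡 n) ∞ N] {ι : Type*} {g : RiemMetric n N} {P : SpinStructure ι g}
  {S : Type*} [NormedAddCommGroup S] [InnerProductSpace ℂ S]
  [FiniteDimensional ℂ S] {ρ : 𝓢 k n S} {c rho lam r₀ : ℝ} {μ : ℂ}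
  {Φ : ℍ k × N → S} {v : Fin 4 → ℍ k × N → S}

theorem modeRad_mul_modeGen (ε : ℂ) (r : ℝ) : modeRad * modeGen ε k c rho lam μ r =
    (ε * μ) • 1 - ε • modeN lam - ((sinhC c r)⁻¹ : ℂ) • modeSph rho -
      ((k / 2 * cothC c r : ℝ) : ℂ) • modeRad := by
  simp only [modeGen, modeA, modeB, mul_sub, mul_add, Matrix.mul_smul, ← mul_assoc, modeRad_sq,
    mul_one, neg_mul, one_mul, smul_neg, smul_sub, mul_smul]
  abel

theorem modeB_mul_modeGen (r : ℝ) : modeB rho * modeGen 1 k c rho lam μ r =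
    modeGen (-1) k c rho lam μ r * modeB rho := by
  simp only [modeGen, mul_sub, mul_add, sub_mul, add_mul, Matrix.mul_smul, Matrix.smul_mul,
    modeB_mul_modeA, mul_one, one_mul, one_smul, neg_smul, neg_mul]

theorem norm_vecMul (x : ℍ k) (s : S) : ‖vecMul ρ x s‖ = ‖x‖ * ‖s‖ := by
  have h := inner_self_eq_norm_sq (𝕜 := ℂ) (vecMul ρ x s)
  rw [inner_vecMul, vecMul_vecMul, inner_neg_right, neg_neg, ← coe_smul, inner_smul_right,
    RCLike.re_to_complex, Complex.re_ofReal_mul, ← RCLike.re_to_complex, inner_self_eq_norm_sq,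
    ← mul_pow] at h
  exact ((sq_eq_sq₀ (by positivity) (norm_nonneg _)).mp h).symm

namespace SpinStructure

variable (P ρ c) in
/-- Solutions on `r > r₀` of the Dirac equation, or of its variant with the sign of `D^N - μ`
reversed. -/
structure IsTwistedSolution (ε : ℝ) (μ : ℂ) (r₀ : ℝ) (Φ : ℍ k × N → S) : Prop where
  diffAt : ∀ p : ℍ k × N, r₀ < ‖p.1‖ → P.SpinorDiffAt ρ Φ p
  contDiffOn : ∀ i y₀, ContDiffOn ℝ 1 (P.chartRep ρ Φ i y₀)
    {q | r₀ < ‖q.1‖ ∧ q.2 ∈ P.coordDom y₀ i}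
  dirac_eq : ∀ p : ℍ k × N, r₀ < ‖p.1‖ → radialMul ρ (P.radialDeriv ρ c Φ) p +
    (sinhC c ‖p.1‖)⁻¹ • P.diracSphere ρ c Φ p + ((k : ℝ) / 2 * cothC c ‖p.1‖) • radialMul ρ Φ p +
    ε • P.diracN ρ c Φ p = (ε * μ) • Φ p

theorem IsModeBasis.isTwistedSolution (hv : P.IsModeBasis ρ c rho lam v) (hr₀ : 0 < r₀) {ε : ℝ}
    {b b' : ℝ → Fin 4 → ℂ} (hb : ∀ r, r₀ < r → HasDerivAt b (b' r) r)
    (hb' : ContinuousOn b' (Set.Ioi r₀))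
    (heq : ∀ p : ℍ k × N, r₀ < ‖p.1‖ → modeEval v p (b' ‖p.1‖) =
      modeEval v p ((modeGen ε k c rho lam μ ‖p.1‖).mulVec (b ‖p.1‖))) :
    P.IsTwistedSolution ρ c ε μ r₀ (fun p => modeEval v p (b ‖p.1‖)) where
  diffAt p hp := hv.spinorDiffAt (norm_pos_iff.mp (hr₀.trans hp)) (hb _ hp)
  contDiffOn i y₀ := by
    have hbc : ContDiffOn ℝ 1 b (Set.Ioi r₀) := by
      rw [show (1 : ℕ∞ω) = 0 + 1 from (zero_add 1).symm, contDiffOn_succ_iff_deriv_of_isOpen isOpen_Ioi]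
      refine ⟨fun r hr => (hb r hr).differentiableAt.differentiableWithinAt, by simp, ?_⟩
      exact contDiffOn_zero.mpr (hb'.congr fun r hr => (hb r hr).deriv)
    have hne : ∀ q ∈ {q : ℍ k × 𝔼 n | r₀ < ‖q.1‖ ∧ q.2 ∈ P.coordDom y₀ i}, q.1 ≠ 0 :=
      fun q hq => norm_pos_iff.mp (hr₀.trans hq.1)
    have e : P.chartRep ρ (fun p => modeEval v p (b ‖p.1‖)) i y₀ =
        fun q => ∑ j, b ‖q.1‖ j • P.chartRep ρ (v j) i y₀ q := by
      funext q
      simp only [chartRep, prodLoc_eq, modeEval_apply, map_sum, map_smul]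
    rw [e]
    refine ContDiffOn.sum fun j _ => ContDiffOn.smul ?_ (((hv.smooth j).contDiffOn_chartRep i y₀).of_le
      (by exact_mod_cast le_top) |>.mono fun q hq => ⟨hne q hq, hq.2⟩)
    exact ((contDiff_apply ℝ ℂ j).comp_contDiffOn hbc).comp (t := Set.Ioi r₀)
      (fun q hq => (contDiffAt_fst.norm ℝ (hne q hq)).contDiffWithinAt) fun q hq => hq.1
  dirac_eq := by
    rintro ⟨x, y⟩ hp
    have hx : x ≠ 0 := norm_pos_iff.mp (hr₀.trans hp)
    rw [radialMul_eq, radialMul_eq, hv.radialDeriv_modeEval hx (hb _ hp),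
      hv.diracSphere_modeEval hx (hb _ hp), hv.diracN_modeEval hx (hb _ hp), heq _ hp,
      ← hv.modeEval_rad (p := (x, y)) hx, ← hv.modeEval_rad (p := (x, y)) hx, mulVec_mulVec,
      modeRad_mul_modeGen]
    simp only [sub_mulVec, smul_mulVec, one_mulVec, map_sub, map_smul,
      ← coe_smul, Complex.ofReal_inv]
    abel

theorem continuousOn_spinConn (i : ι) (y₀ : N) (b : Fin n) :
    ContinuousOn (P.spinConn ρ i y₀ b) (P.coordDom y₀ i) := by
  unfold spinConn spinElement
  refine ContinuousOn.const_smul (M := ℝ) (g := fun u => ∑ d, ∑ e, koszul (P.frameBracket i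
    (χ[n, y₀].symm u)) b d e • (ρ.genL (Sum.inr d) * ρ.genL (Sum.inr e)))
    (continuousOn_finsetSum _ fun d _ =>
    continuousOn_finsetSum _ fun e _ => ContinuousOn.fun_smul ?_ continuousOn_const) _
  exact (P.continuousOn_connCoeff i b d e).comp
    ((continuousOn_extChartAt_symm y₀).mono fun u hu => hu.1) fun u hu => hu.2

variable (P ρ c) in
/-- The orthonormal frame of the product in coordinates. -/
def chartFrame (i : ι) (y₀ : N) : Fin (k + 1) ⊕ Fin n → ℍ k × 𝔼 n → ℍ k × 𝔼 n
  | Sum.inl a => fun q => (hypVec c a q.1, 0)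
  | Sum.inr b => fun q => (0, P.coordFrame y₀ i b q.2)

variable (ρ) in
/-- Clifford multiplication as real linear maps, with the sign `ε` along `N`. -/
def twistedGen (ε : ℝ) : Fin (k + 1) ⊕ Fin n → S →L[ℝ] S
  | Sum.inl a => (ρ.genL (Sum.inl a)).restrictScalars ℝ
  | Sum.inr b => ε • (ρ.genL (Sum.inr b)).restrictScalars ℝ

theorem cliffordRel_twistedGen {ε : ℝ} (hε : ε ^ 2 = 1) : CliffordRel (twistedGen ρ ε) := by
  have h := ρ.cliffordRel_genL
  have h1 : ∀ a s, ρ.genL a (ρ.genL a s) = -s := fun a s => congr_fun (h.sq a) s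
  have h2 : ∀ a b, a ≠ b → ∀ s, ρ.genL a (ρ.genL b s) = -ρ.genL b (ρ.genL a s) :=
    fun a b hab s => congr_fun (h.anti a b hab) s
  refine ⟨?_, ?_⟩
  · rintro (a | a) <;> ext s <;> simp [twistedGen, h1, smul_smul, ← sq, hε]
  · rintro (a | a) (b | b) hab <;> ext s <;> simp [twistedGen, h2 _ _ hab]

theorem sum_vecMul_fderiv (x : ℍ k) (d : ℍ k →ₗ[ℝ] S) :
    ∑ a, ρ.genL (Sum.inl a) (d (hypVec c a x)) = (warp c ‖x‖)⁻¹ • ∑ a, ρ.genL (Sum.inl a) (d δ[a]) +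
      ((1 - (warp c ‖x‖)⁻¹) / ‖x‖ ^ 2) • vecMul ρ x (d x) := by
  simp only [hypVec, map_add, map_smul, map_smul_of_tower,
    sum_add_distrib, ← smul_sum, vecMul_apply, _root_.sum_apply, _root_.smul_apply]
  rw [smul_sum (f := fun a => x a • _)]
  simp only [smul_smul]
  congr 1
  exact sum_congr rfl fun a _ => by congr 1; ring

theorem exists_chart_bound (μ : ℂ) {i : ι} {y₀ : N} {q₀ : ℍ k × 𝔼 n}
    (hq₀ : q₀ ∈ P.chartDom k i y₀) : ∃ K, 0 ≤ K ∧ ∃ O ∈ nhds q₀, O ⊆ P.chartDom k i y₀ ∧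
      ∀ (ε r₀ : ℝ) (Φ : ℍ k × N → S), ε ^ 2 = 1 → P.IsTwistedSolution ρ c ε μ r₀ Φ →
      ∀ q ∈ O, r₀ < ‖q.1‖ →
      ‖∑ a, twistedGen ρ ε a (fderiv ℝ (P.chartRep ρ Φ i y₀) q (P.chartFrame c i y₀ a q))‖ ≤
        K * ‖P.chartRep ρ Φ i y₀ q‖ := by
  set κ : ℍ k × 𝔼 n → ℝ := fun q => (k : ℝ) / 2 * (|(sinhC c ‖q.1‖)⁻¹| + |cothC c ‖q.1‖|) +
    ∑ b, ‖ρ.genL (Sum.inr b)‖ * ‖P.spinConn ρ i y₀ b q.2‖ + ‖μ‖ with hκ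
  have hκ0 : ∀ q, 0 ≤ κ q := fun q => by positivity
  have hr : 0 < ‖q₀.1‖ := norm_pos_iff.mpr hq₀.1
  have hn : ContinuousAt (fun q : ℍ k × 𝔼 n => ‖q.1‖) q₀ := continuousAt_fst.norm
  have hs : ContinuousAt (fun q : ℍ k × 𝔼 n => (sinhC c ‖q.1‖)⁻¹) q₀ :=
    (ContinuousAt.comp (f := fun q : ℍ k × 𝔼 n => ‖q.1‖)
      (hasDerivAt_sinhC c ‖q₀.1‖).continuousAt hn).inv₀ (sinhC_pos hr).ne'
  have hκc : ContinuousAt κ q₀ := by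
    refine ((continuousAt_const.mul (hs.abs.add ?_)).add ?_).add continuousAt_const
    · simp only [cothC_eq, div_eq_mul_inv]
      exact ((ContinuousAt.comp (f := fun q : ℍ k × 𝔼 n => ‖q.1‖)
        (hasDerivAt_coshC c ‖q₀.1‖).continuousAt hn).mul hs).abs
    · refine tendsto_finsetSum _ fun b _ => Filter.Tendsto.const_mul _ (ContinuousAt.norm ?_)
      exact ContinuousAt.comp (f := Prod.snd) ((continuousOn_spinConn i y₀ b).continuousAt
        ((P.isOpen_coordDom y₀ i).mem_nhds hq₀.2)) continuousAt_snd
  refine ⟨κ q₀ + 1, by linarith [hκ0 q₀], P.chartDom k i y₀ ∩ {q | κ q < κ q₀ + 1},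
    Filter.inter_mem ((P.isOpen_chartDom i y₀).mem_nhds hq₀)
      (hκc.eventually (gt_mem_nhds (lt_add_one _))), Set.inter_subset_left, ?_⟩
  rintro ε r₀ Φ hε h q ⟨hq, hqκ⟩ hqr
  refine le_trans ?_ (mul_le_mul_of_nonneg_right (le_of_lt hqκ) (norm_nonneg _))
  obtain ⟨y, hy, hi, e⟩ := exists_of_mem_chartDom hq
  obtain ⟨x, u⟩ := q
  obtain rfl : u = χ[n, y₀] y := congrArg Prod.snd e
  have hx : x ≠ 0 := hq.1
  have hr : 0 < ‖x‖ := norm_pos_iff.mpr hx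
  have hsp := sinhC_pos (c := c) hr
  have hd := h.diffAt (x, y) hqr
  have h1 := congrArg (actRight ρ (P.lift i (P.indexAt y) y : Cl (Fin n))) (h.dirac_eq (x, y) hqr)
  have hrep : ∀ Ψ : ℍ k × N → S, actRight ρ (P.lift i (P.indexAt y) y : Cl (Fin n))
      (Ψ (x, y)) = P.chartRep ρ Ψ i y₀ (x, χ[n, y₀] y) :=
    fun Ψ => (chartRep_apply_chart hy).symm
  simp only [map_add, map_smul_of_tower, map_smul, hrep, chartRep_radialMul, radOp] at h1
  rw [chartRep_radialDeriv c hx hd hy hi, chartRep_diracSphere c hx hd hy hi,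
    chartRep_diracN c hx hd hy hi, sphOp, nOp] at h1
  set w := P.chartRep ρ Φ i y₀ (x, χ[n, y₀] y)
  set L := fderiv ℝ (P.chartRep ρ Φ i y₀) (x, χ[n, y₀] y)
  have h2 := sum_vecMul_fderiv (ρ := ρ) (c := c) x
    ((L : ℍ k × 𝔼 n →ₗ[ℝ] S).comp (LinearMap.inl ℝ _ _))
  have hw : (warp c ‖x‖)⁻¹ = (sinhC c ‖x‖)⁻¹ * ‖x‖ := by
    rw [warp, if_neg hr.ne', inv_div, div_eq_inv_mul]
  have e3 : ((‖x‖⁻¹ • x, 0) : ℍ k × 𝔼 n) = ‖x‖⁻¹ • (x, 0) := by simp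
  have h3 : ∑ a, twistedGen ρ ε a (L (P.chartFrame c i y₀ a (x, χ[n, y₀] y))) =
      (ε * μ) • w + ((k : ℝ) / 2 * ((sinhC c ‖x‖)⁻¹ - cothC c ‖x‖)) • ‖x‖⁻¹ • vecMul ρ x w -
        ε • ∑ b, ρ.genL (Sum.inr b) (P.spinConn ρ i y₀ b (χ[n, y₀] y) w) := by
    rw [← h1, Fintype.sum_sum_type]
    simp only [twistedGen, chartFrame, ContinuousLinearMap.coe_restrictScalars', _root_.smul_apply,
      ← smul_sum, map_add, sum_add_distrib]
    simp only [LinearMap.comp_apply, LinearMap.inl_apply, ContinuousLinearMap.coe_coe] at h2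
    rw [h2, hw, e3, map_smul, map_smul_of_tower]
    have h4 : (1 - (sinhC c ‖x‖)⁻¹ * ‖x‖) / ‖x‖ ^ 2 = ‖x‖⁻¹ * ‖x‖⁻¹ - (sinhC c ‖x‖)⁻¹ * ‖x‖⁻¹ := by
      field_simp
    rw [h4]
    module
  rw [h3]
  have hε1 : |ε| = 1 := (abs_eq zero_le_one).mpr (sq_eq_sq_iff_eq_or_eq_neg.mp (by rwa [one_pow]))
  calc _ ≤ ‖(ε * μ) • w‖ + ‖((k : ℝ) / 2 * ((sinhC c ‖x‖)⁻¹ - cothC c ‖x‖)) • ‖x‖⁻¹ • vecMul ρ x w‖ +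
        ‖ε • ∑ b, ρ.genL (Sum.inr b) (P.spinConn ρ i y₀ b (χ[n, y₀] y) w)‖ :=
      (norm_sub_le _ _).trans (add_le_add_left (norm_add_le _ _) _)
    _ ≤ ‖μ‖ * ‖w‖ + (k : ℝ) / 2 * (|(sinhC c ‖x‖)⁻¹| + |cothC c ‖x‖|) * ‖w‖ +
        (∑ b, ‖ρ.genL (Sum.inr b)‖ * ‖P.spinConn ρ i y₀ b (χ[n, y₀] y)‖) * ‖w‖ := by
      gcongr
      · rw [norm_smul, norm_mul, Complex.norm_real, norm_eq_abs, hε1, one_mul]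
      · rw [norm_smul, norm_smul, norm_vecMul, norm_inv, norm_norm, inv_mul_cancel_left₀ hr.ne',
          norm_mul, norm_of_nonneg (by positivity : (0 : ℝ) ≤ k / 2)]
        gcongr
        exact norm_sub_le _ _
      · rw [norm_smul, norm_eq_abs, hε1, one_mul, sum_mul]
        refine (norm_sum_le _ _).trans (Finset.sum_le_sum fun b _ => ?_)
        rw [mul_assoc]
        exact ((ρ.genL _).le_opNorm _).trans (by gcongr; exact ContinuousLinearMap.le_opNorm _ _)
    _ = _ := by simp only [hκ]; ring

end SpinStructure

theorem contDiffAt_hypVec (a : Fin (k + 1)) {x : ℍ k} (hx : x ≠ 0) :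
    ContDiffAt ℝ 1 (hypVec c a) x := by
  have hn : ContDiffAt ℝ 1 (fun x : ℍ k => ‖x‖) x := contDiffAt_norm ℝ hx
  have hs : ContDiff ℝ 1 (sinhC c) := by
    unfold sinhC
    split_ifs
    · exact contDiff_id
    · exact (Real.contDiff_sinh.comp (contDiff_const.mul contDiff_id)).div_const c
  have hw : ContDiffAt ℝ 1 (fun x : ℍ k => (warp c ‖x‖)⁻¹) x := by
    refine ((hn.div (hs.contDiffAt.comp x hn)
      (sinhC_pos (norm_pos_iff.mpr hx)).ne').congr_of_eventuallyEq ?_)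
    filter_upwards [isOpen_ne.mem_nhds hx] with z hz
    simp only [warp, if_neg (norm_ne_zero_iff.mpr hz), inv_div]; rfl
  unfold hypVec
  exact (hw.smul contDiffAt_const).add (((contDiffAt_const.sub hw).mul
    ((contDiff_piLp_apply (p := 2) (i := a)).contDiffAt.div (hn.pow 2) (by simpa using hx))).smul
      contDiffAt_id)

theorem linearIndependent_hypVec (x : ℍ k) :
    LinearIndependent ℝ fun a => hypVec c a x := by
  refine linearIndependent_of_top_le_span_of_card_eq_finrank (fun v _ => ?_) (by simp)
  rw [sum_smul_of_orthonormal (by simp) (hypInner c x) (hypInner_add_left c x)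
    (fun t => hypInner_smul_left c t x) (fun a => hypVec c a x)
    (fun a b => hypFrame_orthonormal c a b x) v]
  exact Submodule.sum_mem _ fun a _ => Submodule.smul_mem _ _ (Submodule.subset_span ⟨a, rfl⟩)

theorem lintegral_enorm_le {E F : Type*} [MeasurableSpace E] [NormedAddCommGroup F] (ν : Measure E)
    {u : E → F} {V D Q : ℝ} (hD : 0 ≤ D) (hV0 : 0 ≤ V) (hQ : 0 < Q)
    (hV : ν Set.univ ≤ ofReal V)
    (hu : ∫⁻ z, ‖u z‖ₑ ^ 2 ∂ν ≤ ofReal (D * Q ^ 2)) :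
    ∫⁻ z, ‖u z‖ₑ ∂ν ≤ ofReal ((V + D) * Q) := by
  have h1 : ∀ z, ‖u z‖ₑ ≤ ofReal Q + ofReal Q⁻¹ * ‖u z‖ₑ ^ 2 := by
    intro z
    rw [← ofReal_norm, ← ENNReal.ofReal_pow (norm_nonneg _), ← ENNReal.ofReal_mul (by positivity),
      ← ENNReal.ofReal_add hQ.le (by positivity)]
    refine ENNReal.ofReal_le_ofReal ?_
    have h2 : 0 ≤ Q⁻¹ * (‖u z‖ - Q) ^ 2 := by positivity
    have h3 : Q⁻¹ * (‖u z‖ - Q) ^ 2 = Q⁻¹ * ‖u z‖ ^ 2 - 2 * ‖u z‖ + Q := by field_simp; ring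
    linarith [norm_nonneg (u z)]
  refine (lintegral_mono h1).trans ?_
  rw [lintegral_add_left measurable_const, lintegral_const,
    lintegral_const_mul' _ _ ENNReal.ofReal_ne_top]
  calc _ ≤ ofReal Q * ofReal V + ofReal Q⁻¹ * ofReal (D * Q ^ 2) := by
        gcongr
    _ = _ := by
        rw [← ENNReal.ofReal_mul hQ.le, ← ENNReal.ofReal_mul (by positivity),
          ← ENNReal.ofReal_add (by positivity) (by positivity)]
        congr 1
        field_simp

namespace SpinStructure

theorem linearIndependent_chartFrame {i : ι} {y₀ : N} {q : ℍ k × 𝔼 n}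
    (hq : q.2 ∈ P.coordDom y₀ i) : LinearIndependent ℝ fun a => P.chartFrame c i y₀ a q := by
  convert linearIndependent_inl_union_inr' (linearIndependent_hypVec (c := c) q.1)
    (P.linearIndependent_coordFrame hq) using 1
  funext a
  rcases a with a | a <;> rfl

theorem contDiffOn_chartFrame (i : ι) (y₀ : N) (a : Fin (k + 1) ⊕ Fin n) :
    ContDiffOn ℝ 1 (P.chartFrame c i y₀ a) (P.chartDom k i y₀) := by
  rcases a with a | a
  · exact fun q hq => (((contDiffAt_hypVec a hq.1).comp q contDiffAt_fst).prodMk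
      contDiffAt_const).contDiffWithinAt
  · exact contDiffOn_const.prodMk (((P.contDiffOn_coordFrame y₀ i a).of_le
      (by exact_mod_cast le_top)).comp contDiffOn_snd fun q hq => hq.2)

/-- The squared `L²`-norms of `Φ` over the shell of radius `R` are bounded by `Q²`, up to the
factors `D`, in neighbourhoods of size `e` in the charts. -/
def ShellBound (e D : N → ℝ) (R Q : ℝ) (Φ : ℍ k × N → S) : Prop :=
  ∀ z, ∫⁻ q in {q : ℍ k × 𝔼 n | |‖q.1‖ - R| < 1 ∧ q.2 ∈ ball (χ[n, z] z) (e z)},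
    ‖Φ (q.1, χ[n, z].symm q.2)‖ₑ ^ 2 ≤ ofReal (D z * Q ^ 2)

theorem exists_local_sup_bound (P : SpinStructure ι g) (ρ : 𝓢 k n S)
    (c : ℝ) (μ : ℂ) {e D : N → ℝ} (he : ∀ z, 0 < e z) (hD : ∀ z, 0 ≤ D z) {R ε : ℝ}
    (hR : 3 / 2 < R) (hε : ε ^ 2 = 1) {p₀ : ℍ k × N} (hp₀ : |‖p₀.1‖ - R| ≤ 1) :
    ∃ U ∈ nhds p₀, ∃ C > 0, ∃ η > 0, ∀ p ∈ U, ∀ δ, 0 < δ → δ ≤ η → |‖p.1‖ - R| + δ ≤ 1 →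
      ∀ r₀ ≤ R - 3 / 2, ∀ Φ, P.IsTwistedSolution ρ c ε μ r₀ Φ → ∀ Q, 0 < Q →
      ShellBound (n := n) e D R Q Φ → ∀ M, 0 ≤ M → (∀ p', dist p'.1 p.1 < δ → ‖Φ p'‖ ≤ M) →
      ‖Φ p‖ ≤ C * (δ * M + (δ ^ (k + 1 + n))⁻¹ * Q) := by
  obtain ⟨x₀, z⟩ := p₀
  set i := P.indexAt z
  set χ := χ[n, z]
  set q₀ : ℍ k × 𝔼 n := (x₀, χ z)
  have hx₀ : R - 1 ≤ ‖x₀‖ := by linarith [(abs_le.mp hp₀).1]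
  have hq₀ : q₀ ∈ P.chartDom k i z := mem_chartDom_self (norm_pos_iff.mp (by linarith)) z
  obtain ⟨K, hK, O, hO, hOd, hbound⟩ := exists_chart_bound (P := P) (ρ := ρ) (c := c) μ hq₀
  set O' := O ∩ ({q | R - 3 / 2 < ‖q.1‖} ∩ {q : ℍ k × 𝔼 n | q.2 ∈ ball (χ z) (e z)})
  have hO' : O' ∈ nhds q₀ := Filter.inter_mem hO (Filter.inter_mem
    ((isOpen_lt continuous_const continuous_fst.norm).mem_nhds (by
      change R - 3 / 2 < ‖x₀‖; linarith))
    ((isOpen_ball.preimage continuous_snd).mem_nhds (mem_ball_self (he z))))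
  have hli := P.linearIndependent_chartFrame (c := c) (q := q₀) (i := i) (y₀ := z) hq₀.2
  let b := basisOfLinearIndependentOfCardEqFinrank hli (by simp)
  let T := ((EuclideanSpace.basisFun (Fin (k + 1) ⊕ Fin n) ℝ).toBasis.equiv b
    (Equiv.refl _)).toContinuousLinearEquiv
  have hT : ∀ a, T δ[a] = P.chartFrame c i z a q₀ := fun a => by
    have h1 := (EuclideanSpace.basisFun (Fin (k + 1) ⊕ Fin n) ℝ).toBasis.equiv_apply a b
      (Equiv.refl _)
    simp [b] at h1
    exact h1
  have hcard : Fintype.card (Fin (k + 1) ⊕ Fin n) = k + 1 + n := by simp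
  have : (volume : Measure (ℍ k × 𝔼 n)).IsAddHaarMeasure :=
    inferInstanceAs ((volume : Measure (ℍ k)).prod (volume : Measure (𝔼 n))).IsAddHaarMeasure
  obtain ⟨r, hr, hrO, hC⟩ := elliptic_bound_local (volume : Measure (ℍ k × 𝔼 n))
    (cliffordRel_twistedGen (ρ := ρ) hε) hO'
    (fun a => (contDiffOn_chartFrame i z a).mono (Set.inter_subset_left.trans hOd)) T hT
  obtain ⟨C, hC0, hC⟩ := hC K hK
  rw [hcard] at hC
  set V := (volume (ball (0 : ℍ k × 𝔼 n) 1)).toReal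
  have hV0 : 0 ≤ V := ENNReal.toReal_nonneg
  refine ⟨{p | p.2 ∈ χ.source ∧ (p.1, χ p.2) ∈ ball q₀ r}, Filter.inter_mem
    (((isOpen_extChartAt_source z).preimage continuous_snd).mem_nhds (mem_extChartAt_source z))
    (ContinuousAt.preimage_mem_nhds (f := fun p : ℍ k × N => (p.1, χ p.2)) (continuousAt_fst.prodMk 
      (ContinuousAt.comp (f := Prod.snd) (continuousAt_extChartAt z) continuousAt_snd)) (ball_mem_nhds _ hr)),
    C * (1 + (V + D z)), by have := hD z; positivity, r, hr, ?_⟩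
  rintro ⟨x, y⟩ ⟨hy, hp⟩ δ hδ hδr hδR r₀ hr₀ Φ h Q hQ hQΦ M hM hΦ
  set u := P.chartRep ρ Φ i z
  have hball : ball (x, χ y) δ ⊆ O' := fun q hq => hrO <| by
    rw [mem_ball] at hq hp ⊢
    linarith [dist_triangle q (x, χ y) q₀]
  have hfst : ∀ q ∈ ball (x, χ y) δ, dist q.1 x < δ := fun q hq =>
    (le_max_left _ _).trans_lt hq
  have hu : ContDiffOn ℝ 1 u O' := (h.contDiffOn i z).mono fun q hq =>
    ⟨hr₀.trans_lt hq.2.1, (hOd hq.1).2⟩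
  have h0 := hC u hu (x, χ y) hp δ hδ hδr M hM
    (fun q hq => hbound ε r₀ Φ hε h q (hball hq).1 (hr₀.trans_lt (hball hq).2.1))
    (fun q hq => by rw [norm_chartRep]; exact hΦ _ (hfst q hq))
  rw [norm_chartRep, χ.left_inv hy] at h0
  have hint : ∫ q in ball (x, χ y) δ, ‖u q‖ ≤ (V + D z) * Q := by
    have hm : AEStronglyMeasurable u (volume.restrict (ball (x, χ y) δ)) :=
      (hu.continuousOn.mono hball).aestronglyMeasurable measurableSet_ball
    rw [integral_norm_eq_lintegral_enorm hm]
    refine ENNReal.toReal_le_of_le_ofReal (by have := hD z; positivity)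
      (lintegral_enorm_le _ (hD z) hV0 hQ ?_ ((lintegral_mono_set fun q hq => ?_).trans
        (le_of_eq_of_le (lintegral_congr fun q => ?_) (hQΦ z))))
    · rw [Measure.restrict_apply_univ, ENNReal.ofReal_toReal measure_ball_lt_top.ne,
        Measure.addHaar_ball_center]
      refine measure_mono (ball_subset_ball ?_)
      linarith [abs_nonneg (‖x‖ - R)]
    · refine ⟨?_, (hball hq).2.2⟩
      have h1 := hfst q hq
      rw [dist_eq_norm] at h1
      have h2 := abs_norm_sub_norm_le q.1 x
      have h3 := abs_sub_le ‖q.1‖ ‖x‖ R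
      change |‖x‖ - R| + δ ≤ 1 at hδR
      linarith
    · rw [← ofReal_norm, norm_chartRep, ofReal_norm]
  refine h0.trans ?_
  rw [mul_assoc]
  refine mul_le_mul_of_nonneg_left ?_ hC0.le
  have h1 : (δ ^ (k + 1 + n))⁻¹ * ∫ q in ball (x, χ y) δ, ‖u q‖ ≤
      (δ ^ (k + 1 + n))⁻¹ * ((V + D z) * Q) := by gcongr
  have h2 : 0 ≤ (V + D z) * (δ * M) := by have := hD z; positivity
  have h3 : 0 ≤ (δ ^ (k + 1 + n))⁻¹ * Q := by positivity
  nlinarith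

theorem exists_sup_bound [CompactSpace N] (P : SpinStructure ι g)
    (ρ : 𝓢 k n S)
    (c : ℝ) (μ : ℂ) {e D : N → ℝ} (he : ∀ z, 0 < e z) (hD : ∀ z, 0 ≤ D z) {R ε : ℝ}
    (hR : 3 / 2 < R) (hε : ε ^ 2 = 1) :
    ∃ C > 0, ∀ r₀ ≤ R - 3 / 2, ∀ Φ, P.IsTwistedSolution ρ c ε μ r₀ Φ → ∀ Q, 0 < Q →
      ShellBound (n := n) e D R Q Φ → ∀ p : ℍ k × N, ‖p.1‖ = R → ‖Φ p‖ ≤ C * Q := by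
  set d := k + 1 + n
  set A : Set (ℍ k) := {x | |‖x‖ - R| ≤ 1}
  have hA : IsCompact A := (ProperSpace.isCompact_closedBall 0 (R + 1)).of_isClosed_subset
    (isClosed_le (continuous_norm.sub continuous_const).abs continuous_const) fun x hx => by
      rw [mem_closedBall_zero_iff]; linarith [(abs_le.mp (show |‖x‖ - R| ≤ 1 from hx)).2]
  have hAN : IsCompact (A ×ˢ (Set.univ : Set N)) := hA.prod isCompact_univ
  obtain ⟨C, hC, η, hη, hloc⟩ : ∃ C > 0, ∃ η > 0, ∀ p ∈ A ×ˢ (Set.univ : Set N), ∀ δ, 0 < δ →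
      δ ≤ η → |‖p.1‖ - R| + δ ≤ 1 →
      ∀ r₀ ≤ R - 3 / 2, ∀ Φ, P.IsTwistedSolution ρ c ε μ r₀ Φ → ∀ Q, 0 < Q →
      ShellBound (n := n) e D R Q Φ → ∀ M, 0 ≤ M → (∀ p', dist p'.1 p.1 < δ → ‖Φ p'‖ ≤ M) →
      ‖Φ p‖ ≤ C * (δ * M + (δ ^ d)⁻¹ * Q) := by
    refine hAN.induction_on ⟨1, one_pos, 1, one_pos, by simp⟩ ?_ ?_ ?_
    · rintro s t hst ⟨C, hC, η, hη, h⟩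
      exact ⟨C, hC, η, hη, fun p hp => h p (hst hp)⟩
    · rintro s t ⟨C, hC, η, hη, h⟩ ⟨C', hC', η', hη', h'⟩
      refine ⟨max C C', lt_max_of_lt_left hC, min η η', lt_min hη hη', ?_⟩
      rintro p hp δ hδ hδη hδR r₀ hr₀ Φ hΦ Q hQ hQΦ M hM hb
      rcases hp with hp | hp
      · exact (h p hp δ hδ (hδη.trans (min_le_left _ _)) hδR r₀ hr₀ Φ hΦ Q hQ hQΦ M hM hb).trans
          (by gcongr; exact le_max_left _ _)
      · exact (h' p hp δ hδ (hδη.trans (min_le_right _ _)) hδR r₀ hr₀ Φ hΦ Q hQ hQΦ M hM hb).trans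
          (by gcongr; exact le_max_right _ _)
    · rintro p hp
      obtain ⟨U, hU, h⟩ := exists_local_sup_bound P ρ c μ he hD hR hε (p₀ := p) hp.1
      exact ⟨U, mem_nhdsWithin_of_mem_nhds hU, h⟩
  set θ := min (min (1 / 2) η) (1 / (2 * C * 2 ^ d))
  have hθ : 0 < θ := by positivity
  have hθ1 : θ ≤ 1 / 2 := (min_le_left _ _).trans (min_le_left _ _)
  have hθη : θ ≤ η := (min_le_left _ _).trans (min_le_right _ _)
  have hθC : C * θ * 2 ^ d ≤ 1 / 2 := by
    have h1 : θ ≤ 1 / (2 * C * 2 ^ d) := min_le_right _ _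
    rw [le_div_iff₀ (by positivity)] at h1
    linarith
  refine ⟨2 * C * (θ ^ d)⁻¹, by positivity, ?_⟩
  intro r₀ hr₀ Φ h Q hQ hQΦ p hp
  have hcont : ContinuousOn (fun p : ℍ k × N => (1 - |‖p.1‖ - R|) ^ d * ‖Φ p‖)
      (A ×ˢ (Set.univ : Set N)) := fun p hp => by
    have hp1 : |‖p.1‖ - R| ≤ 1 := hp.1
    exact (((by fun_prop : Continuous fun p : ℍ k × N =>
      (1 - |‖p.1‖ - R|) ^ d)).continuousAt.mul (h.diffAt p (by
        linarith [(abs_le.mp hp1).1])).continuousAt_norm).continuousWithinAt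
  have hpA : p ∈ A ×ˢ (Set.univ : Set N) := ⟨by simp [A, hp], trivial⟩
  obtain ⟨p', hp', hmax⟩ := hAN.exists_isMaxOn ⟨p, hpA⟩ hcont
  have h1 := hmax hpA
  simp only [Set.mem_ofPred_eq, hp, sub_self, abs_zero, sub_zero, one_pow, one_mul] at h1
  refine h1.trans ?_
  set t := 1 - |‖p'.1‖ - R| with ht
  have ht0 : 0 ≤ t := by rw [ht]; linarith [show |‖p'.1‖ - R| ≤ 1 from hp'.1]
  rcases ht0.eq_or_lt with ht0 | ht0
  · rw [← ht0, zero_pow (by simp [d]), zero_mul]; positivity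
  have ht1 : t ≤ 1 := by rw [ht]; linarith [abs_nonneg (‖p'.1‖ - R)]
  have h2 := hloc p' hp' (θ * t) (by positivity) (by nlinarith) (by nlinarith) r₀ hr₀ Φ h Q hQ
    hQΦ (2 ^ d * ‖Φ p'‖) (by positivity) (fun q hq => by
      have h3 : t / 2 ≤ 1 - |‖q.1‖ - R| := by
        rw [dist_eq_norm] at hq
        have h4 := abs_norm_sub_norm_le q.1 p'.1
        have h5 := abs_sub_le ‖q.1‖ ‖p'.1‖ R
        nlinarith
      have h4 := hmax (show q ∈ A ×ˢ (Set.univ : Set N) from ⟨by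
        change |‖q.1‖ - R| ≤ 1; linarith, trivial⟩)
      have h5 : (t / 2) ^ d * ‖Φ q‖ ≤ t ^ d * ‖Φ p'‖ :=
        (mul_le_mul_of_nonneg_right (pow_le_pow_left₀ (by positivity) h3 d) (norm_nonneg _)).trans h4
      rw [div_pow, div_mul_eq_mul_div, div_le_iff₀ (by positivity), mul_assoc] at h5
      exact (mul_le_mul_iff_right₀ (by positivity : 0 < t ^ d)).mp (by linarith))
  have h3 : C * (θ * t * (2 ^ d * ‖Φ p'‖)) ≤ 1 / 2 * ‖Φ p'‖ := by
    calc _ = (C * θ * 2 ^ d) * t * ‖Φ p'‖ := by ring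
      _ ≤ 1 / 2 * 1 * ‖Φ p'‖ := by gcongr
      _ = _ := by ring
  have h4 : ‖Φ p'‖ ≤ 2 * C * (((θ * t) ^ d)⁻¹ * Q) := by linarith
  calc _ ≤ t ^ d * (2 * C * (((θ * t) ^ d)⁻¹ * Q)) := by gcongr
    _ = _ := by rw [mul_pow, mul_inv]; field_simp

end SpinStructure
end TwistedSolution

section Symmetric

variable {n k : ℕ} {S : Type*} [NormedAddCommGroup S] [InnerProductSpace ℂ S]
  [FiniteDimensional ℂ S] {ρ : 𝓢 k n S}

theorem map_eq_sum_single (T : ℍ k →L[ℝ] S)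
    (x : ℍ k) : ∑ a, x a • T δ[a] = T x := by
  conv_rhs => rw [← sum_smul_single_euclidean x]
  simp

theorem radial_divergence (ρ : 𝓢 k n S) (x : ℍ k) (f h : S)
    (df dh : ℍ k →L[ℝ] S) (t F : ℝ) :
    ∑ a, ((t * x a) • (inner ℂ f (ρ.genL (Sum.inl a) (vecMul ρ x h)) + x a • inner ℂ f h) +
      F • (inner ℂ (df δ[a]) (ρ.genL (Sum.inl a) (vecMul ρ x h)) +
        inner ℂ f (ρ.genL (Sum.inl a) (ρ.genL (Sum.inl a) h + vecMul ρ x (dh δ[a]))) + inner ℂ f h +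
        x a • (inner ℂ (df δ[a]) h + inner ℂ f (dh δ[a])))) =
      F • (inner ℂ (vecMul ρ x (∑ a, ρ.genL (Sum.inl a) (df δ[a])) + df x) h -
        inner ℂ f (vecMul ρ x (∑ a, ρ.genL (Sum.inl a) (dh δ[a])) + dh x)) := by
  have hr : ∀ (u w : S) (r : ℝ), inner ℂ u (r • w) = r • inner ℂ u w := fun u w r => by
    rw [← coe_smul, inner_smul_right, Complex.real_smul]
  have hl : ∀ (u w : S) (r : ℝ), inner ℂ (r • u) w = r • inner ℂ u w := fun u w r => by
    rw [← coe_smul, inner_smul_left, Complex.conj_ofReal, Complex.real_smul]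
  have h1 : ∑ a, x a • inner ℂ f (ρ.genL (Sum.inl a) (vecMul ρ x h)) = -(‖x‖ ^ 2 • inner ℂ f h) := by
    have h0 : ∀ w, ∑ a, x a • inner ℂ f (ρ.genL (Sum.inl a) w) = inner ℂ f (vecMul ρ x w) :=
      fun w => by simp [vecMul_apply, _root_.sum_apply, inner_sum, hr]
    rw [h0, vecMul_vecMul, inner_neg_right, hr]
  have h2 : ∑ a, x a * x a = ‖x‖ ^ 2 := by
    rw [EuclideanSpace.norm_sq_eq]
    simp [sq]
  have h3 : ∀ a, inner ℂ f (ρ.genL (Sum.inl a) (ρ.genL (Sum.inl a) h +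
      vecMul ρ x (dh δ[a]))) = -inner ℂ f h -
      inner ℂ f (vecMul ρ x (ρ.genL (Sum.inl a) (dh δ[a]))) -
      (2 : ℝ) • x a • inner ℂ f (dh δ[a]) := fun a => by
    have : ρ.genL (Sum.inl a) (ρ.genL (Sum.inl a) h) = -h :=
      congr_fun (ρ.cliffordRel_genL.sq _) h
    rw [map_add, this, genL_vecMul, inner_add_right, inner_sub_right, inner_neg_right,
      inner_neg_right, hr, mul_smul]
    abel
  have h4 : ∀ a, inner ℂ (df δ[a]) (ρ.genL (Sum.inl a) (vecMul ρ x h)) =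
      inner ℂ (vecMul ρ x (ρ.genL (Sum.inl a) (df δ[a]))) h := fun a => by
    rw [inner_vecMul, ρ.inner_genL, neg_neg]
  rw [inner_add_left, inner_add_right, map_sum, map_sum, sum_inner, inner_sum]
  rw [← map_eq_sum_single df x, ← map_eq_sum_single dh x, sum_inner, inner_sum]
  simp only [hr, hl, h3, h4]
  have e : ∀ a, ((t * x a) • (inner ℂ f (ρ.genL (Sum.inl a) (vecMul ρ x h)) + x a • inner ℂ f h)) =
      t • (x a • inner ℂ f (ρ.genL (Sum.inl a) (vecMul ρ x h))) + t • ((x a * x a) • inner ℂ f h) :=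
    fun a => by module
  simp only [e, sum_add_distrib, ← smul_sum, sum_sub_distrib, smul_add, h1,
    ← sum_smul, h2, sum_neg_distrib]
  module

variable (ρ) in
/-- The operator `∂_r · D^{𝕊^k}` in Euclidean coordinates. -/
def radialSphOp (f : ℍ k → S) (x : ℍ k) : S :=
  vecMul ρ x (flatDirac ρ f x) + fderiv ℝ f x x + ((k : ℝ) / 2) • f x

theorem lintegral_radialSphOp_sq {r₀ R lam : ℝ} (hr₀ : 0 < r₀) (χ : ContDiffBump R)
    (hχ : r₀ < R - χ.rOut) (hlam : 0 ≤ lam)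
    {f h : ℍ k → S} (hf : ContDiffOn ℝ 1 f {x | r₀ < ‖x‖})
    (hh : ContDiffOn ℝ 1 h {x | r₀ < ‖x‖}) (hfh : ∀ x, r₀ < ‖x‖ → radialSphOp ρ f x = h x)
    (hhf : ∀ x, r₀ < ‖x‖ → radialSphOp ρ h x = lam • f x) :
    ∫⁻ x, ofReal (χ ‖x‖ * ‖h x‖ ^ 2) = ofReal lam * ∫⁻ x, ofReal (χ ‖x‖ * ‖f x‖ ^ 2) := by
  set U : Set (ℍ k) := {x | r₀ < ‖x‖}
  have hU : IsOpen U := isOpen_lt continuous_const continuous_norm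
  have h0 : ∀ x ∈ U, x ≠ 0 := fun x hx => norm_pos_iff.mp (hr₀.trans hx)
  set A : Set (ℍ k) := {x | |‖x‖ - R| ≤ χ.rOut}
  have hAc : IsClosed A := isClosed_le (continuous_norm.sub continuous_const).abs continuous_const
  have hAU : A ⊆ U := fun x hx => by
    have h1 : |‖x‖ - R| ≤ χ.rOut := hx
    change r₀ < ‖x‖
    linarith [(abs_le.mp h1).1]
  have hA : IsCompact A := (ProperSpace.isCompact_closedBall 0 (R + χ.rOut)).of_isClosed_subset hAc
    fun x hx => by
      rw [mem_closedBall_zero_iff]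
      linarith [(abs_le.mp (show |‖x‖ - R| ≤ χ.rOut from hx)).2]
  have hcut : ∀ {F : Type _} [NormedAddCommGroup F] [NormedSpace ℝ F] {u : ℍ k → F},
      ContDiffOn ℝ 1 u U → ContDiff ℝ 1 (fun x => χ ‖x‖ • u x) ∧
        tsupport (fun x => χ ‖x‖ • u x) ⊆ A := by
    intro F _ _ u hu
    have hs : tsupport (fun x => χ ‖x‖ • u x) ⊆ A := closure_minimal (fun x hx => by
      have h1 : ‖x‖ ∈ Function.support χ := left_ne_zero_of_smul hx
      rw [χ.support_eq, mem_ball, Real.dist_eq] at h1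
      exact h1.le) hAc
    exact ⟨contDiff_of_tsupport_subset hU ((χ.contDiff.comp_contDiffOn fun x hx =>
      (contDiffAt_norm ℝ (h0 x hx)).contDiffWithinAt).smul hu) (hs.trans hAU), hs⟩
  set B : ℍ k →L[ℝ] S →L[ℝ] S :=
    (ContinuousLinearMap.restrictScalarsL ℂ S S ℝ ℝ).comp (vecMul ρ)
  set γ : Fin (k + 1) → S →L[ℝ] S := fun a => (ρ.genL (Sum.inl a)).restrictScalars ℝ
  set w : Fin (k + 1) → ℍ k → ℂ := fun a x =>
    inner ℂ (f x) (γ a (B x (h x))) + x a • inner ℂ (f x) (h x)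
  have hw : ∀ a, ContDiffOn ℝ 1 (w a) U := fun a =>
    (hf.inner ℂ ((γ a).contDiff.comp_contDiffOn (B.contDiff.contDiffOn.clm_apply hh))).add
      ((contDiff_piLp_apply (p := 2) (i := a)).contDiffOn.smul (hf.inner ℂ hh))
  have hdiv : ∀ x, ∑ a, fderiv ℝ (fun x => χ ‖x‖ • w a x) x δ[a] =
      ((χ ‖x‖ * ‖h x‖ ^ 2 - lam * (χ ‖x‖ * ‖f x‖ ^ 2) : ℝ) : ℂ) := by
    intro x
    by_cases hx : x ∈ U
    · have hχd := hasFDerivAt_comp_norm (h0 x hx)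
        ((χ.contDiff (n := 1)).differentiable (by norm_num) ‖x‖).hasDerivAt
      have hfd := (hf.differentiableOn (by norm_num)).differentiableAt (hU.mem_nhds hx) |>.hasFDerivAt
      have hhd := (hh.differentiableOn (by norm_num)).differentiableAt (hU.mem_nhds hx) |>.hasFDerivAt
      have hd : ∀ a, HasFDerivAt (fun x => χ ‖x‖ • w a x) _ x := fun a => hχd.smul
        ((hfd.inner ℂ ((γ a).hasFDerivAt.comp x (B.hasFDerivAt.clm_apply hhd))).add
          ((proj a : ℍ k →L[ℝ] ℝ).hasFDerivAt.smul (hfd.inner ℂ hhd)))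
      have e : ∀ a, fderiv ℝ (fun x => χ ‖x‖ • w a x) x δ[a] =
          (deriv χ ‖x‖ * ‖x‖⁻¹ * x a) • (inner ℂ (f x) (ρ.genL (Sum.inl a) (vecMul ρ x (h x))) +
            x a • inner ℂ (f x) (h x)) + χ ‖x‖ • (inner ℂ (fderiv ℝ f x δ[a])
              (ρ.genL (Sum.inl a) (vecMul ρ x (h x))) + inner ℂ (f x) (ρ.genL (Sum.inl a)
              (ρ.genL (Sum.inl a) (h x) + vecMul ρ x (fderiv ℝ h x δ[a]))) +
              inner ℂ (f x) (h x) + x a • (inner ℂ (fderiv ℝ f x δ[a]) (h x) +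
                inner ℂ (f x) (fderiv ℝ h x δ[a]))) := fun a => by
        rw [(hd a).fderiv]
        simp only [_root_.add_apply, _root_.smul_apply, ContinuousLinearMap.comp_apply,
          ContinuousLinearMap.smulRight_apply, ContinuousLinearMap.prod_apply, fderivInnerCLM_apply,
          innerSL_apply_apply, ContinuousLinearMap.flip_apply]
        have e1 : B δ[a] (h x) = ρ.genL (Sum.inl a) (h x) := by
          rw [← vecMul_single]; rfl
        have e2 : (proj a : ℍ k →L[ℝ] ℝ) δ[a] = 1 := by
          simp
        have e3 : inner ℝ x δ[a] = x a := by
          simp [EuclideanSpace.inner_single_right]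
        have e4 : ∀ s, B x s = vecMul ρ x s := fun s => rfl
        have e5 : ∀ s, γ a s = ρ.genL (Sum.inl a) s := fun s => rfl
        have e6 : (proj a : ℍ k →L[ℝ] ℝ) x = x a := rfl
        rw [e1, e2, e3, e6]
        simp only [w, Function.comp_apply, e4, e5, map_add, inner_add_right, one_smul, smul_eq_mul]
        module
      rw [sum_congr rfl fun a _ => e a, radial_divergence]
      have h1 := hfh x hx
      have h2 := hhf x hx
      simp only [radialSphOp, flatDirac] at h1 h2
      rw [eq_sub_of_add_eq h1, eq_sub_of_add_eq h2, inner_sub_left, inner_sub_right]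
      simp only [← coe_smul, inner_smul_left, inner_smul_right, inner_self_eq_norm_sq_to_K,
        Complex.conj_ofReal]
      push_cast [Complex.coe_algebraMap]
      ring
    · have e : ∀ a, fderiv ℝ (fun x => χ ‖x‖ • w a x) x = 0 := fun a => image_eq_zero_of_notMem_tsupport
        fun hx' => hx (hAU ((hcut (hw a)).2 (tsupport_fderiv_subset ℝ hx')))
      have h1 : χ ‖x‖ = 0 := by
        by_contra h1
        have h2 : ‖x‖ ∈ Function.support χ := h1
        rw [χ.support_eq, mem_ball, Real.dist_eq] at h2
        exact hx (hAU h2.le)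
      rw [Finset.sum_eq_zero fun a _ => by rw [e]; rfl, h1]
      simp
  have hint : ∀ {u : ℍ k → S}, ContDiffOn ℝ 1 u U →
      Integrable (fun x => χ ‖x‖ * ‖u x‖ ^ 2) := fun hu =>
    (hcut (hu.norm_sq ℂ)).1.continuous.integrable_of_hasCompactSupport
      (hA.of_isClosed_subset isClosed_closure (hcut (hu.norm_sq ℂ)).2)
  have hzero : ∫ x, (χ ‖x‖ * ‖h x‖ ^ 2 - lam * (χ ‖x‖ * ‖f x‖ ^ 2)) = 0 := by
    have hcs : ∀ a, HasCompactSupport fun x => χ ‖x‖ • w a x := fun a =>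
      hA.of_isClosed_subset isClosed_closure (hcut (hw a)).2
    have h1 := integral_finsetSum (μ := volume) Finset.univ (f := fun a x =>
      fderiv ℝ (fun x => χ ‖x‖ • w a x) x δ[a]) fun a _ =>
        (((hcut (hw a)).1.continuous_fderiv (by norm_num)).clm_apply
          continuous_const).integrable_of_hasCompactSupport ((hcs a).fderiv_apply ℝ _)
    simp only [hdiv, integral_fderiv_apply_eq_zero volume (hcut (hw _)).1 (hcs _),
      Finset.sum_const_zero] at h1
    rw [integral_complex_ofReal] at h1
    exact_mod_cast h1
  rw [integral_sub (hint hh) ((hint hf).const_mul _), integral_const_mul, sub_eq_zero] at hzero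
  have h2 : ∀ u : ℍ k → S, 0 ≤ᵐ[volume] fun x => χ ‖x‖ * ‖u x‖ ^ 2 := fun u =>
    Filter.Eventually.of_forall fun x => mul_nonneg χ.nonneg (by positivity)
  rw [← ofReal_integral_eq_lintegral_ofReal (hint hh) (h2 h),
    ← ofReal_integral_eq_lintegral_ofReal (hint hf) (h2 f), hzero, ENNReal.ofReal_mul hlam]

end Symmetric

section ModeSupBound

variable {n k : ℕ} {N : Type*} [TopologicalSpace N] [ChartedSpace (𝔼 n) N]
  [IsManifold (𝓡 n) ∞ N] {ι : Type*} {g : RiemMetric n N} {P : SpinStructure ι g}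
  {S : Type*} [NormedAddCommGroup S] [InnerProductSpace ℂ S]
  [FiniteDimensional ℂ S] {ρ : 𝓢 k n S} {c rho lam lam₀ r₀ : ℝ}
  {μ κ₀ : ℂ} {Φ φ : ℍ k × N → S} {v : Fin 4 → ℍ k × N → S}
  {Pr : (Fin 4 → ℂ) →ₗ[ℂ] (Fin 4 → ℂ)} {a : ℝ → Fin 4 → ℂ}

theorem warp_zero (r : ℝ) : warp 0 r = 1 := by
  unfold warp sinhC
  split_ifs <;> simp_all

theorem one_le_warp (hc : 0 ≤ c) {r : ℝ} (hr : 0 < r) : 1 ≤ warp c r := by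
  rw [warp, if_neg hr.ne', one_le_div hr]
  exact le_sinhC hc hr.le

namespace SpinStructure

theorem IsTwistedSolution.contDiffOn_fst {ε : ℝ} (h : P.IsTwistedSolution ρ c ε μ r₀ Φ) (y : N) :
    ContDiffOn ℝ 1 (fun x => Φ (x, y)) {x | r₀ < ‖x‖} := by
  simp_rw [← chartRep_self (P := P) (ρ := ρ) Φ _ y]
  exact (h.contDiffOn (P.indexAt y) y).comp (contDiffOn_id.prodMk contDiffOn_const) fun x hx =>
    ⟨hx, P.mem_coordDom (mem_extChartAt_source y) (P.mem_dom_at y)⟩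

theorem radialSphOp_eq {x : ℍ k} {y : N} (hx : x ≠ 0) (h : P.SpinorDiffAt ρ Φ (x, y)) :
    radialSphOp ρ (fun x => Φ (x, y)) x = ‖x‖⁻¹ • vecMul ρ x (P.diracSphere ρ c Φ (x, y)) := by
  have hr : ‖x‖ ≠ 0 := norm_ne_zero_iff.mpr hx
  rw [diracSphere_eq c hx (h _ (P.mem_dom_at y)), radialSphOp]
  simp only [map_sub, map_smul_of_tower, vecMul_vecMul, smul_sub, smul_neg, smul_smul]
  rw [inv_mul_cancel₀ hr, show ‖x‖⁻¹ * (‖x‖⁻¹ * ‖x‖ ^ 2) = 1 by field_simp,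
    show ‖x‖⁻¹ * ((k : ℝ) / 2 * ‖x‖⁻¹ * ‖x‖ ^ 2) = k / 2 by field_simp]
  module

theorem IsModeBasis.radialSphOp_modeEval (hv : P.IsModeBasis ρ c rho lam v) {b : ℝ → Fin 4 → ℂ}
    {b' : Fin 4 → ℂ} {x : ℍ k} (hx : x ≠ 0) (y : N) (hb : HasDerivAt b b' ‖x‖) :
    radialSphOp ρ (fun x => modeEval v (x, y) (b ‖x‖)) x =
      modeEval v (x, y) ((modeB rho).mulVec (b ‖x‖)) := by
  rw [radialSphOp_eq (c := c) (Φ := fun p => modeEval v p (b ‖p.1‖)) hx (hv.spinorDiffAt hx hb),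
    hv.diracSphere_modeEval hx hb, modeB, ← mulVec_mulVec, hv.modeEval_rad hx]

theorem continuousOn_modeGen_mulVec {ε : ℂ} {b : ℝ → Fin 4 → ℂ} (hr₀ : 0 ≤ r₀)
    (hb : ∀ r, r₀ < r → ContinuousAt b r) :
    ContinuousOn (fun r => (modeGen ε k c rho lam μ r).mulVec (b r)) (Set.Ioi r₀) := by
  intro r hr
  have hs : ContinuousAt (fun r => (sinhC c r)⁻¹) r := (hasDerivAt_sinhC c r).continuousAt.inv₀
    (sinhC_pos (hr₀.trans_lt hr)).ne'
  have hco : ContinuousAt (fun r => cothC c r) r := by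
    simp only [cothC_eq, div_eq_mul_inv]
    exact (hasDerivAt_coshC c r).continuousAt.mul hs
  have hB : ∀ M : Matrix (Fin 4) (Fin 4) ℂ, ContinuousAt (fun r => M.mulVec (b r)) r := fun M =>
    ContinuousAt.comp (g := M.mulVec) (by fun_prop) (hb r hr)
  have h1 : ContinuousAt (fun r => ((sinhC c r : ℂ))⁻¹) r := by
    simp only [← Complex.ofReal_inv]
    exact Complex.continuous_ofReal.continuousAt.comp hs
  have h2 : ContinuousAt (fun r => ((k / 2 * cothC c r : ℝ) : ℂ)) r :=
    ContinuousAt.comp (g := Complex.ofReal) Complex.continuous_ofReal.continuousAt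
      (continuousAt_const.mul hco)
  simp only [modeGen, sub_mulVec, add_mulVec, smul_mulVec]
  exact (((hB _).const_smul ε).add (h1.smul (hB _))).sub (h2.smul (hB _)) |>.continuousWithinAt

theorem IsModeCoeff.hasDerivAt_modeB (h : IsModeCoeff k (n := n) c rho lam r₀ μ v Pr a) {r : ℝ}
    (hr : r₀ < r) : HasDerivAt (fun r => (modeB rho).mulVec (a r))
      ((modeB rho).mulVec (Pr ((modeGen 1 k c rho lam μ r).mulVec (a r)))) r :=
  LinearMap.hasDerivAt_comp (Matrix.mulVecLin (modeB rho)) (h.hasDerivAt r hr)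

theorem IsModeCoeff.continuousOn_deriv (h : IsModeCoeff k (n := n) c rho lam r₀ μ v Pr a)
    (hr₀ : 0 < r₀) : ContinuousOn (fun r => Pr ((modeGen 1 k c rho lam μ r).mulVec (a r)))
      (Set.Ioi r₀) :=
  Pr.continuous_of_finiteDimensional.comp_continuousOn
    (continuousOn_modeGen_mulVec hr₀.le fun r hr => (h.hasDerivAt r hr).continuousAt)

theorem IsModeCoeff.isTwistedSolution (h : IsModeCoeff k (n := n) c rho lam r₀ μ v Pr a)
    (hv : P.IsModeBasis ρ c rho lam v) (hr₀ : 0 < r₀) :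
    P.IsTwistedSolution ρ c 1 μ r₀ (fun p => modeEval v p (a ‖p.1‖)) :=
  hv.isTwistedSolution hr₀ h.hasDerivAt (h.continuousOn_deriv hr₀) fun p hp => by
    rw [h.proj p _ (norm_pos_iff.mp (hr₀.trans hp)), Complex.ofReal_one]

theorem IsModeCoeff.isTwistedSolution_modeB (h : IsModeCoeff k (n := n) c rho lam r₀ μ v Pr a)
    (hv : P.IsModeBasis ρ c rho lam v) (hr₀ : 0 < r₀) :
    P.IsTwistedSolution ρ c (-1) μ r₀ (fun p => modeEval v p ((modeB rho).mulVec (a ‖p.1‖))) :=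
  hv.isTwistedSolution hr₀ (b := fun r => (modeB rho).mulVec (a r)) (fun r hr => h.hasDerivAt_modeB hr)
    ((by fun_prop : Continuous (modeB rho).mulVec).comp_continuousOn (h.continuousOn_deriv hr₀))
    fun p hp => by
      have hp0 : p.1 ≠ 0 := norm_pos_iff.mp (hr₀.trans hp)
      have h1 := hv.modeEval_modeB_eq_zero (d := Pr ((modeGen 1 k c rho lam μ ‖p.1‖).mulVec (a ‖p.1‖)) -
        (modeGen 1 k c rho lam μ ‖p.1‖).mulVec (a ‖p.1‖)) (fun q hq => by
          rw [map_sub, h.proj q _ hq, sub_self]) hp0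
      rw [Matrix.mulVec_sub, map_sub, sub_eq_zero] at h1
      rw [h1, mulVec_mulVec, modeB_mul_modeGen, mulVec_mulVec]
      simp

theorem IsModeCoeff.lintegral_modeB_le (h : IsModeCoeff k (n := n) c rho lam r₀ μ v Pr a)
    (hv : P.IsModeBasis ρ c rho lam v) (hr₀ : 0 < r₀) {R : ℝ} (hR : r₀ ≤ R - 3 / 2) (y : N) :
    ∫⁻ x in {x : ℍ k | |‖x‖ - R| < 1}, ‖modeEval v (x, y) ((modeB rho).mulVec (a ‖x‖))‖ₑ ^ 2 ≤
      ofReal (rho ^ 2) * ∫⁻ x in {x : ℍ k | r₀ < ‖x‖}, ‖modeEval v (x, y) (a ‖x‖)‖ₑ ^ 2 := by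
  let χ : ContDiffBump R := ⟨1, 5 / 4, one_pos, by norm_num⟩
  have hχ : χ.rOut = 5 / 4 := rfl
  have he : ∀ s : S, ‖s‖ₑ ^ 2 = ofReal (‖s‖ ^ 2) := fun s => by
    rw [← ofReal_norm, ENNReal.ofReal_pow (norm_nonneg _)]
  have key := lintegral_radialSphOp_sq (ρ := ρ) hr₀ χ (by rw [hχ]; linarith) (sq_nonneg rho)
    ((h.isTwistedSolution hv hr₀).contDiffOn_fst y)
    ((h.isTwistedSolution_modeB hv hr₀).contDiffOn_fst y)
    (fun x hx => hv.radialSphOp_modeEval (norm_pos_iff.mp (hr₀.trans hx)) y (h.hasDerivAt _ hx))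
    (fun x hx => by
      rw [hv.radialSphOp_modeEval (b := fun r => (modeB rho).mulVec (a r))
        (norm_pos_iff.mp (hr₀.trans hx)) y (h.hasDerivAt_modeB hx), mulVec_mulVec, modeB_sq,
        smul_mulVec, one_mulVec, map_smul, ← Complex.ofReal_pow, coe_smul])
  have hm : MeasurableSet {x : ℍ k | |‖x‖ - R| < 1} :=
    (isOpen_lt (continuous_norm.sub continuous_const).abs continuous_const).measurableSet
  rw [← lintegral_indicator hm, ← lintegral_indicator (isOpen_lt continuous_const
    continuous_norm).measurableSet]
  refine (lintegral_mono fun x => ?_).trans (key.le.trans (mul_le_mul_right (lintegral_mono fun x => ?_) _))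
  · by_cases hx : x ∈ {x : ℍ k | |‖x‖ - R| < 1}
    · rw [Set.indicator_of_mem hx, he, χ.one_of_mem_closedBall (by
        rw [mem_closedBall, Real.dist_eq]; exact le_of_lt hx), one_mul]
    · rw [Set.indicator_of_notMem hx]
      exact zero_le
  · by_cases hx : r₀ < ‖x‖
    · rw [Set.indicator_of_mem (show x ∈ {x : ℍ k | r₀ < ‖x‖} from hx), he]
      exact ENNReal.ofReal_le_ofReal (mul_le_of_le_one_left (by positivity) χ.le_one)
    · rw [χ.zero_of_le_dist (by
        rw [Real.dist_eq, hχ, abs_sub_comm]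
        exact le_trans (by linarith) (le_abs_self _)), zero_mul, ENNReal.ofReal_zero]
      exact zero_le

theorem setLIntegral_prod_le {E F : Type*} [MeasureSpace E] [MeasureSpace F]
    [SFinite (volume : Measure E)] [SFinite (volume : Measure F)] (A : Set E) (B : Set F)
    (f : E × F → ℝ≥0∞) : ∫⁻ q in A ×ˢ B, f q ≤ ∫⁻ u in B, ∫⁻ x in A, f (x, u) := by
  rw [Measure.volume_eq_prod, ← Measure.prod_restrict, ← lintegral_prod_swap]
  exact lintegral_prod_le _

/-- Bounds at radius `R`, uniform in `lam`, for the components of a solution in a mode. -/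
theorem exists_mode_sup_bound [CompactSpace N] [MeasurableSpace N] [BorelSpace N]
    (P : SpinStructure ι g) (ρ : 𝓢 k n S) (hc : 0 ≤ c) (rho : ℝ) (μ : ℂ)
    {R : ℝ} (hR : 3 / 2 < R) : ∃ C > 0, ∀ r₀, 0 < r₀ → r₀ ≤ R - 3 / 2 → ∀ lam φ v Pr a,
      P.IsModeSolution ρ c μ rho lam r₀ φ → P.IsModeBasis ρ c rho lam v →
      IsModeCoeff k (n := n) c rho lam r₀ μ v Pr a → (∀ p, r₀ < ‖p.1‖ → φ p = modeEval v p (a ‖p.1‖)) →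
      ∀ p : ℍ k × N, ‖p.1‖ = R → ‖modeEval v p (a R)‖ ≤ C * (l2Norm g c r₀ φ).toReal ∧
        ‖modeEval v p ((modeB rho).mulVec (a R))‖ ≤ C * (l2Norm g c r₀ φ).toReal := by
  choose e he hed D hD hl2 using fun z : N => exists_l2_chart_bound P ρ c (P.indexAt z)
    (P.mem_coordDom (mem_extChartAt_source z) (P.mem_dom_at z))
  obtain ⟨C₁, hC₁, h₁⟩ := exists_sup_bound P ρ c μ (e := e) (D := fun z => (1 + rho ^ 2) * D z) he
    (fun z => by have := hD z; positivity) hR (one_pow 2)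
  obtain ⟨C₂, hC₂, h₂⟩ := exists_sup_bound P ρ c μ (e := e) (D := fun z => (1 + rho ^ 2) * D z) he
    (fun z => by have := hD z; positivity) hR (neg_one_sq (R := ℝ))
  refine ⟨max C₁ C₂, lt_max_of_lt_left hC₁, ?_⟩
  intro r₀ hr₀ hrR lam φ v Pr a h hv ha hφ
  set L := (l2Norm g c r₀ φ).toReal
  have hdiff : ∀ p : ℍ k × N, r₀ < ‖p.1‖ → P.SpinorDiffAt ρ φ p := fun p hp i hi =>
    h.differentiable i p hp hi
  have hb : ∀ z, ∫⁻ q in {x : ℍ k | r₀ < ‖x‖} ×ˢ ball (χ[n, z] z) (e z),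
      ‖φ (q.1, χ[n, z].symm q.2)‖ₑ ^ 2 ≤ ofReal (D z * L ^ 2) := fun z => by
    rw [ENNReal.ofReal_mul (hD z).le, ENNReal.ofReal_pow ENNReal.toReal_nonneg,
      ENNReal.ofReal_toReal h.l2.ne]
    refine le_trans (setLIntegral_mono' ((isOpen_lt continuous_const
      continuous_norm).prod isOpen_ball).measurableSet fun q hq => ?_) (hl2 z r₀ φ hdiff)
    refine le_mul_of_one_le_right' ?_
    rw [ENNReal.one_le_ofReal]
    exact one_le_pow₀ (one_le_warp hc (hr₀.trans hq.1))
  have hswap : ∀ z, ∫⁻ u in ball (χ[n, z] z) (e z), ∫⁻ x in {x : ℍ k | r₀ < ‖x‖},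
      ‖φ (x, χ[n, z].symm u)‖ₑ ^ 2 ≤ ofReal (D z * L ^ 2) := fun z => by
    refine le_of_eq_of_le ?_ (hb z)
    have hm := measurable_indicator_chart (c := 0) hdiff (y₀ := z) isOpen_ball
      ((hed z).trans fun u hu => hu.1)
    simp only [warp_zero, one_pow, ENNReal.ofReal_one, mul_one] at hm
    rw [Measure.volume_eq_prod, ← Measure.prod_restrict, lintegral_prod_symm _ (by
      rw [Measure.prod_restrict]
      exact (aemeasurable_indicator_iff ((isOpen_lt continuous_const
        continuous_norm).prod isOpen_ball).measurableSet).mp hm.aemeasurable)]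
  have hset : ∀ z, {q : ℍ k × 𝔼 n | |‖q.1‖ - R| < 1 ∧ q.2 ∈ ball (χ[n, z] z) (e z)} =
    {x : ℍ k | |‖x‖ - R| < 1} ×ˢ ball (χ[n, z] z) (e z) := fun z => rfl
  have hshell : ∀ x : ℍ k, |‖x‖ - R| < 1 → r₀ < ‖x‖ := fun x hx => by
    linarith [(abs_lt.mp hx).1]
  have hmono : ∀ z Q, L ≤ Q → D z * L ^ 2 ≤ D z * Q ^ 2 := fun z Q hQ =>
    mul_le_mul_of_nonneg_left (pow_le_pow_left₀ ENNReal.toReal_nonneg hQ 2) (hD z).le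
  have hs₁ : ∀ Q, L ≤ Q → ShellBound (n := n) e (fun z => (1 + rho ^ 2) * D z) R Q
      (fun p => modeEval v p (a ‖p.1‖)) := fun Q hQ z => by
    refine ((lintegral_mono_set (t := {x : ℍ k | r₀ < ‖x‖} ×ˢ ball (χ[n, z] z) (e z))
      fun q hq => ⟨hshell _ hq.1, hq.2⟩).trans (le_of_eq_of_le (setLIntegral_congr_fun ((isOpen_lt
        continuous_const continuous_norm).prod isOpen_ball).measurableSet fun q hq => ?_)
          (hb z))).trans (ENNReal.ofReal_le_ofReal ?_)
    · simp only [hφ (q.1, χ[n, z].symm q.2) hq.1]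
    · have h1 := hmono z Q hQ
      have h2 : 0 ≤ rho ^ 2 * (D z * Q ^ 2) := by have := hD z; positivity
      linarith
  have hs₂ : ∀ Q, L ≤ Q → ShellBound (n := n) e (fun z => (1 + rho ^ 2) * D z) R Q
      (fun p => modeEval v p ((modeB rho).mulVec (a ‖p.1‖))) := fun Q hQ z => by
    rw [hset]
    refine (setLIntegral_prod_le _ _ _).trans ((lintegral_mono fun u =>
      ha.lintegral_modeB_le hv hr₀ hrR _).trans ?_)
    rw [lintegral_const_mul' _ _ ENNReal.ofReal_ne_top]
    refine (mul_le_mul_right (le_of_eq_of_le (lintegral_congr fun u => setLIntegral_congr_fun (isOpen_lt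
      continuous_const continuous_norm).measurableSet fun x hx => ?_) (hswap z)) _).trans ?_
    · simp only [hφ (x, χ[n, z].symm u) hx]
    · rw [← ENNReal.ofReal_mul (sq_nonneg _)]
      refine ENNReal.ofReal_le_ofReal ?_
      have h1 := mul_le_mul_of_nonneg_left (hmono z Q hQ) (sq_nonneg rho)
      have h2 : 0 ≤ D z * Q ^ 2 := by have := hD z; positivity
      linarith
  have hlim : ∀ {X C : ℝ}, 0 < C → (∀ Q, 0 < Q → L ≤ Q → X ≤ C * Q) → C ≤ max C₁ C₂ →
      X ≤ max C₁ C₂ * L := fun {X C} hC hX hCm => by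
    have hL : 0 ≤ L := ENNReal.toReal_nonneg
    refine le_trans (le_of_forall_pos_le_add fun η hη => ?_) (mul_le_mul_of_nonneg_right hCm hL)
    have := hX (L + η / C) (by positivity) (by linarith [div_pos hη hC])
    rwa [mul_add, mul_div_cancel₀ _ hC.ne'] at this
  rintro p rfl
  exact ⟨hlim hC₁ (fun Q hQ hLQ => h₁ r₀ hrR _ (ha.isTwistedSolution hv hr₀) Q hQ (hs₁ Q hLQ) p rfl)
    (le_max_left _ _), hlim hC₂ (fun Q hQ hLQ => h₂ r₀ hrR _ (ha.isTwistedSolution_modeB hv hr₀) Q hQ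
      (hs₂ Q hLQ) p rfl) (le_max_right _ _)⟩

end SpinStructure

theorem exists_exp_le_sinhC {c R : ℝ} (hc : 0 < c) (hR : 0 < R) :
    ∃ m > 0, ∀ r, R ≤ r → m * Real.exp (c * r) ≤ sinhC c r := by
  have h1 : Real.exp (-2 * (c * R)) < 1 := by
    rw [← Real.exp_zero]
    exact Real.exp_lt_exp.mpr (by nlinarith [mul_pos hc hR])
  refine ⟨(1 - Real.exp (-2 * (c * R))) / (2 * c), div_pos (by linarith) (by linarith),
    fun r hr => ?_⟩
  have h2 : Real.exp (-(c * r)) ≤ Real.exp (-2 * (c * R)) * Real.exp (c * r) := by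
    rw [← Real.exp_add]
    exact Real.exp_le_exp.mpr (by nlinarith)
  rw [sinhC, if_neg hc.ne', Real.sinh_eq, div_mul_eq_mul_div, div_div,
    div_le_div_iff_of_pos_right (by positivity)]
  linarith

theorem exists_sqrt_re_nonneg (z : ℂ) : ∃ κ : ℂ, κ ^ 2 = z ∧ 0 ≤ κ.re := by
  obtain ⟨κ, hκ⟩ := IsAlgClosed.exists_pow_nat_eq z two_pos
  rcases le_total 0 κ.re with h | h
  · exact ⟨κ, hκ, h⟩
  · exact ⟨-κ, by rw [neg_sq, hκ], by simpa using h⟩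

namespace SpinStructure

/-- Decay of solutions in a mode beyond the radius `R`, up to the factor `sinh_c(r)^{k/2}`. -/
theorem exists_scaled_decay [CompactSpace N] [MeasurableSpace N] [BorelSpace N]
    (P : SpinStructure ι g) (ρ : 𝓢 k n S) (hc : 0 ≤ c)
    (hμ : μ.im ≠ 0 ∨ μ ∈ Complex.ofReal '' Set.Ioo (-lam₀) lam₀)
    (hκ₀ : κ₀ ^ 2 = (lam₀ : ℂ) ^ 2 - μ ^ 2) (hrho : rho = 0 → k = 0)
    {R : ℝ} (hR : 3 / 2 < R) (hR1 : 1 ≤ κ₀.re * R) (hR2 : 2 * (rho ^ 2 + 2 * |rho|) ≤ κ₀.re * R) :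
    ∃ C > 0, ∀ r₀, 0 < r₀ → r₀ ≤ R - 3 / 2 → ∀ lam φ, lam₀ ^ 2 ≤ lam ^ 2 →
      P.IsModeSolution ρ c μ rho lam r₀ φ → ∀ p : ℍ k × N, R ≤ ‖p.1‖ →
      sinhC c ‖p.1‖ ^ ((k : ℝ) / 2) * ‖φ p‖ ≤
        C * (l2Norm g c r₀ φ).toReal * Real.exp (-κ₀.re * ‖p.1‖) := by
  obtain ⟨C, hC, hsup⟩ := exists_mode_sup_bound P ρ hc rho μ hR
  have hsR : 0 < sinhC c R := sinhC_pos (by linarith)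
  refine ⟨2 * Real.exp (κ₀.re * R) * (sinhC c R ^ ((k : ℝ) / 2) * (1 + |rho|⁻¹) * C),
    by positivity, ?_⟩
  rintro r₀ hr₀ hrR lam φ hlam h ⟨x, y⟩ hp
  obtain ⟨κ, hκ, hκ0⟩ := exists_sqrt_re_nonneg ((lam : ℂ) ^ 2 - μ ^ 2)
  have hκpos := re_pos_of_sq_eq hlam hμ hκ hκ0
  have hκle := re_le_re_of_sq_eq hlam hκ₀ hκ hκpos
  obtain ⟨v, Pr, a, hv, ha, hφ⟩ := h.exists_coeff hr₀ hrho
  set L := (l2Norm g c r₀ φ).toReal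
  have hL : 0 ≤ L := ENNReal.toReal_nonneg
  have hx : 0 < ‖x‖ := by change R ≤ ‖x‖ at hp; linarith
  have hx0 : x ≠ 0 := norm_pos_iff.mp hx
  set z : ℍ k := (R / ‖x‖) • x
  have hz : ‖z‖ = R := by
    rw [norm_smul, norm_div, norm_norm, div_mul_cancel₀ _ hx.ne', norm_of_nonneg (by linarith)]
  obtain ⟨hs1, hs2⟩ := hsup r₀ hr₀ hrR lam φ v Pr a h hv ha hφ (z, y) hz
  have hRr : r₀ < R := by linarith
  have hR0 : 0 ≤ R := by linarith
  have hκR : κ₀.re * R ≤ κ.re * R := mul_le_mul_of_nonneg_right hκle hR0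
  have hσ : ∀ σ : ℝ, σ ^ 2 = 1 →
      ‖modeEval v (x, y) ((modeProj rho σ).mulVec (scaledCoeff k c a ‖x‖))‖ ≤
        Real.exp (κ₀.re * R) * (sinhC c R ^ ((k : ℝ) / 2) * (1 + |rho|⁻¹) * C) * L *
          Real.exp (-κ₀.re * ‖x‖) := by
    intro σ hσ
    have hσ1 : |σ| = 1 := (abs_eq zero_le_one).mpr (sq_eq_sq_iff_eq_or_eq_neg.mp (by rwa [one_pow]))
    have h1 := ha.norm_modeEval_le hv hc hr₀ hRr hκ hκpos (hR1.trans hκR) (hR2.trans hκR) hσ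
      (z := (x, y)) hx0 (r := ‖x‖) hp
    have h2 : ‖modeEval v (x, y) ((modeProj rho σ).mulVec (scaledCoeff k c a R))‖ ≤
        1 / 2 * (sinhC c R ^ ((k : ℝ) / 2) * (1 + |rho|⁻¹) * C * L) := by
      rw [← hv.modeEval_smul (t := R / ‖x‖) (by positivity) hx0]
      have e : modeEval v (z, y) ((modeProj rho σ).mulVec (scaledCoeff k c a R)) =
          (1 / 2 * sinhC c R ^ ((k : ℝ) / 2) : ℝ) • (modeEval v (z, y) (a R) +
            (σ * rho⁻¹) • modeEval v (z, y) ((modeB rho).mulVec (a R))) := by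
        simp only [modeProj, scaledCoeff, smul_mulVec, add_mulVec, one_mulVec,
          Matrix.mulVec_smul, ← coe_smul, map_smul, map_add]
        push_cast
        module
      rw [e, norm_smul, norm_of_nonneg (by positivity)]
      have h3 : ‖modeEval v (z, y) (a R) + (σ * rho⁻¹) • modeEval v (z, y) ((modeB rho).mulVec (a R))‖ ≤
          C * L + |rho|⁻¹ * (C * L) := by
        refine (norm_add_le _ _).trans (add_le_add hs1 ?_)
        rw [norm_smul, norm_mul, norm_eq_abs, hσ1, one_mul, norm_inv, norm_eq_abs]
        gcongr
      calc _ ≤ 1 / 2 * sinhC c R ^ ((k : ℝ) / 2) * (C * L + |rho|⁻¹ * (C * L)) := by gcongr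
        _ = _ := by ring
    have h3 : Real.exp (-κ.re * (‖x‖ - R)) ≤ Real.exp (κ₀.re * R) * Real.exp (-κ₀.re * ‖x‖) := by
      rw [← Real.exp_add]
      refine Real.exp_le_exp.mpr ?_
      nlinarith [mul_le_mul_of_nonneg_right hκle (sub_nonneg.mpr hp)]
    calc _ ≤ 2 * (Real.exp (κ₀.re * R) * Real.exp (-κ₀.re * ‖x‖)) *
          (1 / 2 * (sinhC c R ^ ((k : ℝ) / 2) * (1 + |rho|⁻¹) * C * L)) := h1.trans (by gcongr)
      _ = _ := by ring
  have hsx : 0 < sinhC c ‖x‖ := sinhC_pos hx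
  calc sinhC c ‖x‖ ^ ((k : ℝ) / 2) * ‖φ (x, y)‖
      = ‖modeEval v (x, y) (scaledCoeff k c a ‖x‖)‖ := by
        rw [hφ (x, y) (hRr.trans_le hp), scaledCoeff, ← coe_smul, map_smul, norm_smul,
          Complex.norm_real, norm_of_nonneg (by positivity)]
    _ = ‖modeEval v (x, y) ((modeProj rho 1).mulVec (scaledCoeff k c a ‖x‖)) +
          modeEval v (x, y) ((modeProj rho (-1)).mulVec (scaledCoeff k c a ‖x‖))‖ := by
        rw [← map_add, ← add_mulVec, modeProj_add, one_mulVec]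
    _ ≤ _ := (norm_add_le _ _).trans (add_le_add (hσ 1 (one_pow 2)) (hσ (-1) (neg_one_sq)))
    _ = _ := by ring

theorem exists_decay [CompactSpace N] [MeasurableSpace N] [BorelSpace N]
    (P : SpinStructure ι g) (ρ : 𝓢 k n S) (hc : 0 ≤ c)
    (hμ : μ.im ≠ 0 ∨ μ ∈ Complex.ofReal '' Set.Ioo (-lam₀) lam₀)
    (hκ₀ : κ₀ ^ 2 = (lam₀ : ℂ) ^ 2 - μ ^ 2) (hrho : rho = 0 → k = 0)
    {R : ℝ} (hR : 3 / 2 < R) (hR1 : 1 ≤ κ₀.re * R) (hR2 : 2 * (rho ^ 2 + 2 * |rho|) ≤ κ₀.re * R) :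
    ∃ C > 0, ∀ r₀, 0 < r₀ → r₀ ≤ R - 3 / 2 → ∀ lam φ, lam₀ ^ 2 ≤ lam ^ 2 →
      P.IsModeSolution ρ c μ rho lam r₀ φ →
      (0 < c → ∀ p : ℍ k × N, R ≤ ‖p.1‖ → ‖φ p‖ ≤ C * (l2Norm g c r₀ φ).toReal *
        Real.exp ((-(c * k / 2) - κ₀.re) * ‖p.1‖)) ∧
      (c = 0 → ∀ p : ℍ k × N, R ≤ ‖p.1‖ → ‖φ p‖ ≤ C * (l2Norm g c r₀ φ).toReal *
        (‖p.1‖ ^ (-(k : ℝ) / 2) * Real.exp (-κ₀.re * ‖p.1‖))) := by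
  obtain ⟨C, hC, h⟩ := exists_scaled_decay P ρ hc hμ hκ₀ hrho hR hR1 hR2
  rcases hc.eq_or_lt with rfl | hc
  · refine ⟨C, hC, fun r₀ hr₀ hrR lam φ hlam hφ => ⟨fun h => (lt_irrefl _ h).elim, fun _ p hp => ?_⟩⟩
    have h1 := h r₀ hr₀ hrR lam φ hlam hφ p hp
    have hx : 0 < ‖p.1‖ := by linarith
    rw [sinhC, if_pos rfl, mul_comm, ← le_div_iff₀ (by positivity)] at h1
    refine h1.trans (le_of_eq ?_)
    rw [neg_div, Real.rpow_neg hx.le]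
    ring
  · obtain ⟨m, hm, hms⟩ := exists_exp_le_sinhC hc (by linarith : 0 < R)
    refine ⟨C * (m ^ ((k : ℝ) / 2))⁻¹, by positivity, fun r₀ hr₀ hrR lam φ hlam hφ =>
      ⟨fun _ p hp => ?_, fun h => (hc.ne' h).elim⟩⟩
    have h1 := h r₀ hr₀ hrR lam φ hlam hφ p hp
    have h2 : m ^ ((k : ℝ) / 2) * Real.exp (c * k / 2 * ‖p.1‖) ≤ sinhC c ‖p.1‖ ^ ((k : ℝ) / 2) := by
      calc _ = (m * Real.exp (c * ‖p.1‖)) ^ ((k : ℝ) / 2) := by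
            rw [Real.mul_rpow hm.le (Real.exp_pos _).le, ← Real.exp_mul]
            ring_nf
        _ ≤ _ := Real.rpow_le_rpow (by positivity) (hms _ hp) (by positivity)
    have h3 := (mul_le_mul_of_nonneg_right h2 (norm_nonneg _)).trans h1
    rw [mul_comm, ← le_div_iff₀ (by positivity)] at h3
    refine h3.trans (le_of_eq ?_)
    rw [sub_mul, Real.exp_sub, neg_mul, Real.exp_neg, neg_mul, Real.exp_neg]
    field_simp

end SpinStructure
end ModeSupBound

end

theorem mainTheorem5 {n : ℕ} (k : ℕ) {N : Type*} [TopologicalSpace N]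
    [ChartedSpace (EuclideanSpace ℝ (Fin n)) N] [IsManifold (𝓡 n) ∞ N]
    [CompactSpace N] [T2Space N] [MeasurableSpace N] [BorelSpace N]
    (g : RiemMetric n N) {ι : Type*} (P : SpinStructure ι g)
    {SN : Type*} [NormedAddCommGroup SN] [InnerProductSpace ℂ SN] [FiniteDimensional ℂ SN]
    (ρN : SpinorModule (Fin n) SN)
    {S : Type*} [NormedAddCommGroup S] [InnerProductSpace ℂ S] [FiniteDimensional ℂ S]
    (ρ : SpinorModule (Fin (k + 1) ⊕ Fin n) S)
    (c : ℝ) (hc : 0 ≤ c)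
    (lam₀ : ℝ) (hlam₀ : 0 ≤ lam₀) (hmin : IsLeast (P.diracSqEigenvalues ρN) (lam₀ ^ 2))
    (μ : ℂ) (hμ : μ.im ≠ 0 ∨ μ ∈ Complex.ofReal '' Set.Ioo (-lam₀) lam₀)
    (rho : ℝ) (hrho : ∃ j : ℕ, rho = (k : ℝ) / 2 + j) :
    (∀ (r₀ : ℝ) (_ : 0 < r₀) (lam : ℝ) (φ : EuclideanSpace ℝ (Fin (k + 1)) × N → S),
      P.IsModeSolution ρ c μ rho lam r₀ φ →
      ∀ κ : ℂ, κ ^ 2 = (lam : ℂ) ^ 2 - μ ^ 2 → 0 ≤ κ.re → 0 < κ.re) ∧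
    (∀ κ₀ : ℂ, κ₀ ^ 2 = (lam₀ : ℂ) ^ 2 - μ ^ 2 → 0 < κ₀.re →
      ∃ C : ℝ → ℝ, (∀ r, 0 < C r) ∧
        ∀ r₀ : ℝ, 0 < r₀ → ∃ r₁ : ℝ, r₀ < r₁ ∧
          ∀ (lam : ℝ) (φ : EuclideanSpace ℝ (Fin (k + 1)) × N → S),
            P.IsModeSolution ρ c μ rho lam r₀ φ →
            (0 < c → ∀ p : EuclideanSpace ℝ (Fin (k + 1)) × N, r₁ ≤ ‖p.1‖ →
              ‖φ p‖ ≤ C r₁ * (l2Norm g c r₀ φ).toReal *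
                Real.exp ((-(c * k / 2) - κ₀.re) * ‖p.1‖)) ∧
            (c = 0 → ∀ p : EuclideanSpace ℝ (Fin (k + 1)) × N, r₁ ≤ ‖p.1‖ →
              ‖φ p‖ ≤ C r₁ * (l2Norm g c r₀ φ).toReal *
                (‖p.1‖ ^ (-(k : ℝ) / 2) * Real.exp (-κ₀.re * ‖p.1‖)))) := by
  have hspec : ∀ {r₀ lam : ℝ} {φ : EuclideanSpace ℝ (Fin (k + 1)) × N → S},
      P.IsModeSolution ρ c μ rho lam r₀ φ → lam₀ ^ 2 ≤ lam ^ 2 := fun h => by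
    obtain ⟨ψ, -, -, -, -, hψ, -⟩ := h.mode
    exact hmin.2 hψ.sq_mem_diracSqEigenvalues
  have hrho0 : rho = 0 → k = 0 := fun h0 => by
    obtain ⟨j, hj⟩ := hrho
    have h1 : (0 : ℝ) ≤ j := Nat.cast_nonneg j
    have h2 : (0 : ℝ) ≤ k := Nat.cast_nonneg k
    exact_mod_cast (by linarith : (k : ℝ) = 0)
  refine ⟨fun r₀ _ lam φ h κ hκ hκ0 => re_pos_of_sq_eq (hspec h) hμ hκ hκ0,
    fun κ₀ hκ₀ hpos => ?_⟩
  set B : ℝ := max 2 (max 1 (2 * (rho ^ 2 + 2 * |rho|)) / κ₀.re)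
  have hB : ∀ R, B ≤ R → 3 / 2 < R ∧ 1 ≤ κ₀.re * R ∧ 2 * (rho ^ 2 + 2 * |rho|) ≤ κ₀.re * R :=
    fun R hR => by
      have h1 := (div_le_iff₀' hpos).mp ((le_max_right _ _).trans hR)
      exact ⟨by linarith [(le_max_left _ _).trans hR],
        (le_max_left _ _).trans h1, (le_max_right _ _).trans h1⟩
  choose C hC hdecay using fun (R : ℝ) (hR : B ≤ R) => SpinStructure.exists_decay P ρ hc hμ hκ₀ hrho0
    (hB R hR).1 (hB R hR).2.1 (hB R hR).2.2
  refine ⟨fun R => if hR : B ≤ R then C R hR else 1, fun R => ?_, fun r₀ hr₀ => ?_⟩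
  · dsimp only
    split_ifs with hR
    · exact hC R hR
    · exact one_pos
  · have hR : B ≤ r₀ + B := by linarith
    have h2 : 2 ≤ B := le_max_left _ _
    refine ⟨r₀ + B, by linarith, fun lam φ h => ?_⟩
    simp only [dif_pos hR]
    exact hdecay _ hR r₀ hr₀ (by linarith) lam φ (hspec h) h
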